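/- Let $n\ge 2$ and let $q\in\mathbb C^*$ be not a root of unity. Fix a logarithm $\eta$ of $q$, put $q^x=e^{\eta x}$ for $x\in\mathbb C$, $[x]_q=\frac{q^x-q^{-x}}{q-q^{-1}}$, $(i)_p=\frac{p^i-1}{p-1}$, $(r)_p!=\prod_{i=1}^r (i)_p$ and $1(q)=\{x\in\mathbb C: q^x=1\}$. **Algebra.** $U_q=U_q(\mathfrak{gl}_n)$ is the unital associative $\mathbb C$-algebra generated by $e_i,f_i$ ($1\le i\le n-1$) and $q^h$ ($h\in\bigoplus_{i=1}^n\mathbb Z\epsilon_i$) with relations $q^0=1$, $q^hq^{h'}=q^{h+h'}$, $q^he_iq^{-h}=q^{\langle h,\alpha_i\rangle}e_i$, $q^hf_iq^{-h}=q^{-\langle h,\alpha_i\rangle}f_i$, $e_if_j-f_je_i=\delta_{ij}\frac{q^{\alpha_i}-q^{-\alpha_i}}{q-q^{-1}}$, where $\alpha_i=\epsilon_i-\epsilon_{i+1}$, $e_i^2e_j-(q+q^{-1})e_ie_je_i+e_je_i^2=0=f_i^2f_j-(q+q^{-1})f_if_jf_i+f_jf_i^2$ for $|i-j|=1$, and $e_ie_j=e_je_i$,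 $f_if_j=f_jf_i$ for $|i-j|>1$. For $1\le m\le n$, $(U_m)_q\subseteq U_q$ is the subalgebra generated by $e_i,f_i$ ($i<m$) and $q^h$ ($h\in\bigoplus_{i\le m}\mathbb Z\epsilon_i$), $Z_m$ is its center, and the Gelfand–Tsetlin subalgebra $\Gamma_q$ is the (commutative) subalgebra of $U_q$ generated by $Z_1,\dots,Z_n$. A Gelfand–Tsetlin module is a finitely generated $U_q$-module $M$ with $M=\bigoplus_{\mathfrak m}M(\mathfrak m)$, the sum over the maximal ideals $\mathfrak m$ of $\Gamma_q$, where $M(\mathfrak m)=\{v:\mathfrak m^kv=0\text{ for some }k\ge 0\}$. The standard generators $c_{mk}$ ($1\le m\le n$, $0\le k\le m$) of $\Gamma_q$ are $$c_{mk}=\sum_{\sigma,\sigma'\in S_m}(-q)^{\ell(\sigma)+\ell(\sigma')}\,\ell^+_{\sigma(1)\sigma'(1)}\cdots \ell^+_{\sigma(k)\sigma'(k)}\,\ell^-_{\sigma(k+1)\sigma'(k+1)}\cdots \ell^-_{\sigma(m)\sigma'(m)},$$ where $\ell(\sigma)$ is the number of inversions, $\ell^{\pm}_{ii}=q^{\pm\epsilon_i}$,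 $\ell^+_{ij}=(q-q^{-1})q^{\epsilon_i}E_{ij}$ and $\ell^-_{ji}=-(q-q^{-1})F_{ji}q^{-\epsilon_i}$ for $i<j$, all other $\ell^\pm_{ij}$ are $0$, and $E_{i,i+1}=e_i$, $E_{i,j+1}=qE_{ij}e_j-e_jE_{ij}$, $F_{i+1,i}=f_i$, $F_{j+1,i}=q^{-1}f_jF_{ji}-F_{ji}f_j$. **Relations.** Let $\mathfrak V=\{(i,j):1\le j\le i\le n\}$ and let $\mathcal R$ be the set of the formal relations $(i,j)\ge(i-1,j')$, $(i-1,j')>(i,j)$, and $(n,i)\ge(n,j)$ with $i\ne j$. For $\mathcal C\subseteq\mathcal R$ let $\mathfrak V(\mathcal C)$ be the set of positions that occur in $\mathcal C$. Two sets of relations are disconnected if they have no position in common. A nonempty set is indecomposable if it is not the union of two disconnected nonempty sets; every $\mathcal C$ is uniquely a union of pairwise disconnected indecomposable sets, its components. Write $a\succeq_{\mathcal C}b$ if there is a chain of at least one relation of $\mathcal C$ from $a$ to $b$, and $a\succ_{\mathcal C}b$ if there is such a chain with at least one strict relation. An indecomposable $\mathcal C$ is admissible if 1. $(k,i)\succ_{\mathcal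 C}(k,j)$ only if $i<j$; 2. $(n,i)\succeq_{\mathcal C}(n,j)$ only if $i<j$; 3. $\mathcal C$ contains no cross, i.e. no $\{(k,i)\ge(k-1,t),\ (k-1,s)>(k,j)\}$ with $i<j$ and $s<t$; 4. for all $(k,i),(k,j)\in\mathfrak V(\mathcal C)$ with $k\le n-1$ and $i<j$, either $\{(k,i)>(k+1,s),\ (k+1,s)\ge(k,j),\ (k,i)\ge(k-1,t),\ (k-1,t)>(k,j)\}\subseteq\mathcal C$ for some $s,t$, or $\{(k,i)>(k+1,s),\ (k+1,t)\ge(k,j)\}\subseteq\mathcal C$ for some $s<t$ with $(k+1,s)\succeq_{\mathcal C}(k+1,t)$. An arbitrary $\mathcal C\subseteq\mathcal R$ is admissible if all its components are. **Modules.** A tableau $T(L)$ is given by $L=(l_{ij})_{1\le j\le i\le n}$ with complex entries. It satisfies $a\ge b$ (resp. $a>b$) if $l_a-l_b\in\mathbb Z_{\ge0}+\frac{1(q)}2$ (resp. $\mathbb Z_{>0}+\frac{1(q)}2$). It is a $\mathcal C$-realization if it satisfies all relations of $\mathcal C$ and, for $i\neq j$, $l_{ki}-l_{kj}\in\mathbb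 Z+\frac{1(q)}2$ only if $(k,i)$ and $(k,j)$ are positions of the same component of $\mathcal C$. For a $\mathcal C$-realization $T(L)$, let $\mathcal B_{\mathcal C}(T(L))$ be the set of all $\mathcal C$-realizations $T(L+z)$ with $z$ integral and zero in the top row $n$, and let $V_{\mathcal C}(T(L))$ be the complex vector space with basis $\mathcal B_{\mathcal C}(T(L))$. **Theorem.** Let $\mathcal C$ be admissible and let $T(L)$ be a $\mathcal C$-realization. Then the Gelfand–Tsetlin formulas $$q^{\epsilon_k}T(R)=q^{a_k}T(R),\quad a_k=\sum_{i=1}^{k}r_{ki}-\sum_{i=1}^{k-1}r_{k-1,i}+k\qquad(1\le k\le n),$$ $$e_kT(R)=-\sum_{j=1}^k\frac{\prod_{i=1}^{k+1}[r_{k+1,i}-r_{kj}]_q}{\prod_{i\ne j}[r_{ki}-r_{kj}]_q}T(R+\delta^{kj}),\qquad f_kT(R)=\sum_{j=1}^k\frac{\prod_{i=1}^{k-1}[r_{k-1,i}-r_{kj}]_q}{\prod_{i\ne j}[r_{ki}-r_{kj}]_q}T(R-\delta^{kj})\qquad(1\le k\le n-1)$$ for $T(R)\in\mathcal B_{\mathcal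 C}(T(L))$, where tableaux outside $\mathcal B_{\mathcal C}(T(L))$ are read as $0$, define a $U_q$-module structure on $V_{\mathcal C}(T(L))$. This module is a Gelfand–Tsetlin module, and every element of $\Gamma_q$ acts diagonally in the basis $\mathcal B_{\mathcal C}(T(L))$. For $1\le m\le n$ and $0\le k\le m$ one has $c_{mk}\in\Gamma_q$ and $c_{mk}T(R)=\gamma_{mk}(R)T(R)$ for all $T(R)\in\mathcal B_{\mathcal C}(T(L))$, where $$\gamma_{mk}(R)=(k)_{q^{-2}}!\,(m-k)_{q^{-2}}!\;q^{k(k+1)+\frac{m(m-3)}2}\sum_{\tau}q^{\sum_{i=1}^k r_{m\tau(i)}-\sum_{i=k+1}^m r_{m\tau(i)}},$$ the sum over all $\tau\in S_m$ with $\tau(1)<\dots<\tau(k)$ and $\tau(k+1)<\dots<\tau(m)$. -/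

import Mathlib

noncomputable section

namespace QuantumGT

/-! ### Powers of `q`

`q` is a nonzero complex number and `η` is a fixed logarithm of `q`, so that `q ^ x := exp (η x)`. -/

/-- `q ^ x`, for the branch of the power given by the logarithm `η` of `q`. -/
def qpow (η x : ℂ) : ℂ := Complex.exp (η * x)

/-- `[x]_q = (q ^ x - q ^ (-x)) / (q - q⁻¹)`. -/
def qbracket (q η x : ℂ) : ℂ := (qpow η x - qpow η (-x)) / (q - q⁻¹)

/-- `(r)_p! = (1)_p (2)_p ⋯ (r)_p` with `(i)_p = (p ^ i - 1) / (p - 1)`. -/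
def qfactorial (p : ℂ) (r : ℕ) : ℂ := ∏ i ∈ Finset.Icc 1 r, (p ^ i - 1) / (p - 1)

/-- `1(q) = {x | q ^ x = 1}`. -/
def oneq (η : ℂ) : Set ℂ := {x | qpow η x = 1}

/-! ### The quantum group `U_q(gl_n)` -/

/-- Indices `1, …, n - 1` of the simple roots. -/
abbrev SimpleIdx (n : ℕ) : Type := {i : ℕ // 1 ≤ i ∧ i < n}

/-- The lattice spanned by `ε_1, …, ε_n`. -/
abbrev Lattice (n : ℕ) : Type := {i : ℕ // 1 ≤ i ∧ i ≤ n} → ℤ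

/-- The basis vector `ε_k`. -/
def eps (n k : ℕ) : Lattice n := fun i => if i.1 = k then 1 else 0

/-- The simple root `α_i = ε_i - ε_{i+1}`. -/
def alpha {n : ℕ} (i : SimpleIdx n) : Lattice n := eps n i.1 - eps n (i.1 + 1)

/-- The pairing `⟨h, α_i⟩ = h_i - h_{i+1}`. -/
def pairing {n : ℕ} (h : Lattice n) (i : SimpleIdx n) : ℤ :=
  h ⟨i.1, i.2.1, i.2.2.le⟩ - h ⟨i.1 + 1, Nat.le_add_left 1 i.1, i.2.2⟩

/-- The generators `e_i`, `f_i` and `q ^ h`. -/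
inductive Gen (n : ℕ) : Type
  | e (i : SimpleIdx n) : Gen n
  | f (i : SimpleIdx n) : Gen n
  | qh (h : Lattice n) : Gen n

/-- The free algebra on the generators. -/
abbrev Free (n : ℕ) : Type := FreeAlgebra ℂ (Gen n)

/-- `e_i` in the free algebra. -/
def fe {n : ℕ} (i : SimpleIdx n) : Free n := FreeAlgebra.ι ℂ (Gen.e i)

/-- `f_i` in the free algebra. -/
def ff {n : ℕ} (i : SimpleIdx n) : Free n := FreeAlgebra.ι ℂ (Gen.f i)

/-- `q ^ h` in the free algebra. -/
def fq {n : ℕ} (h : Lattice n) : Free n := FreeAlgebra.ι ℂ (Gen.qh h)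

/-- The defining relations of `U_q(gl_n)`. -/
inductive UqRel (n : ℕ) (q : ℂ) : Free n → Free n → Prop
  | qh_zero : UqRel n q (fq 0) 1
  | qh_add (h h' : Lattice n) : UqRel n q (fq h * fq h') (fq (h + h'))
  | qh_e (h : Lattice n) (i : SimpleIdx n) :
      UqRel n q (fq h * fe i * fq (-h)) (q ^ pairing h i • fe i)
  | qh_f (h : Lattice n) (i : SimpleIdx n) :
      UqRel n q (fq h * ff i * fq (-h)) (q ^ (-pairing h i) • ff i)
  | e_f (i : SimpleIdx n) :
      UqRel n q (fe i * ff i - ff i * fe i) ((q - q⁻¹)⁻¹ • (fq (alpha i) - fq (-alpha i)))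
  | e_f_ne (i j : SimpleIdx n) (hij : i ≠ j) : UqRel n q (fe i * ff j - ff j * fe i) 0
  | serre_e (i j : SimpleIdx n) (hij : i.1 + 1 = j.1 ∨ j.1 + 1 = i.1) :
      UqRel n q (fe i ^ 2 * fe j - (q + q⁻¹) • (fe i * fe j * fe i) + fe j * fe i ^ 2) 0
  | serre_f (i j : SimpleIdx n) (hij : i.1 + 1 = j.1 ∨ j.1 + 1 = i.1) :
      UqRel n q (ff i ^ 2 * ff j - (q + q⁻¹) • (ff i * ff j * ff i) + ff j * ff i ^ 2) 0
  | comm_e (i j : SimpleIdx n) (hij : i.1 + 1 < j.1 ∨ j.1 + 1 < i.1) :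
      UqRel n q (fe i * fe j) (fe j * fe i)
  | comm_f (i j : SimpleIdx n) (hij : i.1 + 1 < j.1 ∨ j.1 + 1 < i.1) :
      UqRel n q (ff i * ff j) (ff j * ff i)

/-- The quantum enveloping algebra `U_q = U_q(gl_n)`. -/
abbrev Uq (n : ℕ) (q : ℂ) : Type := RingQuot (UqRel n q)

/-- The class of a generator in `U_q`. -/
def gen (n : ℕ) (q : ℂ) (g : Gen n) : Uq n q :=
  RingQuot.mkAlgHom ℂ (UqRel n q) (FreeAlgebra.ι ℂ g)

/-- `e_i`, for `1 ≤ i ≤ n - 1` (and `0` for other `i`). -/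
def eU (n : ℕ) (q : ℂ) (i : ℕ) : Uq n q :=
  if h : 1 ≤ i ∧ i < n then gen n q (Gen.e ⟨i, h⟩) else 0

/-- `f_i`, for `1 ≤ i ≤ n - 1` (and `0` for other `i`). -/
def fU (n : ℕ) (q : ℂ) (i : ℕ) : Uq n q :=
  if h : 1 ≤ i ∧ i < n then gen n q (Gen.f ⟨i, h⟩) else 0

/-- `q ^ h`. -/
def qU (n : ℕ) (q : ℂ) (h : Lattice n) : Uq n q := gen n q (Gen.qh h)

/-! ### The Gelfand–Tsetlin subalgebra -/

/-- The subalgebra `U_q(gl_m)` of `U_q(gl_n)`, generated by `e_i, f_i` (`1 ≤ i ≤ m - 1`) and the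
`q ^ h` with `h` in the span of `ε_1, …, ε_m`. -/
def subU (n : ℕ) (q : ℂ) (m : ℕ) : Subalgebra ℂ (Uq n q) :=
  Algebra.adjoin ℂ
    ({x | ∃ i, 1 ≤ i ∧ i < m ∧ (x = eU n q i ∨ x = fU n q i)} ∪
      {x | ∃ h : Lattice n, (∀ i, m < i.1 → h i = 0) ∧ x = qU n q h})

/-- The center `Z_m` of `U_q(gl_m)`. -/
def Zc (n : ℕ) (q : ℂ) (m : ℕ) : Subalgebra ℂ (Uq n q) :=
  subU n q m ⊓ Subalgebra.centralizer ℂ (subU n q m : Set (Uq n q))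

/-- The union of the centers `Z_1, …, Z_n`. -/
def centers (n : ℕ) (q : ℂ) : Set (Uq n q) :=
  {x | ∃ m, 1 ≤ m ∧ m ≤ n ∧ x ∈ Zc n q m}

/-- The Gelfand–Tsetlin subalgebra `Γ_q`, generated by `Z_1, …, Z_n`. -/
def Gam (n : ℕ) (q : ℂ) : Subalgebra ℂ (Uq n q) := Algebra.adjoin ℂ (centers n q)

theorem subU_mono (n : ℕ) (q : ℂ) {m r : ℕ} (h : m ≤ r) : subU n q m ≤ subU n q r := by
  apply Algebra.adjoin_mono
  rintro x (⟨i, h1, h2, hx⟩ | ⟨g, hg, hx⟩)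
  · exact Or.inl ⟨i, h1, by omega, hx⟩
  · exact Or.inr ⟨g, fun i hi => hg i (by omega), hx⟩

theorem centers_comm (n : ℕ) (q : ℂ) (x : Uq n q) (hx : x ∈ centers n q) (y : Uq n q)
    (hy : y ∈ centers n q) : x * y = y * x := by
  obtain ⟨m, -, -, hm⟩ := hx
  obtain ⟨r, -, -, hr⟩ := hy
  rcases le_total m r with h | h
  · exact (Subalgebra.mem_centralizer_iff ℂ).1 hr.2 x (subU_mono n q h hm.1)
  · exact ((Subalgebra.mem_centralizer_iff ℂ).1 hm.2 y (subU_mono n q h hr.1)).symm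

/-- `Γ_q` as a type, with its commutative ring structure. -/
def GamAlg (n : ℕ) (q : ℂ) : Type := Gam n q

theorem Gam_mul_comm (n : ℕ) (q : ℂ) (x y : Gam n q) : x * y = y * x :=
  (Algebra.isMulCommutative_adjoin ℂ (centers_comm n q)).is_comm.comm x y

instance GamAlg.instRing (n : ℕ) (q : ℂ) : Ring (GamAlg n q) :=
  inferInstanceAs (Ring (Gam n q))

instance GamAlg.instCommRing (n : ℕ) (q : ℂ) : CommRing (GamAlg n q) :=
  { GamAlg.instRing n q with mul_comm := Gam_mul_comm n q }

/-- The inclusion of `Γ_q` into `U_q`. -/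
def GamAlg.incl {n : ℕ} {q : ℂ} (x : GamAlg n q) : Uq n q := Subtype.val x

/-! ### Gelfand–Tsetlin modules -/

section Modules

variable {n : ℕ} {q : ℂ} {M : Type*} [AddCommGroup M] [Module ℂ M]

/-- For a `U_q`-module `M`, given by `ρ`, and a maximal ideal `𝔪` of `Γ_q`, the subspace `M(𝔪)` of
all `v` with `𝔪 ^ k v = 0` for some `k`. -/
def genSpace (ρ : Uq n q →ₐ[ℂ] Module.End ℂ M) (𝔪 : MaximalSpectrum (GamAlg n q)) :
    Submodule ℂ M where
  carrier := {v | ∃ k : ℕ, ∀ x ∈ 𝔪.asIdeal ^ k, ρ x.incl v = 0}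
  zero_mem' := ⟨0, fun _ _ => map_zero _⟩
  add_mem' := by
    rintro v w ⟨k, hk⟩ ⟨l, hl⟩
    refine ⟨max k l, fun x hx => ?_⟩
    rw [map_add, hk x (Ideal.pow_le_pow_right (le_max_left k l) hx),
      hl x (Ideal.pow_le_pow_right (le_max_right k l) hx), add_zero]
  smul_mem' := by
    rintro c v ⟨k, hk⟩
    exact ⟨k, fun x hx => by rw [map_smul, hk x hx, smul_zero]⟩

/-- `M` is finitely generated over `U_q`. -/
def IsFinitelyGenerated (ρ : Uq n q →ₐ[ℂ] Module.End ℂ M) : Prop :=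
  letI : Module (Uq n q) M := Module.compHom M (ρ : Uq n q →+* Module.End ℂ M)
  Module.Finite (Uq n q) M

/-- A Gelfand–Tsetlin module: a finitely generated `U_q`-module which is the direct sum of the
subspaces `M(𝔪)`, where `𝔪` runs over the maximal ideals of `Γ_q`. -/
def IsGelfandTsetlin (ρ : Uq n q →ₐ[ℂ] Module.End ℂ M) : Prop :=
  open scoped Classical in
  IsFinitelyGenerated ρ ∧ DirectSum.IsInternal (genSpace ρ)

end Modules

/-! ### The generators `c_{mk}` of `Γ_q` -/

/-- The root vectors `E_{i,i+d+1}`: `E_{i,i+1} = e_i` and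
`E_{i,j+1} = q E_{ij} e_j - e_j E_{ij}`. -/
def rootE (n : ℕ) (q : ℂ) (i : ℕ) : ℕ → Uq n q
  | 0 => eU n q i
  | d + 1 => q • (rootE n q i d * eU n q (i + d + 1)) - eU n q (i + d + 1) * rootE n q i d

/-- The root vectors `F_{i+d+1,i}`: `F_{i+1,i} = f_i` and
`F_{j+1,i} = q⁻¹ f_j F_{ji} - F_{ji} f_j`. -/
def rootF (n : ℕ) (q : ℂ) (i : ℕ) : ℕ → Uq n q
  | 0 => fU n q i
  | d + 1 => q⁻¹ • (fU n q (i + d + 1) * rootF n q i d) - rootF n q i d * fU n q (i + d + 1)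

/-- The entries of the upper triangular matrix `L⁺`: `ℓ⁺_{ii} = q ^ ε_i` and
`ℓ⁺_{ij} = (q - q⁻¹) q ^ ε_i E_{ij}` for `i < j`. -/
def lplus (n : ℕ) (q : ℂ) (i j : ℕ) : Uq n q :=
  if i = j then qU n q (eps n i)
  else if i < j then (q - q⁻¹) • (qU n q (eps n i) * rootE n q i (j - i - 1))
  else 0

/-- The entries of the lower triangular matrix `L⁻`: `ℓ⁻_{jj} = q ^ (-ε_j)` and
`ℓ⁻_{ij} = -(q - q⁻¹) F_{ij} q ^ (-ε_j)` for `i > j`. -/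
def lminus (n : ℕ) (q : ℂ) (i j : ℕ) : Uq n q :=
  if i = j then qU n q (-eps n j)
  else if j < i then -((q - q⁻¹) • (rootF n q j (i - j - 1) * qU n q (-eps n j)))
  else 0

/-- The length (number of inversions) of a permutation. -/
def invNum {m : ℕ} (σ : Equiv.Perm (Fin m)) : ℕ :=
  (Finset.univ.filter fun p : Fin m × Fin m => p.1 < p.2 ∧ σ p.2 < σ p.1).card

/-- `c_{mk} = ∑_{σ, σ'} (-q)^{ℓ(σ) + ℓ(σ')} ℓ⁺_{σ(1)σ'(1)} ⋯ ℓ⁺_{σ(k)σ'(k)}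
ℓ⁻_{σ(k+1)σ'(k+1)} ⋯ ℓ⁻_{σ(m)σ'(m)}`, the sum over all `σ, σ'` in the symmetric group `S_m`. -/
def cgen (n : ℕ) (q : ℂ) (m k : ℕ) : Uq n q :=
  ∑ σ : Equiv.Perm (Fin m), ∑ σ' : Equiv.Perm (Fin m),
    (-q) ^ (invNum σ + invNum σ') •
      (List.ofFn fun a : Fin m =>
        if a.1 < k then lplus n q ((σ a).1 + 1) ((σ' a).1 + 1)
        else lminus n q ((σ a).1 + 1) ((σ' a).1 + 1)).prod

/-! ### Tableaux and relations -/

/-- The set `𝔙` of the positions `(i, j)`, `1 ≤ j ≤ i ≤ n`. -/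
abbrev Pos (n : ℕ) : Type := {p : ℕ × ℕ // 1 ≤ p.2 ∧ p.2 ≤ p.1 ∧ p.1 ≤ n}

/-- The row `i` of the position `(i, j)`. -/
def Pos.row {n : ℕ} (a : Pos n) : ℕ := a.1.1

/-- The index `j` of the position `(i, j)` in its row. -/
def Pos.col {n : ℕ} (a : Pos n) : ℕ := a.1.2

/-- Gelfand–Tsetlin tableaux of height `n`. -/
abbrev Tableau (n : ℕ) : Type := Pos n → ℂ

/-- The entry `l_{ij}` of a tableau (and `0` outside of the tableau). -/
def entry {n : ℕ} (L : Tableau n) (i j : ℕ) : ℂ :=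
  if h : 1 ≤ j ∧ j ≤ i ∧ i ≤ n then L ⟨(i, j), h⟩ else 0

/-- The vector `δ^{ij}`. -/
def delta (n i j : ℕ) : Tableau n := fun a => if a.1 = (i, j) then 1 else 0

/-- A relation `fst ≥ snd` (`strict = false`) or `fst > snd` (`strict = true`). -/
structure Rel (n : ℕ) where
  fst : Pos n
  snd : Pos n
  strict : Bool

/-- The relation `a ≥ b`. -/
def ge {n : ℕ} (a b : Pos n) : Rel n := ⟨a, b, false⟩

/-- The relation `a > b`. -/
def gt {n : ℕ} (a b : Pos n) : Rel n := ⟨a, b, true⟩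

/-- The set `ℛ` of all relations that are considered. -/
def allRel (n : ℕ) : Set (Rel n) :=
  {r | ∃ a b : Pos n, a.row = b.row + 1 ∧ r = ge a b} ∪
  {r | ∃ a b : Pos n, b.row = a.row + 1 ∧ r = gt a b} ∪
  {r | ∃ a b : Pos n, a.row = n ∧ b.row = n ∧ a ≠ b ∧ r = ge a b}

section Relations

variable {n : ℕ}

/-- `𝔙(𝒞)`: the positions that occur in the relations of `𝒞`. -/
def verts (C : Set (Rel n)) : Set (Pos n) := {a | ∃ r ∈ C, a = r.fst ∨ a = r.snd}

/-- Two sets of relations are disconnected if they have no position in common. -/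
def Disconnected (C₁ C₂ : Set (Rel n)) : Prop := Disjoint (verts C₁) (verts C₂)

/-- `𝒞` is nonempty and not the union of two disconnected nonempty sets. -/
def Indecomposable (C : Set (Rel n)) : Prop :=
  C.Nonempty ∧
    ¬ ∃ C₁ C₂ : Set (Rel n), C₁.Nonempty ∧ C₂.Nonempty ∧ C₁ ∪ C₂ = C ∧ Disconnected C₁ C₂

/-- `D` is one of the indecomposable sets of which `𝒞` is the disconnected union. -/
def IsComponent (D C : Set (Rel n)) : Prop :=
  D ⊆ C ∧ Indecomposable D ∧ Disconnected D (C \ D)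

/-- `a ≥ b` or `a > b` belongs to `𝒞`. -/
def Step (C : Set (Rel n)) (a b : Pos n) : Prop := ge a b ∈ C ∨ gt a b ∈ C

/-- `a ⪰_𝒞 b`: there is a chain of relations of `𝒞` from `a` to `b`. -/
def SuccEq (C : Set (Rel n)) (a b : Pos n) : Prop := Relation.TransGen (Step C) a b

/-- `a ≻_𝒞 b`: there is a chain of relations of `𝒞` from `a` to `b`, at least one of them strict. -/
def Succ (C : Set (Rel n)) (a b : Pos n) : Prop :=
  ∃ x y, Relation.ReflTransGen (Step C) a x ∧ gt x y ∈ C ∧ Relation.ReflTransGen (Step C) y b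

/-- `𝒞` contains a cross `{(k,i) ≥ (k-1,t), (k-1,s) > (k,j)}` with `i < j` and `s < t`. -/
def HasCross (C : Set (Rel n)) : Prop :=
  ∃ a b c d : Pos n, a.row = b.row + 1 ∧ c.row = b.row ∧ d.row = a.row ∧
    a.col < d.col ∧ c.col < b.col ∧ ge a b ∈ C ∧ gt c d ∈ C

/-- Admissibility of an indecomposable set of relations. -/
structure AdmissibleIndec (C : Set (Rel n)) : Prop where
  /-- `(k,i) ≻ (k,j)` only if `i < j`. -/
  strict_order : ∀ a b : Pos n, a.row = b.row → Succ C a b → a.col < b.col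
  /-- `(n,i) ⪰ (n,j)` only if `i < j`. -/
  top_order : ∀ a b : Pos n, a.row = n → b.row = n → SuccEq C a b → a.col < b.col
  /-- There is no cross. -/
  no_cross : ¬ HasCross C
  /-- For `i < j` and `k ≤ n - 1`, with `a = (k,i)` and `b = (k,j)` in `𝔙(𝒞)`, either
  `a > (k+1,s) ≥ b` and `a ≥ (k-1,t) > b` are in `𝒞` for some `s`, `t`, or
  `a > (k+1,s)` and `(k+1,t) ≥ b` are in `𝒞` for some `s < t` with `(k+1,s) ⪰ (k+1,t)`. -/
  separated : ∀ a ∈ verts C, ∀ b ∈ verts C, a.row = b.row → a.row + 1 ≤ n → a.col < b.col →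
    (∃ u v : Pos n, u.row = a.row + 1 ∧ v.row + 1 = a.row ∧
      gt a u ∈ C ∧ ge u b ∈ C ∧ ge a v ∈ C ∧ gt v b ∈ C) ∨
    (∃ u v : Pos n, u.row = a.row + 1 ∧ v.row = a.row + 1 ∧ u.col < v.col ∧ SuccEq C u v ∧
      gt a u ∈ C ∧ ge v b ∈ C)

/-- A set of relations is admissible if all its indecomposable components are. -/
def Admissible (C : Set (Rel n)) : Prop :=
  C ⊆ allRel n ∧ ∀ D, IsComponent D C → AdmissibleIndec D

/-- The tableau `T(L)` satisfies the relation `r`: the difference of the entries is in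
`ℤ_{≥ 0} + 1(q)/2`, respectively in `ℤ_{> 0} + 1(q)/2`. -/
def SatisfiesRel (η : ℂ) (L : Tableau n) (r : Rel n) : Prop :=
  ∃ d : ℤ, ∃ x ∈ oneq η, 0 ≤ d ∧ (r.strict = true → 0 < d) ∧ L r.fst - L r.snd = d + x / 2

/-- `T(L)` is a `𝒞`-realization: it satisfies all relations of `𝒞`, and two different entries of a
row differ by an element of `ℤ + 1(q)/2` only if their positions belong to the same
indecomposable component of `𝒞`. -/
def IsRealization (η : ℂ) (C : Set (Rel n)) (L : Tableau n) : Prop :=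
  (∀ r ∈ C, SatisfiesRel η L r) ∧
  ∀ a b : Pos n, a.row = b.row → a ≠ b → (∃ d : ℤ, ∃ x ∈ oneq η, L a - L b = d + x / 2) →
    ∃ D, IsComponent D C ∧ a ∈ verts D ∧ b ∈ verts D

/-- `ℬ_𝒞(T(L))`: the `𝒞`-realizations `T(L + z)` with `z` integral and zero in the top row. -/
def basisSet (η : ℂ) (C : Set (Rel n)) (L : Tableau n) : Set (Tableau n) :=
  {R | (∃ z : Pos n → ℤ, (∀ a, a.row = n → z a = 0) ∧ ∀ a, R a = L a + z a) ∧
    IsRealization η C R}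

/-- `V_𝒞(T(L))`: the vector space with basis `ℬ_𝒞(T(L))`. -/
abbrev VC (η : ℂ) (C : Set (Rel n)) (L : Tableau n) : Type := basisSet η C L →₀ ℂ

/-- The basis vector `T(R)` of `V_𝒞(T(L))` if `R` is in `ℬ_𝒞(T(L))`, and `0` otherwise. -/
def tab (η : ℂ) (C : Set (Rel n)) (L R : Tableau n) : VC η C L :=
  open scoped Classical in
  if h : R ∈ basisSet η C L then Finsupp.single ⟨R, h⟩ 1 else 0

end Relations

/-! ### The Gelfand–Tsetlin formulas and the eigenvalues -/

section Formulas

variable {n : ℕ}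

/-- The exponent `a_k = ∑_{i ≤ k} l_{ki} - ∑_{i ≤ k-1} l_{k-1,i} + k`. -/
def weightExp (L : Tableau n) (k : ℕ) : ℂ :=
  ∑ i ∈ Finset.Icc 1 k, entry L k i - ∑ i ∈ Finset.Icc 1 (k - 1), entry L (k - 1) i + k

/-- `∏_{i ≤ r} [l_{ri} - l_{kj}]_q / ∏_{i ≠ j} [l_{ki} - l_{kj}]_q`. -/
def gtCoeff (q η : ℂ) (L : Tableau n) (r k j : ℕ) : ℂ :=
  (∏ i ∈ Finset.Icc 1 r, qbracket q η (entry L r i - entry L k j)) /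
    ∏ i ∈ (Finset.Icc 1 k).erase j, qbracket q η (entry L k i - entry L k j)

/-- The module structure `ρ` on `V_𝒞(T(L))` is given by the Gelfand–Tsetlin formulas on the basis
`ℬ_𝒞(T(L))`; tableaux which are not in `ℬ_𝒞(T(L))` are read as `0`. -/
structure IsGTAction (q η : ℂ) (C : Set (Rel n)) (L : Tableau n)
    (ρ : Uq n q →ₐ[ℂ] Module.End ℂ (VC η C L)) : Prop where
  weight : ∀ R ∈ basisSet η C L, ∀ k, 1 ≤ k → k ≤ n →
    ρ (qU n q (eps n k)) (tab η C L R) = qpow η (weightExp R k) • tab η C L R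
  raising : ∀ R ∈ basisSet η C L, ∀ k, 1 ≤ k → k < n →
    ρ (eU n q k) (tab η C L R) =
      -∑ j ∈ Finset.Icc 1 k, gtCoeff q η R (k + 1) k j • tab η C L (R + delta n k j)
  lowering : ∀ R ∈ basisSet η C L, ∀ k, 1 ≤ k → k < n →
    ρ (fU n q k) (tab η C L R) =
      ∑ j ∈ Finset.Icc 1 k, gtCoeff q η R (k - 1) k j • tab η C L (R - delta n k j)

/-- `τ(1) < ⋯ < τ(k)` and `τ(k+1) < ⋯ < τ(m)`. -/
def IsShuffle {m : ℕ} (k : ℕ) (τ : Equiv.Perm (Fin m)) : Prop :=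
  ∀ a b : Fin m, a < b → (b.1 < k ∨ k ≤ a.1) → τ a < τ b

/-- The eigenvalue `γ_{mk}(L) = (k)_{q⁻²}! (m-k)_{q⁻²}! q^{k(k+1) + m(m-3)/2}
∑_τ q^{∑_{i ≤ k} l_{mτ(i)} - ∑_{k < i ≤ m} l_{mτ(i)}}`, the sum over all `(k, m-k)`-shuffles `τ`. -/
def gammaVal (q η : ℂ) (m k : ℕ) (L : Tableau n) : ℂ :=
  open scoped Classical in
  qfactorial (q⁻¹ ^ 2) k * qfactorial (q⁻¹ ^ 2) (m - k) *
    qpow η ((k : ℂ) * (k + 1) + (m : ℂ) * (m - 3) / 2) *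
    ∑ τ : Equiv.Perm (Fin m) with IsShuffle k τ,
      qpow η (∑ a : Fin m,
        if a.1 < k then entry L m ((τ a).1 + 1) else -entry L m ((τ a).1 + 1))

end Formulas

end QuantumGT

end

/-! Module structure. The difference of two entries matters only modulo `1(q)/2`, because `[x]_q`
vanishes exactly there; since `q` is not a root of unity the integer part of such a difference is
well defined (`Dif.unique`). The relations of `C` between adjacent rows act as one-way walls. A move
that would break a relation `a ≥ b` carries a zero bracket in the numerator of its coefficient. A
relation `a > b` may be broken by a move with nonzero coefficient, but once broken it can never be
repaired by such a move (`half_mv`, `viol_mv`). So a path that leaves the basis never comes back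
with nonzero coefficient, and a composition of single moves may be computed by multiplying
coefficients formally (`op_op_tab`, `op_op_op_tab`). The relations of `U_q` thereby become
identities between brackets.

Two kinds of poles could spoil these identities. Admissibility makes comparable entries in a row
below the top strictly decreasing (`pos_of_dif`), so the coefficients at basis tableaux have no
poles. Entries of a row with difference `1` produce poles after one move. In the Serre relations
such terms end outside the basis (`not_dif_one`). In the commutator of `e_k` and `f_k` the sum is a
partial fraction expansion with nodes `q^{2r_{ki}}` and `q^{2r_{ki}+2}`, and admissibility supplies
a double zero of the numerator at every double node (`exists_zeroNode`, `lagrange_of_double`,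
`row_lagrange`). The coefficients at these nodes are then `0`, which agrees with the convention `0⁻¹
= 0`.

Eigenvalues. Put `L(z) = z L⁺ - z⁻¹ L⁻`. The exchange relations of `L⁺` and `L⁻` follow from their
commutation relations with the simple generators (`QGens.exch`). At arguments with ratio `q` they
degenerate to antisymmetry (`QGens.rowAnti`), so the quantum minors of `L(z), L(z/q), …` are
`q`-antisymmetric in their columns, and the principal ones `qdet` commute with the generators of
`U_q(gl_m)`. Symmetrizing over rows and columns makes the order of the factors immaterial
(`QGens.symPair_lp_lm`). Hence, up to nonzero scalars, the `c_{mk}` are the Laurent coefficients of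
`qdet` in `z` (`QGens.qdet_expansion`), and they are central.

A Sylvester type identity expresses `qdet` of order `p + 2` times `qdet` of order `p` by `qdet` of
order `p + 1` and the generators `e_{p+1}`, `f_{p+1}` (`QGens.qdet_rec`). Applied to a tableau this
is a recursion for eigenvalues (`eigen_step`). It is solved by the product of the `u - u⁻¹` with `u
= q z q^{r_{mi}}`, because the needed scalar identity is again the partial fraction expansion of a
row, now evaluated at `z⁻²` (`row_eigenvalue`). This gives `detU_tab` and, by comparing
coefficients, `cgen_tab`.

Gelfand–Tsetlin property. The eigenvalues of the determinants determine each row up to order modulo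
`1(q)/2`; as comparable entries decrease, they separate the basis (`exists_detVal_ne`). An element
of `Γ_q` commutes with the determinants and is therefore diagonal (`gam_diag`), and the
decomposition into the spaces `M(𝔪)` follows. For finite generation, tableaux are sorted by the set
of weak inequalities between adjacent rows which they satisfy. There are finitely many such sets,
and two tableaux with the same set are joined by moves with nonzero coefficients
(`tab_mem_of_cone_eq`). -/

set_option linter.all false

/-! ### The matrices `L⁺`, `L⁻`, quantum minors and quantum determinants over abstract generators.
-/

noncomputable section

namespace QuantumGT

/-! ### Root vectors in an algebra with quantum group generators -/

section RootVectors

/-- The scalar `q ^ ⟨ε_a, α_i⟩`. -/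
def wt (q : ℂ) (i a : ℕ) : ℂ := if a = i then q else if a = i + 1 then q⁻¹ else 1

variable {A : Type*} [Ring A] [Algebra ℂ A]

/-- Elements `e_i`, `f_i`, `k_i = q ^ ε_i` and `k_i⁻¹` of an algebra which satisfy the relations of
`U_q(gl_n)`. -/
structure QGens (n : ℕ) (q : ℂ) (e f k k' : ℕ → A) : Prop where
  q_ne : q ≠ 0
  q_sq : q ^ 2 ≠ 1
  q_sq' : q ^ 2 ≠ -1
  k_inv : ∀ i, k i * k' i = 1
  inv_k : ∀ i, k' i * k i = 1
  k_comm : ∀ i j, k i * k j = k j * k i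
  k_e : ∀ a i, k a * e i = wt q i a • (e i * k a)
  k_f : ∀ a i, f i * k a = wt q i a • (k a * f i)
  -- The bounds are essential: outside this range the `e_i`, `f_i` of `U_q` are `0`, while the
  -- Cartan term on the right need not vanish. The other relations hold for all indices.
  e_f : ∀ i, 1 ≤ i → i < n →
    e i * f i - f i * e i = (q - q⁻¹)⁻¹ • (k i * k' (i + 1) - k' i * k (i + 1))
  e_f_ne : ∀ i j, i ≠ j → e i * f j = f j * e i
  serre_e : ∀ i j, (i + 1 = j ∨ j + 1 = i) →
    e i * (e i * e j) - (q + q⁻¹) • (e i * (e j * e i)) + e j * (e i * e i) = 0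
  serre_f : ∀ i j, (i + 1 = j ∨ j + 1 = i) →
    f i * (f i * f j) - (q + q⁻¹) • (f i * (f j * f i)) + f j * (f i * f i) = 0
  e_comm : ∀ i j, (i + 1 < j ∨ j + 1 < i) → e i * e j = e j * e i
  f_comm : ∀ i j, (i + 1 < j ∨ j + 1 < i) → f i * f j = f j * f i

/-- The root vectors `E_{i,i+d+1}`. -/
def rE (q : ℂ) (e : ℕ → A) (i : ℕ) : ℕ → A
  | 0 => e i
  | d + 1 => q • (rE q e i d * e (i + d + 1)) - e (i + d + 1) * rE q e i d

/-- The root vectors `F_{i+d+1,i}`. -/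
def rF (q : ℂ) (f : ℕ → A) (i : ℕ) : ℕ → A
  | 0 => f i
  | d + 1 => q⁻¹ • (f (i + d + 1) * rF q f i d) - rF q f i d * f (i + d + 1)

/-- The upper triangular matrix `L⁺`. -/
def lp (q : ℂ) (e k : ℕ → A) (a b : ℕ) : A :=
  if a = b then k a else if a < b then (q - q⁻¹) • (k a * rE q e a (b - a - 1)) else 0

/-- The lower triangular matrix `L⁻`. -/
def lm (q : ℂ) (f k' : ℕ → A) (a b : ℕ) : A :=
  if a = b then k' b else if b < a then -((q - q⁻¹) • (rF q f b (a - b - 1) * k' b)) else 0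

theorem lp_self (q : ℂ) (e k : ℕ → A) (a : ℕ) : lp q e k a a = k a := by simp [lp]

theorem lp_lt (q : ℂ) (e k : ℕ → A) (a d : ℕ) :
    lp q e k a (a + d + 1) = (q - q⁻¹) • (k a * rE q e a d) := by
  rw [lp, if_neg (by omega), if_pos (by omega)]
  congr 3; omega

theorem lp_succ (q : ℂ) (e k : ℕ → A) (a : ℕ) :
    lp q e k a (a + 1) = (q - q⁻¹) • (k a * e a) := lp_lt q e k a 0

theorem lp_gt (q : ℂ) (e k : ℕ → A) {a b : ℕ} (h : b < a) : lp q e k a b = 0 := by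
  rw [lp, if_neg (by omega), if_neg (by omega)]

theorem lm_self (q : ℂ) (f k' : ℕ → A) (a : ℕ) : lm q f k' a a = k' a := by simp [lm]

theorem lm_gt (q : ℂ) (f k' : ℕ → A) (b d : ℕ) :
    lm q f k' (b + d + 1) b = -((q - q⁻¹) • (rF q f b d * k' b)) := by
  rw [lm, if_neg (by omega), if_pos (by omega)]
  congr 4; omega

theorem lm_lt (q : ℂ) (f k' : ℕ → A) {a b : ℕ} (h : a < b) : lm q f k' a b = 0 := by
  rw [lm, if_neg (by omega), if_neg (by omega)]

theorem wt_ne_zero {q : ℂ} (hq : q ≠ 0) (i a : ℕ) : wt q i a ≠ 0 := by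
  unfold wt; split_ifs <;> simp [hq]

variable {n : ℕ} {q : ℂ} {e f k k' : ℕ → A}

namespace QGens

theorem one_add_sq_ne (H : QGens n q e f k k') : 1 + q ^ 2 ≠ 0 := by
  intro h
  exact H.q_sq' (by linear_combination h)

theorem inv_e (H : QGens n q e f k k') (a i : ℕ) :
    k' a * e i = (wt q i a)⁻¹ • (e i * k' a) := by
  have h := congrArg (fun x => k' a * x * k' a) (H.k_e a i)
  simp only [mul_smul_comm, smul_mul_assoc, mul_assoc, H.k_inv, mul_one] at h
  rw [← mul_assoc (k' a) (k a), H.inv_k, one_mul] at h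
  rw [h, smul_smul, inv_mul_cancel₀ (wt_ne_zero H.q_ne i a), one_smul]

theorem f_inv (H : QGens n q e f k k') (a i : ℕ) :
    f i * k' a = (wt q i a)⁻¹ • (k' a * f i) := by
  have h := congrArg (fun x => k' a * x * k' a) (H.k_f a i)
  simp only [mul_smul_comm, smul_mul_assoc, mul_assoc, H.k_inv, mul_one] at h
  rw [← mul_assoc (k' a) (k a), H.inv_k, one_mul] at h
  rw [h, smul_smul, inv_mul_cancel₀ (wt_ne_zero H.q_ne i a), one_smul]

theorem e_k (H : QGens n q e f k k') (a i : ℕ) :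
    e i * k a = (wt q i a)⁻¹ • (k a * e i) := by
  rw [H.k_e, smul_smul, inv_mul_cancel₀ (wt_ne_zero H.q_ne i a), one_smul]

theorem e_inv (H : QGens n q e f k k') (a i : ℕ) :
    e i * k' a = wt q i a • (k' a * e i) := by
  rw [H.inv_e, smul_smul, mul_inv_cancel₀ (wt_ne_zero H.q_ne i a), one_smul]

theorem k_inv_comm (H : QGens n q e f k k') (i j : ℕ) : k i * k' j = k' j * k i := by
  have h := congrArg (fun x => k' j * x * k' j) (H.k_comm i j)
  simp only [mul_assoc, H.k_inv, mul_one] at h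
  rw [← mul_assoc (k' j) (k j), H.inv_k, one_mul] at h
  exact h.symm

theorem inv_comm (H : QGens n q e f k k') (i j : ℕ) : k' i * k' j = k' j * k' i := by
  have h := congrArg (fun x => k' i * x * k' i) (H.k_inv_comm i j)
  simp only [mul_assoc, H.k_inv, mul_one] at h
  rw [← mul_assoc (k' i) (k i), H.inv_k, one_mul] at h
  exact h.symm

theorem inv_mul_k_smul (H : QGens n q e f k k') (i j : ℕ) (c : ℂ) (z : A) :
    k' i * k j * (c • (k i * z)) = c • (k j * z) := by
  rw [← H.k_inv_comm, mul_smul_comm, mul_assoc, ← mul_assoc (k' i), H.inv_k, one_mul]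

theorem e_rE_far_left (H : QGens n q e f k k') (i a d : ℕ) (h : i + 1 < a) :
    e i * rE q e a d = rE q e a d * e i := by
  induction d with
  | zero => exact H.e_comm _ _ (Or.inl h)
  | succ d ih =>
    have h1 := H.e_comm i (a + d + 1) (Or.inl (by omega))
    rw [rE]
    linear_combination (norm := skip) q • (ih * e (a + d + 1)) + q • (rE q e a d * h1)
      - h1 * rE q e a d - e (a + d + 1) * ih
    simp only [mul_sub, sub_mul, smul_mul_assoc, mul_smul_comm, mul_assoc]
    module

theorem e_rE_far_right (H : QGens n q e f k k') (i a d : ℕ) (h : a + d + 1 < i) :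
    e i * rE q e a d = rE q e a d * e i := by
  induction d with
  | zero => exact H.e_comm _ _ (Or.inr (by omega))
  | succ d ih =>
    have h1 := H.e_comm i (a + d + 1) (Or.inr (by omega))
    have ih := ih (by omega)
    rw [rE]
    linear_combination (norm := skip) q • (ih * e (a + d + 1)) + q • (rE q e a d * h1)
      - h1 * rE q e a d - e (a + d + 1) * ih
    simp only [mul_sub, sub_mul, smul_mul_assoc, mul_smul_comm, mul_assoc]
    module

/-- Only the last simple factor of the root vector interacts with `e_{a+d+1}`; the rest, `z`,
commutes with it. So this is the Serre relation of the two last generators, multiplied by `z` from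
either side. -/
theorem serre_rE (H : QGens n q e f k k') (a d : ℕ) :
    e (a + d + 1) * (e (a + d + 1) * rE q e a d)
      - (q + q⁻¹) • (e (a + d + 1) * (rE q e a d * e (a + d + 1)))
      + rE q e a d * (e (a + d + 1) * e (a + d + 1)) = 0 := by
  cases d with
  | zero => exact H.serre_e _ _ (Or.inr (by omega))
  | succ d =>
    have h1 := H.e_rE_far_right (a + (d + 1) + 1) a d (by omega)
    have h2 := H.serre_e (a + (d + 1) + 1) (a + d + 1) (Or.inr (by omega))
    rw [rE]
    generalize e (a + (d + 1) + 1) = x at *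
    generalize e (a + d + 1) = y at *
    generalize rE q e a d = z at *
    have h3 : x * (x * z) = z * (x * x) := by rw [h1, ← mul_assoc, h1, mul_assoc]
    linear_combination (norm := skip) q • (z * h2) - h2 * z + q • (h3 * y)
      - (q * (q + q⁻¹)) • (h1 * (y * x))
      + y * h3 - (q + q⁻¹) • (x * (y * h1))
    simp only [mul_sub, sub_mul, mul_add, add_mul, smul_mul_assoc, mul_smul_comm, mul_assoc,
      mul_zero, zero_mul]
    module

/-- The Serre relation `serre_rE`, read as a `q`-commutation with the longer root vector. -/
theorem e_rE_last (H : QGens n q e f k k') (a d : ℕ) :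
    e (a + d + 1) * rE q e a (d + 1) = q⁻¹ • (rE q e a (d + 1) * e (a + d + 1)) := by
  have h := H.serre_rE a d
  have hq := H.q_ne
  rw [rE]
  generalize e (a + d + 1) = x at *
  generalize rE q e a d = z at *
  linear_combination (norm := skip) (-1 : ℂ) • h
  simp only [mul_sub, sub_mul, mul_add, add_mul, smul_mul_assoc, mul_smul_comm, mul_assoc,
    mul_zero, zero_mul]
  match_scalars <;> field_simp <;> ring

/-- The root vector can also be built from its left end, since the outer factors at the two ends
commute. This gives the action of `e_{a-1}` on `E_{ab}`. -/
theorem rE_left (H : QGens n q e f k k') (a d : ℕ) :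
    rE q e a (d + 1) = q • (e a * rE q e (a + 1) d) - rE q e (a + 1) d * e a := by
  induction d with
  | zero => rfl
  | succ d ih =>
    have h1 := H.e_comm a (a + (d + 1) + 1) (Or.inl (by omega))
    rw [rE, ih, show rE q e (a + 1) (d + 1) = q • (rE q e (a + 1) d * e (a + (d + 1) + 1))
      - e (a + (d + 1) + 1) * rE q e (a + 1) d by rw [rE]; congr 3 <;> ring_nf]
    generalize e (a + (d + 1) + 1) = x at *
    generalize rE q e (a + 1) d = z at *
    linear_combination (norm := skip) q • (h1 * z) - q • (z * h1)
    simp only [mul_sub, sub_mul, mul_add, add_mul, smul_mul_assoc, mul_smul_comm, mul_assoc,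
      mul_zero, zero_mul]
    module

theorem e_rE_first (H : QGens n q e f k k') (a d : ℕ) :
    e a * rE q e a (d + 1) = q • (rE q e a (d + 1) * e a) := by
  have hq := H.q_ne
  induction d with
  | zero =>
    have h := H.serre_e a (a + 0 + 1) (Or.inl (by omega))
    simp only [rE]
    generalize e (a + 0 + 1) = x at *
    linear_combination (norm := skip) q • h
    simp only [mul_sub, sub_mul, mul_add, add_mul, smul_mul_assoc, mul_smul_comm, mul_assoc,
      mul_zero, zero_mul]
    match_scalars <;> field_simp <;> ring
  | succ d ih =>
    have h1 := H.e_comm a (a + (d + 1) + 1) (Or.inl (by omega))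
    rw [rE]
    generalize e (a + (d + 1) + 1) = x at *
    generalize rE q e a (d + 1) = z at *
    linear_combination (norm := skip) q • (ih * x) + (q * q) • (z * h1) - h1 * z - x * ih
    simp only [mul_sub, sub_mul, mul_add, add_mul, smul_mul_assoc, mul_smul_comm, mul_assoc,
      mul_zero, zero_mul]
    module

/-- The essential case is that of three neighbouring pieces `E`, `y`, `x`. The root vector `W` is at
the same time the `q`-commutator of `Y = [E, y]_q` with `x` and of `E` with `X = [y, x]_q`.
Commuting `y` past each form yields two linear relations between `yW`, `Wy` and `YX - XY`;
eliminating the last leaves `(1 + q²)(yW - Wy) = 0`. This is where `q² ≠ -1` enters. -/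
theorem e_rE_mid (H : QGens n q e f k k') (a p d : ℕ) (h : p + 2 ≤ d) :
    e (a + p + 1) * rE q e a d = rE q e a d * e (a + p + 1) := by
  have hq := H.q_ne
  induction d, h using Nat.le_induction with
  | base =>
    have hY := H.e_rE_last a p
    have hE := H.e_rE_far_right (a + (p + 1) + 1) a p (by omega)
    have hS := H.serre_e (a + p + 1) (a + (p + 1) + 1) (Or.inl (by omega))
    have hW : rE q e a (p + 2) = q • (rE q e a (p + 1) * e (a + (p + 1) + 1))
      - e (a + (p + 1) + 1) * rE q e a (p + 1) := by rw [rE]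
    have hYd : rE q e a (p + 1) = q • (rE q e a p * e (a + p + 1)) - e (a + p + 1) * rE q e a p := by
      rw [rE]
    generalize e (a + (p + 1) + 1) = x at *
    generalize e (a + p + 1) = y at *
    generalize rE q e a p = E at *
    generalize rE q e a (p + 1) = Y at *
    generalize rE q e a (p + 2) = W at *
    obtain ⟨X, hX⟩ : ∃ X, X = q • (y * x) - x * y := ⟨_, rfl⟩
    have h1 : y * X = q • (X * y) := by
      subst hX
      linear_combination (norm := skip) q • hS
      simp only [mul_sub, sub_mul, mul_add, add_mul, smul_mul_assoc, mul_smul_comm, mul_assoc,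
        mul_zero, zero_mul]
      match_scalars <;> field_simp <;> ring
    have h2 : W = q • (E * X) - X * E := by
      rw [hW, hYd, hX]
      linear_combination (norm := skip) - q • (hE * y) + q • (y * hE)
      simp only [mul_sub, sub_mul, mul_add, add_mul, smul_mul_assoc, mul_smul_comm, mul_assoc,
        mul_zero, zero_mul]
      match_scalars <;> field_simp <;> ring
    have h3 : Y * X - X * Y = q • (y * W) - q⁻¹ • (W * y) := by
      rw [hX]
      linear_combination (norm := skip) - q • (y * hW) - (q ^ 2) • (hY * x) + q⁻¹ • (hW * y)
        + x * hY
      simp only [mul_sub, sub_mul, mul_add, add_mul, smul_mul_assoc, mul_smul_comm, mul_assoc,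
        mul_zero, zero_mul]
      match_scalars <;> field_simp <;> ring
    have h4 : y * W = q ^ 2 • (W * y) - q • (Y * X - X * Y) := by
      rw [h2]
      linear_combination (norm := skip) (q ^ 2) • (E * h1) - h1 * E + q • (hYd * X) - q • (X * hYd)
      simp only [mul_sub, sub_mul, mul_add, add_mul, smul_mul_assoc, mul_smul_comm, mul_assoc,
        mul_zero, zero_mul]
      match_scalars <;> field_simp <;> ring
    have h5 : (1 + q ^ 2) • (y * W - W * y) = 0 := by
      linear_combination (norm := skip) h4 - q • h3
      match_scalars <;> field_simp <;> ring
    exact sub_eq_zero.1 ((smul_eq_zero.1 h5).resolve_left H.one_add_sq_ne)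
  | succ d hd ih =>
    have h1 := H.e_comm (a + p + 1) (a + d + 1) (Or.inl (by omega))
    rw [rE]
    linear_combination (norm := skip) q • (ih * e (a + d + 1)) + q • (rE q e a d * h1)
      - h1 * rE q e a d - e (a + d + 1) * ih
    simp only [mul_sub, sub_mul, smul_mul_assoc, mul_smul_comm, mul_assoc]
    module

theorem e_rF_far (H : QGens n q e f k k') (i b d : ℕ) (h : i < b ∨ b + d < i) :
    e i * rF q f b d = rF q f b d * e i := by
  induction d with
  | zero => exact H.e_f_ne _ _ (by omega)
  | succ d ih =>
    have h1 := H.e_f_ne i (b + d + 1) (by omega)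
    have ih := ih (by omega)
    rw [rF]
    linear_combination (norm := skip) q⁻¹ • (h1 * rF q f b d) + q⁻¹ • (f (b + d + 1) * ih)
      - ih * f (b + d + 1) - rF q f b d * h1
    simp only [mul_sub, sub_mul, smul_mul_assoc, mul_smul_comm, mul_assoc]
    module

theorem f_rF_far (H : QGens n q e f k k') (i b d : ℕ) (h : b + d + 1 < i) :
    f i * rF q f b d = rF q f b d * f i := by
  induction d with
  | zero => exact H.f_comm _ _ (Or.inr (by omega))
  | succ d ih =>
    have h1 := H.f_comm i (b + d + 1) (Or.inr (by omega))
    have ih := ih (by omega)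
    rw [rF]
    linear_combination (norm := skip) q⁻¹ • (h1 * rF q f b d) + q⁻¹ • (f (b + d + 1) * ih)
      - ih * f (b + d + 1) - rF q f b d * h1
    simp only [mul_sub, sub_mul, smul_mul_assoc, mul_smul_comm, mul_assoc]
    module

/-- `q ^ ⟨ε_c, ε_a⟩`. -/
def _root_.QuantumGT.du (q : ℂ) (c a : ℕ) : ℂ := if c = a then q else 1

theorem _root_.QuantumGT.du_ne_zero {q : ℂ} (hq : q ≠ 0) (c a : ℕ) : du q c a ≠ 0 := by
  unfold du; split_ifs <;> simp [hq]

theorem _root_.QuantumGT.wt_eq_du {q : ℂ} (hq : q ≠ 0) (i c : ℕ) :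
    wt q i c = du q c i * (du q c (i + 1))⁻¹ := by
  unfold wt du
  split_ifs <;> first | omega | simp [hq]

theorem k_rE (H : QGens n q e f k k') (c a d : ℕ) :
    k c * rE q e a d = (du q c a * (du q c (a + d + 1))⁻¹) • (rE q e a d * k c) := by
  induction d with
  | zero => rw [← wt_eq_du H.q_ne]; exact H.k_e _ _
  | succ d ih =>
    have h1 := H.k_e c (a + d + 1)
    rw [wt_eq_du H.q_ne] at h1
    have := du_ne_zero H.q_ne c (a + d + 1)
    rw [rE, show a + (d + 1) + 1 = a + d + 1 + 1 by ring]
    generalize du q c (a + d + 1) = u at *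
    generalize du q c (a + d + 1 + 1) = v at *
    generalize e (a + d + 1) = x at *
    generalize rE q e a d = z at *
    linear_combination (norm := skip) q • (ih * x) + (q * (du q c a * u⁻¹)) • (z * h1)
      - h1 * z - (u * v⁻¹) • (x * ih)
    simp only [mul_sub, sub_mul, smul_mul_assoc, mul_smul_comm, mul_assoc]
    match_scalars <;> field_simp <;> ring

theorem rF_k (H : QGens n q e f k k') (c b d : ℕ) :
    rF q f b d * k c = (du q c b * (du q c (b + d + 1))⁻¹) • (k c * rF q f b d) := by
  induction d with
  | zero => rw [← wt_eq_du H.q_ne]; exact H.k_f _ _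
  | succ d ih =>
    have h1 := H.k_f c (b + d + 1)
    rw [wt_eq_du H.q_ne] at h1
    have := du_ne_zero H.q_ne c (b + d + 1)
    rw [rF, show b + (d + 1) + 1 = b + d + 1 + 1 by ring]
    generalize du q c (b + d + 1) = u at *
    generalize du q c (b + d + 1 + 1) = v at *
    generalize f (b + d + 1) = x at *
    generalize rF q f b d = z at *
    linear_combination (norm := skip) q⁻¹ • (x * ih) + (q⁻¹ * (du q c b * u⁻¹)) • (h1 * z)
      - z * h1 - (u * v⁻¹) • (ih * x)
    simp only [mul_sub, sub_mul, smul_mul_assoc, mul_smul_comm, mul_assoc]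
    match_scalars <;> field_simp <;> ring

theorem rF_inv (H : QGens n q e f k k') (c b d : ℕ) :
    k' c * rF q f b d = (du q c b * (du q c (b + d + 1))⁻¹) • (rF q f b d * k' c) := by
  have h := congrArg (fun x => k' c * x * k' c) (H.rF_k c b d)
  simp only [mul_smul_comm, smul_mul_assoc, mul_assoc, H.k_inv, mul_one] at h
  rw [← mul_assoc (k' c) (k c), H.inv_k, one_mul] at h
  exact h

/-- The Cartan part of `[e, f]` has two summands. Moved across the shorter root vector they pick up
different powers of `q`; one summand cancels in the `q`-commutator and the other one survives. -/
theorem e_rF_last (H : QGens n q e f k k') (b d : ℕ) (h : b + d + 1 < n) :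
    e (b + d + 1) * rF q f b (d + 1) - rF q f b (d + 1) * e (b + d + 1)
      = k' (b + d + 1) * (k (b + d + 2) * rF q f b d) := by
  have hq := H.q_ne
  have hq2 : q ^ 2 - 1 ≠ 0 := sub_ne_zero.2 H.q_sq
  have h1 := H.e_rF_far (b + d + 1) b d (by omega)
  have h2 := H.e_f (b + d + 1) (by omega) h
  have h3 := H.rF_k (b + d + 1) b d
  have h4 := H.rF_k (b + d + 2) b d
  have h5 := H.rF_inv (b + d + 1) b d
  have h6 := H.rF_inv (b + d + 2) b d
  have e1 : du q (b + d + 1) b * (du q (b + d + 1) (b + d + 1))⁻¹ = q⁻¹ := by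
    simp [du]; omega
  have e2 : du q (b + d + 2) b * (du q (b + d + 2) (b + d + 1))⁻¹ = 1 := by
    simp [du]; omega
  rw [e1] at h3 h5
  rw [e2, one_smul] at h4 h6
  rw [rF]
  change e (b + d + 1) * f (b + d + 1) - f (b + d + 1) * e (b + d + 1) =
    (q - q⁻¹)⁻¹ • (k (b + d + 1) * k' (b + d + 2) - k' (b + d + 1) * k (b + d + 2)) at h2
  generalize e (b + d + 1) = x at *
  generalize f (b + d + 1) = y at *
  generalize rF q f b d = z at *
  generalize k (b + d + 1) = s at *
  generalize k' (b + d + 1) = s' at *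
  generalize k (b + d + 2) = t at *
  generalize k' (b + d + 2) = t' at *
  linear_combination (norm := skip) q⁻¹ • (h2 * z) - z * h2 + q⁻¹ • (y * h1) - h1 * y
    - (q - q⁻¹)⁻¹ • (h3 * t') + ((q - q⁻¹)⁻¹ * q⁻¹) • (s * h6) + ((q - q⁻¹)⁻¹ * q) • (- h5 * t)
    + ((q - q⁻¹)⁻¹ * q) • (s' * h4)
  simp only [mul_sub, sub_mul, mul_add, add_mul, smul_mul_assoc, mul_smul_comm, mul_assoc, neg_mul,
    mul_neg, smul_sub, smul_add]
  match_scalars <;> field_simp <;> ring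

theorem e_rF_first (H : QGens n q e f k k') (b d : ℕ) (hb : 1 ≤ b) (h : b < n) :
    e b * rF q f b (d + 1) - rF q f b (d + 1) * e b
      = -(rF q f (b + 1) d * (k b * k' (b + 1))) := by
  have hq := H.q_ne
  have hq2 : q ^ 2 - 1 ≠ 0 := sub_ne_zero.2 H.q_sq
  induction d with
  | zero =>
    have h2 := H.e_f b hb h
    have h1 := H.e_f_ne b (b + 1) (by omega)
    have h3 := H.k_f b (b + 1)
    have h4 := H.k_f (b + 1) (b + 1)
    have h5 := H.f_inv b (b + 1)
    have h6 := H.f_inv (b + 1) (b + 1)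
    have e1 : wt q (b + 1) b = 1 := by
      rw [wt, if_neg (by omega), if_neg (by omega)]
    have e2 : wt q (b + 1) (b + 1) = q := by simp [wt]
    rw [e1] at h3 h5
    rw [e2] at h4 h6
    simp only [rF, Nat.add_zero]
    generalize e b = x at *
    generalize f b = y at *
    generalize f (b + 1) = z at *
    generalize k b = s at *
    generalize k' b = s' at *
    generalize k (b + 1) = t at *
    generalize k' (b + 1) = t' at *
    linear_combination (norm := skip) q⁻¹ • (z * h2) - h2 * z + q⁻¹ • (h1 * y) - y * h1
      + ((q - q⁻¹)⁻¹ * q⁻¹ + 1) • (h3 * t' + s * h6)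
      - ((q - q⁻¹)⁻¹ * q⁻¹) • (h5 * t + s' * h4)
    simp only [mul_sub, sub_mul, mul_add, add_mul, smul_mul_assoc, mul_smul_comm, mul_assoc,
      neg_mul, mul_neg, smul_sub, smul_add]
    match_scalars <;> field_simp <;> ring
  | succ d ih =>
    have h1 := H.e_f_ne b (b + (d + 1) + 1) (by omega)
    have h3 := H.k_f b (b + (d + 1) + 1)
    have h6 := H.f_inv (b + 1) (b + (d + 1) + 1)
    have e1 : wt q (b + (d + 1) + 1) b = 1 := by
      rw [wt, if_neg (by omega), if_neg (by omega)]
    have e2 : wt q (b + (d + 1) + 1) (b + 1) = 1 := by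
      rw [wt, if_neg (by omega), if_neg (by omega)]
    rw [e1] at h3
    rw [e2] at h6
    rw [rF, show rF q f (b + 1) (d + 1) = q⁻¹ • (f (b + (d + 1) + 1) * rF q f (b + 1) d)
      - rF q f (b + 1) d * f (b + (d + 1) + 1) by rw [rF]; congr 3 <;> ring_nf]
    generalize f (b + (d + 1) + 1) = y at *
    generalize rF q f b (d + 1) = Y at *
    generalize rF q f (b + 1) d = Z at *
    generalize e b = x at *
    generalize k b = s at *
    generalize k' (b + 1) = t' at *
    linear_combination (norm := skip) q⁻¹ • (y * ih) - ih * y + q⁻¹ • (h1 * Y) - Y * h1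
      - Z * h3 * t' - Z * s * h6
    simp only [mul_sub, sub_mul, mul_add, add_mul, smul_mul_assoc, mul_smul_comm, mul_assoc,
      neg_mul, mul_neg, smul_sub, smul_add]
    match_scalars <;> field_simp <;> ring

/-- By `e_rF_last` the commutator with the inner root vector is a Cartan factor times a shorter one.
The next `f` moves across this product with exactly the factor `q` that the outer `q`-commutator
kills. Unlike in `e_rE_mid` no division is needed. -/
theorem e_rF_mid (H : QGens n q e f k k') (b p d : ℕ) (h : p + 2 ≤ d) (hn : b + p + 1 < n) :
    e (b + p + 1) * rF q f b d = rF q f b d * e (b + p + 1) := by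
  have hq := H.q_ne
  induction d, h using Nat.le_induction with
  | base =>
    have hY := H.e_rF_last b p hn
    have hE := H.f_rF_far (b + (p + 1) + 1) b p (by omega)
    have h1 := H.e_f_ne (b + p + 1) (b + (p + 1) + 1) (by omega)
    have h3 := H.k_f (b + p + 2) (b + (p + 1) + 1)
    have h6 := H.f_inv (b + p + 1) (b + (p + 1) + 1)
    have e1 : wt q (b + (p + 1) + 1) (b + p + 2) = q := by
      rw [wt, if_pos (by omega)]
    have e2 : wt q (b + (p + 1) + 1) (b + p + 1) = 1 := by
      rw [wt, if_neg (by omega), if_neg (by omega)]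
    rw [e1] at h3
    rw [e2] at h6
    have hW : rF q f b (p + 2) = q⁻¹ • (f (b + (p + 1) + 1) * rF q f b (p + 1))
      - rF q f b (p + 1) * f (b + (p + 1) + 1) := by rw [rF]
    rw [hW]
    generalize f (b + (p + 1) + 1) = y at *
    generalize rF q f b (p + 1) = Y at *
    generalize rF q f b p = Z at *
    generalize e (b + p + 1) = x at *
    generalize k (b + p + 2) = s at *
    generalize k' (b + p + 1) = t' at *
    linear_combination (norm := skip) q⁻¹ • (y * hY) - hY * y + q⁻¹ • (h1 * Y) - Y * h1
      + q⁻¹ • (h6 * s * Z) + q⁻¹ • (t' * h3 * Z) + t' * s * hE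
    simp only [mul_sub, sub_mul, mul_add, add_mul, smul_mul_assoc, mul_smul_comm, mul_assoc,
      neg_mul, mul_neg, smul_sub, smul_add]
    match_scalars <;> field_simp <;> ring
  | succ d hd ih =>
    have h1 := H.e_f_ne (b + p + 1) (b + d + 1) (by omega)
    rw [rF]
    linear_combination (norm := skip) q⁻¹ • (h1 * rF q f b d) + q⁻¹ • (f (b + d + 1) * ih)
      - ih * f (b + d + 1) - rF q f b d * h1
    simp only [mul_sub, sub_mul, smul_mul_assoc, mul_smul_comm, mul_assoc]
    module

end QGens

/-- The commutation relations of a matrix `L` with the generators `e_i`. -/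
def EInt (n : ℕ) (q : ℂ) (e k k' : ℕ → A) (L : ℕ → ℕ → A) : Prop :=
  ∀ i, 1 ≤ i → i < n → ∀ a b, e i * L a b = wt q i b • (L a b * e i)
    - (if b = i then L a (i + 1) else 0) + (if a = i + 1 then k' i * k (i + 1) * L i b else 0)

/-- The commutation relations of a matrix `L` with the generators `f_i`. -/
def FInt (n : ℕ) (q : ℂ) (f k k' : ℕ → A) (L : ℕ → ℕ → A) : Prop :=
  ∀ i, 1 ≤ i → i < n → ∀ a b, L a b * f i = (wt q i a)⁻¹ • (f i * L a b)
    + (if b = i + 1 then L a i * (k i * k' (i + 1)) else 0) - (if a = i then L (i + 1) b else 0)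

/-- The commutation relations of a matrix `L` with the `k_c`. -/
def KInt (q : ℂ) (k : ℕ → A) (L : ℕ → ℕ → A) : Prop :=
  ∀ c a b, k c * L a b = (du q c a * (du q c b)⁻¹) • (L a b * k c)

namespace QGens

/-- The entry `L⁺_{ab}` is `k_a` times the root vector of the interval from `a` to `b`, so `e_i`
sees only the ends: it extends the interval for `i + 1 = a` and for `i = b`, yields just a power of
`q` for `i = a` or `i + 1 = b`, and commutes otherwise. -/
theorem eInt_lp (H : QGens n q e f k k') : EInt n q e k k' (lp q e k) := by
  have hq := H.q_ne
  intro i hi1 hi2 a b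
  rcases lt_trichotomy a b with hab | hab | hab
  · obtain ⟨d, rfl⟩ : ∃ d, b = a + d + 1 := ⟨b - a - 1, by omega⟩
    have hk := H.e_k a i
    rw [lp_lt]
    rcases lt_trichotomy (i + 1) a with hia | hia | hia
    · have h1 := H.e_rE_far_left i a d hia
      have e1 : wt q i a = 1 := by rw [wt, if_neg (by omega), if_neg (by omega)]
      have e2 : wt q i (a + d + 1) = 1 := by rw [wt, if_neg (by omega), if_neg (by omega)]
      rw [if_neg (by omega), if_neg (by omega), e2]
      rw [e1] at hk
      linear_combination (norm := skip) (q - q⁻¹) • (hk * rE q e a d) + (q - q⁻¹) • (k a * h1)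
      simp only [mul_sub, sub_mul, smul_mul_assoc, mul_smul_comm, mul_assoc]
      module
    · subst hia
      have h1 := H.rE_left i d
      have e1 : wt q i (i + 1) = q⁻¹ := by rw [wt, if_neg (by omega), if_pos (by omega)]
      have e2 : wt q i (i + 1 + d + 1) = 1 := by rw [wt, if_neg (by omega), if_neg (by omega)]
      rw [if_neg (by omega), if_pos rfl, e2, show i + 1 + d + 1 = i + (d + 1) + 1 by ring, lp_lt, h1,
        H.inv_mul_k_smul]
      rw [e1] at hk
      linear_combination (norm := skip) (q - q⁻¹) • (hk * rE q e (i + 1) d)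
      simp only [mul_sub, sub_mul, smul_mul_assoc, mul_smul_comm, mul_assoc]
      match_scalars <;> field_simp <;> ring
    · rw [if_neg (show ¬ a = i + 1 by omega)]
      rcases Nat.lt_or_ge a i with hai | hai
      · obtain ⟨p, rfl⟩ : ∃ p, i = a + p + 1 := ⟨i - a - 1, by omega⟩
        have e1 : wt q (a + p + 1) a = 1 := by rw [wt, if_neg (by omega), if_neg (by omega)]
        rw [e1] at hk
        rcases lt_trichotomy p d with hpd | hpd | hpd
        · rw [if_neg (by omega)]
          rcases Nat.lt_or_ge (p + 1) d with hpd' | hpd'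
          · have h1 := H.e_rE_mid a p d hpd'
            have e2 : wt q (a + p + 1) (a + d + 1) = 1 := by
              rw [wt, if_neg (by omega), if_neg (by omega)]
            rw [e2]
            linear_combination (norm := skip) (q - q⁻¹) • (hk * rE q e a d)
              + (q - q⁻¹) • (k a * h1)
            simp only [mul_sub, sub_mul, smul_mul_assoc, mul_smul_comm, mul_assoc]
            module
          · obtain rfl : d = p + 1 := by omega
            have h1 := H.e_rE_last a p
            have e2 : wt q (a + p + 1) (a + (p + 1) + 1) = q⁻¹ := by
              rw [wt, if_neg (by omega), if_pos (by omega)]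
            rw [e2]
            linear_combination (norm := skip) (q - q⁻¹) • (hk * rE q e a (p + 1))
              + (q - q⁻¹) • (k a * h1)
            simp only [mul_sub, sub_mul, smul_mul_assoc, mul_smul_comm, mul_assoc]
            module
        · subst hpd
          have e2 : wt q (a + p + 1) (a + p + 1) = q := by rw [wt, if_pos rfl]
          rw [if_pos rfl, e2, show a + p + 1 + 1 = a + (p + 1) + 1 by ring, lp_lt, rE]
          linear_combination (norm := skip) (q - q⁻¹) • (hk * rE q e a p)
          simp only [mul_sub, sub_mul, smul_mul_assoc, mul_smul_comm, mul_assoc]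
          module
        · have h1 := H.e_rE_far_right (a + p + 1) a d (by omega)
          have e2 : wt q (a + p + 1) (a + d + 1) = 1 := by
            rw [wt, if_neg (by omega), if_neg (by omega)]
          rw [if_neg (by omega), e2]
          linear_combination (norm := skip) (q - q⁻¹) • (hk * rE q e a d) + (q - q⁻¹) • (k a * h1)
          simp only [mul_sub, sub_mul, smul_mul_assoc, mul_smul_comm, mul_assoc]
          module
      · obtain rfl : i = a := by omega
        have e1 : wt q i i = q := by rw [wt, if_pos rfl]
        rw [e1] at hk
        rw [if_neg (by omega)]
        cases d with
        | zero =>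
          have e2 : wt q i (i + 0 + 1) = q⁻¹ := by rw [wt, if_neg (by omega), if_pos (by omega)]
          rw [e2, rE]
          linear_combination (norm := skip) (q - q⁻¹) • (hk * e i)
          simp only [mul_sub, sub_mul, smul_mul_assoc, mul_smul_comm, mul_assoc]
          module
        | succ d =>
          have h1 := H.e_rE_first i d
          have e2 : wt q i (i + (d + 1) + 1) = 1 := by
            rw [wt, if_neg (by omega), if_neg (by omega)]
          rw [e2]
          linear_combination (norm := skip) (q - q⁻¹) • (hk * rE q e i (d + 1))
            + ((q - q⁻¹) * q⁻¹) • (k i * h1)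
          simp only [mul_sub, sub_mul, smul_mul_assoc, mul_smul_comm, mul_assoc]
          match_scalars <;> field_simp <;> ring
  · subst hab
    rw [lp_self]
    have hk := H.e_k a i
    by_cases h1 : a = i
    · subst h1
      have e1 : wt q a a = q := by rw [wt, if_pos rfl]
      rw [if_pos rfl, if_neg (by omega), e1, lp_succ]
      rw [e1] at hk
      linear_combination (norm := skip) hk
      match_scalars <;> field_simp <;> ring
    · rw [if_neg h1]
      by_cases h2 : a = i + 1
      · subst h2
        have e1 : wt q i (i + 1) = q⁻¹ := by rw [wt, if_neg (by omega), if_pos (by omega)]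
        rw [e1] at hk
        rw [if_pos rfl, lp_succ, e1, H.inv_mul_k_smul]
        linear_combination (norm := skip) hk
        match_scalars <;> field_simp <;> ring
      · have e1 : wt q i a = 1 := by rw [wt, if_neg (by omega), if_neg (by omega)]
        rw [e1] at hk
        rw [if_neg h2, e1, hk]
        simp
  · rw [lp_gt _ _ _ hab]
    by_cases h1 : b = i
    · subst h1
      rw [if_pos rfl]
      by_cases h2 : a = b + 1
      · subst h2
        rw [if_pos rfl, lp_self, lp_self, ← H.k_inv_comm, mul_assoc, H.inv_k]
        simp
      · rw [if_neg h2, lp_gt _ _ _ (by omega)]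
        simp
    · rw [if_neg h1]
      by_cases h2 : a = i + 1
      · rw [if_pos h2, lp_gt _ _ _ (by omega)]
        simp
      · rw [if_neg h2]
        simp

/-- Here `e_i` shortens the interval instead of extending it: `i = b` removes the first simple root,
`i + 1 = a` the last one. For a simple root both happen at once and the result is the Cartan part of
`[e_i, f_i]`. That `L⁺` and `L⁻` obey the same relations lets them pass to every `L(z)`. -/
theorem eInt_lm (H : QGens n q e f k k') : EInt n q e k k' (lm q f k') := by
  have hq := H.q_ne
  have hq2 : q ^ 2 - 1 ≠ 0 := sub_ne_zero.2 H.q_sq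
  intro i hi1 hi2 a b
  have hk := H.e_inv b i
  rcases lt_trichotomy b a with hab | hab | hab
  · obtain ⟨d, rfl⟩ : ∃ d, a = b + d + 1 := ⟨a - b - 1, by omega⟩
    rw [lm_gt]
    by_cases hib : b = i
    · subst hib
      have e1 : wt q b b = q := by rw [wt, if_pos rfl]
      rw [if_pos rfl, e1]
      rw [e1] at hk
      cases d with
      | zero =>
        have h1 := H.e_f b hi1 hi2
        have h2 := H.k_inv_comm b b
        have h3 := H.k_inv b
        have h4 := H.k_inv_comm b (b + 1)
        have h5 := H.k_inv_comm (b + 1) b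
        rw [Nat.add_zero, if_pos rfl, lm_self, lm_self, rF]
        linear_combination (norm := skip) (-(q - q⁻¹)) • (h1 * k' b) - (q - q⁻¹) • (f b * hk)
          - k' (b + 1) * h3 - h4 * k' b
        simp only [mul_sub, sub_mul, smul_mul_assoc, mul_smul_comm, mul_assoc, mul_neg, neg_mul,
          mul_one, smul_sub]
        match_scalars <;> field_simp <;> ring
      | succ d =>
        have h1 := H.e_rF_first b d hi1 hi2
        rw [if_neg (by omega), show b + (d + 1) + 1 = b + 1 + d + 1 by ring, lm_gt]
        have h3 := H.k_inv b
        have h4 := H.k_inv_comm b (b + 1)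
        linear_combination (norm := skip) (-(q - q⁻¹)) • (h1 * k' b)
          - (q - q⁻¹) • (rF q f b (d + 1) * hk)
          + (q - q⁻¹) • (rF q f (b + 1) d * (h4 * k' b + k' (b + 1) * h3))
        simp only [mul_sub, sub_mul, mul_add, add_mul, smul_mul_assoc, mul_smul_comm, mul_assoc,
          mul_neg, neg_mul, mul_one, smul_sub, smul_add, smul_neg]
        match_scalars <;> field_simp <;> ring
    · rw [if_neg hib]
      by_cases hia : i = b + d
      · obtain ⟨d, rfl⟩ : ∃ d', d = d' + 1 := ⟨d - 1, by omega⟩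
        obtain rfl : i = b + d + 1 := by omega
        have h1 := H.e_rF_last b d hi2
        have e1 : wt q (b + d + 1) b = 1 := by rw [wt, if_neg (by omega), if_neg (by omega)]
        rw [e1] at hk
        rw [if_pos (by omega), e1, lm_gt]
        linear_combination (norm := skip) (-(q - q⁻¹)) • (h1 * k' b)
          - (q - q⁻¹) • (rF q f b (d + 1) * hk)
        simp only [mul_sub, sub_mul, mul_add, add_mul, smul_mul_assoc, mul_smul_comm, mul_assoc,
          mul_neg, neg_mul, mul_one, smul_sub, smul_add, smul_neg]
        module
      · rw [if_neg (by omega)]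
        have h1 : e i * rF q f b d = rF q f b d * e i := by
          by_cases h : i < b ∨ b + d < i
          · exact H.e_rF_far i b d h
          · obtain ⟨p, rfl⟩ : ∃ p, i = b + p + 1 := ⟨i - b - 1, by omega⟩
            exact H.e_rF_mid b p d (by omega) hi2
        linear_combination (norm := skip) (-(q - q⁻¹)) • (h1 * k' b)
          - (q - q⁻¹) • (rF q f b d * hk)
        simp only [mul_sub, sub_mul, mul_add, add_mul, smul_mul_assoc, mul_smul_comm, mul_assoc,
          mul_neg, neg_mul, mul_one, smul_sub, smul_add, smul_neg]
        module
  · subst hab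
    rw [lm_self, hk]
    by_cases h1 : b = i
    · subst h1
      rw [if_pos rfl, if_neg (by omega), lm_lt _ _ _ (show b < b + 1 by omega)]
      simp
    · rw [if_neg h1]
      by_cases h2 : b = i + 1
      · rw [if_pos h2, lm_lt _ _ _ (by omega)]
        simp
      · rw [if_neg h2]
        simp
  · rw [lm_lt _ _ _ hab]
    by_cases h1 : b = i
    · rw [if_pos h1, if_neg (by omega), lm_lt _ _ _ (by omega)]
      simp
    · rw [if_neg h1]
      by_cases h2 : a = i + 1
      · rw [if_pos h2, lm_lt _ _ _ (by omega)]
        simp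
      · rw [if_neg h2]
        simp

theorem kInt_lp (H : QGens n q e f k k') : KInt q k (lp q e k) := by
  intro c a b
  have hq := H.q_ne
  rcases lt_trichotomy a b with hab | hab | hab
  · obtain ⟨d, rfl⟩ : ∃ d, b = a + d + 1 := ⟨b - a - 1, by omega⟩
    have h1 := H.k_rE c a d
    have h2 := H.k_comm c a
    rw [lp_lt]
    linear_combination (norm := skip) (q - q⁻¹) • (h2 * rE q e a d) + (q - q⁻¹) • (k a * h1)
    simp only [mul_sub, sub_mul, smul_mul_assoc, mul_smul_comm, mul_assoc]
    module
  · subst hab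
    rw [lp_self, H.k_comm, mul_inv_cancel₀ (du_ne_zero hq _ _), one_smul]
  · rw [lp_gt _ _ _ hab]
    simp

theorem kInt_lm (H : QGens n q e f k k') : KInt q k (lm q f k') := by
  intro c a b
  have hq := H.q_ne
  rcases lt_trichotomy b a with hab | hab | hab
  · obtain ⟨d, rfl⟩ : ∃ d, a = b + d + 1 := ⟨a - b - 1, by omega⟩
    have h1 := H.rF_k c b d
    have h2 := H.k_inv_comm c b
    have h3 := du_ne_zero hq c b
    have h4 := du_ne_zero hq c (b + d + 1)
    rw [lm_gt]
    linear_combination (norm := skip)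
      ((q - q⁻¹) * ((du q c (b + d + 1)) * (du q c b)⁻¹)) • (h1 * k' b)
        - ((q - q⁻¹) * ((du q c (b + d + 1)) * (du q c b)⁻¹)) • (rF q f b d * h2)
    simp only [mul_sub, sub_mul, mul_add, add_mul, smul_mul_assoc, mul_smul_comm, mul_assoc,
      mul_neg, neg_mul, mul_one, smul_sub, smul_add, smul_neg]
    match_scalars <;> field_simp <;> ring
  · subst hab
    rw [lm_self, H.k_inv_comm, mul_inv_cancel₀ (du_ne_zero hq _ _), one_smul]
  · rw [lm_lt _ _ _ hab]
    simp

end QGens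

end RootVectors

end QuantumGT

end

noncomputable section

namespace QuantumGT

/-! ### The opposite algebra and the commutation relations of the matrices `L⁺` and `L⁻` -/

section Exchange

open MulOpposite

variable {A : Type*} [Ring A] [Algebra ℂ A] {n : ℕ} {q : ℂ} {e f k k' : ℕ → A}

theorem wt_inv (q : ℂ) (i a : ℕ) : wt q⁻¹ i a = (wt q i a)⁻¹ := by
  unfold wt; split_ifs <;> simp

theorem du_inv (q : ℂ) (i a : ℕ) : du q⁻¹ i a = (du q i a)⁻¹ := by
  unfold du; split_ifs <;> simp

/-- The opposite algebra satisfies the relations for `q⁻¹`, with `e_i` and `f_i` interchanged. -/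
theorem QGens.opp (H : QGens n q e f k k') :
    QGens n q⁻¹ (fun i => op (f i)) (fun i => op (e i)) (fun i => op (k' i))
      (fun i => op (k i)) where
  q_ne := inv_ne_zero H.q_ne
  q_sq := by rw [inv_pow, ne_eq, inv_eq_one]; exact H.q_sq
  q_sq' := by
    intro h
    apply H.q_sq'
    rw [← inv_inv (q ^ 2), ← inv_pow, h]; norm_num
  k_inv i := by rw [← op_mul, H.k_inv]; rfl
  inv_k i := by rw [← op_mul, H.inv_k]; rfl
  k_comm i j := by rw [← op_mul, ← op_mul, H.inv_comm]
  k_e a i := by rw [← op_mul, ← op_mul, H.f_inv, wt_inv, op_smul]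
  k_f a i := by rw [← op_mul, ← op_mul, H.inv_e, wt_inv, op_smul]
  e_f i h1 h2 := by
    have h := congrArg op (H.e_f i h1 h2)
    rw [H.k_inv_comm i (i + 1), ← H.k_inv_comm (i + 1) i] at h
    simp only [op_sub, op_mul, op_smul] at h
    rw [h, inv_inv, ← neg_sub q q⁻¹, inv_neg]
    module
  e_f_ne i j h := by rw [← op_mul, ← op_mul, H.e_f_ne _ _ h.symm]
  serre_e i j h := by
    have h := congrArg op (H.serre_f i j h)
    simp only [op_sub, op_add, op_mul, op_smul, op_zero, mul_assoc] at h
    rw [← h, inv_inv]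
    module
  serre_f i j h := by
    have h := congrArg op (H.serre_e i j h)
    simp only [op_sub, op_add, op_mul, op_smul, op_zero, mul_assoc] at h
    rw [← h, inv_inv]
    module
  e_comm i j h := by rw [← op_mul, ← op_mul, H.f_comm _ _ h]
  f_comm i j h := by rw [← op_mul, ← op_mul, H.e_comm _ _ h]

theorem rE_op (q : ℂ) (f : ℕ → A) (i d : ℕ) :
    rE q⁻¹ (fun i => op (f i)) i d = op (rF q f i d) := by
  induction d with
  | zero => rfl
  | succ d ih => rw [rE, rF, ih, op_sub, op_smul, op_mul, op_mul]

theorem rF_op (q : ℂ) (e : ℕ → A) (i d : ℕ) :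
    rF q⁻¹ (fun i => op (e i)) i d = op (rE q e i d) := by
  induction d with
  | zero => rfl
  | succ d ih => rw [rE, rF, ih, op_sub, op_smul, op_mul, op_mul, inv_inv]

theorem lp_op (q : ℂ) (f k' : ℕ → A) (a b : ℕ) :
    lp q⁻¹ (fun i => op (f i)) (fun i => op (k' i)) a b = op (lm q f k' b a) := by
  unfold lp lm
  by_cases h : a = b
  · simp [h]
  · rw [if_neg h, if_neg (Ne.symm h)]
    split_ifs
    · rw [rE_op, ← op_mul, ← op_smul, inv_inv, ← neg_sub q q⁻¹, neg_smul]
    · rfl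

theorem lm_op (q : ℂ) (e k : ℕ → A) (a b : ℕ) :
    lm q⁻¹ (fun i => op (e i)) (fun i => op (k i)) a b = op (lp q e k b a) := by
  unfold lp lm
  by_cases h : a = b
  · simp [h]
  · rw [if_neg h, if_neg (Ne.symm h)]
    split_ifs
    · rw [rF_op, ← op_mul, ← op_smul, ← op_neg, inv_inv, ← neg_sub q q⁻¹, neg_smul, neg_neg]
    · rfl

/-- The `f`-relations of a matrix are the `e`-relations of its transpose in the opposite algebra,
which spares a second case analysis. -/
theorem fInt_of_op (H : QGens n q e f k k') {L : ℕ → ℕ → A}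
    (h : EInt n q⁻¹ (fun i => op (f i)) (fun i => op (k' i)) (fun i => op (k i))
      (fun a b => op (L b a))) : FInt n q f k k' L := by
  intro i h1 h2 a b
  have h := congrArg unop (h i h1 h2 b a)
  simp only [unop_add, unop_sub, unop_mul, unop_op, unop_smul, wt_inv] at h
  rw [h]
  by_cases h3 : a = i <;> by_cases h4 : b = i + 1 <;> simp [h3, h4, H.k_inv_comm]; module

theorem QGens.fInt_lp (H : QGens n q e f k k') : FInt n q f k k' (lp q e k) := by
  have h := H.opp.eInt_lm
  apply fInt_of_op H
  convert h using 3
  rw [lm_op]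

theorem QGens.fInt_lm (H : QGens n q e f k k') : FInt n q f k k' (lm q f k') := by
  have h := H.opp.eInt_lp
  apply fInt_of_op H
  convert h using 3
  rw [lp_op]

/-- The exchange relation between `L⁺` and a matrix `L`, with the inverse of the `R`-matrix. -/
def Exch (n : ℕ) (q : ℂ) (X L : ℕ → ℕ → A) : Prop :=
  ∀ a b c d, 1 ≤ b → c ≤ n →
    (du q a b)⁻¹ • (X b c * L a d) - (if b < a then (q - q⁻¹) • (X a c * L b d) else 0) =
    (du q c d)⁻¹ • (L a d * X b c) - (if d < c then (q - q⁻¹) • (L a c * X b d) else 0)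

/-- Induction on the column `c` of the entry of `L⁺`, starting from the diagonal entry `k_b`, where
the claim is the weight relation. The entry in column `c + 1` is a `q`-commutator of the entry in
column `c` with `e_c`, so the relation in column `c` together with the action of `e_c` on `L` gives
the one in column `c + 1`. -/
theorem QGens.exch (H : QGens n q e f k k') {L : ℕ → ℕ → A} (hE : EInt n q e k k' L)
    (hK : KInt q k L) : Exch n q (lp q e k) L := by
  have hq := H.q_ne
  intro a b c d hb hc
  rcases Nat.lt_or_ge c b with hcb | hbc
  · rw [lp_gt _ _ _ hcb]
    have h1 : (if b < a then (q - q⁻¹) • (lp q e k a c * L b d) else 0) = 0 := by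
      split_ifs
      · rw [lp_gt _ _ _ (by omega)]; simp
      · rfl
    have h2 : (if d < c then (q - q⁻¹) • (L a c * lp q e k b d) else 0) = 0 := by
      split_ifs
      · rw [lp_gt _ _ _ (by omega)]; simp
      · rfl
    rw [h1, h2]; simp
  induction c, hbc using Nat.le_induction generalizing a d with
  | base =>
    have h1 : (if b < a then (q - q⁻¹) • (lp q e k a b * L b d) else 0) = 0 := by
      split_ifs
      · rw [lp_gt _ _ _ (by omega)]; simp
      · rfl
    have h2 : (if d < b then (q - q⁻¹) • (L a b * lp q e k b d) else 0) = 0 := by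
      split_ifs
      · rw [lp_gt _ _ _ (by omega)]; simp
      · rfl
    have h3 : du q a b = du q b a := by simp [du, eq_comm]
    rw [h1, h2, lp_self, hK b a d, smul_smul, h3, ← mul_assoc,
      inv_mul_cancel₀ (du_ne_zero hq _ _), one_mul]
  | succ c hbc ih =>
    have ih := fun a d => ih a d (by omega)
    have hEp := H.eInt_lp c (by omega) (by omega)
    have hEL := hE c (by omega) (by omega)
    have hX : ∀ a, a ≠ c + 1 →
        lp q e k a (c + 1) = q • (lp q e k a c * e c) - e c * lp q e k a c := by
      intro a ha
      rw [hEp a c, if_pos rfl, if_neg ha, wt, if_pos rfl]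
      module
    have hXb := hX b (by omega)
    -- `T` is the row term in the relation of `e_c` with `L a d`. It is present only for `a = c +
    -- 1`.
    obtain ⟨T, hT⟩ : ∃ T : ℕ → A, T = fun d => if a = c + 1 then k' c * k (c + 1) * L c d else 0 :=
      ⟨_, rfl⟩
    have hLa : ∀ d, e c * L a d = wt q c d • (L a d * e c)
        - (if d = c then L a (c + 1) else 0) + T d := by
      intro d; rw [hEL a d, hT]
    -- The right hand side of the relation in column `c`. The left hand side in column `c + 1` is
    -- first expressed by `R` and `e_c`; only then is `R` expanded, according to the position of `d`
    -- relative to `c`.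
    set R : ℕ → A := fun d => (du q c d)⁻¹ • (L a d * lp q e k b c)
      - (if d < c then (q - q⁻¹) • (L a c * lp q e k b d) else 0) with hR
    have hcomm : ∀ d, d < c → e c * lp q e k b d = lp q e k b d * e c := by
      intro d hd
      rw [hEp b d, if_neg (by omega), if_neg (by omega), wt, if_neg (by omega), if_neg (by omega)]
      simp
    have key : (du q a b)⁻¹ • (lp q e k b (c + 1) * L a d)
        - (if b < a then (q - q⁻¹) • (lp q e k a (c + 1) * L b d) else 0)
        = (q * wt q c d) • (R d * e c) - (if d = c then q • R (c + 1) else 0) - e c * R d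
          + ((du q c d)⁻¹ • (T d * lp q e k b c)
            - (if d < c then (q - q⁻¹) • (T c * lp q e k b d) else 0)) := by
      by_cases hac : a = c + 1
      · subst hac
        have u1 : du q (c + 1) b = 1 := by rw [du, if_neg (by omega)]
        have h1 := ih (c + 1) d
        have h2 := ih (c + 1) (c + 1)
        have h3 := ih c d
        have h4 := hLa d
        have h5 : lp q e k (c + 1) c = 0 := lp_gt _ _ _ (by omega)
        have h6 := H.k_inv c
        have h7 := H.k_inv_comm (c + 1) c
        have hT' : ∀ d, T d = k' c * k (c + 1) * L c d := by intro d; rw [hT]; simp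
        have h8 := H.kInt_lp (c + 1) b c
        have h9 := H.kInt_lp c b c
        have h10 := H.inv_k c
        rw [show du q (c + 1) c = 1 by rw [du, if_neg (by omega)], u1] at h8
        rw [show du q c c = q by rw [du, if_pos rfl]] at h9
        rw [if_pos (by omega), u1, h5] at h1 h2
        have hb2 : b < c + 1 := by omega
        rw [hXb, lp_self, if_pos hb2, u1]
        -- The terms created by `T` on the left form, up to the Cartan factor, the left side of the
        -- relation with row `c` in the place of row `c + 1`, so that the induction hypothesis
        -- applies to them as well.
        have h11 : q • (lp q e k b c * (k' c * k (c + 1) * L c d)) - (q - q⁻¹) • (k (c + 1) * L b d)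
            = k' c * k (c + 1) * ((du q c b)⁻¹ • (lp q e k b c * L c d)
              - (if b < c then (q - q⁻¹) • (lp q e k c c * L b d) else 0)) := by
          have h12 : lp q e k b c * k' c = (du q c b * q⁻¹) • (k' c * lp q e k b c) := by
            have := congrArg (fun z => k' c * z * k' c) h9
            simp only [mul_smul_comm, smul_mul_assoc, mul_assoc, H.k_inv, mul_one] at this
            rw [← mul_assoc (k' c) (k c), h10, one_mul] at this
            exact this
          rcases Nat.lt_or_ge b c with hbc' | hbc'
          · rw [if_pos hbc', lp_self, show du q c b = 1 by rw [du, if_neg (by omega)]]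
            rw [show du q c b = 1 by rw [du, if_neg (by omega)]] at h12
            linear_combination (norm := skip) q • (h12 * (k (c + 1) * L c d))
              - k' c * h8 * L c d - (q - q⁻¹) • (h7 * (k c * L b d))
              + (q - q⁻¹) • (k (c + 1) * h10 * L b d)
            simp only [mul_sub, sub_mul, mul_add, add_mul, smul_mul_assoc, mul_smul_comm, mul_assoc,
              mul_neg, neg_mul, smul_sub, smul_add, smul_neg, zero_mul, sub_zero, mul_one, one_mul]
            match_scalars <;> field_simp <;> ring
          · obtain rfl : b = c := by omega
            rw [if_neg (by omega), lp_self, show du q b b = q by rw [du, if_pos rfl]]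
            linear_combination (norm := skip) q • (h6 * (k (b + 1) * L b d))
              - q⁻¹ • (k (b + 1) * h10 * L b d) + q⁻¹ • (h7 * (k b * L b d))
            simp only [mul_sub, sub_mul, mul_add, add_mul, smul_mul_assoc, mul_smul_comm, mul_assoc,
              mul_neg, neg_mul, smul_sub, smul_add, smul_neg, zero_mul, sub_zero, mul_one, one_mul]
            match_scalars <;> field_simp <;> ring
        have h13 : (du q c d)⁻¹ • (T d * lp q e k b c)
            - (if d < c then (q - q⁻¹) • (T c * lp q e k b d) else 0) = k' c * k (c + 1) *
              ((du q c d)⁻¹ • (L c d * lp q e k b c)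
                - (if d < c then (q - q⁻¹) • (L c c * lp q e k b d) else 0)) := by
          rw [hT', hT']
          split_ifs <;> simp only [mul_sub, mul_smul_comm, mul_assoc, mul_zero]
        rw [h13, ← h3, ← h11, ← hT' d]
        change _ = R (c + 1) at h2
        change _ = R d at h1
        rw [← h1, ← h2]
        by_cases hdc : d = c
        · rw [if_pos hdc] at h4 ⊢
          linear_combination (norm := skip) q • (lp q e k b c * h4)
          simp only [mul_sub, sub_mul, mul_add, add_mul, smul_mul_assoc, mul_smul_comm, mul_assoc,
            mul_neg, neg_mul, smul_sub, smul_add, smul_neg, zero_mul, mul_zero, smul_zero, sub_zero,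
            mul_one, one_mul]
          match_scalars <;> field_simp <;> ring
        · rw [if_neg hdc] at h4 ⊢
          linear_combination (norm := skip) q • (lp q e k b c * h4)
          simp only [mul_sub, sub_mul, mul_add, add_mul, smul_mul_assoc, mul_smul_comm, mul_assoc,
            mul_neg, neg_mul, smul_sub, smul_add, smul_neg, zero_mul, mul_zero, smul_zero, sub_zero,
            mul_one, one_mul]
          match_scalars <;> field_simp <;> ring
      · have hT' : ∀ d, T d = 0 := by intro d; rw [hT]; simp [hac]
        have h1 := ih a d
        have h2 := ih a (c + 1)
        have h4 := hLa d
        have h5 := hEL b d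
        rw [if_neg (show ¬ b = c + 1 by omega)] at h5
        rw [hT'] at h4
        change _ = R (c + 1) at h2
        change _ = R d at h1
        rw [← h1, ← h2, hT', hT', hXb, hX a hac]
        by_cases hdc : d = c <;> by_cases hab : b < a
        all_goals
          simp only [hdc, hab, if_true, if_false] at h4 h5 ⊢
          linear_combination (norm := skip) (q * (du q a b)⁻¹) • (lp q e k b c * h4)
        · linear_combination (norm := skip) (- q * (q - q⁻¹)) • (lp q e k a c * h5)
          simp only [mul_sub, sub_mul, mul_add, add_mul, smul_mul_assoc, mul_smul_comm, mul_assoc,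
            mul_neg, neg_mul, smul_sub, smul_add, smul_neg, zero_mul, sub_zero, mul_one, one_mul,
            mul_zero, smul_zero]
          split_ifs <;> match_scalars <;> ring
        · simp only [mul_sub, sub_mul, mul_add, add_mul, smul_mul_assoc, mul_smul_comm, mul_assoc,
            mul_neg, neg_mul, smul_sub, smul_add, smul_neg, zero_mul, sub_zero, mul_one, one_mul,
            mul_zero, smul_zero]
          split_ifs <;> match_scalars <;> ring
        · linear_combination (norm := skip) (- q * (q - q⁻¹)) • (lp q e k a c * h5)
          simp only [mul_sub, sub_mul, mul_add, add_mul, smul_mul_assoc, mul_smul_comm, mul_assoc,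
            mul_neg, neg_mul, smul_sub, smul_add, smul_neg, zero_mul, sub_zero, mul_one, one_mul,
            mul_zero, smul_zero]
          split_ifs <;> match_scalars <;> ring
        · simp only [mul_sub, sub_mul, mul_add, add_mul, smul_mul_assoc, mul_smul_comm, mul_assoc,
            mul_neg, neg_mul, smul_sub, smul_add, smul_neg, zero_mul, sub_zero, mul_one, one_mul,
            mul_zero, smul_zero]
          split_ifs <;> match_scalars <;> ring
    rw [key, hR]
    rcases lt_trichotomy d c with hdc | hdc | hdc
    · have e1 : wt q c d = 1 := by rw [wt, if_neg (by omega), if_neg (by omega)]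
      have e2 : du q c d = 1 := by rw [du, if_neg (by omega)]
      have e3 : du q (c + 1) d = 1 := by rw [du, if_neg (by omega)]
      have e4 : wt q c c = q := by rw [wt, if_pos rfl]
      have h1 := hLa d
      have h2 := hLa c
      have h3 := hcomm d hdc
      rw [if_neg (by omega), e1] at h1
      rw [if_pos rfl, e4] at h2
      simp only [if_pos hdc, if_neg (show ¬ d = c by omega), if_pos (show d < c + 1 by omega), e1, e2,
        e3]
      rw [hXb]
      generalize T d = Td at *
      generalize T c = Tc at *
      generalize e c = x at *
      linear_combination (norm := skip) - h1 * lp q e k b c + (q - q⁻¹) • (h2 * lp q e k b d)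
        + ((q - q⁻¹) * q) • (L a c * h3)
      simp only [mul_sub, sub_mul, mul_add, add_mul, smul_mul_assoc, mul_smul_comm, mul_assoc,
        mul_neg, neg_mul, smul_sub, smul_add, smul_neg, zero_mul, sub_zero]
      match_scalars <;> field_simp <;> ring
    · subst hdc
      have e1 : wt q d d = q := by rw [wt, if_pos rfl]
      have e2 : du q d d = q := by rw [du, if_pos rfl]
      have e3 : du q (d + 1) d = 1 := by rw [du, if_neg (by omega)]
      have e4 : du q d (d + 1) = 1 := by rw [du, if_neg (by omega)]
      have h1 := hLa d
      rw [if_pos rfl, e1] at h1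
      simp only [if_pos (show d = d from rfl), if_neg (show ¬ d < d by omega), if_neg (show ¬ d + 1 < d by omega),
        if_pos (show d < d + 1 by omega), e1, e2, e3, e4]
      rw [hXb]
      generalize T d = Td at *
      generalize e d = x at *
      linear_combination (norm := skip) - q⁻¹ • (h1 * lp q e k b d)
      simp only [mul_sub, sub_mul, mul_add, add_mul, smul_mul_assoc, mul_smul_comm, mul_assoc,
        mul_neg, neg_mul, smul_sub, smul_add, smul_neg, zero_mul, sub_zero, if_true]
      match_scalars <;> field_simp <;> ring
    · have e2 : du q c d = 1 := by rw [du, if_neg (by omega)]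
      have h1 := hLa d
      rw [if_neg (by omega)] at h1
      simp only [if_neg (show ¬ d < c by omega), if_neg (show ¬ d = c by omega),
        if_neg (show ¬ d < c + 1 by omega), e2]
      have e5 : (du q (c + 1) d)⁻¹ = wt q c d := by
        rw [du, wt, if_neg (show ¬ d = c by omega)]
        by_cases h : c + 1 = d
        · simp [h]
        · rw [if_neg h, if_neg (Ne.symm h)]; simp
      rw [hXb, e5]
      generalize T d = Td at *
      generalize wt q c d = w at *
      generalize e c = x at *
      linear_combination (norm := skip) - (h1 * lp q e k b c)
      simp only [mul_sub, sub_mul, mul_add, add_mul, smul_mul_assoc, mul_smul_comm, mul_assoc,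
        mul_neg, neg_mul, smul_sub, smul_add, smul_neg, zero_mul, sub_zero]
      match_scalars <;> field_simp <;> ring

end Exchange

end QuantumGT

end

noncomputable section

namespace QuantumGT

/-! ### Symmetries of products of two entries -/

section Pairs

open MulOpposite

variable {A : Type*} [Ring A] [Algebra ℂ A] {n : ℕ} {q : ℂ} {e f k k' : ℕ → A}

/-- The `q`-antisymmetrization of the rows of `L ⊗ L'` is `q`-antisymmetric in the columns. -/
structure RowAnti (n : ℕ) (q : ℂ) (L L' : ℕ → ℕ → A) : Prop where
  swap : ∀ a b c d, 1 ≤ a → a < b → b ≤ n → 1 ≤ c → c < d → d ≤ n →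
    L a d * L' b c - q • (L b d * L' a c) = (-q) • (L a c * L' b d - q • (L b c * L' a d))
  eq : ∀ a b c, 1 ≤ a → a < b → b ≤ n → 1 ≤ c → c ≤ n →
    L a c * L' b c - q • (L b c * L' a c) = 0

/-- The `q`-antisymmetrization of the rows and the columns of `L ⊗ L'`. -/
def pairSum (q : ℂ) (L L' : ℕ → ℕ → A) (a b c d : ℕ) : A :=
  L a c * L' b d - q • (L b c * L' a d) - q • (L a d * L' b c) + q ^ 2 • (L b d * L' a c)

/-- The `q`-antisymmetrization of the rows and the columns is symmetric in the two factors. -/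
def SymPair (n : ℕ) (q : ℂ) (L L' : ℕ → ℕ → A) : Prop :=
  ∀ a b c d, 1 ≤ a → a < b → b ≤ n → 1 ≤ c → c < d → d ≤ n →
    pairSum q L L' a b c d = pairSum q L' L a b c d

/-- The matrix `L(z) = z L⁺ - z⁻¹ L⁻`. -/
def Lz (q : ℂ) (e f k k' : ℕ → A) (z : ℂ) (a b : ℕ) : A :=
  z • lp q e k a b - z⁻¹ • lm q f k' a b

/-- The relations of the entries of `L⁻`, from the opposite algebra. -/
theorem QGens.exch_lm (H : QGens n q e f k k') (a b c d : ℕ) (hb : 1 ≤ b) (hc : c ≤ n) :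
    du q a b • (lm q f k' d a * lm q f k' c b)
      + (if b < a then (q - q⁻¹) • (lm q f k' d b * lm q f k' c a) else 0) =
    du q c d • (lm q f k' c b * lm q f k' d a)
      + (if d < c then (q - q⁻¹) • (lm q f k' d b * lm q f k' c a) else 0) := by
  have h := congrArg unop (H.opp.exch H.opp.eInt_lp H.opp.kInt_lp a b c d hb hc)
  simp only [lp_op, ← op_mul, du_inv, inv_inv] at h
  have e1 : ∀ (p : Prop) [Decidable p] (x : A), unop (if p then (q⁻¹ - q) • op x else 0) =
      - if p then (q - q⁻¹) • x else 0 := by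
    intro p _ x
    split_ifs
    · rw [unop_smul, unop_op]; module
    · simp
  simp only [unop_sub, unop_smul, unop_op, e1, sub_neg_eq_add] at h
  exact h

theorem du_self (q : ℂ) (a : ℕ) : du q a a = q := if_pos rfl

theorem du_of_ne (q : ℂ) {a b : ℕ} (h : a ≠ b) : du q a b = 1 := if_neg h

theorem QGens.exch_lp_of_lt (H : QGens n q e f k k') {L : ℕ → ℕ → A} (hE : EInt n q e k k' L)
    (hK : KInt q k L) {a b c d : ℕ} (ha : 1 ≤ a) (hab : a < b) (hcd : c < d) (hd : d ≤ n) :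
    lp q e k b c * L a d = L a d * lp q e k b c ∧
    lp q e k a c * L b d - (q - q⁻¹) • (lp q e k b c * L a d) = L b d * lp q e k a c ∧
    lp q e k b d * L a c = L a c * lp q e k b d - (q - q⁻¹) • (L a d * lp q e k b c) ∧
    lp q e k a d * L b c - (q - q⁻¹) • (lp q e k b d * L a c) =
      L b c * lp q e k a d - (q - q⁻¹) • (L b d * lp q e k a c) := by
  have X := H.exch hE hK
  refine ⟨?_, ?_, ?_, ?_⟩
  · simpa [du_of_ne, hab.ne, hcd.ne, hab.ne', hcd.ne', hab, hcd, hab.le, hcd.le, not_lt.2]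
      using X a b c d (by omega) (by omega)
  · simpa [du_of_ne, hab.ne, hcd.ne, hab.ne', hcd.ne', hab, hcd, hab.le, hcd.le, not_lt.2]
      using X b a c d (by omega) (by omega)
  · simpa [du_of_ne, hab.ne, hcd.ne, hab.ne', hcd.ne', hab, hcd, hab.le, hcd.le, not_lt.2]
      using X a b d c (by omega) (by omega)
  · simpa [du_of_ne, hab.ne, hcd.ne, hab.ne', hcd.ne', hab, hcd, hab.le, hcd.le, not_lt.2]
      using X b a d c (by omega) (by omega)

theorem QGens.exch_lp_col (H : QGens n q e f k k') {L : ℕ → ℕ → A} (hE : EInt n q e k k' L)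
    (hK : KInt q k L) {a b c : ℕ} (ha : 1 ≤ a) (hab : a < b) (hc : c ≤ n) :
    lp q e k b c * L a c = q⁻¹ • (L a c * lp q e k b c) ∧
    lp q e k a c * L b c - (q - q⁻¹) • (lp q e k b c * L a c) = q⁻¹ • (L b c * lp q e k a c) := by
  have X := H.exch hE hK
  refine ⟨?_, ?_⟩
  · simpa [du_of_ne, du_self, hab.ne, hab.ne', hab, hab.le, not_lt.2]
      using X a b c c (by omega) (by omega)
  · simpa [du_of_ne, du_self, hab.ne, hab.ne', hab, hab.le, not_lt.2]
      using X b a c c (by omega) (by omega)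

theorem QGens.exch_lp_row (H : QGens n q e f k k') {L : ℕ → ℕ → A} (hE : EInt n q e k k' L)
    (hK : KInt q k L) {a c d : ℕ} (ha : 1 ≤ a) (hcd : c < d) (hd : d ≤ n) :
    q⁻¹ • (lp q e k a c * L a d) = L a d * lp q e k a c ∧
    q⁻¹ • (lp q e k a d * L a c) = L a c * lp q e k a d - (q - q⁻¹) • (L a d * lp q e k a c) := by
  have X := H.exch hE hK
  refine ⟨?_, ?_⟩
  · simpa [du_of_ne, du_self, hcd.ne, hcd.ne', hcd, hcd.le, not_lt.2]
      using X a a c d (by omega) (by omega)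
  · simpa [du_of_ne, du_self, hcd.ne, hcd.ne', hcd, hcd.le, not_lt.2]
      using X a a d c (by omega) (by omega)

theorem QGens.exch_lm_of_lt (H : QGens n q e f k k') {a b c d : ℕ} (ha : 1 ≤ a) (hab : a < b)
    (hcd : c < d) (hc : 1 ≤ c) (hb : b ≤ n) :
    lm q f k' b c * lm q f k' a d = lm q f k' a d * lm q f k' b c ∧
    lm q f k' a c * lm q f k' b d =
      lm q f k' b d * lm q f k' a c + (q - q⁻¹) • (lm q f k' a d * lm q f k' b c) := by
  have h1 := H.exch_lm c d a b (by omega) (by omega)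
  have h2 := H.exch_lm c d b a (by omega) (by omega)
  simp [du_of_ne, hab.ne, hcd.ne, hab.ne', hcd.ne', hab, hcd, hab.le, hcd.le, not_lt.2] at h1 h2
  exact ⟨h1, h2⟩

theorem QGens.exch_lm_col (H : QGens n q e f k k') {a b c : ℕ} (ha : 1 ≤ a) (hab : a < b)
    (hc : 1 ≤ c) (hb : b ≤ n) :
    q • (lm q f k' b c * lm q f k' a c) = lm q f k' a c * lm q f k' b c := by
  have h1 := H.exch_lm c c a b (by omega) (by omega)
  simp [du_of_ne, du_self, hab.ne, hab.ne', hab, hab.le, not_lt.2] at h1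
  exact h1

theorem QGens.exch_lm_row (H : QGens n q e f k k') {a c d : ℕ} (ha : 1 ≤ a) (hcd : c < d)
    (hc : 1 ≤ c) (hb : a ≤ n) :
    lm q f k' a c * lm q f k' a d = q • (lm q f k' a d * lm q f k' a c) := by
  have h1 := H.exch_lm c d a a (by omega) (by omega)
  simp [du_of_ne, du_self, hcd.ne, hcd.ne', hcd, hcd.le, not_lt.2] at h1
  exact h1

/-- Fusion: for arguments with ratio `q` the `R`-matrix degenerates to a multiple of an
antisymmetrizer. Concretely, `L⁺L⁺`, `L⁺L⁻` and `L⁻L⁻` each satisfy quadratic relations, and after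
all products are brought to a fixed order the scalars match exactly because the second argument is
`z q⁻¹`. -/
theorem QGens.rowAnti (H : QGens n q e f k k') {z : ℂ} (hz : z ≠ 0) :
    RowAnti n q (Lz q e f k k' z) (Lz q e f k k' (z * q⁻¹)) := by
  have hq := H.q_ne
  constructor
  · intro a b c d ha hab hb hc hcd hd
    obtain ⟨p1, p2, -, -⟩ := H.exch_lp_of_lt H.eInt_lp H.kInt_lp ha hab hcd hd
    obtain ⟨m1, m2, m3, m4⟩ := H.exch_lp_of_lt H.eInt_lm H.kInt_lm ha hab hcd hd
    obtain ⟨n1, n2⟩ := H.exch_lm_of_lt ha hab hcd hc hb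
    -- The mixed relations are turned into rules which move the factor `L⁺` to the left of `L⁻`.
    replace m3 := (eq_sub_iff_add_eq.1 m3).symm
    replace m4 := (sub_eq_iff_eq_add.1 m4.symm)
    rw [← m1] at m3
    rw [← m2] at m4
    unfold Lz
    simp only [mul_sub, sub_mul, smul_mul_assoc, mul_smul_comm, smul_sub, ← p1, ← p2, ← m1, ← m2,
      m3, m4, n1, n2, smul_add]
    match_scalars <;> field_simp <;> ring
  · intro a b c ha hab hb hc hd
    obtain ⟨p1, p2⟩ := H.exch_lp_col H.eInt_lp H.kInt_lp ha hab hd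
    obtain ⟨m1, m2⟩ := H.exch_lp_col H.eInt_lm H.kInt_lm ha hab hd
    have n1 := H.exch_lm_col ha hab hc hb
    rw [eq_inv_smul_iff₀ hq] at p1 m1 m2
    unfold Lz
    simp only [mul_sub, sub_mul, smul_mul_assoc, mul_smul_comm, smul_sub, ← p1, ← m1, ← m2, ← n1,
      smul_add]
    match_scalars <;> field_simp <;> ring

/-- For the transposed matrices the two arguments have to be exchanged. This is why the list in
`fusedT` is reversed. -/
theorem QGens.rowAnti_transpose (H : QGens n q e f k k') {z : ℂ} (hz : z ≠ 0) :
    RowAnti n q (fun a b => Lz q e f k k' (z * q⁻¹) b a) (fun a b => Lz q e f k k' z b a) := by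
  have hq := H.q_ne
  constructor
  · intro c d a b hc hcd hd ha hab hb
    obtain ⟨p1, p2, -, -⟩ := H.exch_lp_of_lt H.eInt_lp H.kInt_lp ha hab hcd hd
    obtain ⟨m1, m2, m3, m4⟩ := H.exch_lp_of_lt H.eInt_lm H.kInt_lm ha hab hcd hd
    obtain ⟨n1, n2⟩ := H.exch_lm_of_lt ha hab hcd hc hb
    replace m3 := (eq_sub_iff_add_eq.1 m3).symm
    replace m4 := (sub_eq_iff_eq_add.1 m4.symm)
    rw [← m1] at m3
    rw [← m2] at m4
    unfold Lz
    simp only [mul_sub, sub_mul, smul_mul_assoc, mul_smul_comm, smul_sub, ← p1, ← p2, ← m1, ← m2,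
      m3, m4, n1, n2, smul_add]
    match_scalars <;> field_simp <;> ring
  · intro c d a hc hcd hd ha hb
    obtain ⟨p1, p2⟩ := H.exch_lp_row H.eInt_lp H.kInt_lp ha hcd hd
    obtain ⟨m1, m2⟩ := H.exch_lp_row H.eInt_lm H.kInt_lm ha hcd hd
    have n1 := H.exch_lm_row ha hcd hc hb
    rw [← m1] at m2
    have m2 := eq_sub_iff_add_eq.1 m2
    unfold Lz
    simp only [mul_sub, sub_mul, smul_mul_assoc, mul_smul_comm, smul_sub, ← p1, ← m1, ← m2, n1,
      smul_add]
    match_scalars <;> field_simp <;> ring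

/-- A single product of entries does depend on the order of `L⁺` and `L⁻`, but the correction terms
of the exchange relations cancel after antisymmetrization in rows and columns. This will allow all
factors `L⁺` in a symmetrized minor to be collected on the left. -/
theorem QGens.symPair_lp_lm (H : QGens n q e f k k') : SymPair n q (lp q e k) (lm q f k') := by
  have hq := H.q_ne
  intro a b c d ha hab hb hc hcd hd
  obtain ⟨m1, m2, m3, m4⟩ := H.exch_lp_of_lt H.eInt_lm H.kInt_lm ha hab hcd hd
  replace m3 := (eq_sub_iff_add_eq.1 m3).symm
  replace m4 := (sub_eq_iff_eq_add.1 m4.symm)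
  rw [← m1] at m3
  rw [← m2] at m4
  unfold pairSum
  simp only [smul_sub, ← m1, ← m2, m3, m4, smul_add]
  match_scalars <;> field_simp <;> ring

/-- Symmetry for linear combinations of two matrices. -/
theorem SymPair.lin {X Y : ℕ → ℕ → A} (h : SymPair n q X Y) (α β α' β' : ℂ) :
    SymPair n q (fun a b => α • X a b + β • Y a b) (fun a b => α' • X a b + β' • Y a b) := by
  intro a b c d ha hab hb hc hcd hd
  have h := h a b c d ha hab hb hc hcd hd
  unfold pairSum at h ⊢
  -- The difference of the two orders is bilinear and alternating in the coefficient vectors, hence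
  -- a multiple of the difference for `X`, `Y` by their determinant.
  linear_combination (norm := skip) (α * β' - β * α') • h
  simp only [mul_add, add_mul, smul_mul_assoc, mul_smul_comm, smul_add]
  match_scalars <;> ring

end Pairs

end QuantumGT

end

noncomputable section

namespace QuantumGT

/-! ### Quantum minors -/

section Minors

variable {A : Type*} [Ring A] [Algebra ℂ A] {n : ℕ} {q : ℂ}

/-- The number of elements of `S` below `s`. -/
def below (S : Finset ℕ) (s : ℕ) : ℕ := (S.filter (· < s)).card

/-- The number of elements of `S` above `s`. -/
def above (S : Finset ℕ) (s : ℕ) : ℕ := (S.filter (s < ·)).card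

theorem below_erase_of_lt {S : Finset ℕ} {a b : ℕ} (ha : a ∈ S) (h : a < b) :
    below (S.erase a) b + 1 = below S b := by
  unfold below
  rw [Finset.filter_erase, Finset.card_erase_add_one]
  simp [ha, h]

theorem below_erase_of_le {S : Finset ℕ} {a b : ℕ} (h : b ≤ a) :
    below (S.erase a) b = below S b := by
  unfold below
  rw [Finset.filter_erase, Finset.erase_eq_of_notMem]
  simp [h]

theorem above_erase_of_lt {S : Finset ℕ} {a b : ℕ} (ha : a ∈ S) (h : b < a) :
    above (S.erase a) b + 1 = above S b := by
  unfold above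
  rw [Finset.filter_erase, Finset.card_erase_add_one]
  simp [ha, h]

theorem above_erase_of_le {S : Finset ℕ} {a b : ℕ} (h : a ≤ b) :
    above (S.erase a) b = above S b := by
  unfold above
  rw [Finset.filter_erase, Finset.erase_eq_of_notMem]
  simp [h]

/-- The quantum minor with rows `S` and with the columns in the list `ts`, built from the matrices
in the list. It is expanded along the first column. -/
def qminor (q : ℂ) : List (ℕ → ℕ → A) → Finset ℕ → List ℕ → A
  | [], S, [] => if S = ∅ then 1 else 0
  | [], _, _ :: _ => 0
  | _ :: _, _, [] => 0
  | L :: Ls, S, t :: ts => ∑ s ∈ S, (-q) ^ below S s • (L s t * qminor q Ls (S.erase s) ts)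

/-- The sum over all orderings of the rows `S` and the columns `T` which is `q`-antisymmetric in
both. -/
def symMinor (q : ℂ) : List (ℕ → ℕ → A) → Finset ℕ → Finset ℕ → A
  | [], S, T => if S = ∅ ∧ T = ∅ then 1 else 0
  | L :: Ls, S, T => ∑ t ∈ T, ∑ s ∈ S,
      (-q) ^ (below S s + below T t) • (L s t * symMinor q Ls (S.erase s) (T.erase t))

/-- The pairs `(a, b)` of elements of `S` with `a < b`. -/
def ltPairs (S : Finset ℕ) : Finset (ℕ × ℕ) := (S ×ˢ S).filter fun p => p.1 < p.2

theorem mem_ltPairs {S : Finset ℕ} {p : ℕ × ℕ} : p ∈ ltPairs S ↔ p.1 ∈ S ∧ p.2 ∈ S ∧ p.1 < p.2 := by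
  simp [ltPairs, and_assoc]

theorem sum_sum_erase {B : Type*} [AddCommMonoid B] (S : Finset ℕ) (F : ℕ → ℕ → B) :
    ∑ s ∈ S, ∑ s' ∈ S.erase s, F s s' = ∑ p ∈ ltPairs S, (F p.1 p.2 + F p.2 p.1) := by
  have h1 : ∀ s ∈ S, ∑ s' ∈ S.erase s, F s s' =
      ∑ s' ∈ S, ((if s < s' then F s s' else 0) + if s' < s then F s s' else 0) := by
    intro s hs
    rw [← Finset.add_sum_erase S _ hs]
    simp only [lt_irrefl, if_false, add_zero, zero_add]
    refine Finset.sum_congr rfl fun s' h => ?_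
    rcases lt_trichotomy s s' with h' | h' | h'
    · simp [h', h'.le, not_lt.2]
    · simp [h'] at h
    · simp [h', h'.le, not_lt.2]
  rw [Finset.sum_congr rfl h1]
  simp only [Finset.sum_add_distrib]
  rw [Finset.sum_comm (f := fun s s' => if s' < s then F s s' else 0)]
  simp only [← Finset.sum_add_distrib]
  rw [ltPairs, Finset.sum_filter, Finset.sum_product]
  refine Finset.sum_congr rfl fun s _ => Finset.sum_congr rfl fun s' _ => ?_
  split_ifs <;> simp

/-- Grouping the first two expansions by the unordered pair of rows exhibits the combination that
`RowAnti` controls; the extra factor `-q` is the inversion of the pair. -/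
theorem qminor_cons_cons (q : ℂ) (L L' : ℕ → ℕ → A) (Ls : List (ℕ → ℕ → A)) (S : Finset ℕ)
    (t t' : ℕ) (ts : List ℕ) :
    qminor q (L :: L' :: Ls) S (t :: t' :: ts) = ∑ p ∈ ltPairs S,
      (-q) ^ (below S p.1 + below (S.erase p.1) p.2) •
        ((L p.1 t * L' p.2 t' - q • (L p.2 t * L' p.1 t')) *
          qminor q Ls ((S.erase p.1).erase p.2) ts) := by
  simp only [qminor, Finset.mul_sum, Finset.smul_sum]
  rw [sum_sum_erase]
  refine Finset.sum_congr rfl fun p hp => ?_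
  obtain ⟨h1, h2, h3⟩ := mem_ltPairs.1 hp
  rw [below_erase_of_le h3.le, ← below_erase_of_lt h1 h3, Finset.erase_right_comm (a := p.2)]
  simp only [mul_sub, sub_mul, smul_mul_assoc, mul_smul_comm, smul_sub, smul_smul, mul_assoc, pow_add]
  match_scalars <;> ring

/-- Antisymmetry in two adjacent columns. -/
theorem qminor_swap {Ls : List (ℕ → ℕ → A)} (hL : Ls.IsChain (RowAnti n q)) {S : Finset ℕ}
    (hS : ∀ s ∈ S, 1 ≤ s ∧ s ≤ n) (pre post : List ℕ) {c d : ℕ} (hc : 1 ≤ c) (hcd : c < d)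
    (hd : d ≤ n) :
    qminor q Ls S (pre ++ d :: c :: post) = (-q) • qminor q Ls S (pre ++ c :: d :: post) := by
  induction pre generalizing Ls S with
  | nil =>
    match Ls with
    | [] => simp [qminor]
    | [L] => simp [qminor]
    | L :: L' :: Ls =>
      have h := (List.isChain_cons_cons.1 hL).1
      rw [List.nil_append, List.nil_append, qminor_cons_cons, qminor_cons_cons, Finset.smul_sum]
      refine Finset.sum_congr rfl fun p hp => ?_
      obtain ⟨h1, h2, h3⟩ := mem_ltPairs.1 hp
      rw [h.swap p.1 p.2 c d (hS _ h1).1 h3 (hS _ h2).2 hc hcd hd, smul_mul_assoc, smul_comm]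
  | cons t pre ih =>
    match Ls with
    | [] => simp [qminor]
    | L :: Ls =>
      simp only [List.cons_append, qminor, Finset.smul_sum]
      refine Finset.sum_congr rfl fun s _ => ?_
      rw [ih (Ls := Ls) hL.tail (fun s hs => hS s (Finset.mem_of_mem_erase hs)), mul_smul_comm, smul_comm]

theorem qminor_adjacent_eq {Ls : List (ℕ → ℕ → A)} (hL : Ls.IsChain (RowAnti n q)) {S : Finset ℕ}
    (hS : ∀ s ∈ S, 1 ≤ s ∧ s ≤ n) (pre post : List ℕ) {c : ℕ} (hc : 1 ≤ c) (hd : c ≤ n) :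
    qminor q Ls S (pre ++ c :: c :: post) = 0 := by
  induction pre generalizing Ls S with
  | nil =>
    match Ls with
    | [] => simp [qminor]
    | [L] => simp [qminor]
    | L :: L' :: Ls =>
      have h := (List.isChain_cons_cons.1 hL).1
      rw [List.nil_append, qminor_cons_cons]
      refine Finset.sum_eq_zero fun p hp => ?_
      obtain ⟨h1, h2, h3⟩ := mem_ltPairs.1 hp
      rw [h.eq p.1 p.2 c (hS _ h1).1 h3 (hS _ h2).2 hc hd, zero_mul, smul_zero]
  | cons t pre ih =>
    match Ls with
    | [] => simp [qminor]
    | L :: Ls =>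
      simp only [List.cons_append, qminor]
      refine Finset.sum_eq_zero fun s _ => ?_
      rw [ih (Ls := Ls) hL.tail (fun s hs => hS s (Finset.mem_of_mem_erase hs)), mul_zero, smul_zero]

/-- Moving a column to the left over smaller ones. -/
theorem qminor_move {Ls : List (ℕ → ℕ → A)} (hL : Ls.IsChain (RowAnti n q)) {S : Finset ℕ}
    (hS : ∀ s ∈ S, 1 ≤ s ∧ s ≤ n) (pre l post : List ℕ) {t : ℕ} (ht : t ≤ n)
    (hl : ∀ x ∈ l, 1 ≤ x ∧ x < t) :
    qminor q Ls S (pre ++ t :: (l ++ post)) =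
      (-q) ^ l.length • qminor q Ls S (pre ++ (l ++ t :: post)) := by
  induction l generalizing pre with
  | nil => simp
  | cons x l ih =>
    have hx := hl x (by simp)
    have h := ih (pre ++ [x]) (fun y hy => hl y (by simp [hy]))
    simp only [List.append_assoc, List.cons_append, List.nil_append] at h
    rw [List.cons_append, qminor_swap hL hS pre (l ++ post) hx.1 hx.2 ht, h, smul_smul]
    simp [pow_succ']

/-- As the list is increasing, the leading `t` can be moved to the right over smaller columns until
it stands beside its second copy. -/
theorem qminor_eq_zero_of_mem {Ls : List (ℕ → ℕ → A)} (hL : Ls.IsChain (RowAnti n q))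
    {S : Finset ℕ} (hS : ∀ s ∈ S, 1 ≤ s ∧ s ≤ n) {l : List ℕ} (hl : l.Pairwise (· < ·))
    (hb : ∀ x ∈ l, 1 ≤ x ∧ x ≤ n) {t : ℕ} (ht : t ∈ l) : qminor q Ls S (t :: l) = 0 := by
  obtain ⟨l₁, l₂, rfl⟩ := List.append_of_mem ht
  have h := qminor_move hL hS [] l₁ (t :: l₂) (hb t ht).2 fun x hx =>
    ⟨(hb x (by simp [hx])).1, (List.pairwise_append.1 hl).2.2 x hx t (by simp)⟩
  rw [List.nil_append] at h
  rw [h, List.nil_append, qminor_adjacent_eq hL hS _ _ (hb t ht).1 (hb t ht).2, smul_zero]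

theorem qminor_last_eq_zero {Ls : List (ℕ → ℕ → A)} (hL : Ls.IsChain (RowAnti n q)) (hq : q ≠ 0)
    {S : Finset ℕ} (hS : ∀ s ∈ S, 1 ≤ s ∧ s ≤ n) {l : List ℕ} (hl : l.Pairwise (· < ·))
    (hb : ∀ x ∈ l, 1 ≤ x ∧ x ≤ n) {t : ℕ} (ht : t ∈ l) : qminor q Ls S (l ++ [t]) = 0 := by
  obtain ⟨l₁, l₂, rfl⟩ := List.append_of_mem ht
  suffices h : ∀ (pre l : List ℕ), (∀ x ∈ l, t < x ∧ x ≤ n) →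
      qminor q Ls S (pre ++ (l ++ [t])) = (-q) ^ l.length • qminor q Ls S (pre ++ (t :: l)) by
    have h := h (l₁ ++ [t]) l₂ fun x hx => ⟨(List.pairwise_cons.1
      (List.pairwise_append.1 hl).2.1).1 x hx, (hb x (by simp [hx])).2⟩
    simp only [List.append_assoc, List.cons_append, List.nil_append] at h ⊢
    rw [h, qminor_adjacent_eq hL hS _ _ (hb t ht).1 (hb t ht).2, smul_zero]
  intro pre l hl
  induction l generalizing pre with
  | nil => simp
  | cons x l ih =>
    have hx := hl x (by simp)
    have h := ih (pre ++ [x]) (fun y hy => hl y (by simp [hy]))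
    simp only [List.append_assoc, List.cons_append, List.nil_append] at h ⊢
    rw [h, qminor_swap hL hS pre _ (hb t ht).1 hx.1 hx.2, smul_smul]
    simp [pow_succ]

/-- Moving the column `t` from its place to the front passes all smaller columns, each at the cost
of `-q`. -/
theorem qminor_cons_erase {Ls : List (ℕ → ℕ → A)} (hL : Ls.IsChain (RowAnti n q))
    {S : Finset ℕ} (hS : ∀ s ∈ S, 1 ≤ s ∧ s ≤ n) {l : List ℕ} (hl : l.Pairwise (· < ·))
    (hb : ∀ x ∈ l, 1 ≤ x ∧ x ≤ n) {t : ℕ} (ht : t ∈ l) :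
    qminor q Ls S (t :: l.erase t) = (-q) ^ below l.toFinset t • qminor q Ls S l := by
  obtain ⟨l₁, l₂, rfl⟩ := List.append_of_mem ht
  have hp := List.pairwise_append.1 hl
  have h1 : ∀ x ∈ l₁, x < t := fun x hx => hp.2.2 x hx t (by simp)
  have h2 : ∀ x ∈ l₂, t < x := fun x hx => (List.pairwise_cons.1 hp.2.1).1 x hx
  have h := qminor_move hL hS [] l₁ l₂ (hb t ht).2 fun x hx =>
    ⟨(hb x (by simp [hx])).1, h1 x hx⟩
  rw [List.nil_append] at h
  rw [List.erase_append_right _ (fun h => (h1 t h).false), List.erase_cons_head, h]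
  congr 2
  unfold below
  rw [← List.toFinset_card_of_nodup (hp.1.imp (fun h => h.ne))]
  congr 1
  ext x
  simp only [Finset.mem_filter, List.mem_toFinset, List.mem_append, List.mem_cons]
  constructor
  · intro h; exact ⟨Or.inl h, h1 x h⟩
  · rintro ⟨h | rfl | h, h'⟩
    · exact h
    · exact absurd h' (lt_irrefl _)
    · exact absurd (h2 x h) (by omega)

/-- The expansion of a quantum minor along its last column. -/
theorem qminor_append (q : ℂ) (Ls : List (ℕ → ℕ → A)) (L : ℕ → ℕ → A) (S : Finset ℕ)
    (ts : List ℕ) (t : ℕ) :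
    qminor q (Ls ++ [L]) S (ts ++ [t]) =
      ∑ s ∈ S, (-q) ^ above S s • (qminor q Ls (S.erase s) ts * L s t) := by
  induction Ls generalizing S ts with
  | nil =>
    match ts with
    | [] =>
      simp only [List.nil_append, qminor]
      refine Finset.sum_congr rfl fun s hs => ?_
      by_cases h : S.erase s = ∅
      · have h1 : S = {s} := by
          rw [← Finset.insert_erase hs, h]; rfl
        subst h1
        simp [below, above, Finset.filter_singleton]
      · simp [h]
    | t' :: ts =>
      simp only [List.nil_append, List.cons_append, qminor]
      cases ts <;> simp [qminor]
  | cons L₀ Ls ih =>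
    match ts with
    | [] =>
      simp only [List.nil_append, List.cons_append, qminor]
      cases Ls <;> simp [qminor]
    | t' :: ts =>
      simp only [List.cons_append, qminor, ih, Finset.mul_sum, Finset.smul_sum, Finset.sum_mul]
      rw [Finset.sum_comm' (t' := S) (s' := fun s => S.erase s)]
      · refine Finset.sum_congr rfl fun s hs => Finset.sum_congr rfl fun s' hs' => ?_
        obtain ⟨hne, hs'⟩ := Finset.mem_erase.1 hs'
        rw [Finset.erase_right_comm]
        simp only [mul_smul_comm, smul_mul_assoc, smul_smul, ← pow_add, mul_assoc]
        congr 2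
        rcases lt_or_gt_of_ne hne with h | h
        · rw [above_erase_of_le h.le, below_erase_of_le h.le, add_comm]
        · have h1 := above_erase_of_lt hs' h
          have h2 := below_erase_of_lt hs h
          omega
      · intro x y
        simp only [Finset.mem_erase]
        tauto

end Minors

end QuantumGT

end

noncomputable section

namespace QuantumGT

/-! ### Symmetrized minors -/

section SymMinors

variable {A : Type*} [Ring A] [Algebra ℂ A] {n : ℕ} {q : ℂ}

/-- As in `qminor_cons_cons`, with unordered pairs of rows and of columns, which produces `pairSum`.
Exchanging the first two matrices is thereby reduced to `SymPair`. -/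
theorem symMinor_cons_cons (q : ℂ) (L L' : ℕ → ℕ → A) (Ls : List (ℕ → ℕ → A)) (S T : Finset ℕ) :
    symMinor q (L :: L' :: Ls) S T = ∑ r ∈ ltPairs T, ∑ p ∈ ltPairs S,
      (-q) ^ (below S p.1 + below (S.erase p.1) p.2 + (below T r.1 + below (T.erase r.1) r.2)) •
        (pairSum q L L' p.1 p.2 r.1 r.2 *
          symMinor q Ls ((S.erase p.1).erase p.2) ((T.erase r.1).erase r.2)) := by
  have h : symMinor q (L :: L' :: Ls) S T = ∑ t ∈ T, ∑ t' ∈ T.erase t, ∑ s ∈ S, ∑ s' ∈ S.erase s,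
      (-q) ^ (below S s + below T t + (below (S.erase s) s' + below (T.erase t) t')) •
        (L s t * (L' s' t' * symMinor q Ls ((S.erase s).erase s') ((T.erase t).erase t'))) := by
    simp only [symMinor, Finset.mul_sum, Finset.smul_sum]
    refine Finset.sum_congr rfl fun t _ => ?_
    rw [Finset.sum_comm]
    refine Finset.sum_congr rfl fun t' _ => Finset.sum_congr rfl fun s _ =>
      Finset.sum_congr rfl fun s' _ => ?_
    rw [mul_smul_comm, smul_smul, ← pow_add]
  rw [h, sum_sum_erase]
  refine Finset.sum_congr rfl fun r hr => ?_
  rw [sum_sum_erase, sum_sum_erase, ← Finset.sum_add_distrib]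
  refine Finset.sum_congr rfl fun p hp => ?_
  obtain ⟨h1, h2, h3⟩ := mem_ltPairs.1 hp
  obtain ⟨g1, g2, g3⟩ := mem_ltPairs.1 hr
  rw [below_erase_of_le h3.le, ← below_erase_of_lt h1 h3, Finset.erase_right_comm (a := p.2),
    below_erase_of_le g3.le, ← below_erase_of_lt g1 g3, Finset.erase_right_comm (a := r.2)]
  unfold pairSum
  simp only [mul_sub, sub_mul, add_mul, smul_mul_assoc, mul_smul_comm, smul_sub, smul_smul,
    mul_assoc, pow_add]
  match_scalars <;> ring

theorem symMinor_swap {L L' : ℕ → ℕ → A} (h : SymPair n q L L') (Ls : List (ℕ → ℕ → A))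
    {S T : Finset ℕ} (hS : ∀ s ∈ S, 1 ≤ s ∧ s ≤ n) (hT : ∀ s ∈ T, 1 ≤ s ∧ s ≤ n) :
    symMinor q (L :: L' :: Ls) S T = symMinor q (L' :: L :: Ls) S T := by
  rw [symMinor_cons_cons, symMinor_cons_cons]
  refine Finset.sum_congr rfl fun r hr => Finset.sum_congr rfl fun p hp => ?_
  obtain ⟨h1, h2, h3⟩ := mem_ltPairs.1 hp
  obtain ⟨g1, g2, g3⟩ := mem_ltPairs.1 hr
  rw [h _ _ _ _ (hS _ h1).1 h3 (hS _ h2).2 (hT _ g1).1 g3 (hT _ g2).2]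

theorem symMinor_perm {Ls Ls' : List (ℕ → ℕ → A)} (hp : Ls.Perm Ls')
    (h : ∀ L ∈ Ls, ∀ L' ∈ Ls, SymPair n q L L') {S T : Finset ℕ} (hS : ∀ s ∈ S, 1 ≤ s ∧ s ≤ n)
    (hT : ∀ s ∈ T, 1 ≤ s ∧ s ≤ n) : symMinor q Ls S T = symMinor q Ls' S T := by
  induction hp generalizing S T with
  | nil => rfl
  | cons L hp ih =>
    simp only [symMinor]
    refine Finset.sum_congr rfl fun t _ => Finset.sum_congr rfl fun s _ => ?_
    rw [ih (fun L hL L' hL' => h L (by simp [hL]) L' (by simp [hL']))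
      (fun s hs => hS s (Finset.mem_of_mem_erase hs))
      (fun s hs => hT s (Finset.mem_of_mem_erase hs))]
  | swap L L' Ls => exact symMinor_swap (h _ (by simp) _ (by simp)) Ls hS hT
  | trans h₁ h₂ ih₁ ih₂ =>
    rw [ih₁ h hS hT, ih₂ (fun L hL L' hL' => h L (h₁.mem_iff.2 hL) L' (h₁.mem_iff.2 hL')) hS hT]

theorem symMinor_transpose (q : ℂ) (Ls : List (ℕ → ℕ → A)) (S T : Finset ℕ) :
    symMinor q Ls S T = symMinor q (Ls.map fun L a b => L b a) T S := by
  induction Ls generalizing S T with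
  | nil => simp [symMinor, and_comm]
  | cons L Ls ih =>
    simp only [List.map_cons, symMinor]
    rw [Finset.sum_comm]
    simp only [ih, add_comm (below S _)]

/-- `[r]_{q²}!`. -/
def qfac (q : ℂ) (r : ℕ) : ℂ := ∏ i ∈ Finset.range r, ∑ j ∈ Finset.range (i + 1), (q ^ 2) ^ j

theorem sum_pow_below (p : ℂ) (T : Finset ℕ) :
    ∑ t ∈ T, p ^ below T t = ∑ j ∈ Finset.range T.card, p ^ j := by
  induction T using Finset.induction_on_max with
  | empty => simp
  | insert m T hm ih =>
    have hmT : m ∉ T := fun h => (hm m h).false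
    rw [Finset.sum_insert hmT, Finset.card_insert_of_notMem hmT, Finset.sum_range_succ, ← ih,
      add_comm]
    congr 1
    · refine Finset.sum_congr rfl fun t ht => ?_
      rw [below, Finset.filter_insert, if_neg (by have := hm t ht; omega)]
      rfl
    · rw [below, Finset.filter_insert, if_neg (by omega), Finset.filter_true_of_mem hm]

/-- Every order of the columns contributes the same minor: antisymmetry gives one factor `(-q)^ℓ`
and the definition of `symMinor` another one. The sum of `q^{2ℓ}` over all orders is the factorial
`[r]_{q²}!`. -/
theorem symMinor_eq_qminor {Ls : List (ℕ → ℕ → A)} (hL : Ls.IsChain (RowAnti n q))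
    {S : Finset ℕ} (hS : ∀ s ∈ S, 1 ≤ s ∧ s ≤ n) {l : List ℕ} (hl : l.Pairwise (· < ·))
    (hb : ∀ x ∈ l, 1 ≤ x ∧ x ≤ n) (hlen : Ls.length = l.length) :
    symMinor q Ls S l.toFinset = qfac q Ls.length • qminor q Ls S l := by
  induction Ls generalizing S l with
  | nil =>
    rw [List.length_nil, eq_comm, List.length_eq_zero_iff] at hlen
    subst hlen
    simp [symMinor, qminor, qfac]
  | cons L Ls ih =>
    have h1 : ∀ t ∈ l.toFinset, ∀ s ∈ S, symMinor q Ls (S.erase s) (l.toFinset.erase t) =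
        qfac q Ls.length • qminor q Ls (S.erase s) (l.erase t) := by
      intro t ht s hs
      have ht' : t ∈ l := List.mem_toFinset.1 ht
      have hnd : l.Nodup := hl.imp fun h => h.ne
      have h2 : l.toFinset.erase t = (l.erase t).toFinset := by
        ext x
        simp [hnd.mem_erase_iff]
      rw [h2, ih hL.tail (fun s hs => hS s (Finset.mem_of_mem_erase hs))
        (hl.sublist List.erase_sublist) (fun x hx => hb x (List.mem_of_mem_erase hx))]
      rw [List.length_erase_of_mem ht', ← hlen]; simp
    have h3 : symMinor q (L :: Ls) S l.toFinset = ∑ t ∈ l.toFinset,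
        (qfac q Ls.length * (-q) ^ below l.toFinset t) • qminor q (L :: Ls) S (t :: l.erase t) := by
      rw [symMinor]
      refine Finset.sum_congr rfl fun t ht => ?_
      rw [qminor, Finset.smul_sum]
      refine Finset.sum_congr rfl fun s hs => ?_
      rw [h1 t ht s hs]
      simp only [mul_smul_comm, smul_smul]
      congr 1
      ring
    have h4 : ∀ t ∈ l.toFinset, (qfac q Ls.length * (-q) ^ below l.toFinset t) •
        qminor q (L :: Ls) S (t :: l.erase t) =
        (qfac q Ls.length * (q ^ 2) ^ below l.toFinset t) • qminor q (L :: Ls) S l := by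
      intro t ht
      rw [qminor_cons_erase hL hS hl hb (List.mem_toFinset.1 ht), smul_smul, mul_assoc, ← mul_pow]
      congr 3
      ring
    rw [h3, Finset.sum_congr rfl h4, ← Finset.sum_smul, ← Finset.mul_sum, sum_pow_below,
      List.toFinset_card_of_nodup (hl.imp fun h => h.ne), ← hlen, List.length_cons, qfac, qfac,
      Finset.prod_range_succ]

theorem symMinor_cons_lin (q : ℂ) (X Y : ℕ → ℕ → A) (α β : ℂ) (Ls : List (ℕ → ℕ → A))
    (S T : Finset ℕ) : symMinor q ((fun a b => α • X a b + β • Y a b) :: Ls) S T =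
      α • symMinor q (X :: Ls) S T + β • symMinor q (Y :: Ls) S T := by
  simp only [symMinor, Finset.smul_sum, ← Finset.sum_add_distrib]
  refine Finset.sum_congr rfl fun t _ => Finset.sum_congr rfl fun s _ => ?_
  simp only [add_mul, smul_mul_assoc, smul_add]
  module

open Polynomial in
/-- The expansion of a symmetrized minor of linear combinations of two matrices. -/
theorem symMinor_lin {X Y : ℕ → ℕ → A} (h : SymPair n q X Y) {S T : Finset ℕ}
    (hS : ∀ s ∈ S, 1 ≤ s ∧ s ≤ n) (hT : ∀ s ∈ T, 1 ≤ s ∧ s ≤ n) (Ps : List (ℂ × ℂ)) (i j : ℕ) :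
    symMinor q ((Ps.map fun p a b => p.1 • X a b + p.2 • Y a b) ++
      (List.replicate i X ++ List.replicate j Y)) S T =
    ∑ c ∈ Finset.range (Ps.length + 1),
      (Ps.map fun p : ℂ × ℂ => C p.1 * (Polynomial.X : ℂ[X]) + C p.2).prod.coeff c •
        symMinor q (List.replicate (c + i) X ++ List.replicate (Ps.length - c + j) Y) S T := by
  have hX : X = fun a b => (1 : ℂ) • X a b + (0 : ℂ) • Y a b := by ext; simp
  have hY : Y = fun a b => (0 : ℂ) • X a b + (1 : ℂ) • Y a b := by ext; simp
  induction Ps generalizing i j with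
  | nil => simp
  | cons p Ps ih =>
    set M := (Ps.map fun p a b => p.1 • X a b + p.2 • Y a b) ++
        (List.replicate i X ++ List.replicate j Y) with hM
    have hall : ∀ L, (L = X ∨ L = Y ∨ L ∈ M) →
        ∃ α β : ℂ, L = fun a b => α • X a b + β • Y a b := by
      intro L hL
      simp only [hM, List.mem_append, List.mem_map, List.mem_replicate] at hL
      rcases hL with rfl | rfl | ⟨p, -, rfl⟩ | ⟨-, rfl⟩ | ⟨-, rfl⟩
      · exact ⟨1, 0, hX⟩
      · exact ⟨0, 1, hY⟩
      · exact ⟨_, _, rfl⟩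
      · exact ⟨1, 0, hX⟩
      · exact ⟨0, 1, hY⟩
    have hall' : ∀ L, (L = X ∨ L = Y ∨ L ∈ M) → ∀ L', (L' = X ∨ L' = Y ∨ L' ∈ M) →
        SymPair n q L L' := by
      intro L hL L' hL'
      obtain ⟨α, β, rfl⟩ := hall L hL
      obtain ⟨α', β', rfl⟩ := hall L' hL'
      exact h.lin α β α' β'
    -- Linearity in the first matrix leaves an `X` or a `Y` in front, which is then permuted into
    -- the block of its kind. This is the reason for carrying arbitrary `i` and `j` through the
    -- induction.
    have e1 := ih (i + 1) j
    have e2 := ih i (j + 1)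
    have p1 : symMinor q (X :: M) S T =
        symMinor q ((Ps.map fun p a b => p.1 • X a b + p.2 • Y a b) ++
        (List.replicate (i + 1) X ++ List.replicate j Y)) S T := by
      apply symMinor_perm (n := n) _ _ hS hT
      · rw [List.replicate_succ, List.cons_append]
        exact List.perm_middle.symm
      · intro L hL L' hL'
        exact hall' L (by rcases List.mem_cons.1 hL with h | h <;> simp [h]) L'
          (by rcases List.mem_cons.1 hL' with h | h <;> simp [h])
    have p2 : symMinor q (Y :: M) S T =
        symMinor q ((Ps.map fun p a b => p.1 • X a b + p.2 • Y a b) ++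
        (List.replicate i X ++ List.replicate (j + 1) Y)) S T := by
      apply symMinor_perm (n := n) _ _ hS hT
      · rw [hM, List.replicate_succ, ← List.append_assoc, ← List.append_assoc]
        exact List.perm_middle.symm
      · intro L hL L' hL'
        exact hall' L (by rcases List.mem_cons.1 hL with h | h <;> simp [h]) L'
          (by rcases List.mem_cons.1 hL' with h | h <;> simp [h])
    rw [List.map_cons, List.cons_append, symMinor_cons_lin, p1, p2, e1, e2, List.map_cons,
      List.prod_cons]
    generalize hf : (Ps.map fun p : ℂ × ℂ => C p.1 * (Polynomial.X : ℂ[X]) + C p.2).prod = g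
    -- The sum belonging to `p.2` is extended by one term, which vanishes for reasons of degree, to
    -- match the length of the list.
    have hg : g.coeff (Ps.length + 1) = 0 := by
      apply coeff_eq_zero_of_natDegree_lt
      rw [← hf]
      refine Nat.lt_succ_of_le ((natDegree_list_prod_le _).trans ?_)
      have := List.sum_le_card_nsmul ((Ps.map fun p : ℂ × ℂ => C p.1 * (Polynomial.X : ℂ[X]) + C p.2).map
        natDegree) 1 (by
          intro x hx
          simp only [List.map_map, List.mem_map] at hx
          obtain ⟨p, -, rfl⟩ := hx
          exact natDegree_linear_le)
      simpa using this
    have hc0 : ((C p.1 * Polynomial.X + C p.2) * g).coeff 0 = p.2 * g.coeff 0 := by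
      simp [add_mul, mul_assoc]
    have hc1 : ∀ c, ((C p.1 * Polynomial.X + C p.2) * g).coeff (c + 1) =
        p.1 * g.coeff c + p.2 * g.coeff (c + 1) := by
      intro c
      simp [add_mul, mul_assoc, coeff_X_mul]
    rw [List.length_cons, Finset.sum_range_succ' _ (Ps.length + 1), hc0]
    simp only [hc1, add_smul, Finset.sum_add_distrib, Finset.smul_sum, smul_smul]
    rw [add_assoc]
    congr 1
    · refine Finset.sum_congr rfl fun c hc => ?_
      congr 4
      · omega
      · omega
    · have h5 := Finset.sum_range_succ' (fun c => (p.2 * g.coeff c) • symMinor q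
        (List.replicate (c + i) X ++ List.replicate (Ps.length + 1 - c + j) Y) S T)
        (Ps.length + 1)
      rw [← h5, Finset.sum_range_succ _ (Ps.length + 1), hg, mul_zero, zero_smul, add_zero]
      refine Finset.sum_congr rfl fun c hc => ?_
      have := Finset.mem_range.1 hc
      congr 4
      omega

end SymMinors

end QuantumGT

end

noncomputable section

namespace QuantumGT

/-! ### Commutation of the generators with quantum minors -/

section MinorComm

variable {A : Type*} [Ring A] [Algebra ℂ A] {n : ℕ} {q : ℂ} {e f k k' : ℕ → A}

theorem du_comm (q : ℂ) (a b : ℕ) : du q a b = du q b a := by simp [du, eq_comm]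

theorem wt_eq_du_mul {q : ℂ} (hq : q ≠ 0) (i a : ℕ) :
    wt q i a = du q i a * (du q (i + 1) a)⁻¹ := by
  rw [wt_eq_du hq, du_comm q a, du_comm q a]

theorem QGens.kInt_right (H : QGens n q e f k k') {L : ℕ → ℕ → A} (hK : KInt q k L) (c a b : ℕ) :
    L a b * k c = (du q c b * (du q c a)⁻¹) • (k c * L a b) := by
  have h1 := du_ne_zero H.q_ne c a
  have h2 := du_ne_zero H.q_ne c b
  rw [hK, smul_smul]
  rw [show du q c b * (du q c a)⁻¹ * (du q c a * (du q c b)⁻¹) = 1 by field_simp, one_smul]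

theorem QGens.kInt_inv (H : QGens n q e f k k') {L : ℕ → ℕ → A} (hK : KInt q k L) (c a b : ℕ) :
    L a b * k' c = (du q c a * (du q c b)⁻¹) • (k' c * L a b) := by
  have h := congrArg (fun x => k' c * x * k' c) (hK c a b)
  simp only [mul_smul_comm, smul_mul_assoc, mul_assoc, H.k_inv, mul_one] at h
  rw [← mul_assoc (k' c) (k c), H.inv_k, one_mul] at h
  exact h

theorem QGens.kInt_wt (H : QGens n q e f k k') {L : ℕ → ℕ → A} (hK : KInt q k L) (i a b : ℕ) :
    L a b * (k' i * k (i + 1)) = (wt q i a * (wt q i b)⁻¹) • (k' i * k (i + 1) * L a b) := by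
  have h1 := du_ne_zero H.q_ne (i + 1) a
  have h2 := du_ne_zero H.q_ne i b
  rw [← mul_assoc, H.kInt_inv hK, smul_mul_assoc, mul_assoc, H.kInt_right hK, mul_smul_comm,
    smul_smul, ← mul_assoc (k' i), wt_eq_du_mul H.q_ne, wt_eq_du_mul H.q_ne]
  congr 1
  field_simp

theorem QGens.kInt_wt' (H : QGens n q e f k k') {L : ℕ → ℕ → A} (hK : KInt q k L) (i a b : ℕ) :
    k i * k' (i + 1) * L a b = (wt q i a * (wt q i b)⁻¹) • (L a b * (k i * k' (i + 1))) := by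
  have h1 := du_ne_zero H.q_ne (i + 1) a
  have h2 := du_ne_zero H.q_ne (i + 1) b
  have h3 := du_ne_zero H.q_ne i b
  have h := H.kInt_inv hK (i + 1) a b
  have h' : k' (i + 1) * L a b = ((du q (i + 1) a)⁻¹ * du q (i + 1) b) • (L a b * k' (i + 1)) := by
    rw [h, smul_smul]
    rw [show (du q (i + 1) a)⁻¹ * du q (i + 1) b * (du q (i + 1) a * (du q (i + 1) b)⁻¹) = 1 by
      field_simp, one_smul]
  rw [mul_assoc, h', mul_smul_comm, ← mul_assoc, hK, smul_mul_assoc, smul_smul, mul_assoc (L a b),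
    wt_eq_du_mul H.q_ne, wt_eq_du_mul H.q_ne]
  congr 1
  field_simp

theorem QGens.k_qminor (H : QGens n q e f k k') (c : ℕ) {Ls : List (ℕ → ℕ → A)}
    (hK : ∀ L ∈ Ls, KInt q k L) (S : Finset ℕ) (ts : List ℕ) :
    k c * qminor q Ls S ts =
      ((∏ s ∈ S, du q c s) * (ts.map (du q c)).prod⁻¹) • (qminor q Ls S ts * k c) := by
  induction Ls generalizing S ts with
  | nil =>
    match ts with
    | [] =>
      by_cases h : S = ∅ <;> simp [qminor, h]
    | t :: ts => simp [qminor]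
  | cons L Ls ih =>
    match ts with
    | [] => simp [qminor]
    | t :: ts =>
      simp only [qminor, Finset.mul_sum, Finset.smul_sum, Finset.sum_mul]
      refine Finset.sum_congr rfl fun s hs => ?_
      rw [mul_smul_comm, ← mul_assoc, hK L (by simp) c s t, smul_mul_assoc, mul_assoc,
        ih (fun L hL => hK L (by simp [hL])), ← Finset.mul_prod_erase S _ hs, List.map_cons,
        List.prod_cons, mul_inv]
      simp only [mul_smul_comm, smul_mul_assoc, smul_smul, mul_assoc]
      congr 1
      ring

theorem QGens.kk_qminor (H : QGens n q e f k k') (i : ℕ) {Ls : List (ℕ → ℕ → A)}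
    (hK : ∀ L ∈ Ls, KInt q k L) (S : Finset ℕ) (ts : List ℕ) :
    k i * k' (i + 1) * qminor q Ls S ts =
      ((∏ s ∈ S, wt q i s) * (ts.map (wt q i)).prod⁻¹) •
        (qminor q Ls S ts * (k i * k' (i + 1))) := by
  induction Ls generalizing S ts with
  | nil =>
    match ts with
    | [] =>
      by_cases h : S = ∅ <;> simp [qminor, h]
    | t :: ts => simp [qminor]
  | cons L Ls ih =>
    match ts with
    | [] => simp [qminor]
    | t :: ts =>
      simp only [qminor, Finset.mul_sum, Finset.smul_sum, Finset.sum_mul]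
      refine Finset.sum_congr rfl fun s hs => ?_
      rw [mul_smul_comm, ← mul_assoc, H.kInt_wt' (hK L (by simp)) i s t, smul_mul_assoc, mul_assoc,
        ih (fun L hL => hK L (by simp [hL])), ← Finset.mul_prod_erase S _ hs, List.map_cons,
        List.prod_cons, mul_inv]
      simp only [mul_smul_comm, smul_mul_assoc, smul_smul, mul_assoc]
      congr 1
      ring

/-- The term of the commutation relation of `e_i` with a minor in which the row `i + 1` is
replaced. -/
def rowE (q : ℂ) (k k' : ℕ → A) (i : ℕ) (Ls : List (ℕ → ℕ → A)) (S : Finset ℕ) (ts : List ℕ) : A :=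
  if i + 1 ∈ S ∧ i ∉ S then k' i * k (i + 1) * qminor q Ls (insert i (S.erase (i + 1))) ts else 0

/-- The term of the commutation relation of `f_i` with a minor in which the row `i` is
replaced. -/
def rowF (q : ℂ) (i : ℕ) (Ls : List (ℕ → ℕ → A)) (S : Finset ℕ) (ts : List ℕ) : A :=
  if i ∈ S ∧ i + 1 ∉ S then qminor q Ls (insert (i + 1) (S.erase i)) ts else 0

theorem below_insert_erase {S : Finset ℕ} {i s : ℕ} (h1 : i + 1 ∈ S) (h2 : i ∉ S) (hs : s ∈ S)
    (hs' : s ≠ i + 1) : below (insert i (S.erase (i + 1))) s = below S s := by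
  rcases lt_or_gt_of_ne hs' with h | h
  · rw [below, Finset.filter_insert, if_neg (by omega), Finset.filter_erase,
      Finset.erase_eq_of_notMem (by simp; omega)]
    rfl
  · have h3 := below_erase_of_lt h1 h
    rw [← h3, below, Finset.filter_insert, if_pos (by omega), Finset.card_insert_of_notMem]
    · rfl
    · simp [h2]

theorem below_insert_erase_self {S : Finset ℕ} {i : ℕ} (h2 : i ∉ S) :
    below (insert i (S.erase (i + 1))) i = below S (i + 1) := by
  rw [below, below, Finset.filter_insert, if_neg (by omega), Finset.filter_erase,
      Finset.erase_eq_of_notMem (by simp)]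
  congr 1
  ext x
  simp only [Finset.mem_filter]
  constructor
  · rintro ⟨h, h'⟩; exact ⟨h, by omega⟩
  · rintro ⟨h, h'⟩
    refine ⟨h, lt_of_le_of_ne (by omega) ?_⟩
    rintro rfl; exact h2 h

theorem below_succ {S : Finset ℕ} {i : ℕ} (h : i ∈ S) : below S (i + 1) = below S i + 1 := by
  rw [← below_erase_of_lt h (Nat.lt_succ_self i)]
  congr 1
  rw [below, below]
  congr 1
  ext x
  simp only [Finset.mem_filter, Finset.mem_erase]
  constructor
  · rintro ⟨⟨h, h'⟩, h''⟩; exact ⟨h', by omega⟩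
  · rintro ⟨h, h'⟩; exact ⟨⟨by omega, h⟩, by omega⟩

theorem insert_erase_comm {S : Finset ℕ} {i j s : ℕ} (h1 : s ≠ i) :
    (insert i (S.erase j)).erase s = insert i ((S.erase s).erase j) := by
  rw [Finset.erase_insert_of_ne h1.symm, Finset.erase_right_comm]

/-- The correction term obeys the same expansion along the first column as the minor. If `i` and `i
+ 1` are both rows, the contributions of `s = i` and `s = i + 1` give the same smaller minor with
opposite signs and cancel. If only `i + 1` is a row, replacing it by `i` does not change the
relative order of the rows. -/
theorem QGens.rowE_cons (H : QGens n q e f k k') (i : ℕ) {L : ℕ → ℕ → A} (hK : KInt q k L)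
    (Ls : List (ℕ → ℕ → A)) (S : Finset ℕ) (t : ℕ) (ts : List ℕ) :
    ∑ s ∈ S, (-q) ^ below S s • (wt q i t • (L s t * rowE q k k' i Ls (S.erase s) ts) +
      (if s = i + 1 then k' i * k (i + 1) * L i t else 0) * qminor q Ls (S.erase s) ts) =
    rowE q k k' i (L :: Ls) S (t :: ts) := by
  have hwt := wt_ne_zero H.q_ne i t
  have hmove : ∀ s, wt q i t • (L s t * (k' i * k (i + 1))) =
      wt q i s • (k' i * k (i + 1) * L s t) := by
    intro s
    rw [H.kInt_wt hK, smul_smul]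
    congr 1
    field_simp
  by_cases h1 : i + 1 ∈ S
  · by_cases h2 : i ∈ S
    · rw [rowE, if_neg (by tauto), Finset.sum_eq_add_of_mem i (i + 1) h2 h1 (by omega)]
      · have e1 : rowE q k k' i Ls (S.erase i) ts =
            k' i * k (i + 1) * qminor q Ls (S.erase (i + 1)) ts := by
          rw [rowE, if_pos (by simp [h1])]
          congr 2
          rw [Finset.erase_right_comm, Finset.insert_erase]
          simp [h2]
        have e2 : rowE q k k' i Ls (S.erase (i + 1)) ts = 0 := by
          rw [rowE, if_neg (by simp)]
        rw [e1, e2, if_neg (by omega), if_pos rfl, below_succ h2, ← mul_assoc,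
          ← smul_mul_assoc (wt q i t), hmove, wt, if_pos (show i = i from rfl)]
        simp only [zero_mul, add_zero, mul_zero, smul_zero, zero_add, smul_mul_assoc, pow_succ]
        module
      · intro s hs hne
        rw [rowE, if_neg (by simp [h2]; intro _ _; exact hne.1.symm), if_neg hne.2]
        simp
    · rw [rowE, if_pos ⟨h1, h2⟩, qminor, Finset.sum_insert (by simp [h2]),
        ← Finset.add_sum_erase S _ h1, mul_add]
      congr 1
      · rw [rowE, if_neg (by simp), if_pos rfl, below_insert_erase_self h2,
          Finset.erase_insert (by simp [h2])]
        simp [mul_assoc]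
      · rw [Finset.mul_sum]
        refine Finset.sum_congr rfl fun s hs => ?_
        obtain ⟨hs1, hs2⟩ := Finset.mem_erase.1 hs
        have hsi : s ≠ i := fun h => h2 (h ▸ hs2)
        rw [rowE, if_pos (by simp [h1, h2, hs1.symm]), if_neg hs1, below_insert_erase h1 h2 hs2 hs1,
          insert_erase_comm hsi, ← mul_assoc, ← smul_mul_assoc (wt q i t), hmove, wt, if_neg hsi,
          if_neg hs1]
        simp [mul_assoc]
  · rw [rowE, if_neg (by tauto)]
    refine Finset.sum_eq_zero fun s hs => ?_
    rw [rowE, if_neg (by simp [h1]), if_neg (by rintro rfl; exact h1 hs)]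
    simp

/-- Same mechanism as `rowE_cons`. The product of weights over the remaining rows appears because
`f_i` is moved to the left through the remaining minor before it meets the first factor. -/
theorem QGens.rowF_cons (H : QGens n q e f k k') (i : ℕ) (L : ℕ → ℕ → A)
    (Ls : List (ℕ → ℕ → A)) (S : Finset ℕ) (t : ℕ) (ts : List ℕ) :
    ∑ s ∈ S, (-q) ^ below S s • (L s t * rowF q i Ls (S.erase s) ts +
      (∏ x ∈ S.erase s, wt q i x)⁻¹ •
        ((if s = i then L (i + 1) t else 0) * qminor q Ls (S.erase s) ts)) =
    rowF q i (L :: Ls) S (t :: ts) := by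
  have hq := H.q_ne
  by_cases h2 : i ∈ S
  · by_cases h1 : i + 1 ∈ S
    · rw [rowF, if_neg (by tauto), Finset.sum_eq_add_of_mem i (i + 1) h2 h1 (by omega)]
      · have e1 : rowF q i Ls (S.erase (i + 1)) ts = qminor q Ls (S.erase i) ts := by
          rw [rowF, if_pos (by simp [h2])]
          congr 1
          rw [Finset.erase_right_comm, Finset.insert_erase]
          simp [h1]
        have e2 : rowF q i Ls (S.erase i) ts = 0 := by
          rw [rowF, if_neg (by simp)]
        have e3 : ∏ x ∈ S.erase i, wt q i x = q⁻¹ := by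
          rw [Finset.prod_eq_single_of_mem (i + 1) (by simp [h1])]
          · simp [wt]
          · intro x hx hne
            rw [wt, if_neg (Finset.ne_of_mem_erase hx), if_neg hne]
        rw [e1, e2, e3, if_neg (show ¬ i + 1 = i by omega), if_pos (show i = i from rfl), below_succ h2]
        simp only [zero_mul, add_zero, mul_zero, smul_zero, zero_add, pow_succ, inv_inv]
        module
      · intro s hs hne
        rw [rowF, if_neg (by simp [h1]; intro _ _; exact hne.2.symm), if_neg hne.1]
        simp
    · rw [rowF, if_pos ⟨h2, h1⟩, qminor, Finset.sum_insert (by simp [h1]),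
        ← Finset.add_sum_erase S _ h2]
      have hS : S = insert i ((insert (i + 1) (S.erase i)).erase (i + 1)) := by
        rw [Finset.erase_insert (by simp [h1]), Finset.insert_erase h2]
      have g1 : i + 1 ∈ insert (i + 1) (S.erase i) := Finset.mem_insert_self _ _
      have g2 : i ∉ insert (i + 1) (S.erase i) := by simp
      congr 1
      · have e3 : ∏ x ∈ S.erase i, wt q i x = 1 := by
          refine Finset.prod_eq_one fun x hx => ?_
          rw [wt, if_neg (Finset.ne_of_mem_erase hx), if_neg]
          rintro rfl
          exact h1 (Finset.mem_of_mem_erase hx)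
        rw [rowF, if_neg (by simp), if_pos rfl, e3, Finset.erase_insert (by simp [h1])]
        nth_rw 1 [hS]
        rw [below_insert_erase_self g2]
        simp
      · refine Finset.sum_congr rfl fun s hs => ?_
        obtain ⟨hs1, hs2⟩ := Finset.mem_erase.1 hs
        have hsi : s ≠ i + 1 := fun h => h1 (h ▸ hs2)
        rw [rowF, if_pos (by simp [h1, h2, hs1.symm]), if_neg hs1, insert_erase_comm hsi]
        nth_rw 1 [hS]
        rw [below_insert_erase g1 g2 (by simp [hs1, hs2]) hsi]
        simp
  · rw [rowF, if_neg (by tauto)]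
    refine Finset.sum_eq_zero fun s hs => ?_
    rw [rowF, if_neg (by simp [h2]), if_neg (by rintro rfl; exact h2 hs)]
    simp

/-- Commutation of `e_i` with a minor without column `i`. -/
theorem QGens.e_qminor (H : QGens n q e f k k') {i : ℕ} (h1 : 1 ≤ i) (hn : i < n)
    {Ls : List (ℕ → ℕ → A)} (hE : ∀ L ∈ Ls, EInt n q e k k' L) (hK : ∀ L ∈ Ls, KInt q k L)
    (S : Finset ℕ) {ts : List ℕ} (hi : i ∉ ts) :
    e i * qminor q Ls S ts = (ts.map (wt q i)).prod • (qminor q Ls S ts * e i)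
      + rowE q k k' i Ls S ts := by
  induction Ls generalizing S ts with
  | nil =>
    match ts with
    | [] =>
      by_cases h : S = ∅
      · simp [qminor, h, rowE]
      · simp [qminor, h, rowE]
    | t :: ts => simp [qminor, rowE]
  | cons L Ls ih =>
    match ts with
    | [] => simp [qminor, rowE]
    | t :: ts =>
      have ht : t ≠ i := fun h => hi (by simp [h])
      rw [← H.rowE_cons i (hK L (by simp)), qminor, Finset.mul_sum, Finset.sum_mul, Finset.smul_sum,
        ← Finset.sum_add_distrib]
      refine Finset.sum_congr rfl fun s hs => ?_
      rw [mul_smul_comm, ← mul_assoc, hE L (by simp) i h1 hn s t, if_neg ht, sub_zero, add_mul,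
        smul_mul_assoc, mul_assoc, ih (fun L hL => hE L (by simp [hL]))
        (fun L hL => hK L (by simp [hL])) _ (fun h => hi (by simp [h])), List.map_cons,
        List.prod_cons]
      simp only [mul_add, mul_smul_comm, smul_mul_assoc, smul_add, mul_assoc]
      module

/-- Commutation of `e_i` with a minor which has the column `i` once. -/
theorem QGens.e_qminor_col (H : QGens n q e f k k') {i : ℕ} (h1 : 1 ≤ i) (hn : i < n)
    {Ls : List (ℕ → ℕ → A)} (hE : ∀ L ∈ Ls, EInt n q e k k' L) (hK : ∀ L ∈ Ls, KInt q k L)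
    (S : Finset ℕ) {pre post : List ℕ} (hi : i ∉ pre) (hi' : i + 1 ∉ pre) (hp : i ∉ post) :
    e i * qminor q Ls S (pre ++ i :: post) =
      ((pre ++ i :: post).map (wt q i)).prod • (qminor q Ls S (pre ++ i :: post) * e i)
      - qminor q Ls S (pre ++ (i + 1) :: post) + rowE q k k' i Ls S (pre ++ i :: post) := by
  induction pre generalizing Ls S with
  | nil =>
    match Ls with
    | [] => simp [qminor, rowE]
    | L :: Ls =>
      rw [List.nil_append, List.nil_append, ← H.rowE_cons i (hK L (by simp)), qminor, qminor,
        Finset.mul_sum, Finset.sum_mul, Finset.smul_sum, ← Finset.sum_sub_distrib,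
        ← Finset.sum_add_distrib]
      refine Finset.sum_congr rfl fun s hs => ?_
      rw [mul_smul_comm, ← mul_assoc, hE L (by simp) i h1 hn s i, if_pos rfl, add_mul, sub_mul,
        smul_mul_assoc, mul_assoc, H.e_qminor h1 hn (fun L hL => hE L (by simp [hL]))
        (fun L hL => hK L (by simp [hL])) _ hp, List.map_cons, List.prod_cons]
      simp only [mul_add, mul_smul_comm, smul_mul_assoc, smul_add, mul_assoc]
      module
  | cons t pre ih =>
    match Ls with
    | [] => simp [qminor, rowE]
    | L :: Ls =>
      have ht : t ≠ i := fun h => hi (by simp [h])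
      have ht' : t ≠ i + 1 := fun h => hi' (by simp [h])
      rw [List.cons_append, List.cons_append, ← H.rowE_cons i (hK L (by simp)), qminor, qminor,
        Finset.mul_sum, Finset.sum_mul, Finset.smul_sum, ← Finset.sum_sub_distrib,
        ← Finset.sum_add_distrib]
      refine Finset.sum_congr rfl fun s hs => ?_
      rw [mul_smul_comm, ← mul_assoc, hE L (by simp) i h1 hn s t, if_neg ht, sub_zero, add_mul,
        smul_mul_assoc, mul_assoc, ih (fun L hL => hE L (by simp [hL]))
        (fun L hL => hK L (by simp [hL])) _ (fun h => hi (by simp [h])) (fun h => hi' (by simp [h])),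
        List.map_cons, List.prod_cons, show wt q i t = 1 by rw [wt, if_neg ht, if_neg ht']]
      simp only [mul_add, mul_sub, mul_smul_comm, smul_mul_assoc, smul_add, smul_sub, mul_assoc]
      module

/-- Commutation of `f_i` with a minor without column `i + 1`. -/
theorem QGens.qminor_f (H : QGens n q e f k k') {i : ℕ} (h1 : 1 ≤ i) (hn : i < n)
    {Ls : List (ℕ → ℕ → A)} (hF : ∀ L ∈ Ls, FInt n q f k k' L)
    (S : Finset ℕ) {ts : List ℕ} (hi : i + 1 ∉ ts) :
    qminor q Ls S ts * f i = (∏ s ∈ S, wt q i s)⁻¹ • (f i * qminor q Ls S ts)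
      - rowF q i Ls S ts := by
  induction Ls generalizing S ts with
  | nil =>
    match ts with
    | [] =>
      by_cases h : S = ∅
      · simp [qminor, h, rowF]
      · simp [qminor, h, rowF]
    | t :: ts => simp [qminor, rowF]
  | cons L Ls ih =>
    match ts with
    | [] => simp [qminor, rowF]
    | t :: ts =>
      have ht : t ≠ i + 1 := fun h => hi (by simp [h])
      rw [← H.rowF_cons i L, qminor, Finset.mul_sum, Finset.sum_mul, Finset.smul_sum,
        ← Finset.sum_sub_distrib]
      refine Finset.sum_congr rfl fun s hs => ?_
      rw [smul_mul_assoc, mul_assoc, ih (fun L hL => hF L (by simp [hL])) _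
        (fun h => hi (by simp [h])), mul_sub, mul_smul_comm, ← mul_assoc, hF L (by simp) i h1 hn s t,
        if_neg ht, add_zero, ← Finset.mul_prod_erase S _ hs, mul_inv]
      simp only [sub_mul, mul_smul_comm, smul_mul_assoc, smul_sub, mul_assoc]
      module

/-- Commutation of `f_i` with a minor which has the column `i + 1` once. -/
theorem QGens.qminor_f_col (H : QGens n q e f k k') {i : ℕ} (h1 : 1 ≤ i) (hn : i < n)
    {Ls : List (ℕ → ℕ → A)} (hF : ∀ L ∈ Ls, FInt n q f k k' L) (hK : ∀ L ∈ Ls, KInt q k L)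
    (S : Finset ℕ) {pre post : List ℕ} (hi : i + 1 ∉ pre) (hp : i ∉ post) (hp' : i + 1 ∉ post) :
    qminor q Ls S (pre ++ (i + 1) :: post) * f i =
      (∏ s ∈ S, wt q i s)⁻¹ • (f i * qminor q Ls S (pre ++ (i + 1) :: post))
      + qminor q Ls S (pre ++ i :: post) * (k i * k' (i + 1))
      - rowF q i Ls S (pre ++ (i + 1) :: post) := by
  induction pre generalizing Ls S with
  | nil =>
    match Ls with
    | [] => simp [qminor, rowF]
    | L :: Ls =>
      rw [List.nil_append, List.nil_append, ← H.rowF_cons i L, qminor, qminor,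
        Finset.mul_sum, Finset.sum_mul, Finset.sum_mul, Finset.smul_sum, ← Finset.sum_add_distrib,
        ← Finset.sum_sub_distrib]
      refine Finset.sum_congr rfl fun s hs => ?_
      have hW : ∏ s ∈ S.erase s, wt q i s ≠ 0 :=
        Finset.prod_ne_zero_iff.2 fun x _ => wt_ne_zero H.q_ne i x
      -- The Cartan factor created at the first matrix has to cross the remaining minor; its columns
      -- `post` have weight `1`, so only the weights of the rows matter and these cancel.
      have hP : (post.map (wt q i)).prod = 1 := by
        apply List.prod_eq_one
        intro x hx
        obtain ⟨y, hy, rfl⟩ := List.mem_map.1 hx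
        rw [wt, if_neg (by rintro rfl; exact hp hy), if_neg (by rintro rfl; exact hp' hy)]
      have hkk := H.kk_qminor i (fun L hL => hK L (by simp [hL])) (S.erase s) post (Ls := Ls)
      rw [hP, inv_one, mul_one] at hkk
      rw [smul_mul_assoc, mul_assoc, H.qminor_f h1 hn (fun L hL => hF L (by simp [hL])) _ hp',
        mul_sub, mul_smul_comm, ← mul_assoc, hF L (by simp) i h1 hn s (i + 1), if_pos rfl,
        ← Finset.mul_prod_erase S _ hs, mul_inv, sub_mul, add_mul, mul_assoc (L s i), hkk]
      simp only [sub_mul, mul_smul_comm, smul_mul_assoc, smul_sub, smul_add, mul_assoc]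
      match_scalars <;> field_simp
  | cons t pre ih =>
    match Ls with
    | [] => simp [qminor, rowF]
    | L :: Ls =>
      have ht : t ≠ i + 1 := fun h => hi (by simp [h])
      rw [List.cons_append, List.cons_append, ← H.rowF_cons i L, qminor, qminor,
        Finset.mul_sum, Finset.sum_mul, Finset.sum_mul, Finset.smul_sum, ← Finset.sum_add_distrib,
        ← Finset.sum_sub_distrib]
      refine Finset.sum_congr rfl fun s hs => ?_
      rw [smul_mul_assoc, mul_assoc, ih (fun L hL => hF L (by simp [hL]))
        (fun L hL => hK L (by simp [hL])) _ (fun h => hi (by simp [h])), mul_sub, mul_add,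
        mul_smul_comm, ← mul_assoc, hF L (by simp) i h1 hn s t,
        if_neg ht, add_zero, ← Finset.mul_prod_erase S _ hs, mul_inv]
      simp only [sub_mul, mul_smul_comm, smul_mul_assoc, smul_sub, smul_add, mul_assoc]
      module

end MinorComm

end QuantumGT

end

noncomputable section

namespace QuantumGT

/-! ### The central elements -/

section Central

variable {A : Type*} [Ring A] [Algebra ℂ A] {n : ℕ} {q : ℂ} {e f k k' : ℕ → A}

theorem EInt.lin {X Y : ℕ → ℕ → A} (hX : EInt n q e k k' X) (hY : EInt n q e k k' Y) (α β : ℂ) :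
    EInt n q e k k' (fun a b => α • X a b - β • Y a b) := by
  intro i h1 hn a b
  simp only [mul_sub, mul_smul_comm, hX i h1 hn a b, hY i h1 hn a b]
  split_ifs <;> simp only [sub_mul, smul_mul_assoc] <;> module

theorem FInt.lin {X Y : ℕ → ℕ → A} (hX : FInt n q f k k' X) (hY : FInt n q f k k' Y) (α β : ℂ) :
    FInt n q f k k' (fun a b => α • X a b - β • Y a b) := by
  intro i h1 hn a b
  simp only [mul_sub, sub_mul, smul_mul_assoc, mul_smul_comm, hX i h1 hn a b, hY i h1 hn a b]
  split_ifs <;> module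

theorem KInt.lin {X Y : ℕ → ℕ → A} (hX : KInt q k X) (hY : KInt q k Y) (α β : ℂ) :
    KInt q k (fun a b => α • X a b - β • Y a b) := by
  intro c a b
  simp only [mul_sub, sub_mul, smul_mul_assoc, mul_smul_comm, hX c a b, hY c a b]
  module

theorem QGens.eInt_Lz (H : QGens n q e f k k') (z : ℂ) : EInt n q e k k' (Lz q e f k k' z) :=
  H.eInt_lp.lin H.eInt_lm z z⁻¹

theorem QGens.fInt_Lz (H : QGens n q e f k k') (z : ℂ) : FInt n q f k k' (Lz q e f k k' z) :=
  H.fInt_lp.lin H.fInt_lm z z⁻¹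

theorem QGens.kInt_Lz (H : QGens n q e f k k') (z : ℂ) : KInt q k (Lz q e f k k' z) :=
  H.kInt_lp.lin H.kInt_lm z z⁻¹

/-- The matrices `L(z), L(z / q), …, L(z / q ^ (r - 1))`. -/
def fused (q : ℂ) (e f k k' : ℕ → A) : ℕ → ℂ → List (ℕ → ℕ → A)
  | 0, _ => []
  | r + 1, z => Lz q e f k k' z :: fused q e f k k' r (z * q⁻¹)

theorem length_fused (q : ℂ) (e f k k' : ℕ → A) (r : ℕ) (z : ℂ) :
    (fused q e f k k' r z).length = r := by
  induction r generalizing z with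
  | zero => rfl
  | succ r ih => simp [fused, ih]

theorem exists_of_mem_fused {r : ℕ} {z : ℂ} {L : ℕ → ℕ → A} (h : L ∈ fused q e f k k' r z) :
    ∃ w, L = Lz q e f k k' w := by
  induction r generalizing z with
  | zero => simp [fused] at h
  | succ r ih =>
    rcases List.mem_cons.1 h with h | h
    · exact ⟨z, h⟩
    · exact ih h

theorem QGens.eInt_fused (H : QGens n q e f k k') (r : ℕ) (z : ℂ) :
    ∀ L ∈ fused q e f k k' r z, EInt n q e k k' L := by
  intro L hL
  obtain ⟨w, rfl⟩ := exists_of_mem_fused hL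
  exact H.eInt_Lz w

theorem QGens.fInt_fused (H : QGens n q e f k k') (r : ℕ) (z : ℂ) :
    ∀ L ∈ fused q e f k k' r z, FInt n q f k k' L := by
  intro L hL
  obtain ⟨w, rfl⟩ := exists_of_mem_fused hL
  exact H.fInt_Lz w

theorem QGens.kInt_fused (H : QGens n q e f k k') (r : ℕ) (z : ℂ) :
    ∀ L ∈ fused q e f k k' r z, KInt q k L := by
  intro L hL
  obtain ⟨w, rfl⟩ := exists_of_mem_fused hL
  exact H.kInt_Lz w

theorem QGens.isChain_fused (H : QGens n q e f k k') (r : ℕ) {z : ℂ} (hz : z ≠ 0) :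
    (fused q e f k k' r z).IsChain (RowAnti n q) := by
  induction r generalizing z with
  | zero => simp [fused]
  | succ r ih =>
    have hz' : z * q⁻¹ ≠ 0 := mul_ne_zero hz (inv_ne_zero H.q_ne)
    cases r with
    | zero => simp [fused]
    | succ r => exact List.isChain_cons_cons.2 ⟨H.rowAnti hz, ih hz'⟩

/-- The transposed matrices in the opposite order. -/
def fusedT (q : ℂ) (e f k k' : ℕ → A) (r : ℕ) (z : ℂ) : List (ℕ → ℕ → A) :=
  ((fused q e f k k' r z).map fun L a b => L b a).reverse

theorem fusedT_succ (q : ℂ) (e f k k' : ℕ → A) (r : ℕ) (z : ℂ) :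
    fusedT q e f k k' (r + 1) z =
      fusedT q e f k k' r (z * q⁻¹) ++ [fun a b => Lz q e f k k' z b a] := by
  simp [fusedT, fused]

theorem QGens.isChain_fusedT (H : QGens n q e f k k') (r : ℕ) {z : ℂ} (hz : z ≠ 0) :
    (fusedT q e f k k' r z).IsChain (RowAnti n q) := by
  rw [fusedT, List.isChain_reverse]
  induction r generalizing z with
  | zero => simp [fused]
  | succ r ih =>
    have hz' : z * q⁻¹ ≠ 0 := mul_ne_zero hz (inv_ne_zero H.q_ne)
    cases r with
    | zero => simp [fused]
    | succ r => exact List.isChain_cons_cons.2 ⟨H.rowAnti_transpose hz, ih hz'⟩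

theorem QGens.symPair_Lz (H : QGens n q e f k k') (z w : ℂ) :
    SymPair n q (Lz q e f k k' z) (Lz q e f k k' w) := by
  have h := H.symPair_lp_lm.lin z (-z⁻¹) w (-w⁻¹)
  have e1 : ∀ z : ℂ, Lz q e f k k' z = fun a b => z • lp q e k a b + (-z⁻¹) • lm q f k' a b := by
    intro z
    ext a b
    rw [Lz, neg_smul, sub_eq_add_neg]
  rw [e1, e1]
  exact h

/-- The transpose of a quantum minor. -/
theorem QGens.qminor_transpose (H : QGens n q e f k k') {r : ℕ} (hr : qfac q r ≠ 0) {z : ℂ}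
    (hz : z ≠ 0) {l l' : List ℕ} (hl : l.Pairwise (· < ·)) (hl' : l'.Pairwise (· < ·))
    (hb : ∀ x ∈ l, 1 ≤ x ∧ x ≤ n) (hb' : ∀ x ∈ l', 1 ≤ x ∧ x ≤ n) (hlen : l.length = r)
    (hlen' : l'.length = r) :
    qminor q (fused q e f k k' r z) l.toFinset l' =
      qminor q (fusedT q e f k k' r z) l'.toFinset l := by
  have h1 := symMinor_eq_qminor (H.isChain_fused r hz) (S := l.toFinset) (by simpa using hb) hl' hb'
    (by rw [length_fused, hlen'])
  have h2 := symMinor_eq_qminor (H.isChain_fusedT r hz) (S := l'.toFinset) (by simpa using hb') hl hb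
    (by rw [fusedT, List.length_reverse, List.length_map, length_fused, hlen])
  rw [fusedT, ← List.map_reverse, ← symMinor_transpose] at h2
  -- Transposition reverses the order of the factors; symmetrized minors do not see the order. The
  -- factorials relating them to minors are equal and nonzero, so they cancel at the end.
  have h3 : symMinor q (fused q e f k k' r z).reverse l.toFinset l'.toFinset =
      symMinor q (fused q e f k k' r z) l.toFinset l'.toFinset := by
    apply symMinor_perm (n := n) (List.reverse_perm _)
    · intro L hL L' hL'
      obtain ⟨w, rfl⟩ := exists_of_mem_fused (List.mem_reverse.1 hL)
      obtain ⟨w', rfl⟩ := exists_of_mem_fused (List.mem_reverse.1 hL')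
      exact H.symPair_Lz w w'
    · simpa using hb
    · simpa using hb'
  rw [h3, h1, List.length_map, List.length_reverse, length_fused] at h2
  rw [List.map_reverse, ← fusedT.eq_def] at h2
  exact smul_right_injective A hr h2

/-- The quantum determinant of the first `m` rows and columns. -/
def qdet (q : ℂ) (e f k k' : ℕ → A) (m : ℕ) (z : ℂ) : A :=
  qminor q (fused q e f k k' m z) (Finset.Icc 1 m) (List.range' 1 m)

theorem toFinset_range' (m : ℕ) : (List.range' 1 m).toFinset = Finset.Icc 1 m := by
  ext x
  simp only [List.mem_toFinset, List.mem_range'_1, Finset.mem_Icc]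
  omega

theorem prod_wt_eq_one {q : ℂ} (hq : q ≠ 0) {i m : ℕ} (h1 : 1 ≤ i) (hm : i < m) :
    ∏ s ∈ Finset.Icc 1 m, wt q i s = 1 := by
  rw [Finset.prod_eq_mul_of_mem i (i + 1) (by simp; omega) (by simp; omega) (by omega)]
  · simp [wt, hq]
  · intro x _ hx
    rw [wt, if_neg hx.1, if_neg hx.2]

theorem range'_split {i m : ℕ} (h1 : 1 ≤ i) (hm : i < m) :
    List.range' 1 m = List.range' 1 (i - 1) ++ i :: (i + 1) :: List.range' (i + 2) (m - i - 1) := by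
  obtain ⟨j, rfl⟩ : ∃ j, i = j + 1 := ⟨i - 1, by omega⟩
  obtain ⟨d, rfl⟩ : ∃ d, m = j + (d + 1 + 1) := ⟨m - j - 2, by omega⟩
  rw [← List.range'_append_1, List.range'_succ, List.range'_succ]
  simp only [Nat.add_sub_cancel]
  congr 2
  · omega
  · congr 1
    · omega
    · congr 1 <;> omega

/-- Both correction terms vanish: replacing column `i` by `i + 1` repeats a column, and row `i + 1`
cannot be replaced by `i`, which is already there. The weights of all columns multiply to `1`. -/
theorem QGens.e_qdet (H : QGens n q e f k k') {i m : ℕ} (h1 : 1 ≤ i) (hi : i < m) (hm : m ≤ n)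
    {z : ℂ} (hz : z ≠ 0) : e i * qdet q e f k k' m z = qdet q e f k k' m z * e i := by
  have hp : ((List.range' 1 m).map (wt q i)).prod = 1 := by
    rw [← List.prod_toFinset _ (List.nodup_range' ..), toFinset_range', prod_wt_eq_one H.q_ne h1 hi]
  have hsplit := range'_split h1 hi
  have h := H.e_qminor_col h1 (by omega) (H.eInt_fused m z) (H.kInt_fused m z) (Finset.Icc 1 m)
    (pre := List.range' 1 (i - 1)) (post := (i + 1) :: List.range' (i + 2) (m - i - 1))
    (by simp [List.mem_range'_1]; omega) (by simp [List.mem_range'_1]; omega)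
    (by simp [List.mem_range'_1])
  rw [qminor_adjacent_eq (H.isChain_fused m hz) (by simp; omega) _ _ (by omega) (by omega),
    ← hsplit, hp, one_smul, rowE, if_neg (by simp; omega), sub_zero, add_zero] at h
  exact h

theorem QGens.qdet_f (H : QGens n q e f k k') {i m : ℕ} (h1 : 1 ≤ i) (hi : i < m) (hm : m ≤ n)
    {z : ℂ} (hz : z ≠ 0) : f i * qdet q e f k k' m z = qdet q e f k k' m z * f i := by
  have hsplit := range'_split h1 hi
  have h := H.qminor_f_col h1 (by omega) (H.fInt_fused m z) (H.kInt_fused m z) (Finset.Icc 1 m)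
    (pre := List.range' 1 (i - 1) ++ [i]) (post := List.range' (i + 2) (m - i - 1))
    (by simp [List.mem_range'_1]; omega) (by simp [List.mem_range'_1])
    (by simp [List.mem_range'_1])
  simp only [List.append_assoc, List.cons_append, List.nil_append] at h
  rw [qminor_adjacent_eq (H.isChain_fused m hz) (by simp; omega) _ _ (by omega) (by omega),
    ← hsplit, prod_wt_eq_one H.q_ne h1 hi, inv_one, one_smul, rowF, if_neg (by simp; omega),
    sub_zero, zero_mul, add_zero] at h
  exact h.symm

theorem QGens.k_qdet (H : QGens n q e f k k') (c m : ℕ) (z : ℂ) :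
    k c * qdet q e f k k' m z = qdet q e f k k' m z * k c := by
  rw [qdet, H.k_qminor c (H.kInt_fused m z), ← List.prod_toFinset _ (List.nodup_range' ..),
    toFinset_range', mul_inv_cancel₀, one_smul]
  exact Finset.prod_ne_zero_iff.2 fun x _ => du_ne_zero H.q_ne c x

/-- The expansion of the quantum determinant along a row, with the row `s` in the place of the
missing row. -/
theorem QGens.sylvester (H : QGens n q e f k k') (hfac : ∀ r, qfac q r ≠ 0) {p : ℕ}
    (hp : p + 2 ≤ n) {z : ℂ} (hz : z ≠ 0) :
    qdet q e f k k' (p + 2) z * qdet q e f k k' p (z * q⁻¹) =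
      qminor q (fused q e f k k' (p + 1) (z * q⁻¹)) (insert (p + 2) (Finset.Icc 1 p))
          (List.range' 1 p ++ [p + 2]) * qdet q e f k k' (p + 1) z
      - q⁻¹ • (qminor q (fused q e f k k' (p + 1) (z * q⁻¹)) (insert (p + 2) (Finset.Icc 1 p))
          (List.range' 1 (p + 1)) *
        qminor q (fused q e f k k' (p + 1) z) (Finset.Icc 1 (p + 1))
          (List.range' 1 p ++ [p + 2])) := by
  have hq := H.q_ne
  have hz' : z * q⁻¹ ≠ 0 := mul_ne_zero hz (inv_ne_zero hq)
  have hP : List.range' 1 (p + 1) = List.range' 1 p ++ [p + 1] := by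
    rw [List.range'_1_concat, add_comm]
  have hG : List.range' 1 (p + 2) = List.range' 1 p ++ [p + 1, p + 2] := by
    rw [List.range'_1_concat, hP, List.append_assoc, add_comm 1 (p + 1)]; rfl
  have hQ : (List.range' 1 p ++ [p + 2]).toFinset = insert (p + 2) (Finset.Icc 1 p) := by
    rw [List.toFinset_append, toFinset_range']
    ext x; simp
  have sH : (List.range' 1 p).Pairwise (· < ·) := List.pairwise_lt_range'
  have sQ : (List.range' 1 p ++ [p + 2]).Pairwise (· < ·) := by
    rw [List.pairwise_append]
    refine ⟨sH, by simp, ?_⟩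
    intro a ha b hb
    simp [List.mem_range'_1] at ha hb
    omega
  have bH : ∀ x ∈ List.range' 1 p, 1 ≤ x ∧ x ≤ n := by
    intro x hx; simp [List.mem_range'_1] at hx; omega
  have bQ : ∀ x ∈ List.range' 1 p ++ [p + 2], 1 ≤ x ∧ x ≤ n := by
    intro x hx; simp [List.mem_range'_1] at hx; omega
  have bIcc : ∀ m, m ≤ n → ∀ x ∈ Finset.Icc 1 m, 1 ≤ x ∧ x ≤ n := by
    intro m hm x hx; simp at hx; omega
  -- the cofactors
  set Q : Finset ℕ := insert (p + 2) (Finset.Icc 1 p) with hQdef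
  set cof : ℕ → A := fun u => qminor q (fusedT q e f k k' (p + 1) (z * q⁻¹))
    ((Finset.Icc 1 (p + 2)).erase u) (List.range' 1 p ++ [p + 2]) with hcof
  have hrow : ∀ s, qminor q (fusedT q e f k k' (p + 2) z) (Finset.Icc 1 (p + 2))
      ((List.range' 1 p ++ [p + 2]) ++ [s]) =
      ∑ u ∈ Finset.Icc 1 (p + 2), (-q) ^ above (Finset.Icc 1 (p + 2)) u •
        (cof u * Lz q e f k k' z s u) := by
    intro s
    rw [fusedT_succ, qminor_append]
  -- For `s ≤ p` the column `s` of the transposed minor is repeated.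
  have hrow0 : ∀ s ∈ Finset.Icc 1 p, ∑ u ∈ Finset.Icc 1 (p + 2),
      (-q) ^ above (Finset.Icc 1 (p + 2)) u • (cof u * Lz q e f k k' z s u) = 0 := by
    intro s hs
    rw [← hrow, qminor_last_eq_zero (H.isChain_fusedT _ hz) hq (bIcc _ hp) sQ bQ]
    simp [List.mem_range'_1] at hs ⊢
    omega
  have hdetT : qminor q (fusedT q e f k k' (p + 2) z) (Finset.Icc 1 (p + 2)) (List.range' 1 (p + 2)) =
      qdet q e f k k' (p + 2) z := by
    rw [qdet, ← toFinset_range', H.qminor_transpose (hfac _) hz List.pairwise_lt_range'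
      List.pairwise_lt_range' _ _ (by simp) (by simp)]
    all_goals
      intro x hx
      simp [List.mem_range'_1] at hx
      omega
  -- For `s = p + 1` the columns are complete, with `p + 2` and `p + 1` in the wrong order; one swap
  -- costs `-q`.
  have hrow1 : ∑ u ∈ Finset.Icc 1 (p + 2),
      (-q) ^ above (Finset.Icc 1 (p + 2)) u • (cof u * Lz q e f k k' z (p + 1) u) =
      (-q) • qdet q e f k k' (p + 2) z := by
    rw [← hrow, ← hdetT, hG, List.append_assoc]
    exact qminor_swap (H.isChain_fusedT _ hz) (bIcc _ hp) _ [] (by omega) (by omega) hp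
  have hlapl : ∀ u, qminor q (fused q e f k k' (p + 1) z) (Finset.Icc 1 (p + 1))
      (u :: List.range' 1 p) = ∑ s ∈ Finset.Icc 1 (p + 1),
        (-q) ^ below (Finset.Icc 1 (p + 1)) s • (Lz q e f k k' z s u *
          qminor q (fused q e f k k' p (z * q⁻¹)) ((Finset.Icc 1 (p + 1)).erase s)
            (List.range' 1 p)) := by
    intro u
    rw [fused, qminor]
  -- Again a repeated column, now in the minor of order `p + 1`.
  have hzero : ∀ u ∈ Finset.Icc 1 p, qminor q (fused q e f k k' (p + 1) z) (Finset.Icc 1 (p + 1))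
      (u :: List.range' 1 p) = 0 := by
    intro u hu
    refine qminor_eq_zero_of_mem (H.isChain_fused _ hz) (bIcc _ (by omega)) sH bH ?_
    simp [List.mem_range'_1] at hu ⊢
    omega
  have hmv : ∀ u, p < u → u ≤ n → qminor q (fused q e f k k' (p + 1) z) (Finset.Icc 1 (p + 1))
      (u :: List.range' 1 p) = (-q) ^ p • qminor q (fused q e f k k' (p + 1) z)
        (Finset.Icc 1 (p + 1)) (List.range' 1 p ++ [u]) := by
    intro u hu hun
    have := qminor_move (H.isChain_fused (p + 1) hz) (bIcc (p + 1) (by omega)) []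
      (List.range' 1 p) [] hun (by intro x hx; simp [List.mem_range'_1] at hx; omega)
    simpa using this
  -- The core of the argument is a double sum of terms (cofactor of `u`) times `L(z)_{su}` times
  -- (minor without row `s`). Summing over `u` first leaves only `s = p + 1` and yields the product
  -- of determinants. Summing over `s` first leaves only `u = p + 1` and `u = p + 2` and yields the
  -- other side.
  have hsum : ∑ u ∈ Finset.Icc 1 (p + 2), (-q) ^ above (Finset.Icc 1 (p + 2)) u •
      (cof u * qminor q (fused q e f k k' (p + 1) z) (Finset.Icc 1 (p + 1))
      (u :: List.range' 1 p)) = (-q) ^ (p + 1) •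
        (qdet q e f k k' (p + 2) z * qdet q e f k k' p (z * q⁻¹)) := by
    simp only [hlapl, Finset.mul_sum, Finset.smul_sum]
    rw [Finset.sum_comm]
    have h1 : ∀ s ∈ Finset.Icc 1 (p + 1), ∑ u ∈ Finset.Icc 1 (p + 2),
        (-q) ^ above (Finset.Icc 1 (p + 2)) u • (cof u *
          (-q) ^ below (Finset.Icc 1 (p + 1)) s • (Lz q e f k k' z s u *
          qminor q (fused q e f k k' p (z * q⁻¹)) ((Finset.Icc 1 (p + 1)).erase s)
            (List.range' 1 p))) = (-q) ^ below (Finset.Icc 1 (p + 1)) s •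
        ((∑ u ∈ Finset.Icc 1 (p + 2), (-q) ^ above (Finset.Icc 1 (p + 2)) u •
          (cof u * Lz q e f k k' z s u)) * qminor q (fused q e f k k' p (z * q⁻¹))
            ((Finset.Icc 1 (p + 1)).erase s) (List.range' 1 p)) := by
      intro s _
      rw [Finset.sum_mul, Finset.smul_sum]
      refine Finset.sum_congr rfl fun u _ => ?_
      simp only [mul_smul_comm, smul_mul_assoc, smul_smul, mul_assoc]
      rw [mul_comm]
    rw [Finset.sum_congr rfl h1, Finset.sum_eq_single_of_mem (p + 1) (by simp)]
    · have h2 : (Finset.Icc 1 (p + 1)).erase (p + 1) = Finset.Icc 1 p := by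
        ext x; simp
      have h3 : below (Finset.Icc 1 (p + 1)) (p + 1) = p := by
        have : (Finset.Icc 1 (p + 1)).filter (· < p + 1) = Finset.Icc 1 p := by
          ext x; simp; omega
        rw [below, this]; simp
      rw [hrow1, h2, h3, smul_mul_assoc, smul_smul, ← pow_succ]
      rfl
    · intro s hs hne
      rw [hrow0 s (by simp at hs ⊢; omega), zero_mul, smul_zero]
  -- The cofactors were formed with transposed matrices; here they become ordinary minors with rows
  -- `Q`.
  have hcofT : ∀ u l, u ∈ Finset.Icc 1 (p + 2) → l.Pairwise (· < ·) → l.length = p + 1 →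
      l.toFinset = (Finset.Icc 1 (p + 2)).erase u →
      cof u = qminor q (fused q e f k k' (p + 1) (z * q⁻¹)) Q l := by
    intro u l hu hl hlen hlf
    rw [hcof]
    simp only
    rw [← hlf, ← hQ, H.qminor_transpose (hfac _) hz' sQ hl bQ _ (by simp) hlen]
    intro x hx
    have hx : x ∈ l.toFinset := List.mem_toFinset.2 hx
    rw [hlf] at hx
    simp at hx
    omega
  have hab1 : above (Finset.Icc 1 (p + 2)) (p + 1) = 1 := by
    have : (Finset.Icc 1 (p + 2)).filter (p + 1 < ·) = {p + 2} := by
      ext x; simp; omega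
    rw [above, this]; simp
  have hab2 : above (Finset.Icc 1 (p + 2)) (p + 2) = 0 := by
    have : (Finset.Icc 1 (p + 2)).filter (p + 2 < ·) = ∅ := by
      ext x; simp
    rw [above, this]; simp
  rw [Finset.sum_eq_add_of_mem (p + 1) (p + 2) (by simp) (by simp) (by omega), hab1, hab2,
    hmv _ (by omega) (by omega), hmv _ (by omega) (by omega),
    hcofT (p + 1) (List.range' 1 p ++ [p + 2]) (by simp) sQ (by simp) (by
      rw [hQ]; ext x; simp [hQdef]; omega),
    hcofT (p + 2) (List.range' 1 (p + 1)) (by simp) List.pairwise_lt_range' (by simp) (by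
      rw [toFinset_range']; ext x; simp; omega), ← hP] at hsum
  · have hne : (-q) ^ (p + 1) ≠ 0 := pow_ne_zero _ (neg_ne_zero.2 hq)
    apply smul_right_injective A hne
    simp only
    rw [← hsum, qdet]
    simp only [mul_smul_comm, smul_sub, smul_smul, pow_succ, pow_zero]
    match_scalars <;> field_simp
  · intro u hu hne
    rw [hzero u (by simp at hu ⊢; omega), mul_zero, smul_zero]

/-- The recursion for the quantum determinants. -/
theorem QGens.qdet_rec (H : QGens n q e f k k') (hfac : ∀ r, qfac q r ≠ 0) {p : ℕ}
    (hp : p + 2 ≤ n) {z : ℂ} (hz : z ≠ 0) {a a' c : A} (ha : a = qdet q e f k k' (p + 1) z)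
    (ha' : a' = qdet q e f k k' (p + 1) (z * q⁻¹))
    (hc : c = q⁻¹ • (f (p + 1) * a') - a' * f (p + 1)) :
    qdet q e f k k' (p + 2) z * qdet q e f k k' p (z * q⁻¹) =
      (q + q⁻¹) • (c * (e (p + 1) * a)) - e (p + 1) * (c * a) - c * (a * e (p + 1))
        + k' (p + 1) * k (p + 2) * (a' * a) := by
  have hq := H.q_ne
  have hz' : z * q⁻¹ ≠ 0 := mul_ne_zero hz (inv_ne_zero hq)
  have hP : List.range' 1 (p + 1) = List.range' 1 p ++ [p + 1] := by
    rw [List.range'_1_concat, add_comm]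
  have hw : ((List.range' 1 (p + 1)).map (wt q (p + 1))).prod = q := by
    rw [hP, List.map_append, List.prod_append]
    rw [List.prod_eq_one]
    · simp [wt]
    · intro x hx
      obtain ⟨y, hy, rfl⟩ := List.mem_map.1 hx
      simp [List.mem_range'_1] at hy
      rw [wt, if_neg (by omega), if_neg (by omega)]
  have hw' : ∏ s ∈ Finset.Icc 1 (p + 1), wt q (p + 1) s = q := by
    rw [← toFinset_range', List.prod_toFinset _ (List.nodup_range' ..), hw]
  have hins : insert (p + 1 + 1) ((Finset.Icc 1 (p + 1)).erase (p + 1)) =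
      insert (p + 2) (Finset.Icc 1 p) := by
    ext x; simp
  have hins' : insert (p + 1) ((insert (p + 2) (Finset.Icc 1 p)).erase (p + 1 + 1)) =
      Finset.Icc 1 (p + 1) := by
    ext x; simp; omega
  have hpre : p + 1 ∉ List.range' 1 p := by simp [List.mem_range'_1]; omega
  have hpre' : p + 1 + 1 ∉ List.range' 1 p := by simp [List.mem_range'_1]; omega
  -- `d_{PQ}`
  have h1 := H.e_qminor_col (i := p + 1) (by omega) (by omega) (H.eInt_fused (p + 1) z)
    (H.kInt_fused (p + 1) z) (Finset.Icc 1 (p + 1)) (pre := List.range' 1 p) (post := [])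
    hpre hpre' (by simp)
  rw [← hP, hw, rowE, if_neg (by simp), add_zero] at h1
  change e (p + 1) * qdet q e f k k' (p + 1) z = q • (qdet q e f k k' (p + 1) z * e (p + 1)) -
    qminor q (fused q e f k k' (p + 1) z) (Finset.Icc 1 (p + 1)) (List.range' 1 p ++ [p + 2]) at h1
  rw [← ha] at h1
  -- `d_{QP}`
  have h2 := H.qminor_f (i := p + 1) (by omega) (by omega) (H.fInt_fused (p + 1) (z * q⁻¹))
    (Finset.Icc 1 (p + 1)) (ts := List.range' 1 (p + 1)) (by simp [List.mem_range'_1]; omega)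
  rw [hw', rowF, if_pos (by simp), hins] at h2
  change qdet q e f k k' (p + 1) (z * q⁻¹) * f (p + 1) =
    q⁻¹ • (f (p + 1) * qdet q e f k k' (p + 1) (z * q⁻¹)) - _ at h2
  rw [← ha'] at h2
  -- `d_{QQ}`
  have h3 := H.e_qminor_col (i := p + 1) (by omega) (by omega) (H.eInt_fused (p + 1) (z * q⁻¹))
    (H.kInt_fused (p + 1) (z * q⁻¹)) (insert (p + 2) (Finset.Icc 1 p)) (pre := List.range' 1 p)
    (post := []) hpre hpre' (by simp)
  rw [← hP, hw, rowE, if_pos (by simp), hins'] at h3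
  change e (p + 1) * _ = q • (_ * e (p + 1)) -
    qminor q (fused q e f k k' (p + 1) (z * q⁻¹)) (insert (p + 2) (Finset.Icc 1 p))
      (List.range' 1 p ++ [p + 2]) +
    k' (p + 1) * k (p + 2) * qdet q e f k k' (p + 1) (z * q⁻¹) at h3
  rw [← ha'] at h3
  -- With `P = {1, …, p+1}` and `Q = {1, …, p, p+2}`, the mixed minors are twisted commutators of
  -- the principal minor `P` with `e_{p+1}` or `f_{p+1}`, and `d_{QQ}` is obtained from `d_{QP}` by
  -- one more commutator with `e_{p+1}`. Substituting these leaves only determinants and generators.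
  rw [H.sylvester hfac hp hz, ← ha]
  generalize qminor q (fused q e f k k' (p + 1) z) (Finset.Icc 1 (p + 1))
    (List.range' 1 p ++ [p + 2]) = dPQ at *
  generalize qminor q (fused q e f k k' (p + 1) (z * q⁻¹)) (insert (p + 2) (Finset.Icc 1 p))
    (List.range' 1 p ++ [p + 2]) = dQQ at *
  generalize qminor q (fused q e f k k' (p + 1) (z * q⁻¹)) (insert (p + 2) (Finset.Icc 1 p))
    (List.range' 1 (p + 1)) = dQP at *
  have h4 : dQP = c := by rw [hc, h2]; abel
  rw [h4] at h3 ⊢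
  have h5 : dPQ = q • (a * e (p + 1)) - e (p + 1) * a := by rw [h1]; abel
  have h6 : dQQ = q • (c * e (p + 1)) - e (p + 1) * c + k' (p + 1) * k (p + 2) * a' := by
    rw [h3]; abel
  rw [h5, h6]
  simp only [mul_sub, sub_mul, mul_add, add_mul, smul_mul_assoc, mul_smul_comm, mul_assoc, smul_sub]
  match_scalars <;> field_simp <;> ring

end Central

end QuantumGT

end

/-! ### From quantum determinants to the elements `c_{mk}`: expansion, permutation formula,
centrality. -/

noncomputable section

namespace QuantumGT

/-! ### The expansion of the quantum determinant in powers of `z` -/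

section Expansion

/-- The Gaussian binomial coefficients. -/
def qbin (p : ℂ) : ℕ → ℕ → ℂ
  | _, 0 => 1
  | 0, _ + 1 => 0
  | r + 1, c + 1 => qbin p r c + p ^ (c + 1) * qbin p r (c + 1)

theorem qbin_of_lt (p : ℂ) {r c : ℕ} (h : r < c) : qbin p r c = 0 := by
  induction r generalizing c with
  | zero => obtain ⟨c, rfl⟩ : ∃ d, c = d + 1 := ⟨c - 1, by omega⟩; rfl
  | succ r ih =>
    obtain ⟨c, rfl⟩ : ∃ d, c = d + 1 := ⟨c - 1, by omega⟩
    rw [qbin, ih (by omega), ih (by omega)]; simp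

theorem qfactorial_succ (p : ℂ) (r : ℕ) :
    qfactorial p (r + 1) = qfactorial p r * ((p ^ (r + 1) - 1) / (p - 1)) := by
  rw [qfactorial, Finset.prod_Icc_succ_top (by omega)]; rfl

theorem qbin_zero (p : ℂ) (r : ℕ) : qbin p r 0 = 1 := by cases r <;> rfl

theorem qbin_mul_qfactorial {p : ℂ} (hp : p ≠ 1) {r c : ℕ} (h : c ≤ r) :
    qbin p r c * (qfactorial p c * qfactorial p (r - c)) = qfactorial p r := by
  have hp' : p - 1 ≠ 0 := sub_ne_zero.2 hp
  induction r generalizing c with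
  | zero =>
    obtain rfl : c = 0 := by omega
    simp [qbin, qfactorial]
  | succ r ih =>
    cases c with
    | zero => simp [qbin_zero, qfactorial]
    | succ c =>
      have h1 := ih (c := c) (by omega)
      rw [Nat.add_sub_add_right, qbin, qfactorial_succ p c, qfactorial_succ p r]
      rcases Nat.lt_or_ge c r with h2 | h2
      · obtain ⟨d, rfl⟩ : ∃ d, r = c + 1 + d := ⟨r - c - 1, by omega⟩
        have h3 := ih (c := c + 1) (by omega)
        rw [show c + 1 + d - c = d + 1 by omega, qfactorial_succ p d] at h1 ⊢
        rw [show c + 1 + d - (c + 1) = d by omega, qfactorial_succ p c] at h3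
        have e1 : (p ^ (c + 1 + d + 1) - 1) / (p - 1) =
            (p ^ (c + 1) - 1) / (p - 1) + p ^ (c + 1) * ((p ^ (d + 1) - 1) / (p - 1)) := by
          field_simp
          ring
        rw [e1]
        linear_combination (p ^ (c + 1) - 1) / (p - 1) * h1 +
          p ^ (c + 1) * ((p ^ (d + 1) - 1) / (p - 1)) * h3
      · obtain rfl : c = r := by omega
        rw [qbin_of_lt p (Nat.lt_succ_self c)]
        linear_combination (p ^ (c + 1) - 1) / (p - 1) * h1

theorem qfactorial_ne_zero {p : ℂ} (hp : ∀ r : ℕ, 0 < r → p ^ r ≠ 1) (r : ℕ) :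
    qfactorial p r ≠ 0 := by
  refine Finset.prod_ne_zero_iff.2 fun i hi => div_ne_zero (sub_ne_zero.2 (hp i ?_)) ?_
  · simp at hi; omega
  · exact sub_ne_zero.2 (by simpa using hp 1 one_pos)

theorem qbin_ne_zero {p : ℂ} (hp : ∀ r : ℕ, 0 < r → p ^ r ≠ 1) {r c : ℕ} (h : c ≤ r) :
    qbin p r c ≠ 0 := by
  intro h0
  have := qbin_mul_qfactorial (by simpa using hp 1 one_pos) h
  rw [h0, zero_mul] at this
  exact qfactorial_ne_zero hp r this.symm

theorem qfac_ne_zero {q : ℂ} (hq : ∀ r : ℕ, 0 < r → q ^ r ≠ 1) (r : ℕ) : qfac q r ≠ 0 := by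
  refine Finset.prod_ne_zero_iff.2 fun i hi h => ?_
  have h1 := geom_sum_mul (q ^ 2) (i + 1)
  rw [h, zero_mul, ← pow_mul] at h1
  exact hq (2 * (i + 1)) (by omega) (sub_eq_zero.1 h1.symm)

theorem qfac_eq {q : ℂ} (hq0 : q ≠ 0) (hq : q ^ 2 ≠ 1) (r : ℕ) :
    qfac q r = q ^ (r * (r - 1)) * qfactorial (q⁻¹ ^ 2) r := by
  have h1 : q ^ 2 - 1 ≠ 0 := sub_ne_zero.2 hq
  have h2 : q⁻¹ ^ 2 - 1 ≠ 0 := by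
    rw [inv_pow, sub_ne_zero, ne_eq, inv_eq_one]; exact hq
  induction r with
  | zero => simp [qfac, qfactorial]
  | succ r ih =>
    rw [qfac, Finset.prod_range_succ, ← qfac, ih, qfactorial_succ, geom_sum_eq hq]
    have e1 : ((q ^ 2) ^ (r + 1) - 1) / (q ^ 2 - 1) =
        q ^ (2 * r) * (((q⁻¹ ^ 2) ^ (r + 1) - 1) / (q⁻¹ ^ 2 - 1)) := by
      have e3 : (q⁻¹ ^ 2) ^ (r + 1) = (q ^ (2 * r) * q ^ 2)⁻¹ := by
        rw [← pow_add, ← pow_mul, inv_pow]; ring_nf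
      have e4 : (q ^ 2) ^ (r + 1) = q ^ (2 * r) * q ^ 2 := by ring
      have e5 : q ^ (2 * r) ≠ 0 := pow_ne_zero _ hq0
      rw [mul_div_assoc', div_eq_div_iff h1 h2, e3, e4]
      generalize q ^ (2 * r) = u at *
      field_simp
      ring
    rw [e1]
    have e2 : (r + 1) * (r + 1 - 1) = r * (r - 1) + 2 * r := by
      cases r with
      | zero => rfl
      | succ r => simp; ring
    rw [e2, pow_add]
    ring

/-- The coefficients of `L⁺` and `L⁻` in `L(z), L(z / q), …`. -/
def fusedCoeffs (q : ℂ) : ℕ → ℂ → List (ℂ × ℂ)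
  | 0, _ => []
  | r + 1, z => (z, -z⁻¹) :: fusedCoeffs q r (z * q⁻¹)

theorem length_fusedCoeffs (q : ℂ) (r : ℕ) (z : ℂ) : (fusedCoeffs q r z).length = r := by
  induction r generalizing z with
  | zero => rfl
  | succ r ih => simp [fusedCoeffs, ih]

theorem map_fusedCoeffs {A : Type*} [Ring A] [Algebra ℂ A] (q : ℂ) (e f k k' : ℕ → A) (r : ℕ)
    (z : ℂ) : ((fusedCoeffs q r z).map fun p a b => p.1 • lp q e k a b + p.2 • lm q f k' a b) =
      fused q e f k k' r z := by
  induction r generalizing z with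
  | zero => rfl
  | succ r ih =>
    rw [fusedCoeffs, fused, List.map_cons, ih]
    congr 1
    ext a b
    rw [Lz, neg_smul, sub_eq_add_neg]

open Polynomial in
-- The `q`-binomial theorem for the product of the factors `z q^{-i} X - z⁻¹ q^i`, `0 ≤ i < r`,
-- proved by splitting off the first factor; the recursion of `qbin` is the one that results.
theorem coeff_fusedCoeffs {q : ℂ} (hq : q ≠ 0) (r : ℕ) {z : ℂ} (hz : z ≠ 0) (c : ℕ) :
    ((fusedCoeffs q r z).map fun p : ℂ × ℂ => C p.1 * (X : ℂ[X]) + C p.2).prod.coeff c =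
      z ^ (2 * c - r : ℤ) * ((-1) ^ (r + c) * q ^ ((r.choose 2 : ℤ) - c * (c - 1)) *
        qbin (q⁻¹ ^ 2) r c) := by
  induction r generalizing z c with
  | zero =>
    cases c with
    | zero => simp [fusedCoeffs, qbin]
    | succ c => simp [fusedCoeffs, qbin, coeff_one]
  | succ r ih =>
    have hz' : z * q⁻¹ ≠ 0 := mul_ne_zero hz (inv_ne_zero hq)
    have hch : (((r + 1).choose 2 : ℕ) : ℤ) = r.choose 2 + r := by
      rw [Nat.choose_succ_succ' r 1]; push_cast; simp; ring
    rw [fusedCoeffs, List.map_cons, List.prod_cons]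
    have hc0 : ∀ g : ℂ[X], ((C z * (X : ℂ[X]) + C (-z⁻¹)) * g).coeff 0 = -z⁻¹ * g.coeff 0 := by
      intro g; simp [add_mul, mul_assoc]
    have hc1 : ∀ (g : ℂ[X]) (c : ℕ), ((C z * (X : ℂ[X]) + C (-z⁻¹)) * g).coeff (c + 1) =
        z * g.coeff c + -z⁻¹ * g.coeff (c + 1) := by
      intro g c; simp [add_mul, mul_assoc, coeff_X_mul]
    cases c with
    | zero =>
      rw [hc0, ih hz', hch, qbin_zero, qbin_zero, mul_zpow, inv_zpow']
      push_cast
      rw [sub_zero, sub_zero, show (0 - (r + 1) : ℤ) = (0 - r) + (-1) by ring, zpow_add₀ hz,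
        zpow_neg_one, zpow_add₀ hq, show -(0 - (r : ℤ)) = r by ring]
      ring
    | succ c =>
      rw [hc1, ih hz', ih hz', hch, qbin, mul_zpow,
        mul_zpow, inv_zpow', inv_zpow']
      push_cast
      have e1 : z ^ (2 * (c + 1) - (r + 1) : ℤ) = z ^ (2 * c - r : ℤ) * z := by
        rw [← zpow_add_one₀ hz]; congr 1; ring
      have e2 : z ^ (2 * (c + 1) - r : ℤ) = z ^ (2 * c - r : ℤ) * (z * z) := by
        rw [← mul_assoc, ← zpow_add_one₀ hz, ← zpow_add_one₀ hz]
        congr 1; ring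
      have e3 : (q⁻¹ ^ 2) ^ (c + 1) = q ^ (-(2 * (c + 1)) : ℤ) := by
        rw [← pow_mul, inv_pow, ← zpow_natCast, ← zpow_neg]; push_cast; rfl
      have e4 : q ^ (-(2 * c - r) : ℤ) * q ^ ((r.choose 2 : ℤ) - c * (c - 1)) =
          q ^ ((r.choose 2 : ℤ) + r - (c + 1) * (c + 1 - 1)) := by
        rw [← zpow_add₀ hq]; congr 1; ring
      have e5 : q ^ (-(2 * (c + 1) - r) : ℤ) * q ^ ((r.choose 2 : ℤ) - (c + 1) * (c + 1 - 1)) =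
          q ^ ((r.choose 2 : ℤ) + r - (c + 1) * (c + 1 - 1)) * q ^ (-(2 * (c + 1)) : ℤ) := by
        rw [← zpow_add₀ hq, ← zpow_add₀ hq]; congr 1; ring
      rw [e1, e2, e3]
      have e6 : z⁻¹ * z = 1 := inv_mul_cancel₀ hz
      linear_combination (z * z ^ (2 * c - r : ℤ) * (-1) ^ (r + c) * qbin (q⁻¹ ^ 2) r c) * e4
        - (z⁻¹ * z * z * z ^ (2 * c - r : ℤ) * (-1) ^ (r + c + 1) * qbin (q⁻¹ ^ 2) r (c + 1)) * e5
        - (z * z ^ (2 * c - r : ℤ) * (-1) ^ (r + c + 1) * qbin (q⁻¹ ^ 2) r (c + 1)) *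
          (q ^ ((r.choose 2 : ℤ) + r - (c + 1) * (c + 1 - 1)) * q ^ (-(2 * (c + 1)) : ℤ)) * e6

/-- The coefficient of `c_{mk}` in the quantum determinant. -/
def detCoeff (q : ℂ) (m c : ℕ) : ℂ :=
  (-1) ^ (m + c) * q ^ ((m.choose 2 : ℤ) - c * (c - 1)) * qbin (q⁻¹ ^ 2) m c

theorem inv_sq_pow_ne_one {q : ℂ} (hq : ∀ r : ℕ, 0 < r → q ^ r ≠ 1) (r : ℕ) (hr : 0 < r) :
    (q⁻¹ ^ 2) ^ r ≠ 1 := by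
  rw [← pow_mul, inv_pow, ne_eq, inv_eq_one]
  exact hq _ (by omega)

theorem detCoeff_ne_zero {q : ℂ} (hq0 : q ≠ 0) (hq : ∀ r : ℕ, 0 < r → q ^ r ≠ 1) {m c : ℕ}
    (h : c ≤ m) : detCoeff q m c ≠ 0 :=
  mul_ne_zero (mul_ne_zero (pow_ne_zero _ (by norm_num)) (zpow_ne_zero _ hq0))
    (qbin_ne_zero (inv_sq_pow_ne_one hq) h)

variable {A : Type*} [Ring A] [Algebra ℂ A] {n : ℕ} {q : ℂ} {e f k k' : ℕ → A}

/-- The elements `c_{mk}`. -/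
def cmk (q : ℂ) (e f k k' : ℕ → A) (m c : ℕ) : A :=
  symMinor q (List.replicate c (lp q e k) ++ List.replicate (m - c) (lm q f k'))
    (Finset.Icc 1 m) (Finset.Icc 1 m)

/-- The determinant is, up to the factorial, a symmetrized minor of linear combinations of `L⁺` and
`L⁻`. By `symMinor_lin` these combine like commuting linear factors, so the scalars are the
coefficients computed in `coeff_fusedCoeffs`. -/
theorem QGens.qdet_expansion (H : QGens n q e f k k') {m : ℕ} (hm : m ≤ n) {z : ℂ} (hz : z ≠ 0) :
    qfac q m • qdet q e f k k' m z = ∑ c ∈ Finset.range (m + 1),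
      (z ^ (2 * c - m : ℤ) * detCoeff q m c) • cmk q e f k k' m c := by
  have hb : ∀ x ∈ List.range' 1 m, 1 ≤ x ∧ x ≤ n := by
    intro x hx; simp [List.mem_range'_1] at hx; omega
  have hb' : ∀ x ∈ Finset.Icc 1 m, 1 ≤ x ∧ x ≤ n := by
    intro x hx; simp at hx; omega
  have h1 := symMinor_eq_qminor (H.isChain_fused m hz) hb' List.pairwise_lt_range' hb
    (by rw [length_fused]; simp)
  rw [length_fused, toFinset_range'] at h1
  have h2 := symMinor_lin H.symPair_lp_lm hb' hb' (fusedCoeffs q m z) 0 0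
  rw [map_fusedCoeffs, length_fusedCoeffs] at h2
  simp only [List.replicate_zero, List.append_nil, add_zero] at h2
  rw [qdet, ← h1, h2]
  refine Finset.sum_congr rfl fun c _ => ?_
  rw [coeff_fusedCoeffs H.q_ne m hz]
  rfl

/-- The coefficients of a Laurent polynomial whose values are, up to finitely many
exceptions, in a subspace are in the subspace. -/
theorem mem_of_forall_sum_zpow_smul_mem {V : Type*} [AddCommGroup V] [Module ℂ V]
    (W : Submodule ℂ V) (m : ℕ) (v : ℕ → V) {F : Set ℂ} (hF : F.Finite)
    (h : ∀ z : ℂ, z ≠ 0 → z ∉ F → ∑ c ∈ Finset.range (m + 1), z ^ (2 * c - m : ℤ) • v c ∈ W) {c : ℕ}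
    (hc : c ≤ m) : v c ∈ W := by
  -- Passing to the quotient by `W` and applying a linear functional reduces the claim to scalar
  -- Laurent polynomials.
  rw [← Submodule.Quotient.mk_eq_zero, ← Module.forall_dual_apply_eq_zero_iff ℂ]
  intro φ
  -- The Laurent polynomial times `z ^ m`. It vanishes at all but finitely many points.
  set p : Polynomial ℂ := ∑ c ∈ Finset.range (m + 1),
    Polynomial.C (φ (Submodule.Quotient.mk (v c))) * Polynomial.X ^ (2 * c) with hp
  have hp0 : p = 0 := by
    apply Polynomial.eq_zero_of_infinite_isRoot
    have hinf : ((insert 0 F)ᶜ : Set ℂ).Infinite := (hF.insert 0).infinite_compl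
    refine hinf.mono fun z hz => ?_
    obtain ⟨hz, hzF⟩ : z ≠ 0 ∧ z ∉ F := by simpa [not_or] using hz
    have h1 := h z hz hzF
    rw [← Submodule.Quotient.mk_eq_zero] at h1
    have h2 := congrArg φ h1
    rw [← Submodule.mkQ_apply, map_sum, map_sum, map_zero] at h2
    simp only [map_smul, Submodule.mkQ_apply, smul_eq_mul] at h2
    change p.eval z = 0
    rw [hp, Polynomial.eval_finsetSum]
    have h3 : ∀ c : ℕ, z ^ (2 * c - m : ℤ) = z ^ (2 * c) * (z ^ m)⁻¹ := by
      intro c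
      rw [zpow_sub₀ hz, zpow_natCast, div_eq_mul_inv]
      norm_cast
    simp only [h3] at h2
    have h4 : (∑ c ∈ Finset.range (m + 1), z ^ (2 * c) * φ (Submodule.Quotient.mk (v c))) *
        (z ^ m)⁻¹ = 0 := by
      rw [← h2, Finset.sum_mul]
      exact Finset.sum_congr rfl fun c _ => by ring
    rcases mul_eq_zero.1 h4 with h5 | h5
    · rw [← h5]
      exact Finset.sum_congr rfl fun c _ => by
        rw [Polynomial.eval_mul, Polynomial.eval_C, Polynomial.eval_pow, Polynomial.eval_X, mul_comm]
    · exact absurd h5 (inv_ne_zero (pow_ne_zero _ hz))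
  have h6 : p.coeff (2 * c) = φ (Submodule.Quotient.mk (v c)) := by
    rw [hp, Polynomial.finsetSum_coeff, Finset.sum_eq_single_of_mem c (by simp; omega)]
    · simp
    · intro b _ hb
      rw [Polynomial.coeff_C_mul_X_pow, if_neg (by omega)]
  rw [← h6, hp0, Polynomial.coeff_zero]

end Expansion

end QuantumGT

end

noncomputable section

namespace QuantumGT

/-! ### Symmetrized minors as sums over permutations -/

section Permutations

variable {A : Type*} [Ring A] [Algebra ℂ A]

/-- The permutation with first value `p` and the other values in the order given by `τ`. -/
def permCons {r : ℕ} (x : Fin (r + 1) × Equiv.Perm (Fin r)) : Equiv.Perm (Fin (r + 1)) :=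
  ((finSuccEquiv' 0).trans (Equiv.optionCongr x.2)).trans (finSuccEquiv' x.1).symm

theorem permCons_zero {r : ℕ} (p : Fin (r + 1)) (τ : Equiv.Perm (Fin r)) :
    permCons (p, τ) 0 = p := by
  simp [permCons]

theorem permCons_succ {r : ℕ} (p : Fin (r + 1)) (τ : Equiv.Perm (Fin r)) (i : Fin r) :
    permCons (p, τ) i.succ = p.succAbove (τ i) := by
  have : (finSuccEquiv' (0 : Fin (r + 1))) i.succ = some i := by
    rw [← Fin.succAbove_zero_apply, finSuccEquiv'_succAbove]
  simp [permCons, this]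

theorem permCons_bijective (r : ℕ) : Function.Bijective (permCons (r := r)) := by
  rw [Fintype.bijective_iff_injective_and_card]
  constructor
  · rintro ⟨p, τ⟩ ⟨p', τ'⟩ h
    have h0 := congrArg (fun σ => σ 0) h
    simp only [permCons_zero] at h0
    subst h0
    congr 1
    ext i
    have h1 := congrArg (fun σ => σ i.succ) h
    simp only [permCons_succ] at h1
    rw [Fin.succAbove_right_injective h1]
  · rw [Fintype.card_prod, Fintype.card_perm, Fintype.card_perm, Fintype.card_fin, Fintype.card_fin,
      Nat.factorial_succ]

theorem sum_perm_succ {B : Type*} [AddCommMonoid B] {r : ℕ} (F : Equiv.Perm (Fin (r + 1)) → B) :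
    ∑ σ, F σ = ∑ p, ∑ τ : Equiv.Perm (Fin r), F (permCons (p, τ)) := by
  rw [← Fintype.sum_prod_type' fun p τ => F (permCons (p, τ))]
  exact (Function.Bijective.sum_comp (permCons_bijective r) F).symm

theorem invNum_eq_sum {m : ℕ} (σ : Equiv.Perm (Fin m)) :
    invNum σ = ∑ i, ∑ j, if i < j ∧ σ j < σ i then 1 else 0 := by
  rw [invNum, Finset.card_filter, Fintype.sum_prod_type]

theorem invNum_permCons {r : ℕ} (p : Fin (r + 1)) (τ : Equiv.Perm (Fin r)) :
    invNum (permCons (p, τ)) = p + invNum τ := by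
  rw [invNum_eq_sum, Fin.sum_univ_succ, invNum_eq_sum τ]
  congr 1
  · rw [Fin.sum_univ_succ]
    simp only [permCons_zero, permCons_succ, lt_irrefl, false_and, if_false, zero_add, Fin.succ_pos,
      true_and]
    rw [Equiv.sum_comp τ (fun y => if p.succAbove y < p then 1 else 0)]
    simp only [Fin.succAbove_lt_iff_castSucc_lt]
    rw [← Finset.card_filter]
    have : (Finset.univ.filter fun y : Fin r => y.castSucc < p) =
        Finset.univ.filter fun y : Fin r => y.1 < p.1 := by
      ext y; simp [Fin.lt_def]
    rw [this, Fin.card_filter_val_lt]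
    omega
  · refine Finset.sum_congr rfl fun i _ => ?_
    rw [Fin.sum_univ_succ]
    simp [permCons_succ, Fin.succAbove_lt_succAbove_iff]

theorem below_image {r : ℕ} {a : Fin r → ℕ} (ha : StrictMono a) (p : Fin r) :
    below (Finset.univ.image a) (a p) = p := by
  have : (Finset.univ.image a).filter (· < a p) = (Finset.Iio p).image a := by
    ext x
    simp only [Finset.mem_filter, Finset.mem_image, Finset.mem_univ, true_and, Finset.mem_Iio]
    constructor
    · rintro ⟨⟨i, rfl⟩, h⟩; exact ⟨i, ha.lt_iff_lt.1 h, rfl⟩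
    · rintro ⟨i, h, rfl⟩; exact ⟨⟨i, rfl⟩, ha h⟩
  rw [below, this, Finset.card_image_of_injective _ ha.injective, Fin.card_Iio]

theorem image_erase {r : ℕ} {a : Fin (r + 1) → ℕ} (ha : StrictMono a) (p : Fin (r + 1)) :
    (Finset.univ.image a).erase (a p) = Finset.univ.image (a ∘ p.succAbove) := by
  ext x
  simp only [Finset.mem_erase, Finset.mem_image, Finset.mem_univ, true_and, Function.comp]
  constructor
  · rintro ⟨h, i, rfl⟩
    obtain ⟨j, rfl⟩ := Fin.exists_succAbove_eq (show i ≠ p from fun h' => h (by rw [h']))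
    exact ⟨j, rfl⟩
  · rintro ⟨j, rfl⟩
    exact ⟨fun h => Fin.succAbove_ne p j (ha.injective h), _, rfl⟩

/-- Choosing the first row and column is choosing the first values of `σ` and `σ'`; the number of
smaller elements still available counts the inversions of that first value. -/
theorem symMinor_eq_sum_perm (q : ℂ) {r : ℕ} (Lf : Fin r → ℕ → ℕ → A) {a b : Fin r → ℕ}
    (ha : StrictMono a) (hb : StrictMono b) :
    symMinor q (List.ofFn Lf) (Finset.univ.image a) (Finset.univ.image b) =
      ∑ σ : Equiv.Perm (Fin r), ∑ σ' : Equiv.Perm (Fin r), (-q) ^ (invNum σ + invNum σ') •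
        (List.ofFn fun i => Lf i (a (σ i)) (b (σ' i))).prod := by
  induction r with
  | zero => simp [symMinor, invNum]
  | succ r ih =>
    rw [List.ofFn_succ, symMinor, Finset.sum_image hb.injective.injOn, sum_perm_succ, Finset.sum_comm]
    rw [Finset.sum_image ha.injective.injOn]
    refine Finset.sum_congr rfl fun p _ => ?_
    simp only [sum_perm_succ]
    rw [Finset.sum_comm]
    refine Finset.sum_congr rfl fun p' _ => ?_
    rw [image_erase ha, image_erase hb, ih (fun i => Lf i.succ)
      (ha.comp (Fin.strictMono_succAbove p)) (hb.comp (Fin.strictMono_succAbove p')),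
      below_image ha, below_image hb]
    simp only [Finset.mul_sum, Finset.smul_sum]
    refine Finset.sum_congr rfl fun τ _ => Finset.sum_congr rfl fun τ' _ => ?_
    rw [List.ofFn_succ, List.prod_cons, permCons_zero, permCons_zero, invNum_permCons,
      invNum_permCons, mul_smul_comm, smul_smul, ← pow_add]
    simp only [permCons_succ, Function.comp]
    congr 2
    ring

end Permutations

/-! ### The generators of `U_q` -/

section UqGens

variable {n : ℕ} {q : ℂ}

theorem qU_zero (n : ℕ) (q : ℂ) : qU n q 0 = 1 := by
  have := RingQuot.mkAlgHom_rel ℂ (UqRel.qh_zero (n := n) (q := q))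
  rwa [map_one] at this

theorem qU_add (h h' : Lattice n) : qU n q h * qU n q h' = qU n q (h + h') := by
  have := RingQuot.mkAlgHom_rel ℂ (UqRel.qh_add (q := q) h h')
  rwa [map_mul] at this

theorem qU_neg_mul (h : Lattice n) : qU n q (-h) * qU n q h = 1 := by
  rw [qU_add, neg_add_cancel, qU_zero]

theorem qU_gen_e (h : Lattice n) (i : SimpleIdx n) :
    qU n q h * gen n q (Gen.e i) = q ^ pairing h i • (gen n q (Gen.e i) * qU n q h) := by
  have := RingQuot.mkAlgHom_rel ℂ (UqRel.qh_e (q := q) h i)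
  rw [map_mul, map_mul, map_smul] at this
  have := congrArg (· * qU n q h) this
  simp only [smul_mul_assoc] at this
  change qU n q h * gen n q (Gen.e i) * qU n q (-h) * qU n q h = _ at this
  rw [mul_assoc, qU_neg_mul, mul_one] at this
  exact this

theorem qU_gen_f (h : Lattice n) (i : SimpleIdx n) :
    qU n q h * gen n q (Gen.f i) = q ^ (-pairing h i) • (gen n q (Gen.f i) * qU n q h) := by
  have := RingQuot.mkAlgHom_rel ℂ (UqRel.qh_f (q := q) h i)
  rw [map_mul, map_mul, map_smul] at this
  have := congrArg (· * qU n q h) this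
  simp only [smul_mul_assoc] at this
  change qU n q h * gen n q (Gen.f i) * qU n q (-h) * qU n q h = _ at this
  rw [mul_assoc, qU_neg_mul, mul_one] at this
  exact this

theorem eU_of (i : SimpleIdx n) : eU n q i.1 = gen n q (Gen.e i) := dif_pos i.2

theorem fU_of (i : SimpleIdx n) : fU n q i.1 = gen n q (Gen.f i) := dif_pos i.2

theorem eU_of_not {i : ℕ} (h : ¬ (1 ≤ i ∧ i < n)) : eU n q i = 0 := dif_neg h

theorem fU_of_not {i : ℕ} (h : ¬ (1 ≤ i ∧ i < n)) : fU n q i = 0 := dif_neg h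

theorem zpow_pairing_eps (hq : q ≠ 0) (c : ℕ) (i : SimpleIdx n) :
    q ^ pairing (eps n c) i = wt q i.1 c := by
  unfold pairing eps wt
  simp only
  by_cases h1 : c = i.1
  · simp [h1]
  · by_cases h2 : c = i.1 + 1
    · simp [h2]
    · simp [h1, h2, Ne.symm h1, Ne.symm h2]

theorem uq_gens (hq0 : q ≠ 0) (hq : ∀ r : ℕ, 0 < r → q ^ r ≠ 1) :
    QGens n q (eU n q) (fU n q) (fun c => qU n q (eps n c)) (fun c => qU n q (-eps n c)) where
  q_ne := hq0
  q_sq := hq 2 (by omega)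
  q_sq' h := hq 4 (by omega) (by rw [show q ^ 4 = (q ^ 2) ^ 2 by ring, h]; norm_num)
  k_inv i := by rw [qU_add, add_neg_cancel, qU_zero]
  inv_k i := by rw [qU_add, neg_add_cancel, qU_zero]
  k_comm i j := by rw [qU_add, qU_add, add_comm]
  k_e a i := by
    by_cases h : 1 ≤ i ∧ i < n
    · rw [eU_of ⟨i, h⟩, qU_gen_e, zpow_pairing_eps hq0]
    · simp [eU_of_not h]
  k_f a i := by
    by_cases h : 1 ≤ i ∧ i < n
    · rw [fU_of ⟨i, h⟩, qU_gen_f, zpow_neg, zpow_pairing_eps hq0, smul_smul,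
        mul_inv_cancel₀ (wt_ne_zero hq0 _ _), one_smul]
    · simp [fU_of_not h]
  e_f i h1 h2 := by
    have := RingQuot.mkAlgHom_rel ℂ (UqRel.e_f (q := q) (⟨i, h1, h2⟩ : SimpleIdx n))
    rw [map_sub, map_mul, map_mul, map_smul, map_sub] at this
    rw [qU_add, qU_add, eU_of ⟨i, h1, h2⟩, fU_of ⟨i, h1, h2⟩, ← sub_eq_add_neg, neg_add_eq_sub,
      ← neg_sub (eps n i)]
    exact this
  e_f_ne i j hij := by
    by_cases h : 1 ≤ i ∧ i < n
    · by_cases h' : 1 ≤ j ∧ j < n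
      · have := RingQuot.mkAlgHom_rel ℂ (UqRel.e_f_ne (q := q) (⟨i, h⟩ : SimpleIdx n) ⟨j, h'⟩
          (by simpa [Subtype.ext_iff] using hij))
        rw [map_sub, map_mul, map_mul, map_zero] at this
        rw [eU_of ⟨i, h⟩, fU_of ⟨j, h'⟩]
        exact sub_eq_zero.1 this
      · simp [fU_of_not h']
    · simp [eU_of_not h]
  serre_e i j hij := by
    by_cases h : 1 ≤ i ∧ i < n
    · by_cases h' : 1 ≤ j ∧ j < n
      · have := RingQuot.mkAlgHom_rel ℂ (UqRel.serre_e (q := q) (⟨i, h⟩ : SimpleIdx n) ⟨j, h'⟩ hij)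
        simp only [map_sub, map_add, map_smul, map_mul, map_zero, pow_two, mul_assoc] at this
        rw [eU_of ⟨i, h⟩, eU_of ⟨j, h'⟩]
        exact this
      · simp [eU_of_not h']
    · simp [eU_of_not h]
  serre_f i j hij := by
    by_cases h : 1 ≤ i ∧ i < n
    · by_cases h' : 1 ≤ j ∧ j < n
      · have := RingQuot.mkAlgHom_rel ℂ (UqRel.serre_f (q := q) (⟨i, h⟩ : SimpleIdx n) ⟨j, h'⟩ hij)
        simp only [map_sub, map_add, map_smul, map_mul, map_zero, pow_two, mul_assoc] at this
        rw [fU_of ⟨i, h⟩, fU_of ⟨j, h'⟩]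
        exact this
      · simp [fU_of_not h']
    · simp [fU_of_not h]
  e_comm i j hij := by
    by_cases h : 1 ≤ i ∧ i < n
    · by_cases h' : 1 ≤ j ∧ j < n
      · have := RingQuot.mkAlgHom_rel ℂ (UqRel.comm_e (q := q) (⟨i, h⟩ : SimpleIdx n) ⟨j, h'⟩ hij)
        rw [map_mul, map_mul] at this
        rw [eU_of ⟨i, h⟩, eU_of ⟨j, h'⟩]
        exact this
      · simp [eU_of_not h']
    · simp [eU_of_not h]
  f_comm i j hij := by
    by_cases h : 1 ≤ i ∧ i < n
    · by_cases h' : 1 ≤ j ∧ j < n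
      · have := RingQuot.mkAlgHom_rel ℂ (UqRel.comm_f (q := q) (⟨i, h⟩ : SimpleIdx n) ⟨j, h'⟩ hij)
        rw [map_mul, map_mul] at this
        rw [fU_of ⟨i, h⟩, fU_of ⟨j, h'⟩]
        exact this
      · simp [fU_of_not h']
    · simp [fU_of_not h]

theorem rootE_eq (n : ℕ) (q : ℂ) (i d : ℕ) : rootE n q i d = rE q (eU n q) i d := by
  induction d with
  | zero => rfl
  | succ d ih => rw [rootE, rE, ih]

theorem rootF_eq (n : ℕ) (q : ℂ) (i d : ℕ) : rootF n q i d = rF q (fU n q) i d := by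
  induction d with
  | zero => rfl
  | succ d ih => rw [rootF, rF, ih]

theorem lplus_eq (n : ℕ) (q : ℂ) : lplus n q = lp q (eU n q) (fun c => qU n q (eps n c)) := by
  ext a b
  rw [lplus, lp, rootE_eq]

theorem lminus_eq (n : ℕ) (q : ℂ) : lminus n q = lm q (fU n q) (fun c => qU n q (-eps n c)) := by
  ext a b
  rw [lminus, lm, rootF_eq]

/-- The quantum determinant in `U_q`. -/
abbrev detU (n : ℕ) (q : ℂ) (m : ℕ) (z : ℂ) : Uq n q :=
  qdet q (eU n q) (fU n q) (fun c => qU n q (eps n c)) (fun c => qU n q (-eps n c)) m z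

theorem cgen_eq (n : ℕ) (q : ℂ) {m c : ℕ} (hc : c ≤ m) :
    cgen n q m c = cmk q (eU n q) (fU n q) (fun c => qU n q (eps n c))
      (fun c => qU n q (-eps n c)) m c := by
  have ha : StrictMono (fun i : Fin m => i.1 + 1) := fun i j h => by simpa using h
  have h := symMinor_eq_sum_perm q (fun i : Fin m => if i.1 < c then lplus n q else lminus n q) ha ha
  have himg : Finset.univ.image (fun i : Fin m => i.1 + 1) = Finset.Icc 1 m := by
    ext x
    simp only [Finset.mem_image, Finset.mem_univ, true_and, Finset.mem_Icc]
    constructor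
    · rintro ⟨i, rfl⟩; omega
    · rintro ⟨h1, h2⟩; exact ⟨⟨x - 1, by omega⟩, by simp; omega⟩
  have hlist : (List.ofFn fun i : Fin m => if i.1 < c then lplus n q else lminus n q) =
      List.replicate c (lplus n q) ++ List.replicate (m - c) (lminus n q) := by
    apply List.ext_getElem
    · simp; omega
    · intro i h1 h2
      simp only [List.getElem_ofFn, List.getElem_append, List.getElem_replicate,
        List.length_replicate]
      split_ifs <;> rfl
  rw [himg, hlist] at h
  rw [cmk, ← lplus_eq, ← lminus_eq, h, cgen]
  refine Finset.sum_congr rfl fun σ _ => Finset.sum_congr rfl fun σ' _ => ?_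
  congr 3
  ext i
  split_ifs <;> rfl

end UqGens

end QuantumGT

end

noncomputable section

namespace QuantumGT

/-! ### The elements `c_{mk}` are central in `U_q(gl_m)` -/

section Centers

variable {n : ℕ} {q : ℂ}

/-- Every `q^h` is a product of the elements `q^{±ε_c}`, so conditions on a subalgebra need to be
tested on these only. -/
theorem qU_mem {W : Subalgebra ℂ (Uq n q)}
    (hW : ∀ c, qU n q (eps n c) ∈ W ∧ qU n q (-eps n c) ∈ W) (h : Lattice n) : qU n q h ∈ W := by
  have h1 : ∀ (c : {i : ℕ // 1 ≤ i ∧ i ≤ n}) (z : ℤ), qU n q (Pi.single c z) ∈ W := by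
    intro c z
    have hs : ∀ w : ℤ, (Pi.single c w : Lattice n) = w • eps n c.1 := by
      intro w
      ext i
      rw [Pi.single_apply]
      simp only [eps, Pi.smul_apply, smul_eq_mul, Subtype.ext_iff]
      split_ifs <;> simp
    rw [hs]
    induction z using Int.induction_on with
    | zero => rw [zero_smul, qU_zero]; exact W.one_mem
    | succ i ih => rw [add_smul, one_smul, ← qU_add]; exact W.mul_mem ih (hW _).1
    | pred i ih =>
      rw [sub_smul, one_smul, sub_eq_add_neg, ← qU_add]; exact W.mul_mem ih (hW _).2
  have h2 : ∀ s : Finset {i : ℕ // 1 ≤ i ∧ i ≤ n},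
      qU n q (∑ i ∈ s, Pi.single i (h i)) ∈ W := by
    intro s
    induction s using Finset.induction_on with
    | empty => rw [Finset.sum_empty, qU_zero]; exact W.one_mem
    | insert a s ha ih => rw [Finset.sum_insert ha, ← qU_add]; exact W.mul_mem (h1 _ _) ih
  let _ : Fintype {i : ℕ // 1 ≤ i ∧ i ≤ n} := Fintype.subtype (Finset.Icc 1 n) (by simp)
  have := h2 Finset.univ
  rwa [Finset.univ_sum_single] at this

theorem eU_mem_subU {i m : ℕ} (h1 : 1 ≤ i) (h2 : i < m) : eU n q i ∈ subU n q m :=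
  Algebra.subset_adjoin (Or.inl ⟨i, h1, h2, Or.inl rfl⟩)

theorem fU_mem_subU {i m : ℕ} (h1 : 1 ≤ i) (h2 : i < m) : fU n q i ∈ subU n q m :=
  Algebra.subset_adjoin (Or.inl ⟨i, h1, h2, Or.inr rfl⟩)

theorem qU_eps_mem_subU {c m : ℕ} (h : c ≤ m) :
    qU n q (eps n c) ∈ subU n q m ∧ qU n q (-eps n c) ∈ subU n q m := by
  have h1 : ∀ i : {i : ℕ // 1 ≤ i ∧ i ≤ n}, m < i.1 → eps n c i = 0 := by
    intro i hi
    rw [eps, if_neg (by omega)]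
  exact ⟨Algebra.subset_adjoin (Or.inr ⟨_, h1, rfl⟩),
    Algebra.subset_adjoin (Or.inr ⟨_, fun i hi => by rw [Pi.neg_apply, h1 i hi, neg_zero], rfl⟩)⟩

theorem rootE_mem_subU {a d m : ℕ} (ha : 1 ≤ a) (h : a + d < m) : rootE n q a d ∈ subU n q m := by
  induction d with
  | zero => exact eU_mem_subU ha h
  | succ d ih =>
    have h1 := ih (by omega)
    have h2 : eU n q (a + d + 1) ∈ subU n q m := eU_mem_subU (by omega) (by omega)
    exact Subalgebra.sub_mem _ (Subalgebra.smul_mem _ (Subalgebra.mul_mem _ h1 h2) _)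
      (Subalgebra.mul_mem _ h2 h1)

theorem rootF_mem_subU {a d m : ℕ} (ha : 1 ≤ a) (h : a + d < m) : rootF n q a d ∈ subU n q m := by
  induction d with
  | zero => exact fU_mem_subU ha h
  | succ d ih =>
    have h1 := ih (by omega)
    have h2 : fU n q (a + d + 1) ∈ subU n q m := fU_mem_subU (by omega) (by omega)
    exact Subalgebra.sub_mem _ (Subalgebra.smul_mem _ (Subalgebra.mul_mem _ h2 h1) _)
      (Subalgebra.mul_mem _ h1 h2)

theorem lplus_mem_subU {a b m : ℕ} (ha : 1 ≤ a) (hb : 1 ≤ b) (ham : a ≤ m) (hbm : b ≤ m) :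
    lplus n q a b ∈ subU n q m := by
  rw [lplus]
  split_ifs with h1 h2
  · exact (qU_eps_mem_subU ham).1
  · exact Subalgebra.smul_mem _ (Subalgebra.mul_mem _ (qU_eps_mem_subU ham).1
      (rootE_mem_subU ha (by omega))) _
  · exact Subalgebra.zero_mem _

theorem lminus_mem_subU {a b m : ℕ} (ha : 1 ≤ a) (hb : 1 ≤ b) (ham : a ≤ m) (hbm : b ≤ m) :
    lminus n q a b ∈ subU n q m := by
  rw [lminus]
  split_ifs with h1 h2
  · exact (qU_eps_mem_subU hbm).2
  · exact Subalgebra.neg_mem _ (Subalgebra.smul_mem _ (Subalgebra.mul_mem _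
      (rootF_mem_subU hb (by omega)) (qU_eps_mem_subU hbm).2) _)
  · exact Subalgebra.zero_mem _

theorem cgen_mem_subU (n : ℕ) (q : ℂ) (m c : ℕ) : cgen n q m c ∈ subU n q m := by
  refine Subalgebra.sum_mem _ fun σ _ => Subalgebra.sum_mem _ fun σ' _ =>
    Subalgebra.smul_mem _ (Subalgebra.list_prod_mem _ ?_) _
  intro x hx
  rw [List.mem_ofFn] at hx
  obtain ⟨a, rfl⟩ := hx
  split_ifs
  · exact lplus_mem_subU (by omega) (by omega) (by omega) (by omega)
  · exact lminus_mem_subU (by omega) (by omega) (by omega) (by omega)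

/-- What commutes with the quantum determinants commutes with `c_{mk}`. -/
theorem cgen_mem_of_detU_mem (hq0 : q ≠ 0) (hq : ∀ r : ℕ, 0 < r → q ^ r ≠ 1) {m c : ℕ} (hm : m ≤ n)
    (hc : c ≤ m) {W : Submodule ℂ (Uq n q)} (h : ∀ z : ℂ, z ≠ 0 → detU n q m z ∈ W) :
    cgen n q m c ∈ W := by
  have H := uq_gens (n := n) hq0 hq
  have h1 := mem_of_forall_sum_zpow_smul_mem W m (fun c => detCoeff q m c •
    cmk q (eU n q) (fU n q) (fun c => qU n q (eps n c)) (fun c => qU n q (-eps n c)) m c)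
    Set.finite_empty (by
      intro z hz _
      have h2 := H.qdet_expansion hm hz
      simp only [mul_smul] at h2
      rw [← h2]
      exact W.smul_mem _ (h z hz)) hc
  rw [cgen_eq n q hc]
  exact (Submodule.smul_mem_iff _ (detCoeff_ne_zero hq0 hq hc)).1 h1

/-- The centralizer of an element is a linear subspace. If it contains the determinants for all `z`,
it contains their Laurent coefficients, which are nonzero multiples of the `c_{mk}`. The
determinants commute with all `q^h` and with the `e_i`, `f_i` for `i < m`. -/
theorem cgen_mem_Zc (hq0 : q ≠ 0) (hq : ∀ r : ℕ, 0 < r → q ^ r ≠ 1) {m c : ℕ} (hm : m ≤ n)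
    (hc : c ≤ m) : cgen n q m c ∈ Zc n q m := by
  have H := uq_gens (n := n) hq0 hq
  have hcomm : ∀ g : Uq n q, (∀ z : ℂ, z ≠ 0 → g * detU n q m z = detU n q m z * g) →
      g ∈ Subalgebra.centralizer ℂ {cgen n q m c} := by
    intro g hg
    have := cgen_mem_of_detU_mem hq0 hq hm hc
      (W := Subalgebra.toSubmodule (Subalgebra.centralizer ℂ {g})) (fun z hz => by
        rw [Subalgebra.mem_toSubmodule, Subalgebra.mem_centralizer_iff]
        rintro x rfl
        exact hg z hz)
    rw [Subalgebra.mem_toSubmodule, Subalgebra.mem_centralizer_iff] at this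
    rw [Subalgebra.mem_centralizer_iff]
    rintro x rfl
    exact (this g rfl).symm
  refine ⟨cgen_mem_subU n q m c, ?_⟩
  have hle : subU n q m ≤ Subalgebra.centralizer ℂ {cgen n q m c} := by
    apply Algebra.adjoin_le
    rintro x (⟨i, h1, h2, rfl | rfl⟩ | ⟨h, -, rfl⟩)
    · exact hcomm _ fun z hz => H.e_qdet h1 h2 hm hz
    · exact hcomm _ fun z hz => H.qdet_f h1 h2 hm hz
    · refine qU_mem (fun c => ⟨hcomm _ fun z hz => H.k_qdet c m z, hcomm _ fun z hz => ?_⟩) h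
      have h1 := H.k_qdet c m z
      have h2 := congrArg (fun x => qU n q (-eps n c) * x * qU n q (-eps n c)) h1
      simp only [mul_assoc] at h2
      rw [qU_add (eps n c), add_neg_cancel, qU_zero, mul_one, ← mul_assoc (qU n q (-eps n c)),
        qU_neg_mul, one_mul] at h2
      exact h2.symm
  rw [SetLike.mem_coe, Subalgebra.mem_centralizer_iff]
  intro g hg
  have := hle hg
  rw [Subalgebra.mem_centralizer_iff] at this
  exact (this _ rfl).symm

theorem cgen_mem_Gam (hq0 : q ≠ 0) (hq : ∀ r : ℕ, 0 < r → q ^ r ≠ 1) {m c : ℕ} (h1 : 1 ≤ m)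
    (hm : m ≤ n) (hc : c ≤ m) : cgen n q m c ∈ Gam n q :=
  Algebra.subset_adjoin ⟨m, h1, hm, cgen_mem_Zc hq0 hq hm hc⟩

theorem detU_mem_Gam (hq0 : q ≠ 0) (hq : ∀ r : ℕ, 0 < r → q ^ r ≠ 1) {m : ℕ} (h1 : 1 ≤ m)
    (hm : m ≤ n) {z : ℂ} (hz : z ≠ 0) : detU n q m z ∈ Gam n q := by
  have H := uq_gens (n := n) hq0 hq
  have h2 := H.qdet_expansion hm hz
  have h3 : qfac q m • detU n q m z ∈ Subalgebra.toSubmodule (Gam n q) := by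
    rw [h2]
    refine Submodule.sum_mem _ fun c hc => Submodule.smul_mem _ _ ?_
    have hc : c ≤ m := by simpa [Nat.lt_succ_iff] using hc
    rw [← cgen_eq n q hc]
    exact cgen_mem_Gam hq0 hq h1 hm hc
  exact (Submodule.smul_mem_iff _ (qfac_ne_zero hq m)).1 h3

end Centers

end QuantumGT

end

/-! ### The module structure on the span of the realizations. -/

noncomputable section

namespace QuantumGT

/-! ### Powers of `q` and integral differences -/

section Powers

variable {q η : ℂ}

theorem qpow_add (η x y : ℂ) : qpow η (x + y) = qpow η x * qpow η y := by
  rw [qpow, mul_add, Complex.exp_add]; rfl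

theorem qpow_zero (η : ℂ) : qpow η 0 = 1 := by simp [qpow]

theorem qpow_ne_zero (η x : ℂ) : qpow η x ≠ 0 := Complex.exp_ne_zero _

theorem qpow_neg (η x : ℂ) : qpow η (-x) = (qpow η x)⁻¹ := by
  rw [qpow, mul_neg, Complex.exp_neg]; rfl

theorem qpow_sub (η x y : ℂ) : qpow η (x - y) = qpow η x / qpow η y := by
  rw [sub_eq_add_neg, qpow_add, qpow_neg, div_eq_mul_inv]

theorem qpow_one (hη : Complex.exp η = q) : qpow η 1 = q := by rw [qpow, mul_one, hη]

theorem qpow_int (hη : Complex.exp η = q) (m : ℤ) : qpow η m = q ^ m := by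
  rw [qpow, mul_comm, Complex.exp_int_mul, hη]

theorem qpow_two_mul (η x : ℂ) : qpow η (2 * x) = qpow η x ^ 2 := by
  rw [two_mul, qpow_add, sq]

theorem qpow_sum {ι : Type*} (η : ℂ) (s : Finset ι) (f : ι → ℂ) :
    qpow η (∑ i ∈ s, f i) = ∏ i ∈ s, qpow η (f i) := by
  rw [qpow, Finset.mul_sum, Complex.exp_sum]; rfl

/-- `x` is in `m + 1(q)/2`. -/
def Dif (η x : ℂ) (m : ℤ) : Prop := ∃ u ∈ oneq η, x = m + u / 2

theorem dif_iff {η x : ℂ} {m : ℤ} : Dif η x m ↔ qpow η (2 * (x - m)) = 1 := by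
  constructor
  · rintro ⟨u, hu, rfl⟩
    rw [show 2 * ((m : ℂ) + u / 2 - m) = u by ring]; exact hu
  · intro h
    exact ⟨2 * (x - m), h, by ring⟩

theorem Dif.add {x y : ℂ} {m m' : ℤ} (h : Dif η x m) (h' : Dif η y m') :
    Dif η (x + y) (m + m') := by
  rw [dif_iff] at *
  push_cast
  rw [show 2 * (x + y - (m + m')) = 2 * (x - m) + 2 * (y - m') by ring, qpow_add, h, h', one_mul]

theorem Dif.neg {x : ℂ} {m : ℤ} (h : Dif η x m) : Dif η (-x) (-m) := by
  rw [dif_iff] at *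
  push_cast
  rw [show 2 * (-x - -m) = -(2 * (x - m)) by ring, qpow_neg, h, inv_one]

theorem Dif.sub {x y : ℂ} {m m' : ℤ} (h : Dif η x m) (h' : Dif η y m') :
    Dif η (x - y) (m - m') := by
  rw [sub_eq_add_neg, sub_eq_add_neg]; exact h.add h'.neg

theorem dif_int (η : ℂ) (m : ℤ) : Dif η m m := by rw [dif_iff]; simp [qpow_zero]

theorem Dif.add_int {x : ℂ} {m : ℤ} (h : Dif η x m) (d : ℤ) : Dif η (x + d) (m + d) :=
  h.add (dif_int η d)

theorem zpow_eq_one_iff (hq0 : q ≠ 0) (hq : ∀ r : ℕ, 0 < r → q ^ r ≠ 1) {m : ℤ} :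
    q ^ m = 1 ↔ m = 0 := by
  constructor
  · intro h
    by_contra hm
    rcases lt_or_gt_of_ne hm with h1 | h1
    · refine hq (-m).toNat (by omega) ?_
      rw [← zpow_natCast, Int.toNat_of_nonneg (by omega), zpow_neg, h, inv_one]
    · refine hq m.toNat (by omega) ?_
      rw [← zpow_natCast, Int.toNat_of_nonneg (by omega), h]
  · rintro rfl; simp

/-- Two values `m`, `m'` for the same `x` give `q^{2(m - m')} = 1`, which forces `m = m'` because
`q` is not a root of unity. Comparisons of entries therefore behave as comparisons of integers. -/
theorem Dif.unique (hη : Complex.exp η = q) (hq : ∀ r : ℕ, 0 < r → q ^ r ≠ 1) {x : ℂ} {m m' : ℤ}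
    (h : Dif η x m) (h' : Dif η x m') : m = m' := by
  have hq0 : q ≠ 0 := by rw [← hη]; exact Complex.exp_ne_zero _
  have h1 := h.sub h'
  rw [sub_self, dif_iff, show (2 * (0 - ((m - m' : ℤ) : ℂ))) = ((2 * (m' - m) : ℤ) : ℂ) by
    push_cast; ring, qpow_int hη, zpow_eq_one_iff hq0 hq] at h1
  omega

theorem sub_inv_ne_zero (hη : Complex.exp η = q) (hq : ∀ r : ℕ, 0 < r → q ^ r ≠ 1) :
    q - q⁻¹ ≠ 0 := by
  have hq0 : q ≠ 0 := by rw [← hη]; exact Complex.exp_ne_zero _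
  intro h
  apply hq 2 (by omega)
  field_simp at h
  linear_combination h

theorem qbracket_eq_zero_iff (hη : Complex.exp η = q) (hq : ∀ r : ℕ, 0 < r → q ^ r ≠ 1) {x : ℂ} :
    qbracket q η x = 0 ↔ Dif η x 0 := by
  have h1 := sub_inv_ne_zero hη hq
  have h2 := qpow_ne_zero η x
  rw [qbracket, div_eq_zero_iff, or_iff_left h1, dif_iff, qpow_neg, Int.cast_zero, sub_zero,
    qpow_two_mul, sub_eq_zero]
  constructor
  · intro h; rw [sq]; nth_rewrite 2 [h]; exact mul_inv_cancel₀ h2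
  · intro h; rw [sq] at h; exact eq_inv_of_mul_eq_one_left h

theorem qbracket_neg (q η x : ℂ) : qbracket q η (-x) = -qbracket q η x := by
  rw [qbracket, qbracket, neg_neg]; ring

end Powers

/-! ### Moves of tableaux -/

section Moves

variable {n : ℕ} {q η : ℂ} {C : Set (Rel n)} {L : Tableau n}

theorem entry_pos (R : Tableau n) (a : Pos n) : entry R a.row a.col = R a := dif_pos a.2

/-- The sign of a move: raising for `true`, lowering for `false`. -/
def sg (b : Bool) : ℤ := if b then 1 else -1

/-- The row in the numerator of the coefficient of a move in row `k`. -/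
def src (b : Bool) (k : ℕ) : ℕ := if b then k + 1 else k - 1

/-- The tableau `R ± δ^{kj}`. -/
def mv (b : Bool) (k j : ℕ) (R : Tableau n) : Tableau n := R + (sg b : ℂ) • delta n k j

/-- The coefficient of a move. -/
def co (q η : ℂ) (b : Bool) (k j : ℕ) (R : Tableau n) : ℂ :=
  -(sg b : ℂ) * gtCoeff q η R (src b k) k j

theorem mv_of_eq (b : Bool) {k j : ℕ} (R : Tableau n) {a : Pos n} (h : a.1 = (k, j)) :
    mv b k j R a = R a + sg b := by simp [mv, delta, h]

theorem mv_of_ne (b : Bool) {k j : ℕ} (R : Tableau n) {a : Pos n} (h : a.1 ≠ (k, j)) :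
    mv b k j R a = R a := by simp [mv, delta, h]

/-- The operator of a single move. -/
def op (q η : ℂ) (C : Set (Rel n)) (L : Tableau n) (b : Bool) (k j : ℕ) :
    VC η C L →ₗ[ℂ] VC η C L :=
  Finsupp.linearCombination ℂ fun R : basisSet η C L => co q η b k j R.1 • tab η C L (mv b k j R.1)

theorem tab_of_mem {R : Tableau n} (h : R ∈ basisSet η C L) :
    tab η C L R = Finsupp.single ⟨R, h⟩ 1 := dif_pos h

theorem tab_of_notMem {R : Tableau n} (h : R ∉ basisSet η C L) : tab η C L R = 0 := dif_neg h

theorem op_tab_of_mem {R : Tableau n} (h : R ∈ basisSet η C L) (b : Bool) (k j : ℕ) :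
    op q η C L b k j (tab η C L R) = co q η b k j R • tab η C L (mv b k j R) := by
  rw [tab_of_mem h, op, Finsupp.linearCombination_single, one_smul]

/-- Integral shifts of `L` which are zero in the top row and satisfy the relations `a ≥ b` of
`C`. -/
def Half (η : ℂ) (C : Set (Rel n)) (L R : Tableau n) : Prop :=
  (∃ z : Pos n → ℤ, (∀ a, a.row = n → z a = 0) ∧ ∀ a, R a = L a + z a) ∧
    ∀ r ∈ C, r.strict = false → SatisfiesRel η R r

/-- A relation `a > b` of `C` is violated. -/
def Viol (η : ℂ) (C : Set (Rel n)) (R : Tableau n) : Prop :=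
  ∃ r ∈ C, r.strict = true ∧ ∃ m : ℤ, m ≤ 0 ∧ Dif η (R r.fst - R r.snd) m

theorem satisfiesRel_iff {R : Tableau n} {r : Rel n} : SatisfiesRel η R r ↔
    ∃ d : ℤ, 0 ≤ d ∧ (r.strict = true → 0 < d) ∧ Dif η (R r.fst - R r.snd) d := by
  constructor
  · rintro ⟨d, x, hx, h1, h2, h3⟩; exact ⟨d, h1, h2, x, hx, h3⟩
  · rintro ⟨d, h1, h2, x, hx, h3⟩; exact ⟨d, x, hx, h1, h2, h3⟩

theorem half_of_mem {R : Tableau n} (h : R ∈ basisSet η C L) : Half η C L R :=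
  ⟨h.1, fun r hr _ => h.2.1 r hr⟩

theorem Dif.shift {R L : Tableau n} {z : Pos n → ℤ} (hz : ∀ a, R a = L a + z a) {a b : Pos n}
    {m : ℤ} (h : Dif η (L a - L b) m) : Dif η (R a - R b) (m + (z a - z b)) := by
  have := h.add_int (z a - z b)
  push_cast at this
  rwa [hz a, hz b, show L a + z a - (L b + z b) = L a - L b + ((z a : ℂ) - z b) by ring]

theorem Dif.unshift {R L : Tableau n} {z : Pos n → ℤ} (hz : ∀ a, R a = L a + z a) {a b : Pos n}
    {m : ℤ} (h : Dif η (R a - R b) m) : Dif η (L a - L b) (m - (z a - z b)) := by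
  have := Dif.shift (L := R) (R := L) (z := fun a => -z a) (η := η)
    (fun a => by rw [hz]; push_cast; ring) h
  convert this using 1
  ring

/-- The second part of the definition of a realization is invariant under integral shifts. -/
theorem mem_basisSet_iff (hL : IsRealization η C L) {R : Tableau n} : R ∈ basisSet η C L ↔
    (∃ z : Pos n → ℤ, (∀ a, a.row = n → z a = 0) ∧ ∀ a, R a = L a + z a) ∧
      ∀ r ∈ C, SatisfiesRel η R r := by
  constructor
  · intro h; exact ⟨h.1, h.2.1⟩
  · rintro ⟨⟨z, hz0, hz⟩, h⟩
    refine ⟨⟨z, hz0, hz⟩, h, ?_⟩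
    rintro a b hab hne ⟨d, x, hx, hd⟩
    have h1 : Dif η (R a - R b) d := ⟨x, hx, hd⟩
    obtain ⟨x', hx', h2⟩ := Dif.unshift hz h1
    exact hL.2 a b hab hne ⟨_, x', hx', h2⟩

/-- Integral shifts keep the property that related entries have a difference in `ℤ + 1(q)/2`. So a
failing strict relation still has a definite integer difference, which is then at most `0`. -/
theorem viol_of_half (hL : IsRealization η C L) {R : Tableau n} (h : Half η C L R)
    (hR : R ∉ basisSet η C L) : Viol η C R := by
  obtain ⟨⟨z, hz0, hz⟩, h⟩ := h
  rw [mem_basisSet_iff hL] at hR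
  have hR' : ∃ r ∈ C, ¬ SatisfiesRel η R r := by
    by_contra hcon
    push Not at hcon
    exact hR ⟨⟨z, hz0, hz⟩, hcon⟩
  obtain ⟨r, hr, hnot⟩ := hR'
  have hs : r.strict = true := by
    by_contra hs
    exact hnot (h r hr (by simpa using hs))
  obtain ⟨d, -, -, hd⟩ := satisfiesRel_iff.1 (hL.1 r hr)
  have hd' := Dif.shift hz hd
  refine ⟨r, hr, hs, _, ?_, hd'⟩
  by_contra hpos
  exact hnot (satisfiesRel_iff.2 ⟨_, by omega, fun _ => by omega, hd'⟩)

theorem notMem_of_viol (hη : Complex.exp η = q) (hq : ∀ r : ℕ, 0 < r → q ^ r ≠ 1) {R : Tableau n}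
    (h : Viol η C R) : R ∉ basisSet η C L := by
  obtain ⟨r, hr, hs, m, hm, hd⟩ := h
  intro hR
  obtain ⟨d, -, hd2, hd3⟩ := satisfiesRel_iff.1 (hR.2.1 r hr)
  have := hd.unique hη hq hd3
  have := hd2 hs
  omega

theorem co_eq_zero (hη : Complex.exp η = q) (hq : ∀ r : ℕ, 0 < r → q ^ r ≠ 1) {R : Tableau n}
    {b : Bool} {a c : Pos n} (hc : c.row = src b a.row) (h : Dif η (R c - R a) 0) :
    co q η b a.row a.col R = 0 := by
  rw [co, gtCoeff, Finset.prod_eq_zero (i := c.col), zero_div, mul_zero]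
  · rw [← hc]; exact Finset.mem_Icc.2 ⟨c.2.1, c.2.2.1⟩
  · rw [← hc, entry_pos, entry_pos, qbracket_eq_zero_iff hη hq]; exact h

theorem Pos.ext_iff' {a b : Pos n} : a = b ↔ a.row = b.row ∧ a.col = b.col := by
  rw [Subtype.ext_iff, Prod.ext_iff]; rfl

/-- A relation `c ≥ e` can only be lost by raising `e` or lowering `c` when the difference is `0`.
In either case the other entry lies in the row of the numerator of the coefficient and contributes
the factor `[0]_q = 0`. Relations in the top row are not touched. -/
theorem half_mv (hη : Complex.exp η = q) (hq : ∀ r : ℕ, 0 < r → q ^ r ≠ 1) (hC : C ⊆ allRel n)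
    {R : Tableau n} (h : Half η C L R) {b : Bool} {a : Pos n} (ha : a.row < n)
    (hco : co q η b a.row a.col R ≠ 0) : Half η C L (mv b a.row a.col R) := by
  obtain ⟨⟨z, hz0, hz⟩, h⟩ := h
  have hmv : ∀ c, mv b a.row a.col R c = R c + ((if c = a then sg b else 0 : ℤ) : ℂ) := by
    intro c
    by_cases hca : c = a
    · rw [mv_of_eq b R (by rw [hca]; rfl), if_pos hca]
    · rw [mv_of_ne b R, if_neg hca]
      · simp
      · intro hc; exact hca (Subtype.ext hc)
  refine ⟨⟨fun c => z c + if c = a then sg b else 0, ?_, ?_⟩, ?_⟩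
  · intro c hc
    show z c + (if c = a then sg b else 0) = 0
    rw [hz0 c hc, if_neg (by rintro rfl; omega), add_zero]
  · intro c
    rw [hmv, hz]; push_cast; ring
  · intro r hr hs
    obtain ⟨d, hd0, -, hd⟩ := satisfiesRel_iff.1 (h r hr hs)
    have hd' := Dif.shift hmv hd
    refine satisfiesRel_iff.2 ⟨_, ?_, by simp [hs], hd'⟩
    by_contra hneg
    rcases hC hr with (⟨c, e, hrow, rfl⟩ | ⟨c, e, hrow, rfl⟩) | ⟨c, e, hc, he, hne, rfl⟩
    · change ¬ 0 ≤ d + ((if c = a then sg b else 0) - if e = a then sg b else 0) at hneg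
      change Dif η (R c - R e) d at hd
      have hce : c ≠ e := by rintro rfl; omega
      cases b
      · by_cases h1 : c = a
        · subst h1
          rw [if_pos rfl, if_neg (Ne.symm hce)] at hneg
          simp only [sg] at hneg
          have : d = 0 := by simp at hneg; omega
          subst this
          refine hco (co_eq_zero hη hq (c := e) (by simp [src]; omega) ?_)
          have := hd.neg
          rwa [neg_sub] at this
        · rw [if_neg h1] at hneg
          split_ifs at hneg <;> simp [sg] at hneg <;> omega
      · by_cases h1 : e = a
        · subst h1
          rw [if_pos rfl, if_neg hce] at hneg
          simp only [sg] at hneg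
          have : d = 0 := by simp at hneg; omega
          subst this
          exact hco (co_eq_zero hη hq (c := c) (by simp [src]; omega) hd)
        · rw [if_neg h1] at hneg
          split_ifs at hneg <;> simp [sg] at hneg <;> omega
    · simp [gt] at hs
    · change ¬ 0 ≤ d + ((if c = a then sg b else 0) - if e = a then sg b else 0) at hneg
      rw [if_neg (by rintro rfl; omega), if_neg (by rintro rfl; omega)] at hneg
      omega

/-- A violated relation `c > e` could only be repaired by a step from difference `0` to difference
`1`, and again the coefficient of that step contains `[0]_q`. -/
theorem viol_mv (hη : Complex.exp η = q) (hq : ∀ r : ℕ, 0 < r → q ^ r ≠ 1) (hC : C ⊆ allRel n)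
    {R : Tableau n} (h : Viol η C R) {b : Bool} {a : Pos n} (ha : a.row < n)
    (hco : co q η b a.row a.col R ≠ 0) : Viol η C (mv b a.row a.col R) := by
  obtain ⟨r, hr, hs, m, hm, hd⟩ := h
  have hmv : ∀ c, mv b a.row a.col R c = R c + ((if c = a then sg b else 0 : ℤ) : ℂ) := by
    intro c
    by_cases hca : c = a
    · rw [mv_of_eq b R (by rw [hca]; rfl), if_pos hca]
    · rw [mv_of_ne b R, if_neg hca]
      · simp
      · intro hc; exact hca (Subtype.ext hc)
  refine ⟨r, hr, hs, _, ?_, Dif.shift hmv hd⟩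
  by_contra hneg
  rcases hC hr with (⟨c, e, hrow, rfl⟩ | ⟨c, e, hrow, rfl⟩) | ⟨c, e, hc, he, hne, rfl⟩
  · simp [ge] at hs
  · change ¬ m + ((if c = a then sg b else 0) - if e = a then sg b else 0) ≤ 0 at hneg
    change Dif η (R c - R e) m at hd
    have hce : c ≠ e := by rintro rfl; omega
    cases b
    · by_cases h1 : e = a
      · subst h1
        rw [if_pos rfl, if_neg hce] at hneg
        simp only [sg] at hneg
        have : m = 0 := by simp at hneg; omega
        subst this
        exact hco (co_eq_zero hη hq (c := c) (by simp [src]; omega) hd)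
      · rw [if_neg h1] at hneg
        split_ifs at hneg <;> simp [sg] at hneg <;> omega
    · by_cases h1 : c = a
      · subst h1
        rw [if_pos rfl, if_neg (Ne.symm hce)] at hneg
        simp only [sg] at hneg
        have : m = 0 := by simp at hneg; omega
        subst this
        refine hco (co_eq_zero hη hq (c := e) (by simp [src]; omega) ?_)
        have := hd.neg
        rwa [neg_sub] at this
      · rw [if_neg h1] at hneg
        split_ifs at hneg <;> simp [sg] at hneg <;> omega
  · simp [ge] at hs

/-- The formula for a single move stays valid outside the basis, where `T(R)` is read as `0`, as
long as the weak relations hold: the strict relation that is broken stays broken under a move with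
nonzero coefficient, so both sides vanish. -/
theorem op_tab (hη : Complex.exp η = q) (hq : ∀ r : ℕ, 0 < r → q ^ r ≠ 1) (hC : C ⊆ allRel n)
    (hL : IsRealization η C L) {R : Tableau n} (h : Half η C L R) (b : Bool) {a : Pos n}
    (ha : a.row < n) : op q η C L b a.row a.col (tab η C L R) =
      co q η b a.row a.col R • tab η C L (mv b a.row a.col R) := by
  by_cases hR : R ∈ basisSet η C L
  · exact op_tab_of_mem hR b _ _
  · rw [tab_of_notMem hR, map_zero]
    by_cases hco : co q η b a.row a.col R = 0
    · rw [hco, zero_smul]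
    · rw [tab_of_notMem, smul_zero]
      exact notMem_of_viol hη hq (viol_mv hη hq hC (viol_of_half hL h hR) ha hco)

theorem op_smul_tab (hη : Complex.exp η = q) (hq : ∀ r : ℕ, 0 < r → q ^ r ≠ 1) (hC : C ⊆ allRel n)
    (hL : IsRealization η C L) {R : Tableau n} {x : ℂ} (h : x ≠ 0 → Half η C L R) (b : Bool)
    {a : Pos n} (ha : a.row < n) : op q η C L b a.row a.col (x • tab η C L R) =
      (x * co q η b a.row a.col R) • tab η C L (mv b a.row a.col R) := by
  by_cases hx : x = 0
  · simp [hx]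
  · rw [map_smul, op_tab hη hq hC hL (h hx) b ha, smul_smul]

/-- The composition of two moves. -/
theorem op_op_tab (hη : Complex.exp η = q) (hq : ∀ r : ℕ, 0 < r → q ^ r ≠ 1) (hC : C ⊆ allRel n)
    (hL : IsRealization η C L) {R : Tableau n} (h : R ∈ basisSet η C L) (b b' : Bool) {a a' : Pos n}
    (ha : a.row < n) (ha' : a'.row < n) :
    op q η C L b' a'.row a'.col (op q η C L b a.row a.col (tab η C L R)) =
      (co q η b a.row a.col R * co q η b' a'.row a'.col (mv b a.row a.col R)) •
        tab η C L (mv b' a'.row a'.col (mv b a.row a.col R)) := by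
  rw [op_tab_of_mem h, op_smul_tab hη hq hC hL (half_mv hη hq hC (half_of_mem h) ha) b' ha']

/-- The composition of three moves. -/
theorem op_op_op_tab (hη : Complex.exp η = q) (hq : ∀ r : ℕ, 0 < r → q ^ r ≠ 1)
    (hC : C ⊆ allRel n) (hL : IsRealization η C L) {R : Tableau n} (h : R ∈ basisSet η C L)
    (b b' b'' : Bool) {a a' a'' : Pos n} (ha : a.row < n) (ha' : a'.row < n) (ha'' : a''.row < n) :
    op q η C L b'' a''.row a''.col (op q η C L b' a'.row a'.col
      (op q η C L b a.row a.col (tab η C L R))) =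
      (co q η b a.row a.col R * co q η b' a'.row a'.col (mv b a.row a.col R) *
        co q η b'' a''.row a''.col (mv b' a'.row a'.col (mv b a.row a.col R))) •
        tab η C L (mv b'' a''.row a''.col (mv b' a'.row a'.col (mv b a.row a.col R))) := by
  rw [op_op_tab hη hq hC hL h b b' ha ha', op_smul_tab hη hq hC hL _ b'' ha'']
  intro hne
  exact half_mv hη hq hC (half_mv hη hq hC (half_of_mem h) ha (left_ne_zero_of_mul hne)) ha'
    (right_ne_zero_of_mul hne)

end Moves

end QuantumGT

end

noncomputable section

namespace QuantumGT

/-! ### Separation of the entries of a row -/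

section Separation

variable {n : ℕ} {q η : ℂ} {C : Set (Rel n)} {L : Tableau n}

theorem dif_of_gt {R : Tableau n} (hR : R ∈ basisSet η C L) {a b : Pos n} (h : gt a b ∈ C) :
    ∃ d : ℤ, 0 < d ∧ Dif η (R a - R b) d := by
  obtain ⟨d, -, h1, h2⟩ := satisfiesRel_iff.1 (hR.2.1 _ h)
  exact ⟨d, h1 rfl, h2⟩

theorem dif_of_ge {R : Tableau n} (hR : R ∈ basisSet η C L) {a b : Pos n} (h : ge a b ∈ C) :
    ∃ d : ℤ, 0 ≤ d ∧ Dif η (R a - R b) d := by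
  obtain ⟨d, h0, -, h2⟩ := satisfiesRel_iff.1 (hR.2.1 _ h)
  exact ⟨d, h0, h2⟩

theorem dif_of_step {R : Tableau n} (hR : R ∈ basisSet η C L) {a b : Pos n} (h : Step C a b) :
    ∃ d : ℤ, 0 ≤ d ∧ Dif η (R a - R b) d := by
  rcases h with h | h
  · exact dif_of_ge hR h
  · obtain ⟨d, hd, h'⟩ := dif_of_gt hR h
    exact ⟨d, hd.le, h'⟩

theorem dif_of_succEq {R : Tableau n} (hR : R ∈ basisSet η C L) {a b : Pos n}
    (h : SuccEq C a b) : ∃ d : ℤ, 0 ≤ d ∧ Dif η (R a - R b) d := by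
  induction h with
  | single h => exact dif_of_step hR h
  | tail _ h ih =>
    obtain ⟨d, hd, h1⟩ := ih
    obtain ⟨d', hd', h2⟩ := dif_of_step hR h
    refine ⟨d + d', by omega, ?_⟩
    have := h1.add h2
    rwa [sub_add_sub_cancel] at this

/-- Two different positions of a row below the top with integral difference are separated by
relations of `C`. -/
theorem separated_cases (hC : Admissible C) {R : Tableau n} (hR : R ∈ basisSet η C L) {a b : Pos n}
    (hab : a.row = b.row) (ha : a.row < n) (hcol : a.col < b.col) {m : ℤ}
    (hm : Dif η (R a - R b) m) :
    (∃ u v : Pos n, u.row = a.row + 1 ∧ v.row + 1 = a.row ∧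
      gt a u ∈ C ∧ ge u b ∈ C ∧ ge a v ∈ C ∧ gt v b ∈ C) ∨
    (∃ u v : Pos n, u.row = a.row + 1 ∧ v.row = a.row + 1 ∧ u.col < v.col ∧ SuccEq C u v ∧
      gt a u ∈ C ∧ ge v b ∈ C) := by
  obtain ⟨x, hx, hd⟩ := hm
  obtain ⟨D, hD, haD, hbD⟩ := hR.2.2 a b hab (by rintro rfl; omega) ⟨m, x, hx, hd⟩
  rcases (hC.2 D hD).separated a haD b hbD hab ha hcol with
    ⟨u, v, h1, h2, h3, h4, h5, h6⟩ | ⟨u, v, h1, h2, h3, h4, h5, h6⟩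
  · exact Or.inl ⟨u, v, h1, h2, hD.1 h3, hD.1 h4, hD.1 h5, hD.1 h6⟩
  · refine Or.inr ⟨u, v, h1, h2, h3, ?_, hD.1 h5, hD.1 h6⟩
    exact Relation.TransGen.mono (r := Step D) (fun _ _ h => Or.imp (fun h => hD.1 h) (fun h => hD.1 h) h) _ _ h4

/-- Along either configuration of the fourth admissibility condition the chain from `a` to `b`
contains the strict relation `a > u`, so the total difference is positive. -/
theorem pos_of_dif (hη : Complex.exp η = q) (hq : ∀ r : ℕ, 0 < r → q ^ r ≠ 1)
    (hC : Admissible C) {R : Tableau n} (hR : R ∈ basisSet η C L) {a b : Pos n}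
    (hab : a.row = b.row) (ha : a.row < n) (hcol : a.col < b.col) {m : ℤ}
    (hm : Dif η (R a - R b) m) : 0 < m := by
  rcases separated_cases hC hR hab ha hcol hm with
    ⟨u, v, h1, h2, h3, h4, h5, h6⟩ | ⟨u, v, h1, h2, h3, h4, h5, h6⟩
  · obtain ⟨d, hd, h⟩ := dif_of_gt hR h3
    obtain ⟨d', hd', h'⟩ := dif_of_ge hR h4
    have := (h.add h')
    rw [sub_add_sub_cancel] at this
    have := this.unique hη hq hm
    omega
  · obtain ⟨d, hd, h⟩ := dif_of_gt hR h5
    obtain ⟨d', hd', h'⟩ := dif_of_ge hR h6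
    obtain ⟨d'', hd'', h''⟩ := dif_of_succEq hR h4
    have := (h.add h'').add h'
    rw [sub_add_sub_cancel, sub_add_sub_cancel] at this
    have := this.unique hη hq hm
    omega

theorem qbracket_row_ne_zero (hη : Complex.exp η = q) (hq : ∀ r : ℕ, 0 < r → q ^ r ≠ 1)
    (hC : Admissible C) {R : Tableau n} (hR : R ∈ basisSet η C L)
    {a b : Pos n} (hab : a.row = b.row) (ha : a.row < n) (hne : a ≠ b) :
    qbracket q η (R a - R b) ≠ 0 := by
  rw [Ne, qbracket_eq_zero_iff hη hq]
  intro h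
  have hcol : a.col ≠ b.col := fun h => hne (Pos.ext_iff'.2 ⟨hab, h⟩)
  rcases lt_or_gt_of_ne hcol with h1 | h1
  · exact lt_irrefl _ (pos_of_dif hη hq hC hR hab ha h1 h)
  · have h2 := h.neg
    rw [neg_sub] at h2
    exact lt_irrefl _ (pos_of_dif hη hq hC hR hab.symm (by omega) h1 h2)

/-- Two positions of a row which are moved up together with just one further position do not have
neighbouring entries. -/
theorem not_dif_one (hη : Complex.exp η = q) (hq : ∀ r : ℕ, 0 < r → q ^ r ≠ 1)
    (hC : Admissible C) {R R' : Tableau n} (hR : R ∈ basisSet η C L)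
    (hR' : R' ∈ basisSet η C L) {a b p : Pos n} (hab : a.row = b.row) (ha : a.row < n)
    (hne : a ≠ b) (hp : p.row ≠ a.row)
    (hRR : ∀ c, R' c = R c + ((if c = a ∨ c = b ∨ c = p then 1 else 0 : ℤ) : ℂ)) :
    ¬ Dif η (R a - R b) 1 := by
  intro hm
  have hcol : a.col < b.col := by
    rcases lt_trichotomy a.col b.col with h | h | h
    · exact h
    · exact absurd (Pos.ext_iff'.2 ⟨hab, h⟩) hne
    · have h2 := hm.neg
      rw [neg_sub] at h2
      have := pos_of_dif hη hq hC hR hab.symm (by omega) h h2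
      omega
  have hp1 : p ≠ a := by rintro rfl; exact hp rfl
  have hp2 : p ≠ b := by rintro rfl; exact hp hab.symm
  have key : ∀ {c d : Pos n} {m m' : ℤ}, Dif η (R c - R d) m → Dif η (R' c - R' d) m' →
      m' = m + ((if c = a ∨ c = b ∨ c = p then 1 else 0) - if d = a ∨ d = b ∨ d = p then 1 else 0) :=
    fun h h' => h'.unique hη hq (Dif.shift hRR h)
  rcases separated_cases hC hR hab ha hcol hm with
    ⟨u, v, h1, h2, h3, h4, h5, h6⟩ | ⟨u, v, h1, h2, h3, h4, h5, h6⟩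
  -- If the difference of `a` and `b` is `1`, then `u` is level with `b` and `v` is level with `a`.
  -- After `a` and `b` are raised, `u ≥ b` and `v > b` persist only if `u` and `v` are raised too,
  -- but just one further position moves.
  · obtain ⟨d3, hd3, g3⟩ := dif_of_gt hR h3
    obtain ⟨d4, hd4, g4⟩ := dif_of_ge hR h4
    obtain ⟨d5, hd5, g5⟩ := dif_of_ge hR h5
    obtain ⟨d6, hd6, g6⟩ := dif_of_gt hR h6
    obtain ⟨e4, he4, k4⟩ := dif_of_ge hR' h4
    obtain ⟨e6, he6, k6⟩ := dif_of_gt hR' h6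
    have e1 := g3.add g4
    rw [sub_add_sub_cancel] at e1
    have e1 := e1.unique hη hq hm
    have e2 := g5.add g6
    rw [sub_add_sub_cancel] at e2
    have e2 := e2.unique hη hq hm
    have t4 := key g4 k4
    have t6 := key g6 k6
    have hua : u ≠ a := by rintro rfl; omega
    have hub : u ≠ b := by rintro rfl; omega
    have hva : v ≠ a := by rintro rfl; omega
    have hvb : v ≠ b := by rintro rfl; omega
    have huv : u ≠ v := by rintro rfl; omega
    simp only [hua, hub, hva, hvb, false_or, true_or, or_true, if_true] at t4 t6
    by_cases hup : u = p
    · have hvp : v ≠ p := by rintro rfl; exact huv hup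
      simp only [hvp, if_false] at t6
      omega
    · simp only [hup, if_false] at t4
      omega
  -- Now `u`, `v` and `b` are all level. Raising `b` forces `v` to be raised, and then `u ⪰ v`
  -- forces `u` as well.
  · obtain ⟨d4, hd4, g4⟩ := dif_of_succEq hR h4
    obtain ⟨d5, hd5, g5⟩ := dif_of_gt hR h5
    obtain ⟨d6, hd6, g6⟩ := dif_of_ge hR h6
    obtain ⟨e4, he4, k4⟩ := dif_of_succEq hR' h4
    obtain ⟨e6, he6, k6⟩ := dif_of_ge hR' h6
    have e1 := (g5.add g4).add g6
    rw [sub_add_sub_cancel, sub_add_sub_cancel] at e1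
    have e1 := e1.unique hη hq hm
    have t4 := key g4 k4
    have t6 := key g6 k6
    have hua : u ≠ a := by rintro rfl; omega
    have hub : u ≠ b := by rintro rfl; omega
    have hva : v ≠ a := by rintro rfl; omega
    have hvb : v ≠ b := by rintro rfl; omega
    have huv : u ≠ v := by rintro rfl; omega
    simp only [hua, hub, hva, hvb, false_or, true_or, or_true, if_true] at t4 t6
    by_cases hvp : v = p
    · have hup : u ≠ p := by rintro rfl; exact huv hvp.symm
      simp only [hup, hvp, if_true, if_false] at t4
      omega
    · simp only [hvp, if_false] at t6
      omega

theorem not_dif_one_of_shift (hη : Complex.exp η = q) (hq : ∀ r : ℕ, 0 < r → q ^ r ≠ 1)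
    (hC : Admissible C) {R R' : Tableau n} (hR : R ∈ basisSet η C L)
    (hR' : R' ∈ basisSet η C L) {a b p : Pos n} (hab : a.row = b.row) (ha : a.row < n)
    (hne : a ≠ b) (hp : p.row ≠ a.row) (s : Bool)
    (hRR : ∀ c, R' c = R c + ((if c = a ∨ c = b ∨ c = p then sg s else 0 : ℤ) : ℂ)) :
    ¬ Dif η (R a - R b) 1 := by
  cases s
  · have h : R' a - R' b = R a - R b := by rw [hRR a, hRR b]; simp
    rw [← h]
    refine not_dif_one hη hq hC hR' hR hab ha hne hp fun c => ?_
    rw [hRR c]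
    split_ifs <;> simp [sg]
  · exact not_dif_one hη hq hC hR hR' hab ha hne hp hRR

end Separation

/-! ### Factors of the coefficients -/

section Factors

variable {n : ℕ} {q η : ℂ} {C : Set (Rel n)} {L : Tableau n}

instance : Finite (Pos n) :=
  Finite.of_injective (β := Fin (n + 1) × Fin (n + 1))
    (fun a => (⟨a.1.1, by have := a.2; omega⟩, ⟨a.1.2, by have := a.2; omega⟩)) (by
      intro a b h
      simp only [Prod.mk.injEq, Fin.mk.injEq] at h
      exact Subtype.ext (Prod.ext h.1 h.2))

instance : Fintype (Pos n) := Fintype.ofFinite _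

/-- The positions of row `k`. -/
def rowP (n k : ℕ) : Finset (Pos n) := Finset.univ.filter fun a => a.row = k

theorem mem_rowP {k : ℕ} {a : Pos n} : a ∈ rowP n k ↔ a.row = k := by simp [rowP]

theorem prod_Icc_eq {M : Type*} [CommMonoid M] {k : ℕ} (hk : k ≤ n) (F : ℕ → M) :
    ∏ j ∈ Finset.Icc 1 k, F j = ∏ a ∈ rowP n k, F a.col := by
  symm
  refine Finset.prod_bij (fun a _ => a.col) ?_ ?_ ?_ (fun _ _ => rfl)
  · intro a ha
    rw [mem_rowP] at ha
    exact Finset.mem_Icc.2 ⟨a.2.1, ha ▸ a.2.2.1⟩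
  · intro a ha b hb h
    rw [mem_rowP] at ha hb
    exact Pos.ext_iff'.2 ⟨ha.trans hb.symm, h⟩
  · intro j hj
    rw [Finset.mem_Icc] at hj
    exact ⟨⟨(k, j), hj.1, hj.2, hk⟩, mem_rowP.2 rfl, rfl⟩

theorem sum_Icc_eq {M : Type*} [AddCommMonoid M] {k : ℕ} (hk : k ≤ n) (F : ℕ → M) :
    ∑ j ∈ Finset.Icc 1 k, F j = ∑ a ∈ rowP n k, F a.col := by
  symm
  refine Finset.sum_bij (fun a _ => a.col) ?_ ?_ ?_ (fun _ _ => rfl)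
  · intro a ha
    rw [mem_rowP] at ha
    exact Finset.mem_Icc.2 ⟨a.2.1, ha ▸ a.2.2.1⟩
  · intro a ha b hb h
    rw [mem_rowP] at ha hb
    exact Pos.ext_iff'.2 ⟨ha.trans hb.symm, h⟩
  · intro j hj
    rw [Finset.mem_Icc] at hj
    exact ⟨⟨(k, j), hj.1, hj.2, hk⟩, mem_rowP.2 rfl, rfl⟩

/-- The factor of the position `c` in the coefficient of the move of `a`; here `x` is the difference
of the entries. -/
def fac (q η : ℂ) (b : Bool) (a c : Pos n) (x : ℂ) : ℂ :=
  if c.row = src b a.row then qbracket q η x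
  else if c.row = a.row ∧ c ≠ a then (qbracket q η x)⁻¹ else 1

theorem src_ne (b : Bool) {k : ℕ} (hk : 1 ≤ k) : src b k ≠ k := by
  cases b <;> simp [src]; omega

theorem Pos.row_pos (a : Pos n) : 1 ≤ a.row := a.2.1.trans a.2.2.1

theorem gtCoeff_eq (R : Tableau n) {r : ℕ} (hr : r ≤ n) (a : Pos n) :
    gtCoeff q η R r a.row a.col = (∏ c ∈ rowP n r, qbracket q η (R c - R a)) /
      ∏ c ∈ (rowP n a.row).erase a, qbracket q η (R c - R a) := by
  classical
  rw [gtCoeff, prod_Icc_eq hr, entry_pos]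
  congr 1
  · refine Finset.prod_congr rfl fun c hc => ?_
    rw [← mem_rowP.1 hc, entry_pos]
  · symm
    refine Finset.prod_bij (fun c _ => c.col) ?_ ?_ ?_ ?_
    · intro c hc
      rw [Finset.mem_erase, mem_rowP] at hc
      refine Finset.mem_erase.2 ⟨fun h => hc.1 (Pos.ext_iff'.2 ⟨hc.2, h⟩), ?_⟩
      exact Finset.mem_Icc.2 ⟨c.2.1, hc.2 ▸ c.2.2.1⟩
    · intro c hc d hd h
      rw [Finset.mem_erase, mem_rowP] at hc hd
      exact Pos.ext_iff'.2 ⟨hc.2.trans hd.2.symm, h⟩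
    · intro j hj
      rw [Finset.mem_erase, Finset.mem_Icc] at hj
      refine ⟨⟨(a.row, j), hj.2.1, hj.2.2, a.2.2.2⟩, ?_, rfl⟩
      rw [Finset.mem_erase, mem_rowP]
      exact ⟨fun h => hj.1 (congrArg Pos.col h), rfl⟩
    · intro c hc
      rw [Finset.mem_erase, mem_rowP] at hc
      rw [← hc.2, entry_pos]

theorem src_le (b : Bool) {k : ℕ} (hk : k < n) : src b k ≤ n := by
  cases b <;> simp [src] <;> omega

/-- As a product over all positions, with factor `1` where a position does not matter, the
coefficient shows its dependence on each single entry. Commutation of moves then involves only the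
factors between the moved positions. -/
theorem co_eq_prod (b : Bool) {a : Pos n} (ha : a.row < n) (R : Tableau n) :
    co q η b a.row a.col R = -(sg b : ℂ) * ∏ c, fac q η b a c (R c - R a) := by
  classical
  rw [co, gtCoeff_eq R (src_le b ha), div_eq_mul_inv, ← Finset.prod_inv_distrib]
  congr 1
  simp only [fac]
  rw [Finset.prod_ite, ← rowP]
  congr 1
  rw [Finset.prod_ite, Finset.prod_const_one, mul_one]
  refine Finset.prod_congr ?_ fun _ _ => rfl
  ext c
  simp only [Finset.mem_erase, mem_rowP, Finset.mem_filter, Finset.mem_univ, true_and]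
  constructor
  · rintro ⟨h1, h2⟩
    exact ⟨by rw [h2]; exact (src_ne b a.row_pos).symm, h2, h1⟩
  · rintro ⟨-, h1, h2⟩
    exact ⟨h2, h1⟩

/-- The part of the coefficient of the move of `a` that does not involve the positions in `S`. -/
def corest (q η : ℂ) (b : Bool) (a : Pos n) (S : Set (Pos n)) (R : Tableau n) : ℂ :=
  open scoped Classical in
  -(sg b : ℂ) * ∏ c with c ∉ S, fac q η b a c (R c - R a)

theorem corest_congr (b : Bool) (a : Pos n) {S : Set (Pos n)} {R R' : Tableau n} (ha : R' a = R a)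
    (h : ∀ c, c ∉ S → R' c = R c) : corest q η b a S R' = corest q η b a S R := by
  classical
  rw [corest, corest]
  congr 1
  refine Finset.prod_congr rfl fun c hc => ?_
  rw [ha, h c (Finset.mem_filter.1 hc).2]

theorem co_eq_corest (b : Bool) {a : Pos n} (ha : a.row < n) (R : Tableau n) (c : Pos n) :
    co q η b a.row a.col R = corest q η b a {c} R * fac q η b a c (R c - R a) := by
  classical
  rw [co_eq_prod b ha, corest, mul_assoc, ← Finset.prod_erase_mul _ _ (Finset.mem_univ c)]
  congr 2
  refine Finset.prod_congr ?_ fun _ _ => rfl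
  ext d
  simp

theorem co_eq_corest_pair (b : Bool) {a : Pos n} (ha : a.row < n) (R : Tableau n) {c d : Pos n}
    (hcd : c ≠ d) : co q η b a.row a.col R =
      corest q η b a {c, d} R * (fac q η b a c (R c - R a) * fac q η b a d (R d - R a)) := by
  classical
  rw [co_eq_prod b ha, corest, mul_assoc, ← Finset.prod_erase_mul _ _ (Finset.mem_univ c),
    ← Finset.prod_erase_mul _ _ (Finset.mem_erase.2 ⟨hcd.symm, Finset.mem_univ d⟩),
    mul_assoc, mul_comm (fac q η b a d _)]
  congr 2
  refine Finset.prod_congr ?_ fun _ _ => rfl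
  ext e
  simp only [Finset.mem_erase, Finset.mem_univ, Finset.mem_filter, true_and, Set.mem_insert_iff,
    Set.mem_singleton_iff, and_true]
  tauto

theorem mv_apply (b : Bool) (a : Pos n) (R : Tableau n) (c : Pos n) :
    mv b a.row a.col R c = R c + ((if c = a then sg b else 0 : ℤ) : ℂ) := by
  by_cases hca : c = a
  · rw [mv_of_eq b R (by rw [hca]; rfl), if_pos hca]
  · rw [mv_of_ne b R, if_neg hca]
    · simp
    · intro hc; exact hca (Subtype.ext hc)

theorem mv_self (b : Bool) (a : Pos n) (R : Tableau n) : mv b a.row a.col R a = R a + sg b := by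
  rw [mv_apply, if_pos rfl]

theorem mv_other (b : Bool) {a c : Pos n} (h : c ≠ a) (R : Tableau n) :
    mv b a.row a.col R c = R c := by
  rw [mv_apply, if_neg h]; simp

theorem mv_comm (b b' : Bool) (k j k' j' : ℕ) (R : Tableau n) :
    mv b' k' j' (mv b k j R) = mv b k j (mv b' k' j' R) := by
  rw [mv, mv, mv, mv]; abel

theorem co_mv (b b' : Bool) {a p : Pos n} (hap : a ≠ p) (ha : a.row < n) (R : Tableau n) :
    co q η b a.row a.col (mv b' p.row p.col R) =
      corest q η b a {p} R * fac q η b a p (R p + sg b' - R a) := by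
  rw [co_eq_corest b ha _ p, mv_self, mv_other b' hap,
    corest_congr (S := {p}) b a (mv_other b' hap R) fun c hc => mv_other b' hc R]

/-- Moving `p` changes the coefficient of `a` in the one factor belonging to `p` and conversely; all
remaining factors agree on both sides. -/
theorem co_mul_co (b b' : Bool) {a p : Pos n} (hap : a ≠ p) (ha : a.row < n) (hp : p.row < n)
    (R : Tableau n) (h : fac q η b a p (R p - R a) * fac q η b' p a (R a + sg b - R p) =
      fac q η b' p a (R a - R p) * fac q η b a p (R p + sg b' - R a)) :
    co q η b a.row a.col R * co q η b' p.row p.col (mv b a.row a.col R) =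
      co q η b' p.row p.col R * co q η b a.row a.col (mv b' p.row p.col R) := by
  rw [co_mv b' b hap.symm hp, co_mv b b' hap ha, co_eq_corest b ha R p, co_eq_corest b' hp R a]
  linear_combination corest q η b a {p} R * corest q η b' p {a} R * h

theorem op_comm (hη : Complex.exp η = q) (hq : ∀ r : ℕ, 0 < r → q ^ r ≠ 1) (hC : C ⊆ allRel n)
    (hL : IsRealization η C L) {R : Tableau n} (hR : R ∈ basisSet η C L) (b b' : Bool) {a p : Pos n}
    (hap : a ≠ p) (ha : a.row < n) (hp : p.row < n)
    (h : fac q η b a p (R p - R a) * fac q η b' p a (R a + sg b - R p) =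
      fac q η b' p a (R a - R p) * fac q η b a p (R p + sg b' - R a)) :
    op q η C L b' p.row p.col (op q η C L b a.row a.col (tab η C L R)) =
      op q η C L b a.row a.col (op q η C L b' p.row p.col (tab η C L R)) := by
  rw [op_op_tab hη hq hC hL hR b b' ha hp, op_op_tab hη hq hC hL hR b' b hp ha,
    co_mul_co b b' hap ha hp R h, mv_comm]

/-- Moves in rows which are not neighbours commute. -/
theorem op_comm_of_far (hη : Complex.exp η = q) (hq : ∀ r : ℕ, 0 < r → q ^ r ≠ 1)
    (hC : C ⊆ allRel n) (hL : IsRealization η C L) {R : Tableau n} (hR : R ∈ basisSet η C L)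
    (b b' : Bool) {a p : Pos n} (ha : a.row < n) (hp : p.row < n)
    (hfar : a.row + 1 < p.row ∨ p.row + 1 < a.row) :
    op q η C L b' p.row p.col (op q η C L b a.row a.col (tab η C L R)) =
      op q η C L b a.row a.col (op q η C L b' p.row p.col (tab η C L R)) := by
  have h1 : ∀ x, fac q η b a p x = 1 := fun x => by
    have := p.row_pos
    rw [fac, if_neg, if_neg] <;> cases b <;> simp [src] <;> omega
  have h2 : ∀ x, fac q η b' p a x = 1 := fun x => by
    have := a.row_pos
    rw [fac, if_neg, if_neg] <;> cases b' <;> simp [src] <;> omega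
  refine op_comm hη hq hC hL hR b b' (by rintro rfl; omega) ha hp ?_
  rw [h1, h2, h1, h2]

/-- Raising and lowering different positions commute. -/
theorem op_raise_lower (hη : Complex.exp η = q) (hq : ∀ r : ℕ, 0 < r → q ^ r ≠ 1)
    (hC : C ⊆ allRel n) (hL : IsRealization η C L) {R : Tableau n} (hR : R ∈ basisSet η C L)
    {a p : Pos n} (hap : a ≠ p) (ha : a.row < n) (hp : p.row < n) :
    op q η C L false p.row p.col (op q η C L true a.row a.col (tab η C L R)) =
      op q η C L true a.row a.col (op q η C L false p.row p.col (tab η C L R)) := by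
  have e1 : qbracket q η (R p + ((-1 : ℤ) : ℂ) - R a) = -qbracket q η (R a + ((1 : ℤ) : ℂ) - R p) := by
    rw [← qbracket_neg]; congr 1; push_cast; ring
  have e2 : qbracket q η (R p - R a) = -qbracket q η (R a - R p) := by
    rw [← qbracket_neg]; congr 1; ring
  refine op_comm hη hq hC hL hR true false hap ha hp ?_
  simp only [fac, src, sg, if_true, if_false, Bool.false_eq_true, reduceIte]
  have := a.row_pos
  have := p.row_pos
  -- With `p` directly above `a` the interacting factors are brackets in the numerators, and in the
  -- same row they are inverse brackets. Each time the two orders agree up to two cancelling signs.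
  -- For inverse brackets this remains true under `0⁻¹ = 0`. In all other cases there is no
  -- interaction.
  by_cases h1 : p.row = a.row + 1
  · rw [if_pos h1, if_pos (by omega), if_pos (by omega), if_pos h1, e1, e2]; ring
  · have h3 : ¬ a.row = p.row - 1 := by omega
    simp only [if_neg h1, if_neg h3]
    by_cases h2 : p.row = a.row
    · simp only [h2, hap, hap.symm, Ne, not_false_iff, and_self, if_true, e1, e2, inv_neg]
      ring
    · simp only [h2, Ne.symm h2, false_and, if_false]

end Factors

end QuantumGT

end

noncomputable section

namespace QuantumGT

/-! ### Serre relations -/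

section Serre

variable {n : ℕ} {q η : ℂ} {C : Set (Rel n)} {L : Tableau n}

theorem qpow_sg (hη : Complex.exp η = q) (s : Bool) : qpow η (sg s) = q ^ sg s := qpow_int hη _

theorem add_inv_sg (q : ℂ) (s : Bool) : q + q⁻¹ = q ^ sg s + (q ^ sg s)⁻¹ := by
  cases s <;> simp [sg, add_comm]

theorem qbracket_add_add (hη : Complex.exp η = q) (s : Bool) (u : ℂ) :
    qbracket q η (u + sg s) + qbracket q η (u - sg s) = (q + q⁻¹) * qbracket q η u := by
  have hq0 : q ^ sg s ≠ 0 := zpow_ne_zero _ (by rw [← hη]; exact Complex.exp_ne_zero _)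
  have hu := qpow_ne_zero η u
  rw [add_inv_sg q s]
  simp only [qbracket, qpow_neg, qpow_add, qpow_sub, qpow_sg hη]
  field_simp
  ring

/-- The addition formula behind the Serre relation for two different positions of a row, with `u`,
`v` their distances to the moved entry of the adjacent row. The three nonvanishing conditions permit
clearing denominators, which leaves the polynomial identity `key`. -/
theorem qbracket_serre (hη : Complex.exp η = q) (hq : ∀ r : ℕ, 0 < r → q ^ r ≠ 1) (s : Bool)
    (u v : ℂ) (h0 : qbracket q η (u - v) ≠ 0) (h1 : qbracket q η (u - v + sg s) ≠ 0)
    (h2 : qbracket q η (u - v - sg s) ≠ 0) :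
    ((qbracket q η (u - v))⁻¹ * (qbracket q η (sg s - (u - v)))⁻¹ +
      (qbracket q η (v - u))⁻¹ * (qbracket q η (u - v + sg s))⁻¹) *
      (qbracket q η u * qbracket q η v + qbracket q η (u + sg s) * qbracket q η (v + sg s)) =
    (q + q⁻¹) * (qbracket q η u * qbracket q η (v + sg s) *
        ((qbracket q η (u - v))⁻¹ * (qbracket q η (sg s - (u - v)))⁻¹) +
      qbracket q η v * qbracket q η (u + sg s) *
        ((qbracket q η (v - u))⁻¹ * (qbracket q η (u - v + sg s))⁻¹)) := by
  have e1 : qbracket q η (v - u) = - qbracket q η (u - v) := by rw [← qbracket_neg, neg_sub]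
  have e2 : qbracket q η (sg s - (u - v)) = - qbracket q η (u - v - sg s) := by
    rw [← qbracket_neg, neg_sub]
  have hl := sub_inv_ne_zero hη hq
  have hq0 : q ^ sg s ≠ 0 := zpow_ne_zero _ (by rw [← hη]; exact Complex.exp_ne_zero _)
  have hu := qpow_ne_zero η u
  have hv := qpow_ne_zero η v
  rw [e1, e2]
  have key : (qbracket q η (u - v + sg s) + qbracket q η (u - v - sg s)) *
      (qbracket q η u * qbracket q η v + qbracket q η (u + sg s) * qbracket q η (v + sg s)) =
      (q + q⁻¹) * (qbracket q η u * qbracket q η (v + sg s) * qbracket q η (u - v + sg s) +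
        qbracket q η v * qbracket q η (u + sg s) * qbracket q η (u - v - sg s)) := by
    rw [add_inv_sg q s]
    simp only [qbracket, qpow_neg, qpow_add, qpow_sub, qpow_sg hη]
    generalize q - q⁻¹ = l at *
    generalize q ^ sg s = Q at *
    field_simp
    ring
  generalize qbracket q η (u - v) = x at *
  generalize qbracket q η (u - v + sg s) = y at *
  generalize qbracket q η (u - v - sg s) = z at *
  generalize q⁻¹ = q' at *
  field_simp
  linear_combination -key

theorem co_of_eq (s : Bool) {a p : Pos n} (ha : a.row < n) {R S : Tableau n} (h0 : S a = R a)
    (h : ∀ c, c ≠ p → S c = R c) : co q η s a.row a.col S =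
      corest q η s a {p} R * fac q η s a p (S p - R a) := by
  rw [co_eq_corest s ha S p, h0, corest_congr (S := {p}) s a h0 h]

theorem co_of_eq_pair (s : Bool) {a p p' : Pos n} (hp : p ≠ p') (ha : a.row < n) {R S : Tableau n}
    (h0 : S a = R a) (h : ∀ c, c ≠ p → c ≠ p' → S c = R c) : co q η s a.row a.col S =
      corest q η s a {p, p'} R * (fac q η s a p (S p - R a) * fac q η s a p' (S p' - R a)) := by
  rw [co_eq_corest_pair s ha S hp, h0, corest_congr (S := {p, p'}) s a h0]
  intro c hc
  simp only [Set.mem_insert_iff, Set.mem_singleton_iff, not_or] at hc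
  exact h c hc.1 hc.2

theorem fac_row (s : Bool) {a c : Pos n} (h : c.row = a.row) (hne : c ≠ a) (x : ℂ) :
    fac q η s a c x = (qbracket q η x)⁻¹ := by
  rw [fac, if_neg (by rw [h]; exact (src_ne s a.row_pos).symm), if_pos ⟨h, hne⟩]

/-- Of two neighbouring rows just one occurs in the numerators of the other one. -/
theorem fac_adjacent (s : Bool) {a p : Pos n} (h : p.row + 1 = a.row ∨ a.row + 1 = p.row) :
    ((∀ x, fac q η s a p x = qbracket q η x) ∧ ∀ x, fac q η s p a x = 1) ∨
      ((∀ x, fac q η s a p x = 1) ∧ ∀ x, fac q η s p a x = qbracket q η x) := by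
  have := a.row_pos
  have := p.row_pos
  cases s <;> simp only [fac, src, Bool.false_eq_true, if_true, if_false]
  · rcases h with h | h
    · left
      refine ⟨fun x => if_pos (by omega), fun x => ?_⟩
      rw [if_neg (by omega), if_neg (by omega)]
    · right
      refine ⟨fun x => ?_, fun x => if_pos (by omega)⟩
      rw [if_neg (by omega), if_neg (by omega)]
  · rcases h with h | h
    · right
      refine ⟨fun x => ?_, fun x => if_pos (by omega)⟩
      rw [if_neg (by omega), if_neg (by omega)]
    · left
      refine ⟨fun x => if_pos (by omega), fun x => ?_⟩
      rw [if_neg (by omega), if_neg (by omega)]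

/-- When one position is moved twice, the three products differ only in the bracket between the two
rows, and the claim is the three-term recurrence `[x + 1] + [x - 1] = (q + q⁻¹)[x]`. -/
theorem serre_coeff_same (hη : Complex.exp η = q) (s : Bool) {a p : Pos n} (ha : a.row < n)
    (hp : p.row < n) (hadj : p.row + 1 = a.row ∨ a.row + 1 = p.row) (R : Tableau n) :
    co q η s p.row p.col R * co q η s a.row a.col (mv s p.row p.col R) *
        co q η s a.row a.col (mv s a.row a.col (mv s p.row p.col R)) -
      (q + q⁻¹) * (co q η s a.row a.col R * co q η s p.row p.col (mv s a.row a.col R) *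
        co q η s a.row a.col (mv s p.row p.col (mv s a.row a.col R))) +
      co q η s a.row a.col R * co q η s a.row a.col (mv s a.row a.col R) *
        co q η s p.row p.col (mv s a.row a.col (mv s a.row a.col R)) = 0 := by
  have hap : a ≠ p := by rintro rfl; omega
  have e : ∀ c, c ≠ p → mv s a.row a.col (mv s p.row p.col R) c = mv s a.row a.col R c := by
    intro c hc
    rw [mv_apply, mv_other s hc, mv_apply]
  have e' : mv s a.row a.col (mv s p.row p.col R) a = R a + sg s := by
    rw [mv_self, mv_other s hap]
  have e'' : ∀ c, c ≠ a → mv s a.row a.col (mv s a.row a.col R) c = R c := by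
    intro c hc
    rw [mv_other s hc, mv_other s hc]
  rw [co_of_eq (p := a) (R := R) s hp rfl (fun _ _ => rfl),
    co_of_eq (p := p) (R := R) s ha (mv_other s hap R) (fun c hc => mv_other s hc R),
    co_of_eq (p := p) (R := mv s a.row a.col R) s ha (e a hap) e,
    co_of_eq (p := p) (R := R) s ha rfl (fun _ _ => rfl),
    co_of_eq (p := a) (R := R) s hp (mv_other s hap.symm R) (fun c hc => mv_other s hc R),
    mv_comm s s a.row a.col p.row p.col,
    co_of_eq (p := p) (R := mv s a.row a.col R) s ha (e a hap) e,
    co_of_eq (p := p) (R := mv s a.row a.col R) s ha rfl (fun _ _ => rfl),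
    co_of_eq (p := a) (R := R) s hp (e'' p hap.symm) e'',
    mv_self, mv_self, mv_self, mv_other s hap.symm, mv_self, mv_other s hap.symm, mv_self]
  have h3 := qbracket_add_add hη s (R p - R a)
  have h4 := qbracket_add_add hη s (R a + sg s - R p)
  rcases fac_adjacent (q := q) (η := η) s hadj with ⟨f1, f2⟩ | ⟨f1, f2⟩
  · simp only [f1, f2]
    rw [show R p + (sg s : ℂ) - (R a + sg s) = R p - R a by ring,
      show R p + (sg s : ℂ) - R a = R p - R a + sg s by ring,
      show R p - (R a + sg s) = R p - R a - sg s by ring]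
    generalize corest q η s a {p} R = A
    generalize corest q η s a {p} (mv s a.row a.col R) = B
    generalize corest q η s p {a} R = P
    linear_combination A * B * P * qbracket q η (R p - R a) * h3
  · simp only [f1, f2]
    rw [show R a + (sg s : ℂ) + sg s - R p = R a + sg s - R p + sg s by ring,
      show R a - R p = R a + sg s - R p - sg s by ring]
    generalize corest q η s a {p} R = A
    generalize corest q η s a {p} (mv s a.row a.col R) = B
    generalize corest q η s p {a} R = P
    linear_combination A * B * P * h4

/-- Neither order of `a` and `b` satisfies the relation alone, only the sum of both orders does. The
factors not involving `a`, `b`, `p` are common to all six products; what remains is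
`qbracket_serre`. -/
theorem serre_coeff_ne (hη : Complex.exp η = q) (hq : ∀ r : ℕ, 0 < r → q ^ r ≠ 1) (s : Bool)
    {a b p : Pos n} (hab : b.row = a.row) (hne : a ≠ b) (ha : a.row < n) (hp : p.row < n)
    (hadj : p.row + 1 = a.row ∨ a.row + 1 = p.row) (R : Tableau n)
    (h0 : qbracket q η (R a - R b) ≠ 0) (h1 : qbracket q η (R a - R b + sg s) ≠ 0)
    (h2 : qbracket q η (R a - R b - sg s) ≠ 0) :
    (co q η s p.row p.col R * co q η s a.row a.col (mv s p.row p.col R) *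
        co q η s b.row b.col (mv s a.row a.col (mv s p.row p.col R)) -
      (q + q⁻¹) * (co q η s a.row a.col R * co q η s p.row p.col (mv s a.row a.col R) *
        co q η s b.row b.col (mv s p.row p.col (mv s a.row a.col R))) +
      co q η s a.row a.col R * co q η s b.row b.col (mv s a.row a.col R) *
        co q η s p.row p.col (mv s b.row b.col (mv s a.row a.col R))) +
    (co q η s p.row p.col R * co q η s b.row b.col (mv s p.row p.col R) *
        co q η s a.row a.col (mv s b.row b.col (mv s p.row p.col R)) -
      (q + q⁻¹) * (co q η s b.row b.col R * co q η s p.row p.col (mv s b.row b.col R) *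
        co q η s a.row a.col (mv s p.row p.col (mv s b.row b.col R))) +
      co q η s b.row b.col R * co q η s a.row a.col (mv s b.row b.col R) *
        co q η s p.row p.col (mv s a.row a.col (mv s b.row b.col R))) = 0 := by
  have hap : a ≠ p := by rintro rfl; omega
  have hbp : b ≠ p := by rintro rfl; omega
  have hb : b.row < n := by omega
  have hadj' : p.row + 1 = b.row ∨ b.row + 1 = p.row := by omega
  have sing : ∀ {c d : Pos n} (T : Tableau n), d ≠ c → mv s c.row c.col T d = T d :=
    fun T h => mv_other s h T
  rw [co_of_eq_pair (R := R) s hne hp rfl (fun _ _ _ => rfl),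
    co_of_eq_pair (R := R) s hbp ha (sing _ hap) (fun c hc hc' => sing _ hc'),
    co_of_eq_pair (S := mv s a.row a.col (mv s p.row p.col R)) (R := R) s hap hb
      ((sing _ hne.symm).trans (sing _ hbp)) (fun c hc hc' => (sing _ hc).trans (sing _ hc')),
    co_of_eq_pair (S := R) (R := R) s hbp ha rfl (fun _ _ _ => rfl),
    co_of_eq_pair (S := mv s a.row a.col R) (R := R) s hne hp
      (sing _ hap.symm) (fun c hc hc' => sing _ hc),
    co_of_eq_pair (S := mv s p.row p.col (mv s a.row a.col R)) (R := R) s hap hb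
      ((sing _ hbp).trans (sing _ hne.symm)) (fun c hc hc' => (sing _ hc').trans (sing _ hc)),
    co_of_eq_pair (S := mv s a.row a.col R) (R := R) s hap hb
      (sing _ hne.symm) (fun c hc hc' => sing _ hc),
    co_of_eq_pair (S := mv s b.row b.col (mv s a.row a.col R)) (R := R) s hne hp
      ((sing _ hbp.symm).trans (sing _ hap.symm)) (fun c hc hc' => (sing _ hc').trans (sing _ hc)),
    co_of_eq_pair (S := mv s p.row p.col R) (R := R) s hap hb
      (sing _ hbp) (fun c hc hc' => sing _ hc'),
    co_of_eq_pair (S := mv s b.row b.col (mv s p.row p.col R)) (R := R) s hbp ha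
      ((sing _ hne).trans (sing _ hap)) (fun c hc hc' => (sing _ hc).trans (sing _ hc')),
    co_of_eq_pair (S := R) (R := R) s hap hb rfl (fun _ _ _ => rfl),
    co_of_eq_pair (S := mv s b.row b.col R) (R := R) s hne hp
      (sing _ hbp.symm) (fun c hc hc' => sing _ hc'),
    co_of_eq_pair (S := mv s p.row p.col (mv s b.row b.col R)) (R := R) s hbp ha
      ((sing _ hap).trans (sing _ hne)) (fun c hc hc' => (sing _ hc').trans (sing _ hc)),
    co_of_eq_pair (S := mv s b.row b.col R) (R := R) s hbp ha
      (sing _ hne) (fun c hc hc' => sing _ hc),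
    co_of_eq_pair (S := mv s a.row a.col (mv s b.row b.col R)) (R := R) s hne hp
      ((sing _ hap.symm).trans (sing _ hbp.symm)) (fun c hc hc' => (sing _ hc).trans (sing _ hc'))]
  simp only [mv_self, sing _ hap, sing _ hbp, sing _ hap.symm, sing _ hbp.symm, sing _ hne,
    sing _ hne.symm, fac_row s hab hne.symm, fac_row s hab.symm hne]
  generalize corest q η s a {b, p} R = A
  generalize corest q η s b {a, p} R = B
  generalize corest q η s p {a, b} R = P
  rcases fac_adjacent (q := q) (η := η) s hadj with ⟨f1, f2⟩ | ⟨f1, f2⟩ <;>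
  rcases fac_adjacent (q := q) (η := η) s hadj' with ⟨f3, f4⟩ | ⟨f3, f4⟩
  · simp only [f1, f2, f3, f4]
    have key := qbracket_serre hη hq s (R p - R b) (R p - R a)
    rw [show R p - R b - (R p - R a) = R a - R b by ring,
      show R p - R a - (R p - R b) = R b - R a by ring,
      show (sg s : ℂ) - (R a - R b) = R b + sg s - R a by ring,
      show R a - R b + (sg s : ℂ) = R a + sg s - R b by ring,
      show R p - R a + (sg s : ℂ) = R p + sg s - R a by ring,
      show R p - R b + (sg s : ℂ) = R p + sg s - R b by ring] at key
    have key := key h0 (by convert h1 using 2; ring) h2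
    linear_combination A * B * P * key
  -- The positions `a` and `b` lie in the same row, so `p` cannot be in the numerator of just one of
  -- them: the same factor at `0` would be both `[0]_q = 0` and `1`.
  · have h7 := f1 0
    have h8 := f3 0
    exfalso
    simp only [fac, hab] at h7 h8
    have hpa : ¬ (p.row = a.row ∧ p ≠ a) := by omega
    have hpb : ¬ (p.row = a.row ∧ p ≠ b) := by omega
    rw [if_neg hpb] at h8
    rw [if_neg hpa, h8] at h7
    simp [qbracket] at h7
  · have h7 := f1 0
    have h8 := f3 0
    exfalso
    simp only [fac, hab] at h7 h8
    have hpa : ¬ (p.row = a.row ∧ p ≠ a) := by omega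
    have hpb : ¬ (p.row = a.row ∧ p ≠ b) := by omega
    rw [if_neg hpa] at h7
    rw [if_neg hpb, h7] at h8
    simp [qbracket] at h8
  · simp only [f1, f2, f3, f4]
    have key := qbracket_serre hη hq s (R a - R p) (R b - R p)
    rw [show R a - R p - (R b - R p) = R a - R b by ring,
      show R b - R p - (R a - R p) = R b - R a by ring,
      show (sg s : ℂ) - (R a - R b) = R b + sg s - R a by ring,
      show R a - R b + (sg s : ℂ) = R a + sg s - R b by ring,
      show R a - R p + (sg s : ℂ) = R a + sg s - R p by ring,
      show R b - R p + (sg s : ℂ) = R b + sg s - R p by ring] at key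
    have key := key h0 (by convert h1 using 2; ring) h2
    linear_combination A * B * P * key

theorem dif_zero_add_sg {x : ℂ} (s : Bool) (h : Dif η (x + sg s) 0) : Dif η x (-sg s) := by
  have := h.add_int (-sg s)
  push_cast at this
  rwa [add_neg_cancel_right, zero_add] at this

/-- All six compositions end at the same tableau, so only the sum of their coefficients matters. -/
theorem serre_op (hη : Complex.exp η = q) (hq : ∀ r : ℕ, 0 < r → q ^ r ≠ 1) (hC : Admissible C)
    (hL : IsRealization η C L) {R : Tableau n} (hR : R ∈ basisSet η C L) (s : Bool)
    {a b p : Pos n} (hab : b.row = a.row) (ha : a.row < n) (hp : p.row < n)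
    (hadj : p.row + 1 = a.row ∨ a.row + 1 = p.row) :
    (op q η C L s b.row b.col (op q η C L s a.row a.col (op q η C L s p.row p.col (tab η C L R))) -
      (q + q⁻¹) • op q η C L s b.row b.col
        (op q η C L s p.row p.col (op q η C L s a.row a.col (tab η C L R))) +
      op q η C L s p.row p.col
        (op q η C L s b.row b.col (op q η C L s a.row a.col (tab η C L R)))) +
    (op q η C L s a.row a.col (op q η C L s b.row b.col (op q η C L s p.row p.col (tab η C L R))) -
      (q + q⁻¹) • op q η C L s a.row a.col
        (op q η C L s p.row p.col (op q η C L s b.row b.col (tab η C L R))) +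
      op q η C L s p.row p.col
        (op q η C L s a.row a.col (op q η C L s b.row b.col (tab η C L R)))) = 0 := by
  have hb : b.row < n := by omega
  simp only [op_op_op_tab hη hq hC.1 hL hR s s s ha hb hp, op_op_op_tab hη hq hC.1 hL hR s s s hb ha hp,
    op_op_op_tab hη hq hC.1 hL hR s s s ha hp hb, op_op_op_tab hη hq hC.1 hL hR s s s hb hp ha,
    op_op_op_tab hη hq hC.1 hL hR s s s hp ha hb, op_op_op_tab hη hq hC.1 hL hR s s s hp hb ha]
  have t1 : mv s b.row b.col (mv s p.row p.col (mv s a.row a.col R)) =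
    mv s b.row b.col (mv s a.row a.col (mv s p.row p.col R)) := by rw [mv_comm s s a.row]
  have t2 : mv s p.row p.col (mv s b.row b.col (mv s a.row a.col R)) =
    mv s b.row b.col (mv s a.row a.col (mv s p.row p.col R)) := by
      rw [mv_comm s s b.row b.col p.row, mv_comm s s a.row a.col p.row]
  have t3 : mv s a.row a.col (mv s b.row b.col (mv s p.row p.col R)) =
    mv s b.row b.col (mv s a.row a.col (mv s p.row p.col R)) := by rw [mv_comm s s a.row]
  have t4 : mv s a.row a.col (mv s p.row p.col (mv s b.row b.col R)) =
    mv s b.row b.col (mv s a.row a.col (mv s p.row p.col R)) := by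
      rw [mv_comm s s b.row b.col p.row, mv_comm s s a.row]
  have t5 : mv s p.row p.col (mv s a.row a.col (mv s b.row b.col R)) =
    mv s b.row b.col (mv s a.row a.col (mv s p.row p.col R)) := by
      rw [mv_comm s s b.row b.col a.row, t2]
  rw [t1, t2, t3, t4, t5]
  -- If the common final tableau is outside the basis there is nothing to prove. If it is in the
  -- basis, `not_dif_one_of_shift` excludes the differences `±1` between `a` and `b`, which are the
  -- only possible poles besides difference `0`.
  by_cases hfin : mv s b.row b.col (mv s a.row a.col (mv s p.row p.col R)) ∈ basisSet η C L
  swap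
  · simp [tab_of_notMem hfin]
  by_cases hne : a = b
  · subst hne
    have := serre_coeff_same hη s ha hp hadj R
    simp only [smul_smul, ← sub_smul, ← add_smul]
    rw [this]; simp
  · have hap : a ≠ p := by rintro rfl; omega
    have hbp : b ≠ p := by rintro rfl; omega
    have hshift : ∀ c, mv s b.row b.col (mv s a.row a.col (mv s p.row p.col R)) c =
        R c + ((if c = a ∨ c = b ∨ c = p then sg s else 0 : ℤ) : ℂ) := by
      intro c
      simp only [mv_apply]
      by_cases h1 : c = a
      · subst h1; simp [hne, hap]
      · by_cases h2 : c = b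
        · subst h2; simp [h1, hbp]
        · by_cases h3 : c = p
          · subst h3; simp [h1, h2]
          · simp [h1, h2, h3]
    have hshift' : ∀ c, mv s b.row b.col (mv s a.row a.col (mv s p.row p.col R)) c =
        R c + ((if c = b ∨ c = a ∨ c = p then sg s else 0 : ℤ) : ℂ) := by
      intro c
      rw [hshift c]
      simp only [or_left_comm]
    have hpr : p.row ≠ a.row := by omega
    have d1 := not_dif_one_of_shift hη hq hC hR hfin hab.symm ha hne hpr s hshift
    have d2 := not_dif_one_of_shift hη hq hC hR hfin hab hb (Ne.symm hne) (by omega) s hshift'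
    have d3 : ¬ Dif η (R a - R b) (-1) := by
      intro h
      apply d2
      have := h.neg
      rwa [neg_sub, neg_neg] at this
    have := serre_coeff_ne hη hq s hab hne ha hp hadj R
      (qbracket_row_ne_zero hη hq hC hR hab.symm ha hne) ?_ ?_
    · simp only [smul_smul, ← sub_smul, ← add_smul]
      rw [this]; simp
    · rw [Ne, qbracket_eq_zero_iff hη hq]
      intro h
      have := dif_zero_add_sg s h
      cases s
      · exact d1 this
      · exact d3 this
    · rw [Ne, qbracket_eq_zero_iff hη hq]
      intro h
      have := h.add_int (sg s)
      rw [sub_add_cancel, zero_add] at this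
      cases s
      · exact d3 this
      · exact d1 this

end Serre

end QuantumGT

end

noncomputable section

namespace QuantumGT

/-! ### Partial fractions -/

section Lagrange

variable {F ι κ : Type*} [Field F] [DecidableEq ι]

/-- The two products are monic of the same degree, so their difference has smaller degree and equals
its Lagrange interpolation at the nodes `y`. -/
theorem lagrange_of_injOn (y : ι → F) (c : κ → F) (s : Finset ι) (t : Finset κ)
    (hcard : t.card = s.card) (hy : Set.InjOn y s) (W : F) :
    ∏ i ∈ t, (W - c i) = ∏ a ∈ s, (W - y a) + ∑ a ∈ s,
      (∏ i ∈ t, (y a - c i)) * (∏ b ∈ s.erase a, (y a - y b))⁻¹ * ∏ b ∈ s.erase a, (W - y b) := by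
  open Polynomial in
  have hs : (∏ i ∈ s, (X - C (y i)) : F[X]).Monic :=
    monic_prod_of_monic _ _ fun i _ => monic_X_sub_C _
  have hd : ∀ u : Finset ι, (∏ i ∈ u, (X - C (y i)) : F[X]).degree = u.card := fun u => by
    rw [degree_prod]; simp
  have ht : (∏ i ∈ t, (X - C (c i)) : F[X]).Monic :=
    monic_prod_of_monic _ _ fun i _ => monic_X_sub_C _
  have hd' : (∏ i ∈ t, (X - C (c i)) : F[X]).degree = t.card := by
    rw [degree_prod]; simp
  have key : (∏ i ∈ t, (X - C (c i)) - ∏ a ∈ s, (X - C (y a)) : F[X]) = ∑ a ∈ s,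
      C ((∏ i ∈ t, (y a - c i)) * (∏ b ∈ s.erase a, (y a - y b))⁻¹) *
        ∏ b ∈ s.erase a, (X - C (y b)) := by
    refine eq_of_degrees_lt_of_eval_index_eq (v := y) s hy ?_ ?_ ?_
    · refine lt_of_lt_of_eq (degree_sub_lt_left ?_ ?_ ?_) (hd'.trans (by rw [hcard]))
      · rw [hd', hd, hcard]
      · exact ht.ne_zero
      · rw [ht.leadingCoeff, hs.leadingCoeff]
    · refine lt_of_le_of_lt (degree_sum_le _ _) ?_
      rw [Finset.sup_lt_iff (WithBot.bot_lt_coe _)]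
      intro a ha
      rw [← smul_eq_C_mul]
      refine lt_of_le_of_lt (degree_smul_le _ _) ?_
      rw [hd]
      exact_mod_cast Finset.card_erase_lt_of_mem ha
    · intro a ha
      rw [eval_sub, eval_prod, eval_prod, eval_finsetSum, Finset.sum_eq_single_of_mem a ha,
        Finset.prod_eq_zero ha (by simp)]
      · have h0 : ∏ b ∈ s.erase a, (y a - y b) ≠ 0 := by
          rw [Finset.prod_ne_zero_iff]
          intro b hb
          rw [Finset.mem_erase] at hb
          exact sub_ne_zero.2 fun h => hb.1 (hy hb.2 ha h.symm)
        simp only [eval_mul, eval_C, eval_prod, eval_sub, eval_X, sub_zero]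
        rw [mul_assoc, inv_mul_cancel₀ h0, mul_one]
      · intro b hb hba
        rw [eval_mul, eval_prod, Finset.prod_eq_zero (s := s.erase b)
          (f := fun j => eval (y a) (X - C (y j))) (Finset.mem_erase.2 ⟨hba.symm, ha⟩) (by simp),
          mul_zero]
  have := congrArg (eval W) key
  simp only [eval_sub, eval_mul, eval_C, eval_prod, eval_X, eval_finsetSum] at this
  rw [← this]; ring

/-- Partial fractions where double poles are cancelled by double zeros of the numerator; the
coefficients at the double poles are zero. -/
theorem lagrange_of_double [DecidableEq κ] (y : ι → F) (c : κ → F) : ∀ (N : ℕ) (s : Finset ι) (t : Finset κ),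
    s.card = N → t.card = s.card →
    (∀ a ∈ s, ∀ b ∈ s, ∀ d ∈ s, a ≠ b → b ≠ d → a ≠ d → y a = y b → y b ≠ y d) →
    (∀ a ∈ s, ∀ b ∈ s, a ≠ b → y a = y b → ∃ i ∈ t, ∃ j ∈ t, i ≠ j ∧ c i = y a ∧ c j = y a) →
    ∀ W : F, ∏ i ∈ t, (W - c i) = ∏ a ∈ s, (W - y a) + ∑ a ∈ s,
      (∏ i ∈ t, (y a - c i)) * (∏ b ∈ s.erase a, (y a - y b))⁻¹ * ∏ b ∈ s.erase a, (W - y b) := by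
  intro N
  induction N using Nat.strong_induction_on with
  | _ N ih =>
    intro s t hN hcard hmult hdbl W
    by_cases hinj : Set.InjOn y s
    · exact lagrange_of_injOn y c s t hcard hinj W
    · obtain ⟨a, ha, b, hb, hab, hne⟩ : ∃ a ∈ s, ∃ b ∈ s, y a = y b ∧ a ≠ b := by
        simpa [Set.InjOn] using hinj
      obtain ⟨i, hi, j, hj, hij, hci, hcj⟩ := hdbl a ha b hb hne hab
      have hb' : b ∈ s.erase a := Finset.mem_erase.2 ⟨hne.symm, hb⟩
      have hj' : j ∈ t.erase i := Finset.mem_erase.2 ⟨hij.symm, hj⟩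
      -- A pair of equal nodes and a pair of zeros at the same place are removed together: both
      -- contribute the common factor `(W - y a)²`, and in the remaining coefficients these factors
      -- cancel because no third node coincides with `y a`.
      set s' := (s.erase a).erase b with hs'
      set t' := (t.erase i).erase j with ht'
      have hs'mem : ∀ d ∈ s', d ≠ a ∧ d ≠ b ∧ d ∈ s := by
        intro d hd
        rw [hs', Finset.mem_erase, Finset.mem_erase] at hd
        tauto
      have hS : ∀ V : F, ∏ d ∈ s, (V - y d) = (V - y a) ^ 2 * ∏ d ∈ s', (V - y d) := by
        intro V
        rw [← Finset.mul_prod_erase s _ ha, ← Finset.mul_prod_erase _ _ hb', ← hab]; ring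
      have hT : ∀ V : F, ∏ d ∈ t, (V - c d) = (V - y a) ^ 2 * ∏ d ∈ t', (V - c d) := by
        intro V
        rw [← Finset.mul_prod_erase t _ hi, ← Finset.mul_prod_erase _ _ hj', hci, hcj]; ring
      have hE : ∀ d ∈ s', ∀ V : F, ∏ x ∈ s.erase d, (V - y x) =
          (V - y a) ^ 2 * ∏ x ∈ s'.erase d, (V - y x) := by
        intro d hd V
        obtain ⟨h1, h2, h3⟩ := hs'mem d hd
        have ha1 : a ∈ s.erase d := Finset.mem_erase.2 ⟨h1.symm, ha⟩
        have hb1 : b ∈ (s.erase d).erase a :=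
          Finset.mem_erase.2 ⟨hne.symm, Finset.mem_erase.2 ⟨h2.symm, hb⟩⟩
        rw [← Finset.mul_prod_erase _ _ ha1, ← Finset.mul_prod_erase _ _ hb1, ← hab,
          Finset.erase_right_comm (s := s), Finset.erase_right_comm (s := s.erase a)]
        ring
      have hsc : s'.card + 2 = s.card := by
        rw [← Finset.card_erase_add_one ha, ← Finset.card_erase_add_one hb']
      have htc : t'.card + 2 = t.card := by
        rw [← Finset.card_erase_add_one hi, ← Finset.card_erase_add_one hj']
      have IH := ih s'.card (by omega) s' t' rfl (by omega) (by
        intro d hd e he f hf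
        exact hmult d (hs'mem d hd).2.2 e (hs'mem e he).2.2 f (hs'mem f hf).2.2) (by
        intro d hd e he hde hyde
        obtain ⟨h1, h2, h3⟩ := hs'mem d hd
        obtain ⟨i', hi', j', hj', hne', hc1, hc2⟩ := hdbl d h3 e (hs'mem e he).2.2 hde hyde
        have hyd : y d ≠ y a := by
          intro h
          exact hmult a ha b hb d h3 hne h2.symm h1.symm hab (by rw [← hab, h])
        have aux : ∀ l ∈ t, c l = y d → l ∈ t' := by
          intro l hl hcl
          rw [ht', Finset.mem_erase, Finset.mem_erase]
          refine ⟨?_, ?_, hl⟩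
          · rintro rfl; exact hyd (by rw [← hcl, hcj])
          · rintro rfl; exact hyd (by rw [← hcl, hci])
        exact ⟨i', aux i' hi' hc1, j', aux j' hj' hc2, hne', hc1, hc2⟩) W
      -- The terms of `a` and `b` vanish: the product of differences contains `0`, and its inverse
      -- is `0` by convention.
      rw [hT, IH, hS, ← Finset.add_sum_erase s _ ha, ← Finset.add_sum_erase _ _ hb', ← hs',
        Finset.prod_eq_zero (f := fun x => y a - y x) hb' (by rw [hab, sub_self]),
        Finset.prod_eq_zero (s := s.erase b) (f := fun x => y b - y x)
          (Finset.mem_erase.2 ⟨hne, ha⟩) (by rw [hab, sub_self]), inv_zero, mul_zero, zero_mul,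
        mul_zero, zero_mul, zero_add, zero_add, mul_add, Finset.mul_sum]
      congr 1
      refine Finset.sum_congr rfl fun d hd => ?_
      obtain ⟨h1, h2, h3⟩ := hs'mem d hd
      have hyd : y d - y a ≠ 0 := by
        refine sub_ne_zero.2 fun h => ?_
        exact hmult a ha b hb d h3 hne h2.symm h1.symm hab (by rw [← hab, h])
      rw [hT, hE d hd, hE d hd, mul_inv]
      field_simp

/-- The normalization of the partial fraction expansion at zero. -/
theorem lagrange_at_zero (y : ι → F) (c : κ → F) (s : Finset ι) (t : Finset κ) (u : ι → F)
    (heven : Even s.card) (hcard : t.card = s.card) (hy : ∀ a ∈ s, y a ≠ 0)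
    (h : ∀ W : F, ∏ i ∈ t, (W - c i) = ∏ a ∈ s, (W - y a) +
      ∑ a ∈ s, y a * u a * ∏ b ∈ s.erase a, (W - y b)) :
    1 - ∑ a ∈ s, u a = (∏ i ∈ t, c i) / ∏ a ∈ s, y a ∧
    ∀ W : F, ∏ i ∈ t, (W - c i) = (1 - ∑ a ∈ s, u a) * ∏ a ∈ s, (W - y a) +
      W * ∑ a ∈ s, u a * ∏ b ∈ s.erase a, (W - y b) := by
  have h2 : ∀ W : F, ∏ i ∈ t, (W - c i) = (1 - ∑ a ∈ s, u a) * ∏ a ∈ s, (W - y a) +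
      W * ∑ a ∈ s, u a * ∏ b ∈ s.erase a, (W - y b) := by
    intro W
    have e1 : ∑ a ∈ s, y a * u a * ∏ b ∈ s.erase a, (W - y b) =
        W * ∑ a ∈ s, u a * ∏ b ∈ s.erase a, (W - y b) -
          (∑ a ∈ s, u a) * ∏ a ∈ s, (W - y a) := by
      rw [Finset.mul_sum, Finset.sum_mul, ← Finset.sum_sub_distrib]
      refine Finset.sum_congr rfl fun a ha => ?_
      rw [← Finset.mul_prod_erase s _ ha]
      ring
    rw [h W, e1]; ring
  refine ⟨?_, h2⟩
  -- At `W = 0` only the constant term remains. The number of nodes is even, so the signs of the two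
  -- products disappear.
  have h3 := h2 0
  simp only [zero_sub, zero_mul, add_zero] at h3
  rw [Finset.prod_neg, Finset.prod_neg, hcard, heven.neg_one_pow, one_mul, one_mul] at h3
  rw [h3, mul_div_assoc, div_self, mul_one]
  exact Finset.prod_ne_zero_iff.2 hy

end Lagrange

end QuantumGT

end

noncomputable section

namespace QuantumGT

/-! ### The diagonal coefficients of a row -/

section RowCoeff

variable {n : ℕ} {q η : ℂ} {C : Set (Rel n)} {L : Tableau n}

theorem card_rowP {k : ℕ} (hk : k ≤ n) : (rowP n k).card = k := by
  have := sum_Icc_eq hk (fun _ => 1)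
  simpa using this.symm

instance : DecidableEq (Pos n) := inferInstanceAs (DecidableEq {p : ℕ × ℕ // _})

/-- The coefficient of `T(R)` in the result of lowering and then raising the position `a`. -/
def coLR (q η : ℂ) (R : Tableau n) (a : Pos n) : ℂ :=
  co q η false a.row a.col R * co q η true a.row a.col (mv false a.row a.col R)

/-- The coefficient of `T(R)` in the result of raising and then lowering the position `a`. -/
def coRL (q η : ℂ) (R : Tableau n) (a : Pos n) : ℂ :=
  co q η true a.row a.col R * co q η false a.row a.col (mv true a.row a.col R)

/-- `q ^ (a_k - a_{k+1})`. -/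
def kval (q η : ℂ) (R : Tableau n) (k : ℕ) : ℂ :=
  (∏ a ∈ rowP n k, qpow η (R a) ^ 2) /
    (q * (∏ a ∈ rowP n (k + 1), qpow η (R a)) * ∏ a ∈ rowP n (k - 1), qpow η (R a))

theorem sum_entry (R : Tableau n) {k : ℕ} (hk : k ≤ n) :
    ∑ i ∈ Finset.Icc 1 k, entry R k i = ∑ a ∈ rowP n k, R a := by
  rw [sum_Icc_eq hk]
  refine Finset.sum_congr rfl fun a ha => ?_
  rw [← mem_rowP.1 ha, entry_pos]

theorem weightExp_eq (R : Tableau n) {k : ℕ} (hk : k ≤ n) :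
    weightExp R k = ∑ a ∈ rowP n k, R a - ∑ a ∈ rowP n (k - 1), R a + k := by
  rw [weightExp, sum_entry R hk, sum_entry R (by omega)]

theorem kval_eq (hη : Complex.exp η = q) (R : Tableau n) {k : ℕ} (hk : k < n) :
    qpow η (weightExp R k - weightExp R (k + 1)) = kval q η R k := by
  rw [weightExp_eq R hk.le, weightExp_eq R (k := k + 1) hk, Nat.add_sub_cancel]
  rw [show (∑ a ∈ rowP n k, R a - ∑ a ∈ rowP n (k - 1), R a + k -
    (∑ a ∈ rowP n (k + 1), R a - ∑ a ∈ rowP n k, R a + ((k + 1 : ℕ) : ℂ))) =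
    2 * ∑ a ∈ rowP n k, R a - (1 + ∑ a ∈ rowP n (k + 1), R a + ∑ a ∈ rowP n (k - 1), R a) by
      push_cast; ring, qpow_sub, qpow_add, qpow_add, qpow_two_mul, qpow_sum, qpow_sum, qpow_sum,
    qpow_one hη, kval, Finset.prod_pow]

theorem kval_ne_zero (hη : Complex.exp η = q) (R : Tableau n) {k : ℕ} (hk : k < n) :
    kval q η R k ≠ 0 := by rw [← kval_eq hη R hk]; exact qpow_ne_zero _ _

theorem qbracket_sub (q η x y : ℂ) : qbracket q η (x - y) =
    (qpow η x ^ 2 - qpow η y ^ 2) / ((q - q⁻¹) * qpow η y * qpow η x) := by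
  have hx := qpow_ne_zero η x
  have hy := qpow_ne_zero η y
  by_cases h : q - q⁻¹ = 0
  · rw [qbracket, h]; simp
  · rw [qbracket, qpow_neg, qpow_sub]
    field_simp

theorem prod_qbracket_sub (s : Finset (Pos n)) (R : Tableau n) (x : ℂ) :
    ∏ c ∈ s, qbracket q η (R c - x) = (∏ c ∈ s, (qpow η (R c) ^ 2 - qpow η x ^ 2)) /
      (((q - q⁻¹) * qpow η x) ^ s.card * ∏ c ∈ s, qpow η (R c)) := by
  simp only [qbracket_sub, Finset.prod_div_distrib, Finset.prod_mul_distrib, Finset.prod_const]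
  rw [mul_pow]

/-- The nodes of the partial fraction expansion belonging to a row. -/
def node (q η : ℂ) (R : Tableau n) (p : Pos n × Bool) : ℂ :=
  if p.2 then q ^ 2 * qpow η (R p.1) ^ 2 else qpow η (R p.1) ^ 2

/-- The zeros of the partial fraction expansion belonging to the row `k`. -/
def zeroNode (q η : ℂ) (R : Tableau n) (k : ℕ) (c : Pos n) : ℂ :=
  if c.row = k + 1 then q ^ 2 * qpow η (R c) ^ 2 else qpow η (R c) ^ 2

/-- The indices of the nodes of row `k`. -/
def nodes (n k : ℕ) : Finset (Pos n × Bool) := rowP n k ×ˢ Finset.univ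

theorem mem_nodes {k : ℕ} {p : Pos n × Bool} : p ∈ nodes n k ↔ p.1.row = k := by
  simp [nodes, mem_rowP]

theorem prod_nodes_erase {k : ℕ} {a : Pos n} (ha : a.row = k) (b : Bool) (F : Pos n × Bool → ℂ) :
    ∏ p ∈ (nodes n k).erase (a, b), F p =
      F (a, !b) * ((∏ c ∈ (rowP n k).erase a, F (c, false)) * ∏ c ∈ (rowP n k).erase a, F (c, true)) := by
  have h : (nodes n k).erase (a, b) =
      insert (a, !b) (((rowP n k).erase a) ×ˢ (Finset.univ : Finset Bool)) := by
    ext ⟨c, b'⟩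
    simp only [Finset.mem_erase, mem_nodes, Finset.mem_insert, Finset.mem_product, mem_rowP,
      Finset.mem_univ, and_true, Prod.mk.injEq, Ne, not_and]
    by_cases hca : c = a
    · subst hca; cases b <;> cases b' <;> simp [ha]
    · simp [hca]
  rw [h, Finset.prod_insert (by simp), Finset.prod_product, ← Finset.prod_mul_distrib]
  congr 1
  refine Finset.prod_congr rfl fun c _ => ?_
  rw [Fintype.prod_bool, mul_comm]

theorem prod_sub_comm {ι : Type*} (s : Finset ι) (x : ℂ) (f : ι → ℂ) :
    ∏ i ∈ s, (x - f i) = (-1) ^ s.card * ∏ i ∈ s, (f i - x) := by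
  rw [← Finset.prod_neg]
  exact Finset.prod_congr rfl fun i _ => (neg_sub _ _).symm

/-- The zero nodes belong to the rows above and below. -/
theorem prod_zeroNode {k : ℕ} (x : ℂ) (R : Tableau n) :
    ∏ c ∈ rowP n (k + 1) ∪ rowP n (k - 1), (x - zeroNode q η R k c) =
      (∏ c ∈ rowP n (k + 1), (x - q ^ 2 * qpow η (R c) ^ 2)) *
        ∏ c ∈ rowP n (k - 1), (x - qpow η (R c) ^ 2) := by
  rw [Finset.prod_union]
  · congr 1
    · refine Finset.prod_congr rfl fun c hc => ?_
      rw [zeroNode, if_pos (mem_rowP.1 hc)]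
    · refine Finset.prod_congr rfl fun c hc => ?_
      rw [zeroNode, if_neg (by rw [mem_rowP.1 hc]; omega)]
  · rw [Finset.disjoint_left]
    intro c hc hc'
    rw [mem_rowP] at hc hc'
    omega

/-- The coefficients of the partial fraction expansion. -/
def pfCoeff (q η : ℂ) (R : Tableau n) (k : ℕ) (p : Pos n × Bool) : ℂ :=
  (∏ c ∈ rowP n (k + 1) ∪ rowP n (k - 1), (node q η R p - zeroNode q η R k c)) *
    (∏ b ∈ (nodes n k).erase p, (node q η R p - node q η R b))⁻¹ / node q η R p

/-- Written in the squares `q^{2r}`, the brackets of the lowering coefficient and of the raising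
coefficient together form the zeros and the nodes of the partial fraction expansion at the node
`q^{2r_a}`; the remaining monomials assemble to `kval`. Raising first gives the node `q^{2r_a + 2}`
in the same way, with the opposite sign (`coRL_eq`). -/
theorem coLR_eq (hη : Complex.exp η = q) (hq : ∀ r : ℕ, 0 < r → q ^ r ≠ 1) (R : Tableau n)
    {k : ℕ} {a : Pos n} (ha : a.row = k) (hk : k < n) :
    coLR q η R a = pfCoeff q η R k (a, false) * kval q η R k / (q - q⁻¹) := by
  have hq0 : q ≠ 0 := by rw [← hη]; exact Complex.exp_ne_zero _
  have hl := sub_inv_ne_zero hη hq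
  have hx := qpow_ne_zero η (R a)
  obtain ⟨j, rfl⟩ : ∃ j, k = j + 1 := ⟨k - 1, by have := a.row_pos; omega⟩
  have haJ : a ∈ rowP n (j + 1) := mem_rowP.2 ha
  rw [coLR, co, co, gtCoeff_eq R (src_le _ (by omega)), gtCoeff_eq _ (src_le _ (by omega)), mv_self,
    kval, pfCoeff, prod_zeroNode, prod_nodes_erase ha]
  simp only [src, sg, ha, Bool.false_eq_true, if_true, if_false, Nat.add_sub_cancel, node,
    Bool.not_false]
  have e1 : ∀ c ∈ rowP n (j + 1 + 1), qbracket q η (mv false (j + 1) a.col R c - (R a + ((-1 : ℤ) : ℂ))) =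
      qbracket q η (R c - (R a + ((-1 : ℤ) : ℂ))) := by
    intro c hc
    rw [mem_rowP] at hc
    rw [← ha, mv_other]
    rintro rfl; omega
  have e2 : ∀ c ∈ (rowP n (j + 1)).erase a,
      qbracket q η (mv false (j + 1) a.col R c - (R a + ((-1 : ℤ) : ℂ))) =
      qbracket q η (R c - (R a + ((-1 : ℤ) : ℂ))) := by
    intro c hc
    rw [← ha, mv_other _ (Finset.ne_of_mem_erase hc)]
  rw [Finset.prod_congr rfl e1, Finset.prod_congr rfl e2]
  simp only [prod_qbracket_sub]
  rw [card_rowP (by omega), card_rowP (by omega), Finset.card_erase_of_mem haJ, card_rowP (by omega),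
    prod_sub_comm, prod_sub_comm, prod_sub_comm, prod_sub_comm, card_rowP (by omega),
    card_rowP (by omega), Finset.card_erase_of_mem haJ, card_rowP (by omega), Nat.add_sub_cancel,
    ← Finset.mul_prod_erase _ (fun c => qpow η (R c) ^ 2) haJ, Finset.prod_pow]
  have e3 : qpow η (R a + ((-1 : ℤ) : ℂ)) = qpow η (R a) / q := by
    rw [qpow_add, qpow_int hη, zpow_neg, zpow_one, div_eq_mul_inv]
  rw [e3]
  have e4 : ∀ s : Finset (Pos n), ∏ c ∈ s, (qpow η (R c) ^ 2 - (qpow η (R a) / q) ^ 2) =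
      (∏ c ∈ s, (q ^ 2 * qpow η (R c) ^ 2 - qpow η (R a) ^ 2)) / (q ^ 2) ^ s.card := by
    intro s
    rw [← Finset.prod_const, ← Finset.prod_div_distrib]
    refine Finset.prod_congr rfl fun c _ => ?_
    field_simp
  rw [e4, e4, card_rowP (by omega), Finset.card_erase_of_mem haJ, card_rowP (by omega),
    Nat.add_sub_cancel]
  have p1 : ∏ c ∈ rowP n j, qpow η (R c) ≠ 0 := Finset.prod_ne_zero_iff.2 fun _ _ => qpow_ne_zero _ _
  have p2 : ∏ c ∈ rowP n (j + 1 + 1), qpow η (R c) ≠ 0 :=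
    Finset.prod_ne_zero_iff.2 fun _ _ => qpow_ne_zero _ _
  have p3 : ∏ c ∈ (rowP n (j + 1)).erase a, qpow η (R c) ≠ 0 :=
    Finset.prod_ne_zero_iff.2 fun _ _ => qpow_ne_zero _ _
  have hq2 : 1 - q ^ 2 ≠ 0 := sub_ne_zero.2 (hq 2 (by omega)).symm
  have hlq : q - q⁻¹ = -(1 - q ^ 2) / q := by field_simp; ring
  rw [hlq]
  generalize ∏ c ∈ rowP n j, qpow η (R c) = P at *
  generalize ∏ c ∈ rowP n (j + 1 + 1), qpow η (R c) = S at *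
  generalize ∏ c ∈ (rowP n (j + 1)).erase a, qpow η (R c) = Y at *
  generalize ∏ c ∈ rowP n j, (qpow η (R c) ^ 2 - qpow η (R a) ^ 2) = A1
  generalize ∏ c ∈ rowP n (j + 1 + 1), (q ^ 2 * qpow η (R c) ^ 2 - qpow η (R a) ^ 2) = A2
  generalize ∏ c ∈ (rowP n (j + 1)).erase a, (qpow η (R c) ^ 2 - qpow η (R a) ^ 2) = B1
  generalize ∏ c ∈ (rowP n (j + 1)).erase a, (q ^ 2 * qpow η (R c) ^ 2 - qpow η (R a) ^ 2) = B2
  generalize qpow η (R a) = x at *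
  have hm : ((-1 : ℂ) ^ j) ≠ 0 := pow_ne_zero _ (by norm_num)
  have hm2 : ((-1 : ℂ) ^ j) * (-1) ^ j = 1 := by rw [← mul_pow]; simp
  rw [show x ^ 2 - q ^ 2 * x ^ 2 = (1 - q ^ 2) * x ^ 2 by ring]
  generalize 1 - q ^ 2 = l at *
  simp only [mul_inv, div_eq_mul_inv, pow_succ, mul_pow, inv_inv]
  -- If a denominator vanishes then both sides are `0` by the convention for inverses. This is
  -- needed because the intermediate tableau may have equal entries in a row.
  by_cases hB1 : B1 = 0
  · simp [hB1]
  by_cases hB2 : B2 = 0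
  · simp [hB2]
  generalize (-1 : ℂ) ^ j = m at *
  have hlj : (-l) ^ j ≠ 0 := pow_ne_zero _ (neg_ne_zero.2 hq2)
  push_cast
  field_simp

theorem coRL_eq (hη : Complex.exp η = q) (hq : ∀ r : ℕ, 0 < r → q ^ r ≠ 1) (R : Tableau n)
    {k : ℕ} {a : Pos n} (ha : a.row = k) (hk : k < n) :
    coRL q η R a = -(pfCoeff q η R k (a, true) * kval q η R k / (q - q⁻¹)) := by
  have hq0 : q ≠ 0 := by rw [← hη]; exact Complex.exp_ne_zero _
  have hl := sub_inv_ne_zero hη hq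
  have hx := qpow_ne_zero η (R a)
  obtain ⟨j, rfl⟩ : ∃ j, k = j + 1 := ⟨k - 1, by have := a.row_pos; omega⟩
  have haJ : a ∈ rowP n (j + 1) := mem_rowP.2 ha
  rw [coRL, co, co, gtCoeff_eq R (src_le _ (by omega)), gtCoeff_eq _ (src_le _ (by omega)), mv_self,
    kval, pfCoeff, prod_zeroNode, prod_nodes_erase ha]
  simp only [src, sg, ha, Bool.false_eq_true, if_true, if_false, Nat.add_sub_cancel, node,
    Bool.not_true]
  have e1 : ∀ c ∈ rowP n j, qbracket q η (mv true (j + 1) a.col R c - (R a + ((1 : ℤ) : ℂ))) =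
      qbracket q η (R c - (R a + ((1 : ℤ) : ℂ))) := by
    intro c hc
    rw [mem_rowP] at hc
    rw [← ha, mv_other]
    rintro rfl; omega
  have e2 : ∀ c ∈ (rowP n (j + 1)).erase a,
      qbracket q η (mv true (j + 1) a.col R c - (R a + ((1 : ℤ) : ℂ))) =
      qbracket q η (R c - (R a + ((1 : ℤ) : ℂ))) := by
    intro c hc
    rw [← ha, mv_other _ (Finset.ne_of_mem_erase hc)]
  rw [Finset.prod_congr rfl e1, Finset.prod_congr rfl e2]
  simp only [prod_qbracket_sub]
  have e3 : qpow η (R a + ((1 : ℤ) : ℂ)) = q * qpow η (R a) := by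
    rw [qpow_add, qpow_int hη, zpow_one, mul_comm]
  have e4 : ∀ s : Finset (Pos n), ∏ c ∈ s, (q ^ 2 * qpow η (R a) ^ 2 - q ^ 2 * qpow η (R c) ^ 2) =
      (q ^ 2) ^ s.card * ((-1) ^ s.card * ∏ c ∈ s, (qpow η (R c) ^ 2 - qpow η (R a) ^ 2)) := by
    intro s
    rw [← prod_sub_comm, ← Finset.prod_const, ← Finset.prod_mul_distrib]
    refine Finset.prod_congr rfl fun c _ => ?_
    ring
  rw [card_rowP (by omega), card_rowP (by omega), Finset.card_erase_of_mem haJ, card_rowP (by omega),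
    e4, e4, prod_sub_comm, prod_sub_comm, card_rowP (by omega),
    card_rowP (by omega), Finset.card_erase_of_mem haJ, card_rowP (by omega), Nat.add_sub_cancel,
    ← Finset.mul_prod_erase _ (fun c => qpow η (R c) ^ 2) haJ, Finset.prod_pow, e3]
  have p1 : ∏ c ∈ rowP n j, qpow η (R c) ≠ 0 := Finset.prod_ne_zero_iff.2 fun _ _ => qpow_ne_zero _ _
  have p2 : ∏ c ∈ rowP n (j + 1 + 1), qpow η (R c) ≠ 0 :=
    Finset.prod_ne_zero_iff.2 fun _ _ => qpow_ne_zero _ _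
  have p3 : ∏ c ∈ (rowP n (j + 1)).erase a, qpow η (R c) ≠ 0 :=
    Finset.prod_ne_zero_iff.2 fun _ _ => qpow_ne_zero _ _
  have hq2 : 1 - q ^ 2 ≠ 0 := sub_ne_zero.2 (hq 2 (by omega)).symm
  have hlq : q - q⁻¹ = -(1 - q ^ 2) / q := by field_simp; ring
  rw [hlq]
  simp only [mul_pow q]
  generalize ∏ c ∈ rowP n j, qpow η (R c) = P at *
  generalize ∏ c ∈ rowP n (j + 1 + 1), qpow η (R c) = S at *
  generalize ∏ c ∈ (rowP n (j + 1)).erase a, qpow η (R c) = Y at *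
  generalize ∏ c ∈ rowP n j, (qpow η (R c) ^ 2 - q ^ 2 * qpow η (R a) ^ 2) = A1
  generalize ∏ c ∈ rowP n (j + 1 + 1), (qpow η (R c) ^ 2 - qpow η (R a) ^ 2) = A2
  generalize ∏ c ∈ (rowP n (j + 1)).erase a, (qpow η (R c) ^ 2 - qpow η (R a) ^ 2) = B1
  generalize ∏ c ∈ (rowP n (j + 1)).erase a, (qpow η (R c) ^ 2 - q ^ 2 * qpow η (R a) ^ 2) = B2
  generalize qpow η (R a) = x at *
  have hm : ((-1 : ℂ) ^ j) ≠ 0 := pow_ne_zero _ (by norm_num)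
  rw [show q ^ 2 * x ^ 2 - x ^ 2 = -((1 - q ^ 2) * x ^ 2) by ring]
  generalize 1 - q ^ 2 = l at *
  simp only [mul_inv, div_eq_mul_inv, pow_succ, mul_pow, inv_inv]
  by_cases hB1 : B1 = 0
  · simp [hB1]
  by_cases hB2 : B2 = 0
  · simp [hB2]
  generalize (-1 : ℂ) ^ j = m at *
  have hlj : (-l) ^ j ≠ 0 := pow_ne_zero _ (neg_ne_zero.2 hq2)
  push_cast
  field_simp

/-- The heights of two nodes that coincide. -/
theorem dif_of_node_eq (hη : Complex.exp η = q) {R : Tableau n} {a b : Pos n} {m : ℕ}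
    (h : qpow η (R a) ^ 2 = (q ^ m) ^ 2 * qpow η (R b) ^ 2) : Dif η (R a - R b) m := by
  have hb := qpow_ne_zero η (R b)
  have hq0 : q ≠ 0 := by rw [← hη]; exact Complex.exp_ne_zero _
  rw [dif_iff, qpow_two_mul, qpow_sub, qpow_sub, qpow_int hη, zpow_natCast, div_pow, div_pow, h]
  field_simp

theorem node_eq_of_dif (hη : Complex.exp η = q) {R : Tableau n} {a b : Pos n} {m : ℕ}
    (h : Dif η (R a - R b) m) : qpow η (R a) ^ 2 = (q ^ m) ^ 2 * qpow η (R b) ^ 2 := by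
  have hb := qpow_ne_zero η (R b)
  have hq0 : q ≠ 0 := by rw [← hη]; exact Complex.exp_ne_zero _
  rw [dif_iff, qpow_two_mul, qpow_sub, qpow_sub, qpow_int hη, zpow_natCast, div_pow, div_pow] at h
  field_simp at h
  rw [h, mul_comm]

theorem sq_ne_sq_row (hη : Complex.exp η = q) (hq : ∀ r : ℕ, 0 < r → q ^ r ≠ 1)
    (hC : Admissible C) {R : Tableau n} (hR : R ∈ basisSet η C L)
    {a b : Pos n} (hab : a.row = b.row) (ha : a.row < n) (hne : a ≠ b) :
    qpow η (R a) ^ 2 ≠ qpow η (R b) ^ 2 := by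
  intro h
  apply qbracket_row_ne_zero hη hq hC hR hab ha hne
  rw [qbracket_sub, h, sub_self, zero_div]

/-- Where two nodes of a row coincide, so do two of the zeros. -/
theorem exists_zeroNode (hη : Complex.exp η = q) (hq : ∀ r : ℕ, 0 < r → q ^ r ≠ 1)
    (hC : Admissible C) {R : Tableau n} (hR : R ∈ basisSet η C L) {a b : Pos n} (hab : b.row = a.row)
    (ha : a.row < n) (h : qpow η (R a) ^ 2 = q ^ 2 * qpow η (R b) ^ 2) :
    ∃ i ∈ rowP n (a.row + 1) ∪ rowP n (a.row - 1), ∃ j ∈ rowP n (a.row + 1) ∪ rowP n (a.row - 1),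
      i ≠ j ∧ zeroNode q η R a.row i = qpow η (R a) ^ 2 ∧
      zeroNode q η R a.row j = qpow η (R a) ^ 2 := by
  have hm : Dif η (R a - R b) 1 := by
    have := dif_of_node_eq (m := 1) hη (by rw [pow_one]; exact h)
    exact_mod_cast this
  have hcol : a.col < b.col := by
    rcases lt_trichotomy a.col b.col with h1 | h1 | h1
    · exact h1
    · exfalso
      obtain rfl := Pos.ext_iff'.2 ⟨hab.symm, h1⟩
      rw [sub_self] at hm
      have h3 := hm.unique hη hq (m' := 0) (by exact_mod_cast dif_int η 0)
      omega
    · exfalso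
      have h2 := hm.neg
      rw [neg_sub] at h2
      have := pos_of_dif hη hq hC hR hab (by omega) h1 h2
      omega
  have up : ∀ u : Pos n, u.row = a.row + 1 → Dif η (R a - R u) 1 →
      zeroNode q η R a.row u = qpow η (R a) ^ 2 := by
    intro u hu hd
    rw [zeroNode, if_pos hu]
    have := node_eq_of_dif (m := 1) hη (by exact_mod_cast hd)
    rw [this, pow_one]
  -- Difference exactly `1` makes the separating chains tight. Either the zeros come from one
  -- position above and one below the row, or both come from the row above.
  rcases separated_cases hC hR hab.symm ha hcol hm with
    ⟨u, v, h1, h2, h3, h4, h5, h6⟩ | ⟨u, v, h1, h2, h3, h4, h5, h6⟩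
  · obtain ⟨d3, hd3, g3⟩ := dif_of_gt hR h3
    obtain ⟨d4, hd4, g4⟩ := dif_of_ge hR h4
    obtain ⟨d5, hd5, g5⟩ := dif_of_ge hR h5
    obtain ⟨d6, hd6, g6⟩ := dif_of_gt hR h6
    have e1 := g3.add g4
    rw [sub_add_sub_cancel] at e1
    have e1 := e1.unique hη hq hm
    have e2 := g5.add g6
    rw [sub_add_sub_cancel] at e2
    have e2 := e2.unique hη hq hm
    obtain rfl : d3 = 1 := by omega
    obtain rfl : d5 = 0 := by omega
    refine ⟨u, by simp [mem_rowP, h1], v, ?_, by rintro rfl; omega, up u h1 g3, ?_⟩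
    · simp only [Finset.mem_union, mem_rowP]; omega
    · rw [zeroNode, if_neg (by omega)]
      have := node_eq_of_dif (m := 0) hη (by exact_mod_cast g5)
      rw [this]; simp
  · obtain ⟨d4, hd4, g4⟩ := dif_of_succEq hR h4
    obtain ⟨d5, hd5, g5⟩ := dif_of_gt hR h5
    obtain ⟨d6, hd6, g6⟩ := dif_of_ge hR h6
    have e0 := g5.add g4
    rw [sub_add_sub_cancel] at e0
    have e1 := e0.add g6
    rw [sub_add_sub_cancel] at e1
    have e1 := e1.unique hη hq hm
    obtain rfl : d5 = 1 := by omega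
    obtain rfl : d4 = 0 := by omega
    exact ⟨u, by simp [mem_rowP, h1], v, by simp [mem_rowP, h2], by rintro rfl; omega, up u h1 g5,
      up v h2 e0⟩

theorem node_ne_zero (hη : Complex.exp η = q) (R : Tableau n) (p : Pos n × Bool) :
    node q η R p ≠ 0 := by
  have hq0 : q ≠ 0 := by rw [← hη]; exact Complex.exp_ne_zero _
  have := qpow_ne_zero η (R p.1)
  rw [node]; split_ifs <;> positivity

/-- The partial fraction expansion of a row. -/
theorem row_lagrange (hη : Complex.exp η = q) (hq : ∀ r : ℕ, 0 < r → q ^ r ≠ 1)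
    (hC : Admissible C) {R : Tableau n} (hR : R ∈ basisSet η C L) {k : ℕ} (hk1 : 1 ≤ k)
    (hk : k < n) :
    1 - ∑ p ∈ nodes n k, pfCoeff q η R k p = (kval q η R k ^ 2)⁻¹ ∧
    ∀ W : ℂ, (∏ c ∈ rowP n (k + 1), (W - q ^ 2 * qpow η (R c) ^ 2)) *
        ∏ c ∈ rowP n (k - 1), (W - qpow η (R c) ^ 2) =
      (kval q η R k ^ 2)⁻¹ * ∏ p ∈ nodes n k, (W - node q η R p) +
      W * ∑ p ∈ nodes n k, pfCoeff q η R k p * ∏ b ∈ (nodes n k).erase p, (W - node q η R b) := by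
  have hq0 : q ≠ 0 := by rw [← hη]; exact Complex.exp_ne_zero _
  have hcardN : (nodes n k).card = 2 * k := by
    rw [nodes, Finset.card_product, card_rowP hk.le]; simp [mul_comm]
  have hdisj : Disjoint (rowP n (k + 1)) (rowP n (k - 1)) := by
    rw [Finset.disjoint_left]
    intro c hc hc'
    rw [mem_rowP] at hc hc'
    omega
  have hcardZ : (rowP n (k + 1) ∪ rowP n (k - 1)).card = (nodes n k).card := by
    rw [Finset.card_union_of_disjoint hdisj, card_rowP (by omega), card_rowP (by omega), hcardN]
    omega
  have same : ∀ a b : Pos n, ∀ s : Bool, a.row = k → b.row = k →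
      node q η R (a, s) = node q η R (b, s) → a = b := by
    intro a b s ha hb h
    by_contra hne
    apply sq_ne_sq_row hη hq hC hR (ha.trans hb.symm) (by omega) hne
    cases s
    · simpa [node] using h
    · simpa [node, hq0] using h
  -- Nodes of the same kind are distinct because the squares `q^{2r}` in a row are. Hence at most
  -- two nodes coincide, one of each kind, and for such a pair `exists_zeroNode` provides the double
  -- zero.
  have H := lagrange_of_double (node q η R) (zeroNode q η R k) _ (nodes n k)
    (rowP n (k + 1) ∪ rowP n (k - 1)) rfl hcardZ (by
      rintro ⟨a, s⟩ ha ⟨b, s'⟩ hb ⟨d, s''⟩ hd h1 h2 h3 h4 h5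
      rw [mem_nodes] at ha hb hd
      have : s = s' ∨ s' = s'' ∨ s = s'' := by
        cases s <;> cases s' <;> cases s'' <;> simp
      rcases this with rfl | rfl | rfl
      · exact h1 (by rw [same a b s ha hb h4])
      · exact h2 (by rw [same b d s' hb hd h5])
      · exact h3 (by rw [same a d s ha hd (h4.trans h5)])) (by
      rintro ⟨a, s⟩ ha ⟨b, s'⟩ hb hne hab
      rw [mem_nodes] at ha hb
      simp only at ha hb
      by_cases hs : s = s'
      · subst hs
        exact absurd (by rw [same a b s ha hb hab]) hne
      · cases s
        · obtain rfl : s' = true := by simpa using hs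
          obtain ⟨i, hi, j, hj, hij, h1, h2⟩ := exists_zeroNode hη hq hC hR (hb.trans ha.symm)
            (by omega) (by simpa [node] using hab)
          rw [ha] at hi hj h1 h2
          exact ⟨i, hi, j, hj, hij, by simpa [node] using h1, by simpa [node] using h2⟩
        · obtain rfl : s' = false := by simpa using hs
          obtain ⟨i, hi, j, hj, hij, h1, h2⟩ := exists_zeroNode hη hq hC hR (ha.trans hb.symm)
            (by omega) (by simpa [node] using hab.symm)
          rw [hb] at hi hj h1 h2
          rw [hab]
          exact ⟨i, hi, j, hj, hij, by simpa [node] using h1, by simpa [node] using h2⟩)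
  obtain ⟨h1, h2⟩ := lagrange_at_zero (node q η R) (zeroNode q η R k) (nodes n k)
    (rowP n (k + 1) ∪ rowP n (k - 1)) (pfCoeff q η R k) (by rw [hcardN]; exact even_two_mul k) hcardZ
    (fun p _ => node_ne_zero hη R p) (fun W => by
      rw [H W]
      congr 1
      refine Finset.sum_congr rfl fun p _ => ?_
      rw [pfCoeff, mul_div_cancel₀ _ (node_ne_zero hη R p)])
  -- The constant in the expansion is the product of the zeros over the product of the nodes, a pure
  -- monomial.
  have h3 : (∏ i ∈ rowP n (k + 1) ∪ rowP n (k - 1), zeroNode q η R k i) /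
      ∏ p ∈ nodes n k, node q η R p = (kval q η R k ^ 2)⁻¹ := by
    have e1 := prod_zeroNode (q := q) (η := η) (k := k) 0 R
    simp only [zero_sub] at e1
    rw [Finset.prod_neg, Finset.prod_neg, Finset.prod_neg, hcardZ, hcardN, card_rowP (by omega),
      card_rowP (by omega), (even_two_mul k).neg_one_pow, one_mul, mul_mul_mul_comm, ← pow_add,
      show k + 1 + (k - 1) = 2 * k by omega, (even_two_mul k).neg_one_pow, one_mul] at e1
    rw [e1, nodes, Finset.prod_product, kval]
    simp only [Fintype.prod_bool, node, if_true, Bool.false_eq_true, if_false,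
      Finset.prod_mul_distrib, Finset.prod_const, Finset.prod_pow]
    rw [card_rowP (by omega), card_rowP (by omega)]
    have p1 : ∏ c ∈ rowP n (k - 1), qpow η (R c) ≠ 0 :=
      Finset.prod_ne_zero_iff.2 fun _ _ => qpow_ne_zero _ _
    have p2 : ∏ c ∈ rowP n (k + 1), qpow η (R c) ≠ 0 :=
      Finset.prod_ne_zero_iff.2 fun _ _ => qpow_ne_zero _ _
    have p3 : ∏ c ∈ rowP n k, qpow η (R c) ≠ 0 :=
      Finset.prod_ne_zero_iff.2 fun _ _ => qpow_ne_zero _ _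
    field_simp
    rw [pow_succ, mul_comm]
  rw [h3] at h1
  refine ⟨h1, fun W => ?_⟩
  rw [← prod_zeroNode, h2, h1]

theorem sum_nodes {k : ℕ} (F : Pos n × Bool → ℂ) :
    ∑ p ∈ nodes n k, F p = ∑ a ∈ rowP n k, (F (a, false) + F (a, true)) := by
  rw [nodes, Finset.sum_product]
  refine Finset.sum_congr rfl fun a _ => ?_
  rw [Fintype.sum_bool, add_comm]

/-- The commutator of raising and lowering in a row. -/
theorem sum_coLR_sub_coRL (hη : Complex.exp η = q) (hq : ∀ r : ℕ, 0 < r → q ^ r ≠ 1)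
    (hC : Admissible C) {R : Tableau n} (hR : R ∈ basisSet η C L) {k : ℕ} (hk1 : 1 ≤ k)
    (hk : k < n) : ∑ a ∈ rowP n k, (coLR q η R a - coRL q η R a) =
      (q - q⁻¹)⁻¹ * (kval q η R k - (kval q η R k)⁻¹) := by
  have h := (row_lagrange hη hq hC hR hk1 hk).1
  have hK := kval_ne_zero hη R hk
  have hl := sub_inv_ne_zero hη hq
  -- The difference of the two diagonal coefficients is a common factor times the coefficients at
  -- both nodes of `a`; their sum over the row is the normalization at zero in `row_lagrange`.
  have e : ∀ a ∈ rowP n k, coLR q η R a - coRL q η R a =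
      (pfCoeff q η R k (a, false) + pfCoeff q η R k (a, true)) * (kval q η R k / (q - q⁻¹)) := by
    intro a ha
    rw [coLR_eq hη hq R (mem_rowP.1 ha) hk, coRL_eq hη hq R (mem_rowP.1 ha) hk]
    ring
  rw [Finset.sum_congr rfl e, ← Finset.sum_mul, ← sum_nodes, ← sub_eq_iff_eq_add'.2 (sub_eq_iff_eq_add.1 h)]
  field_simp

end RowCoeff

end QuantumGT

end

noncomputable section

namespace QuantumGT

/-! ### The representation -/

section Representation

variable {n : ℕ} {q η : ℂ} {C : Set (Rel n)} {L : Tableau n}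

/-- The operators of `e_k` and `f_k`. -/
def rowOp (q η : ℂ) (C : Set (Rel n)) (L : Tableau n) (b : Bool) (k : ℕ) :
    Module.End ℂ (VC η C L) := ∑ a ∈ rowP n k, op q η C L b a.row a.col

theorem rowOp_apply (b : Bool) (k : ℕ) (v : VC η C L) :
    rowOp q η C L b k v = ∑ a ∈ rowP n k, op q η C L b a.row a.col v := by
  rw [rowOp, LinearMap.sum_apply]

/-- The coordinates of an element of the lattice. -/
def latVal (h : Lattice n) (k : ℕ) : ℤ := if hk : 1 ≤ k ∧ k ≤ n then h ⟨k, hk⟩ else 0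

/-- The exponent of the weight of `T(R)`. -/
def wtExp (h : Lattice n) (R : Tableau n) : ℂ := ∑ k ∈ Finset.Icc 1 n, latVal h k * weightExp R k

/-- The operator of `q ^ h`. -/
def wtOp (η : ℂ) (C : Set (Rel n)) (L : Tableau n) (h : Lattice n) : Module.End ℂ (VC η C L) :=
  Finsupp.linearCombination ℂ fun R : basisSet η C L => qpow η (wtExp h R.1) • tab η C L R.1

theorem wtOp_tab (h : Lattice n) {R : Tableau n} (hR : R ∈ basisSet η C L) :
    wtOp η C L h (tab η C L R) = qpow η (wtExp h R) • tab η C L R := by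
  rw [tab_of_mem hR, wtOp, Finsupp.linearCombination_single, one_smul, tab_of_mem hR]

theorem linearMap_ext_tab {M : Type*} [AddCommMonoid M] [Module ℂ M] {f g : VC η C L →ₗ[ℂ] M}
    (h : ∀ R ∈ basisSet η C L, f (tab η C L R) = g (tab η C L R)) : f = g := by
  refine Finsupp.lhom_ext' fun R => LinearMap.ext_ring ?_
  have := h R.1 R.2
  rw [tab_of_mem R.2] at this
  simpa using this

theorem wtExp_zero (R : Tableau n) : wtExp 0 R = 0 := by
  refine Finset.sum_eq_zero fun k _ => ?_
  rw [latVal]; split_ifs <;> simp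

theorem wtExp_add (h h' : Lattice n) (R : Tableau n) :
    wtExp (h + h') R = wtExp h R + wtExp h' R := by
  rw [wtExp, wtExp, wtExp, ← Finset.sum_add_distrib]
  refine Finset.sum_congr rfl fun k _ => ?_
  simp only [latVal]; split_ifs <;> simp [add_mul]

theorem wtExp_neg (h : Lattice n) (R : Tableau n) : wtExp (-h) R = -wtExp h R := by
  have := wtExp_add h (-h) R
  rw [add_neg_cancel, wtExp_zero] at this
  linear_combination -this

theorem wtExp_eps {k : ℕ} (h1 : 1 ≤ k) (hk : k ≤ n) (R : Tableau n) :
    wtExp (eps n k) R = weightExp R k := by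
  rw [wtExp, Finset.sum_eq_single k]
  · rw [latVal, dif_pos ⟨h1, hk⟩]; simp [eps]
  · intro b hb hbk
    rw [latVal]; split_ifs <;> simp [eps, hbk]
  · intro h; simp [h1, hk] at h

theorem weightExp_mv (b : Bool) (a : Pos n) (R : Tableau n) {k : ℕ} (h1 : 1 ≤ k) (hk : k ≤ n) :
    weightExp (mv b a.row a.col R) k = weightExp R k +
      ((if k = a.row then sg b else 0) - if k = a.row + 1 then sg b else 0 : ℤ) := by
  have key : ∀ r : ℕ, ∑ c ∈ rowP n r, mv b a.row a.col R c =
      ∑ c ∈ rowP n r, R c + ((if r = a.row then sg b else 0 : ℤ) : ℂ) := by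
    intro r
    simp only [mv_apply, Finset.sum_add_distrib]
    congr 1
    by_cases hr : r = a.row
    · rw [Finset.sum_eq_single_of_mem a (mem_rowP.2 hr.symm)]
      · simp [hr]
      · intro c _ hc; simp [hc]
    · rw [if_neg hr]
      refine (Finset.sum_eq_zero fun c hc => ?_).trans (by simp)
      rw [if_neg]; · simp
      rintro rfl
      exact hr (mem_rowP.1 hc).symm
  have e : (k - 1 = a.row) = (k = a.row + 1) := propext (by omega)
  rw [weightExp_eq _ hk, weightExp_eq _ hk, key, key]
  simp only [e]
  push_cast
  ring

theorem wtExp_mv (h : Lattice n) (b : Bool) (a : Pos n) (ha : a.row < n) (R : Tableau n) :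
    wtExp h (mv b a.row a.col R) =
      wtExp h R + (sg b * pairing h ⟨a.row, a.row_pos, ha⟩ : ℤ) := by
  have e : ∀ k ∈ Finset.Icc 1 n, (latVal h k : ℂ) * weightExp (mv b a.row a.col R) k =
      latVal h k * weightExp R k + ((if k = a.row then (latVal h k * sg b : ℂ) else 0) -
        if k = a.row + 1 then (latVal h k * sg b : ℂ) else 0) := by
    intro k hk
    rw [Finset.mem_Icc] at hk
    rw [weightExp_mv b a R hk.1 hk.2]
    push_cast
    split_ifs <;> ring
  have hr := a.row_pos
  rw [wtExp, Finset.sum_congr rfl e, Finset.sum_add_distrib, Finset.sum_sub_distrib,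
    Finset.sum_ite_eq', Finset.sum_ite_eq', if_pos (Finset.mem_Icc.2 ⟨hr, ha.le⟩),
    if_pos (Finset.mem_Icc.2 ⟨by omega, ha⟩), latVal, latVal, dif_pos ⟨hr, ha.le⟩,
    dif_pos ⟨by omega, ha⟩, ← wtExp, pairing]
  push_cast
  ring

/-- The operators of the generators. -/
def genOp (q η : ℂ) (C : Set (Rel n)) (L : Tableau n) : Gen n → Module.End ℂ (VC η C L)
  | Gen.e i => rowOp q η C L true i.1
  | Gen.f i => rowOp q η C L false i.1
  | Gen.qh h => wtOp η C L h

theorem wtOp_conj (hη : Complex.exp η = q) (h : Lattice n) (b : Bool) (i : SimpleIdx n) :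
    wtOp η C L h * rowOp q η C L b i.1 * wtOp η C L (-h) =
      q ^ (sg b * pairing h i) • rowOp q η C L b i.1 := by
  refine linearMap_ext_tab fun R hR => ?_
  rw [Module.End.mul_apply, Module.End.mul_apply, wtOp_tab _ hR, map_smul, map_smul,
    LinearMap.smul_apply, rowOp_apply, map_sum, Finset.smul_sum, Finset.smul_sum]
  refine Finset.sum_congr rfl fun a ha => ?_
  rw [mem_rowP] at ha
  obtain ⟨i, hi⟩ := i
  simp only at ha
  subst ha
  rw [op_tab_of_mem hR, map_smul]
  by_cases hm : mv b a.row a.col R ∈ basisSet η C L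
  · rw [wtOp_tab _ hm, wtExp_mv _ _ _ hi.2, wtExp_neg, qpow_add, qpow_neg, qpow_int hη]
    have := qpow_ne_zero η (wtExp h R)
    simp only [smul_smul]
    congr 1
    field_simp
  · simp [tab_of_notMem hm]

theorem mv_true_false (k j : ℕ) (R : Tableau n) : mv true k j (mv false k j R) = R := by
  rw [mv, mv]; simp [sg]

theorem mv_false_true (k j : ℕ) (R : Tableau n) : mv false k j (mv true k j R) = R := by
  rw [mv, mv]; simp [sg]

theorem wtExp_alpha (i : SimpleIdx n) (R : Tableau n) :
    wtExp (alpha i) R = weightExp R i.1 - weightExp R (i.1 + 1) := by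
  rw [alpha, sub_eq_add_neg, wtExp_add, wtExp_neg, wtExp_eps i.2.1 i.2.2.le,
    wtExp_eps (by omega) i.2.2]
  ring

/-- Terms which move two different positions cancel by `op_raise_lower`; the diagonal terms add up
to the Cartan part by `sum_coLR_sub_coRL`. -/
theorem rowOp_comm (hη : Complex.exp η = q) (hq : ∀ r : ℕ, 0 < r → q ^ r ≠ 1)
    (hC : Admissible C) (hL : IsRealization η C L) (i : SimpleIdx n) :
    rowOp q η C L true i.1 * rowOp q η C L false i.1 -
      rowOp q η C L false i.1 * rowOp q η C L true i.1 =
      (q - q⁻¹)⁻¹ • (wtOp η C L (alpha i) - wtOp η C L (-alpha i)) := by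
  refine linearMap_ext_tab fun R hR => ?_
  obtain ⟨k, hk1, hk⟩ := i
  rw [LinearMap.sub_apply, Module.End.mul_apply, Module.End.mul_apply, LinearMap.smul_apply,
    LinearMap.sub_apply, wtOp_tab _ hR, wtOp_tab _ hR, ← sub_smul, smul_smul, wtExp_neg, qpow_neg,
    wtExp_alpha, kval_eq hη R hk, ← sum_coLR_sub_coRL hη hq hC hR hk1 hk, Finset.sum_smul]
  simp only [rowOp_apply, map_sum]
  rw [Finset.sum_comm, ← Finset.sum_sub_distrib]
  refine Finset.sum_congr rfl fun p hp => ?_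
  rw [← Finset.sum_sub_distrib]
  rw [mem_rowP] at hp
  have hpn : p.row < n := by omega
  rw [Finset.sum_eq_single_of_mem p (mem_rowP.2 hp)]
  · rw [op_op_tab hη hq hC.1 hL hR _ _ hpn hpn, op_op_tab hη hq hC.1 hL hR _ _ hpn hpn,
      mv_true_false, mv_false_true, ← sub_smul]
    rfl
  · intro a ha hap
    rw [mem_rowP] at ha
    rw [← op_raise_lower hη hq hC.1 hL hR hap.symm hpn (by omega), sub_self]

theorem rowOp_raise_lower (hη : Complex.exp η = q) (hq : ∀ r : ℕ, 0 < r → q ^ r ≠ 1)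
    (hC : Admissible C) (hL : IsRealization η C L) {i j : ℕ} (hij : i ≠ j) (hi : i < n)
    (hj : j < n) : rowOp q η C L true i * rowOp q η C L false j =
      rowOp q η C L false j * rowOp q η C L true i := by
  refine linearMap_ext_tab fun R hR => ?_
  simp only [Module.End.mul_apply, rowOp_apply, map_sum]
  rw [Finset.sum_comm]
  refine Finset.sum_congr rfl fun p hp => Finset.sum_congr rfl fun a ha => ?_
  rw [mem_rowP] at ha hp
  exact (op_raise_lower hη hq hC.1 hL hR (by rintro rfl; omega) (by omega) (by omega)).symm

theorem rowOp_comm_of_far (hη : Complex.exp η = q) (hq : ∀ r : ℕ, 0 < r → q ^ r ≠ 1)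
    (hC : Admissible C) (hL : IsRealization η C L) {i j : ℕ} (hij : i + 1 < j ∨ j + 1 < i)
    (hi : i < n) (hj : j < n) (b : Bool) : rowOp q η C L b i * rowOp q η C L b j =
      rowOp q η C L b j * rowOp q η C L b i := by
  refine linearMap_ext_tab fun R hR => ?_
  simp only [Module.End.mul_apply, rowOp_apply, map_sum]
  rw [Finset.sum_comm]
  refine Finset.sum_congr rfl fun p hp => Finset.sum_congr rfl fun a ha => ?_
  rw [mem_rowP] at ha hp
  exact (op_comm_of_far hη hq hC.1 hL hR b b (by omega) (by omega) (by omega))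

theorem sum_rotate₁ {ι κ M : Type*} [AddCommMonoid M] (s : Finset ι) (t : Finset κ)
    (g : ι → ι → κ → M) : ∑ b ∈ s, ∑ a ∈ s, ∑ p ∈ t, g a b p = ∑ p ∈ t, ∑ a ∈ s, ∑ b ∈ s, g a b p := by
  rw [Finset.sum_comm, Finset.sum_comm' (s := t) (t' := s) (s' := fun _ => t) (by simp)]
  exact Finset.sum_congr rfl fun a _ => Finset.sum_comm

theorem sum_rotate₂ {ι κ M : Type*} [AddCommMonoid M] (s : Finset ι) (t : Finset κ)
    (g : ι → ι → κ → M) : ∑ b ∈ s, ∑ p ∈ t, ∑ a ∈ s, g a b p = ∑ p ∈ t, ∑ a ∈ s, ∑ b ∈ s, g a b p := by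
  rw [Finset.sum_comm]
  exact Finset.sum_congr rfl fun p _ => Finset.sum_comm

theorem sum_rotate₃ {ι κ M : Type*} [AddCommMonoid M] (s : Finset ι) (t : Finset κ)
    (g : ι → ι → κ → M) : ∑ p ∈ t, ∑ b ∈ s, ∑ a ∈ s, g a b p = ∑ p ∈ t, ∑ a ∈ s, ∑ b ∈ s, g a b p :=
  Finset.sum_congr rfl fun p _ => Finset.sum_comm

theorem rowOp_rowOp_rowOp (s : Bool) (i j k : ℕ) (v : VC η C L) :
    rowOp q η C L s i (rowOp q η C L s j (rowOp q η C L s k v)) =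
      ∑ c ∈ rowP n i, ∑ b ∈ rowP n j, ∑ a ∈ rowP n k, op q η C L s c.row c.col
        (op q η C L s b.row b.col (op q η C L s a.row a.col v)) := by
  rw [rowOp_apply s k, map_sum, map_sum]
  simp only [rowOp_apply s i, rowOp_apply s j, map_sum]
  rw [Finset.sum_comm]
  exact Finset.sum_congr rfl fun c _ => Finset.sum_comm

/-- Since `serre_op` concerns the sum over both orders of `a` and `b`, twice the double sum over the
row is shown to vanish. -/
theorem rowOp_serre (hη : Complex.exp η = q) (hq : ∀ r : ℕ, 0 < r → q ^ r ≠ 1)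
    (hC : Admissible C) (hL : IsRealization η C L) {i j : ℕ} (hij : i + 1 = j ∨ j + 1 = i)
    (hi : i < n) (hj : j < n) (s : Bool) :
    rowOp q η C L s i ^ 2 * rowOp q η C L s j -
      (q + q⁻¹) • (rowOp q η C L s i * rowOp q η C L s j * rowOp q η C L s i) +
      rowOp q η C L s j * rowOp q η C L s i ^ 2 = 0 := by
  refine linearMap_ext_tab fun R hR => ?_
  let F : Pos n → Pos n → Pos n → VC η C L := fun a b p =>
    op q η C L s b.row b.col (op q η C L s a.row a.col (op q η C L s p.row p.col (tab η C L R))) -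
      (q + q⁻¹) • op q η C L s b.row b.col
        (op q η C L s p.row p.col (op q η C L s a.row a.col (tab η C L R))) +
      op q η C L s p.row p.col
        (op q η C L s b.row b.col (op q η C L s a.row a.col (tab η C L R)))
  have e : (rowOp q η C L s i ^ 2 * rowOp q η C L s j -
      (q + q⁻¹) • (rowOp q η C L s i * rowOp q η C L s j * rowOp q η C L s i) +
      rowOp q η C L s j * rowOp q η C L s i ^ 2) (tab η C L R) =
      ∑ p ∈ rowP n j, ∑ a ∈ rowP n i, ∑ b ∈ rowP n i, F a b p := by
    rw [sq, LinearMap.add_apply, LinearMap.sub_apply, LinearMap.smul_apply]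
    simp only [Module.End.mul_apply]
    rw [rowOp_rowOp_rowOp, rowOp_rowOp_rowOp, rowOp_rowOp_rowOp,
      sum_rotate₁ (rowP n i) (rowP n j) fun a b p => op q η C L s b.row b.col
        (op q η C L s a.row a.col (op q η C L s p.row p.col (tab η C L R))),
      sum_rotate₂ (rowP n i) (rowP n j) fun a b p => op q η C L s b.row b.col
        (op q η C L s p.row p.col (op q η C L s a.row a.col (tab η C L R))),
      sum_rotate₃ (rowP n i) (rowP n j) fun a b p => op q η C L s p.row p.col
        (op q η C L s b.row b.col (op q η C L s a.row a.col (tab η C L R)))]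
    simp only [F, Finset.sum_add_distrib, Finset.sum_sub_distrib, Finset.smul_sum]
  rw [e, LinearMap.zero_apply]
  refine Finset.sum_eq_zero fun p hp => ?_
  have h2 : ∑ a ∈ rowP n i, ∑ b ∈ rowP n i, F a b p + ∑ a ∈ rowP n i, ∑ b ∈ rowP n i, F a b p = 0 := by
    nth_rewrite 2 [Finset.sum_comm]
    rw [← Finset.sum_add_distrib]
    refine Finset.sum_eq_zero fun a ha => ?_
    rw [← Finset.sum_add_distrib]
    refine Finset.sum_eq_zero fun b hb => ?_
    rw [mem_rowP] at ha hb hp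
    exact serre_op hη hq hC hL hR s (by omega) (by omega) (by omega) (by omega)
  rw [← two_smul ℂ, smul_eq_zero] at h2
  exact h2.resolve_left two_ne_zero

theorem exists_rep (hη : Complex.exp η = q) (hq : ∀ r : ℕ, 0 < r → q ^ r ≠ 1)
    (hC : Admissible C) (hL : IsRealization η C L) :
    ∃ ρ : Uq n q →ₐ[ℂ] Module.End ℂ (VC η C L), ∀ g, ρ (gen n q g) = genOp q η C L g := by
  have w : ∀ ⦃x y : Free n⦄, UqRel n q x y →
      FreeAlgebra.lift ℂ (genOp q η C L) x = FreeAlgebra.lift ℂ (genOp q η C L) y := by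
    intro x y h
    cases h <;> simp only [map_mul, map_sub, map_add, map_smul, map_pow, map_zero, map_one, fe, ff,
      fq, FreeAlgebra.lift_ι_apply, genOp]
    case qh_zero =>
      refine linearMap_ext_tab fun R hR => ?_
      rw [wtOp_tab _ hR, wtExp_zero, qpow_zero, one_smul]; rfl
    case qh_add h h' =>
      refine linearMap_ext_tab fun R hR => ?_
      rw [Module.End.mul_apply, wtOp_tab _ hR, map_smul, wtOp_tab _ hR, wtOp_tab _ hR, wtExp_add,
        qpow_add, smul_smul, mul_comm]
    case qh_e h i =>
      rw [wtOp_conj hη]; simp [sg]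
    case qh_f h i =>
      rw [wtOp_conj hη]; simp [sg]
    case e_f i => exact rowOp_comm hη hq hC hL i
    case e_f_ne i j hij =>
      rw [rowOp_raise_lower hη hq hC hL (fun h => hij (Subtype.ext h)) i.2.2 j.2.2, sub_self]
    case serre_e i j hij => exact rowOp_serre hη hq hC hL hij i.2.2 j.2.2 true
    case serre_f i j hij => exact rowOp_serre hη hq hC hL hij i.2.2 j.2.2 false
    case comm_e i j hij => exact rowOp_comm_of_far hη hq hC hL hij i.2.2 j.2.2 true
    case comm_f i j hij => exact rowOp_comm_of_far hη hq hC hL hij i.2.2 j.2.2 false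
  refine ⟨RingQuot.liftAlgHom ℂ ⟨FreeAlgebra.lift ℂ (genOp q η C L), w⟩, fun g => ?_⟩
  rw [gen, RingQuot.liftAlgHom_mkAlgHom_apply, FreeAlgebra.lift_ι_apply]

theorem isGTAction_of_gen {ρ : Uq n q →ₐ[ℂ] Module.End ℂ (VC η C L)}
    (hρ : ∀ g, ρ (gen n q g) = genOp q η C L g) : IsGTAction q η C L ρ where
  weight R hR k h1 hk := by
    rw [qU, hρ, genOp, wtOp_tab _ hR, wtExp_eps h1 hk]
  raising R hR k h1 hk := by
    rw [eU, dif_pos ⟨h1, hk⟩, hρ, genOp, rowOp_apply, sum_Icc_eq hk.le, ← Finset.sum_neg_distrib]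
    refine Finset.sum_congr rfl fun a ha => ?_
    rw [op_tab_of_mem hR, mem_rowP.1 ha, co, mv]
    simp [sg, src]
  lowering R hR k h1 hk := by
    rw [fU, dif_pos ⟨h1, hk⟩, hρ, genOp, rowOp_apply, sum_Icc_eq hk.le]
    refine Finset.sum_congr rfl fun a ha => ?_
    rw [op_tab_of_mem hR, mem_rowP.1 ha, co, mv]
    simp [sg, src, sub_eq_add_neg]

end Representation

end QuantumGT

end

/-! ### Eigenvalues of the quantum determinants and of the elements `c_{mk}`. -/

noncomputable section

namespace QuantumGT

/-! ### The scalar recursion for the eigenvalues -/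

section EigenScalar

variable {n : ℕ} {q η : ℂ} {C : Set (Rel n)} {L : Tableau n}

/-- `u - u⁻¹`. -/
def hh (u : ℂ) : ℂ := u - u⁻¹

theorem prod_hh (s : Finset (Pos n)) (R : Tableau n) {z : ℂ} (hz : z ≠ 0) :
    ∏ c ∈ s, hh (z * qpow η (R c)) =
      (-z) ^ s.card / (∏ c ∈ s, qpow η (R c)) * ∏ c ∈ s, ((z ^ 2)⁻¹ - qpow η (R c) ^ 2) := by
  rw [← Finset.prod_const, ← Finset.prod_div_distrib, ← Finset.prod_mul_distrib]
  refine Finset.prod_congr rfl fun c _ => ?_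
  have := qpow_ne_zero η (R c)
  rw [hh]
  field_simp
  ring

theorem prod_hh_mul (hq0 : q ≠ 0) (s : Finset (Pos n)) (R : Tableau n) {z : ℂ} (hz : z ≠ 0) :
    ∏ c ∈ s, hh (q * z * qpow η (R c)) =
      (-z) ^ s.card / (q ^ s.card * ∏ c ∈ s, qpow η (R c)) *
        ∏ c ∈ s, ((z ^ 2)⁻¹ - q ^ 2 * qpow η (R c) ^ 2) := by
  rw [← Finset.prod_const, ← Finset.prod_const, ← Finset.prod_mul_distrib, ← Finset.prod_div_distrib,
    ← Finset.prod_mul_distrib]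
  refine Finset.prod_congr rfl fun c _ => ?_
  have := qpow_ne_zero η (R c)
  rw [hh]
  field_simp
  ring

/-- This is the second part of `row_lagrange` at `W = z⁻²`. Each `u - u⁻¹` is a monomial times the
difference of `z⁻²` and a node or a zero; the monomials are matched by the definition of `kval`. -/
theorem row_eigenvalue (hη : Complex.exp η = q) (hq : ∀ r : ℕ, 0 < r → q ^ r ≠ 1)
    (hC : Admissible C) {R : Tableau n} (hR : R ∈ basisSet η C L) {k : ℕ} (hk1 : 1 ≤ k)
    (hk : k < n) {z : ℂ} (hz : z ≠ 0) :
    (kval q η R k)⁻¹ * ((∏ c ∈ rowP n k, hh (q * z * qpow η (R c))) *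
        ∏ c ∈ rowP n k, hh (z * qpow η (R c))) +
      ∑ a ∈ rowP n k, (coRL q η R a * ((q - q⁻¹) * q⁻¹ * (z * qpow η (R a))⁻¹ *
          ((∏ c ∈ rowP n k, hh (z * qpow η (R c))) *
            ∏ c ∈ (rowP n k).erase a, hh (q * z * qpow η (R c)))) -
        coLR q η R a * ((q - q⁻¹) * (z * qpow η (R a))⁻¹ *
          ((∏ c ∈ rowP n k, hh (q * z * qpow η (R c))) *
            ∏ c ∈ (rowP n k).erase a, hh (z * qpow η (R c))))) =
      (∏ c ∈ rowP n (k + 1), hh (q * z * qpow η (R c))) *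
        ∏ c ∈ rowP n (k - 1), hh (z * qpow η (R c)) := by
  have hq0 : q ≠ 0 := by rw [← hη]; exact Complex.exp_ne_zero _
  have hl := sub_inv_ne_zero hη hq
  have H := (row_lagrange hη hq hC hR hk1 hk).2 (z ^ 2)⁻¹
  have hK := kval_ne_zero hη R hk
  obtain ⟨j, rfl⟩ : ∃ j, k = j + 1 := ⟨k - 1, by omega⟩
  have hSK : kval q η R (j + 1) * (q * (∏ c ∈ rowP n (j + 1 + 1), qpow η (R c)) *
      ∏ c ∈ rowP n j, qpow η (R c)) = (∏ c ∈ rowP n (j + 1), qpow η (R c)) ^ 2 := by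
    have p1 : ∏ c ∈ rowP n j, qpow η (R c) ≠ 0 := Finset.prod_ne_zero_iff.2 fun _ _ => qpow_ne_zero _ _
    have p2 : ∏ c ∈ rowP n (j + 1 + 1), qpow η (R c) ≠ 0 :=
      Finset.prod_ne_zero_iff.2 fun _ _ => qpow_ne_zero _ _
    rw [kval, Nat.add_sub_cancel, Finset.prod_pow]
    field_simp
  have p1 : ∏ c ∈ rowP n j, qpow η (R c) ≠ 0 := Finset.prod_ne_zero_iff.2 fun _ _ => qpow_ne_zero _ _
  have p2 : ∏ c ∈ rowP n (j + 1 + 1), qpow η (R c) ≠ 0 :=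
    Finset.prod_ne_zero_iff.2 fun _ _ => qpow_ne_zero _ _
  have p3 : ∏ c ∈ rowP n (j + 1), qpow η (R c) ≠ 0 :=
    Finset.prod_ne_zero_iff.2 fun _ _ => qpow_ne_zero _ _
  have hnodes : ∏ p ∈ nodes n (j + 1), ((z ^ 2)⁻¹ - node q η R p) =
      (∏ c ∈ rowP n (j + 1), ((z ^ 2)⁻¹ - qpow η (R c) ^ 2)) *
        ∏ c ∈ rowP n (j + 1), ((z ^ 2)⁻¹ - q ^ 2 * qpow η (R c) ^ 2) := by
    rw [nodes, Finset.prod_product, ← Finset.prod_mul_distrib]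
    refine Finset.prod_congr rfl fun c _ => ?_
    rw [Fintype.prod_bool, mul_comm]
    simp [node]
  rw [Nat.add_sub_cancel, hnodes, sum_nodes] at H
  rw [Nat.add_sub_cancel]
  -- The two terms of a position `a` are those of its two nodes. The scalar in front does not depend
  -- on `a`, so the sum over the row is the one in the expansion.
  have hterm : ∀ a ∈ rowP n (j + 1),
      (coRL q η R a * ((q - q⁻¹) * q⁻¹ * (z * qpow η (R a))⁻¹ *
          ((∏ c ∈ rowP n (j + 1), hh (z * qpow η (R c))) *
            ∏ c ∈ (rowP n (j + 1)).erase a, hh (q * z * qpow η (R c)))) -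
        coLR q η R a * ((q - q⁻¹) * (z * qpow η (R a))⁻¹ *
          ((∏ c ∈ rowP n (j + 1), hh (q * z * qpow η (R c))) *
            ∏ c ∈ (rowP n (j + 1)).erase a, hh (z * qpow η (R c))))) =
      kval q η R (j + 1) * (-z) ^ j * (-z) ^ j / (q ^ (j + 1) *
        (∏ c ∈ rowP n (j + 1), qpow η (R c)) ^ 2) *
      (pfCoeff q η R (j + 1) (a, false) *
          ∏ b ∈ (nodes n (j + 1)).erase (a, false), ((z ^ 2)⁻¹ - node q η R b) +
        pfCoeff q η R (j + 1) (a, true) *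
          ∏ b ∈ (nodes n (j + 1)).erase (a, true), ((z ^ 2)⁻¹ - node q η R b)) := by
    intro a ha
    have har := mem_rowP.1 ha
    have p4 : ∏ c ∈ (rowP n (j + 1)).erase a, qpow η (R c) ≠ 0 :=
      Finset.prod_ne_zero_iff.2 fun _ _ => qpow_ne_zero _ _
    have hx := qpow_ne_zero η (R a)
    rw [coLR_eq hη hq R har hk, coRL_eq hη hq R har hk, prod_nodes_erase har, prod_nodes_erase har,
      prod_hh _ R hz, prod_hh _ R hz, prod_hh_mul hq0 _ R hz, prod_hh_mul hq0 _ R hz,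
      Finset.card_erase_of_mem ha, card_rowP hk.le, Nat.add_sub_cancel,
      ← Finset.mul_prod_erase _ (fun c => qpow η (R c)) ha,
      ← Finset.mul_prod_erase _ (fun c => (z ^ 2)⁻¹ - qpow η (R c) ^ 2) ha,
      ← Finset.mul_prod_erase _ (fun c => (z ^ 2)⁻¹ - q ^ 2 * qpow η (R c) ^ 2) ha]
    simp only [node, Bool.not_true, Bool.not_false, if_true, Bool.false_eq_true, if_false]
    generalize ∏ c ∈ (rowP n (j + 1)).erase a, qpow η (R c) = Y at *
    generalize ∏ c ∈ (rowP n (j + 1)).erase a, ((z ^ 2)⁻¹ - qpow η (R c) ^ 2) = A at *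
    generalize ∏ c ∈ (rowP n (j + 1)).erase a, ((z ^ 2)⁻¹ - q ^ 2 * qpow η (R c) ^ 2) = B at *
    generalize kval q η R (j + 1) = K at *
    generalize pfCoeff q η R (j + 1) (a, false) = u
    generalize pfCoeff q η R (j + 1) (a, true) = v
    generalize hX : (z ^ 2)⁻¹ - qpow η (R a) ^ 2 = X1
    generalize hX' : (z ^ 2)⁻¹ - q ^ 2 * qpow η (R a) ^ 2 = X2
    generalize qpow η (R a) = x at *
    generalize q - q⁻¹ = l at *
    rw [pow_succ (-z), pow_succ q]
    generalize (-z) ^ j = Z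
    field_simp
    ring
  rw [Finset.sum_congr rfl hterm, ← Finset.mul_sum, prod_hh _ R hz, prod_hh _ R hz,
    prod_hh_mul hq0 _ R hz, prod_hh_mul hq0 _ R hz, card_rowP (by omega), card_rowP (by omega),
    card_rowP (by omega)]
  generalize ∏ c ∈ rowP n j, qpow η (R c) = P at *
  generalize ∏ c ∈ rowP n (j + 1 + 1), qpow η (R c) = S at *
  generalize ∏ c ∈ rowP n (j + 1), qpow η (R c) = Y at *
  generalize ∏ c ∈ rowP n j, ((z ^ 2)⁻¹ - qpow η (R c) ^ 2) = NP at *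
  generalize ∏ c ∈ rowP n (j + 1 + 1), ((z ^ 2)⁻¹ - q ^ 2 * qpow η (R c) ^ 2) = NS at *
  generalize ∏ c ∈ rowP n (j + 1), ((z ^ 2)⁻¹ - qpow η (R c) ^ 2) = A at *
  generalize ∏ c ∈ rowP n (j + 1), ((z ^ 2)⁻¹ - q ^ 2 * qpow η (R c) ^ 2) = B at *
  clear hterm hnodes
  generalize ∑ a ∈ rowP n (j + 1), (pfCoeff q η R (j + 1) (a, false) *
      ∏ b ∈ (nodes n (j + 1)).erase (a, false), ((z ^ 2)⁻¹ - node q η R b) +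
    pfCoeff q η R (j + 1) (a, true) *
      ∏ b ∈ (nodes n (j + 1)).erase (a, true), ((z ^ 2)⁻¹ - node q η R b)) = T at *
  simp only [pow_succ (-z) j, pow_succ (-z) (j + 1), pow_succ q j, pow_succ q (j + 1)]
  generalize (-z) ^ j = Z
  generalize kval q η R (j + 1) = K at *
  have e2 : Z * -z * -z / (q ^ j * q * q * S) * NS * (Z / P * NP) =
      Z * Z * z ^ 2 / (q ^ j * q * q * S * P) * (NS * NP) := by field_simp
  have e3 : K⁻¹ * (Z * -z / (q ^ j * q * Y) * B * (Z * -z / Y * A)) =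
      Z * Z * z ^ 2 / (q ^ j * q * Y ^ 2) * K⁻¹ * (A * B) := by field_simp
  rw [e2, e3, H, ← hSK]
  field_simp

end EigenScalar

end QuantumGT

end

noncomputable section

namespace QuantumGT

/-! ### The recursion for the eigenvalues -/

section EigenStep

variable {n : ℕ} {q η : ℂ} {C : Set (Rel n)} {L : Tableau n}

theorem diag_tab {D : Module.End ℂ (VC η C L)} {d : Tableau n → ℂ}
    (h : ∀ S ∈ basisSet η C L, D (tab η C L S) = d S • tab η C L S) (S : Tableau n) :
    D (tab η C L S) = d S • tab η C L S := by
  by_cases hS : S ∈ basisSet η C L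
  · exact h S hS
  · simp [tab_of_notMem hS]

theorem diag_op_tab {D : Module.End ℂ (VC η C L)} {d : Tableau n → ℂ}
    (h : ∀ S ∈ basisSet η C L, D (tab η C L S) = d S • tab η C L S) (b : Bool) (k j : ℕ)
    (S : Tableau n) : D (op q η C L b k j (tab η C L S)) =
      d (mv b k j S) • op q η C L b k j (tab η C L S) := by
  by_cases hS : S ∈ basisSet η C L
  · rw [op_tab_of_mem hS, map_smul, diag_tab h, smul_comm]
  · simp [tab_of_notMem hS]

theorem prod_mv (hη : Complex.exp η = q) (s : Bool) (R : Tableau n) (J : Finset (Pos n)) {a : Pos n}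
    (ha : a ∈ J) (g : ℂ → ℂ) : ∏ c ∈ J, g (qpow η (mv s a.row a.col R c)) =
      g (q ^ sg s * qpow η (R a)) * ∏ c ∈ J.erase a, g (qpow η (R c)) := by
  rw [← Finset.mul_prod_erase _ _ ha, mv_self, qpow_add, qpow_sg hη, mul_comm (qpow η _)]
  congr 1
  refine Finset.prod_congr rfl fun c hc => ?_
  rw [mv_other s (Finset.ne_of_mem_erase hc)]

theorem hh_three (hq0 : q ≠ 0) {u : ℂ} (hu : u ≠ 0) :
    (q + q⁻¹) * hh (q * u) - hh (q * (q * u)) = hh u := by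
  rw [hh, hh, hh]
  field_simp
  ring

theorem hh_lower (hq0 : q ≠ 0) {u : ℂ} (hu : u ≠ 0) :
    q⁻¹ * hh u - hh (q⁻¹ * u) = (q - q⁻¹) * u⁻¹ := by
  rw [hh, hh]
  field_simp
  ring

/-- The operator `q⁻¹ f A' - A' f` for a diagonal operator `A'`. -/
theorem lower_diag_tab {D : Module.End ℂ (VC η C L)} {d : Tableau n → ℂ}
    (h : ∀ S ∈ basisSet η C L, D (tab η C L S) = d S • tab η C L S) (k : ℕ) (S : Tableau n) :
    q⁻¹ • rowOp q η C L false k (D (tab η C L S)) - D (rowOp q η C L false k (tab η C L S)) =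
      ∑ a ∈ rowP n k, (q⁻¹ * d S - d (mv false a.row a.col S)) •
        op q η C L false a.row a.col (tab η C L S) := by
  rw [diag_tab h, map_smul, rowOp_apply, map_sum, smul_smul, Finset.smul_sum,
    ← Finset.sum_sub_distrib]
  refine Finset.sum_congr rfl fun a _ => ?_
  rw [diag_op_tab h, sub_smul]

theorem lower_diag_raise {D : Module.End ℂ (VC η C L)} {d : Tableau n → ℂ}
    (h : ∀ S ∈ basisSet η C L, D (tab η C L S) = d S • tab η C L S) (k : ℕ) {R : Tableau n}
    (hR : R ∈ basisSet η C L) (k' j' : ℕ) :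
    q⁻¹ • rowOp q η C L false k (D (op q η C L true k' j' (tab η C L R))) -
        D (rowOp q η C L false k (op q η C L true k' j' (tab η C L R))) =
      ∑ a ∈ rowP n k, (q⁻¹ * d (mv true k' j' R) - d (mv false a.row a.col (mv true k' j' R))) •
        op q η C L false a.row a.col (op q η C L true k' j' (tab η C L R)) := by
  rw [op_tab_of_mem hR]
  simp only [map_smul]
  rw [smul_comm, ← smul_sub, lower_diag_tab h, Finset.smul_sum]
  exact Finset.sum_congr rfl fun a _ => smul_comm _ _ _

/-- The right hand side of `QGens.qdet_rec` applied to a basis vector, once the determinants `A`,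
`A'` of order `k` at `z` and `z q⁻¹` are known to be diagonal. The outcome is the product of the
expected eigenvalues of orders `k + 1` and `k - 1`. -/
theorem eigen_step (hη : Complex.exp η = q) (hq : ∀ r : ℕ, 0 < r → q ^ r ≠ 1)
    (hC : Admissible C) (hL : IsRealization η C L) {R : Tableau n} (hR : R ∈ basisSet η C L)
    {k : ℕ} (hk1 : 1 ≤ k) (hk : k < n) {z : ℂ} (hz : z ≠ 0) {A A' : Module.End ℂ (VC η C L)}
    (hA : ∀ S ∈ basisSet η C L, A (tab η C L S) =
      (∏ c ∈ rowP n k, hh (q * z * qpow η (S c))) • tab η C L S)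
    (hA' : ∀ S ∈ basisSet η C L, A' (tab η C L S) =
      (∏ c ∈ rowP n k, hh (z * qpow η (S c))) • tab η C L S)
    {c : Module.End ℂ (VC η C L)}
    (hc : c = q⁻¹ • (rowOp q η C L false k * A') - A' * rowOp q η C L false k) :
    (q + q⁻¹) • c (rowOp q η C L true k (A (tab η C L R))) -
      rowOp q η C L true k (c (A (tab η C L R))) - c (A (rowOp q η C L true k (tab η C L R))) +
      (kval q η R k)⁻¹ • A' (A (tab η C L R)) =
    ((∏ c ∈ rowP n (k + 1), hh (q * z * qpow η (R c))) *
        ∏ c ∈ rowP n (k - 1), hh (z * qpow η (R c))) • tab η C L R := by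
  have hq0 : q ≠ 0 := by rw [← hη]; exact Complex.exp_ne_zero _
  set α : Tableau n → ℂ := fun S => ∏ c ∈ rowP n k, hh (q * z * qpow η (S c)) with hα
  set α' : Tableau n → ℂ := fun S => ∏ c ∈ rowP n k, hh (z * qpow η (S c)) with hα'
  set T := tab η C L R with hT
  have hcv : ∀ v, c v = q⁻¹ • rowOp q η C L false k (A' v) - A' (rowOp q η C L false k v) := by
    intro v; rw [hc]; rfl
  have h1 : c (rowOp q η C L true k (A T)) = ∑ b ∈ rowP n k, ∑ a ∈ rowP n k,
      (α R * (q⁻¹ * α' (mv true b.row b.col R) - α' (mv false a.row a.col (mv true b.row b.col R)))) •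
        op q η C L false a.row a.col (op q η C L true b.row b.col T) := by
    rw [hA R hR, map_smul, map_smul, rowOp_apply, map_sum, Finset.smul_sum]
    refine Finset.sum_congr rfl fun b _ => ?_
    rw [hcv, lower_diag_raise (d := α') hA' k hR, Finset.smul_sum]
    exact Finset.sum_congr rfl fun a _ => smul_smul _ _ _
  have h2 : rowOp q η C L true k (c (A T)) = ∑ b ∈ rowP n k, ∑ a ∈ rowP n k,
      (α R * (q⁻¹ * α' R - α' (mv false a.row a.col R))) •
        op q η C L true b.row b.col (op q η C L false a.row a.col T) := by
    rw [hA R hR, map_smul, map_smul, hcv, lower_diag_tab (d := α') hA', rowOp_apply,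
      Finset.smul_sum]
    refine Finset.sum_congr rfl fun b _ => ?_
    rw [map_sum, Finset.smul_sum]
    refine Finset.sum_congr rfl fun a _ => ?_
    rw [map_smul, smul_smul]
  have h3 : c (A (rowOp q η C L true k T)) = ∑ b ∈ rowP n k, ∑ a ∈ rowP n k,
      (α (mv true b.row b.col R) *
        (q⁻¹ * α' (mv true b.row b.col R) - α' (mv false a.row a.col (mv true b.row b.col R)))) •
        op q η C L false a.row a.col (op q η C L true b.row b.col T) := by
    rw [rowOp_apply, map_sum, map_sum]
    refine Finset.sum_congr rfl fun b _ => ?_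
    rw [diag_op_tab (d := α) hA, map_smul, hcv, lower_diag_raise (d := α') hA' k hR, Finset.smul_sum]
    exact Finset.sum_congr rfl fun a _ => smul_smul _ _ _
  have h4 : A' (A T) = (α R * α' R) • T := by
    rw [hA R hR, map_smul, hA' R hR, smul_smul]
  have hsum : (q + q⁻¹) • c (rowOp q η C L true k (A T)) - rowOp q η C L true k (c (A T)) -
      c (A (rowOp q η C L true k T)) = ∑ b ∈ rowP n k,
        (coRL q η R b * ((q - q⁻¹) * q⁻¹ * (z * qpow η (R b))⁻¹ *
          ((∏ c ∈ rowP n k, hh (z * qpow η (R c))) *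
            ∏ c ∈ (rowP n k).erase b, hh (q * z * qpow η (R c)))) -
        coLR q η R b * ((q - q⁻¹) * (z * qpow η (R b))⁻¹ *
          ((∏ c ∈ rowP n k, hh (q * z * qpow η (R c))) *
            ∏ c ∈ (rowP n k).erase b, hh (z * qpow η (R c))))) • T := by
    rw [h1, h2, h3, Finset.smul_sum, ← Finset.sum_sub_distrib, ← Finset.sum_sub_distrib]
    refine Finset.sum_congr rfl fun b hb => ?_
    rw [Finset.smul_sum, ← Finset.sum_sub_distrib, ← Finset.sum_sub_distrib]
    have hbr := mem_rowP.1 hb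
    have hbn : b.row < n := by omega
    have hxb := mul_ne_zero hz (qpow_ne_zero η (R b))
    have hq1 : q ^ sg true = q := by simp [sg]
    have hq2 : q ^ sg false = q⁻¹ := by simp [sg]
    -- For fixed raised position `b`, the terms that lower another position cancel. The term that
    -- lowers `b` itself returns to the same tableau.
    rw [Finset.sum_eq_single_of_mem b hb]
    · rw [hT, op_op_tab hη hq hC.1 hL hR true false hbn hbn,
        op_op_tab hη hq hC.1 hL hR false true hbn hbn, mv_false_true, mv_true_false]
      simp only [smul_smul, ← sub_smul]
      congr 1
      rw [← coRL, ← coLR]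
      simp only [hα, hα']
      rw [prod_mv hη true R _ hb fun x => hh (z * x), prod_mv hη false R _ hb fun x => hh (z * x),
        prod_mv hη true R _ hb fun x => hh (q * z * x), hq1, hq2,
        ← Finset.mul_prod_erase _ (fun c => hh (z * qpow η (R c))) hb,
        ← Finset.mul_prod_erase _ (fun c => hh (q * z * qpow η (R c))) hb]
      have g1 := hh_three hq0 hxb
      have g2 := hh_lower hq0 hxb
      have g3 := hh_lower hq0 (mul_ne_zero hq0 hxb)
      rw [inv_mul_cancel_left₀ hq0, mul_inv] at g3
      rw [show z * (q * qpow η (R b)) = q * (z * qpow η (R b)) by ring,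
        show z * (q⁻¹ * qpow η (R b)) = q⁻¹ * (z * qpow η (R b)) by ring,
        show q * z * (q * qpow η (R b)) = q * (q * (z * qpow η (R b))) by ring,
        show q * z * qpow η (R b) = q * (z * qpow η (R b)) by ring]
      generalize ∏ c ∈ (rowP n k).erase b, hh (z * qpow η (R c)) = B'
      generalize ∏ c ∈ (rowP n k).erase b, hh (q * z * qpow η (R c)) = B
      generalize z * qpow η (R b) = u at *
      linear_combination coRL q η R b * B * B' * ((q⁻¹ * hh (q * u) - hh u) * g1 + hh u * g3) -
        coLR q η R b * B * B' * hh (q * u) * g2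
    -- Raising `b` and lowering `a ≠ b` commute, so the three contributions have a common vector.
    -- Their coefficients cancel by the three-term recurrence `hh_three` for the factor of `b`.
    · intro a ha hab
      have har := mem_rowP.1 ha
      rw [hT, op_raise_lower hη hq hC.1 hL hR hab.symm hbn (by omega)]
      simp only [smul_smul, ← sub_smul]
      refine (congrArg (· • _) ?_).trans (zero_smul ℂ _)
      have hxa := mul_ne_zero hz (qpow_ne_zero η (R a))
      have hbe : b ∈ (rowP n k).erase a := Finset.mem_erase.2 ⟨hab.symm, hb⟩
      simp only [hα, hα']
      rw [prod_mv hη false _ _ ha fun x => hh (z * x), mv_other true hab,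
        prod_mv hη true R _ hbe fun x => hh (z * x), prod_mv hη true R _ hb fun x => hh (z * x),
        prod_mv hη false R _ ha fun x => hh (z * x), prod_mv hη true R _ hb fun x => hh (q * z * x),
        hq1, hq2, ← Finset.mul_prod_erase (rowP n k) (fun c => hh (z * qpow η (R c))) hb,
        ← Finset.mul_prod_erase (rowP n k) (fun c => hh (q * z * qpow η (R c))) hb,
        ← Finset.mul_prod_erase ((rowP n k).erase a) (fun c => hh (z * qpow η (R c))) hbe,
        Finset.erase_right_comm (s := rowP n k) (a := a) (b := b)]
      have hae : a ∈ (rowP n k).erase b := Finset.mem_erase.2 ⟨hab, ha⟩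
      rw [← Finset.mul_prod_erase ((rowP n k).erase b) (fun c => hh (z * qpow η (R c))) hae]
      have g1 := hh_three hq0 hxb
      have g2 := hh_lower hq0 hxa
      rw [show z * (q * qpow η (R b)) = q * (z * qpow η (R b)) by ring,
        show z * (q⁻¹ * qpow η (R a)) = q⁻¹ * (z * qpow η (R a)) by ring,
        show q * z * (q * qpow η (R b)) = q * (q * (z * qpow η (R b))) by ring,
        show q * z * qpow η (R b) = q * (z * qpow η (R b)) by ring]
      generalize ∏ c ∈ ((rowP n k).erase b).erase a, hh (z * qpow η (R c)) = B'
      generalize ∏ c ∈ (rowP n k).erase b, hh (q * z * qpow η (R c)) = B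
      generalize z * qpow η (R b) = u at *
      generalize z * qpow η (R a) = w at *
      linear_combination (q⁻¹ * hh w - hh (q⁻¹ * w)) * B * B' * hh (q * u) * g1
  rw [hsum, h4, ← Finset.sum_smul, smul_smul, ← add_smul, ← row_eigenvalue hη hq hC hR hk1 hk hz]
  congr 1
  rw [add_comm]

end EigenStep

end QuantumGT

end

noncomputable section

namespace QuantumGT

/-! ### Shuffles -/

section Shuffles

/-- The values of a shuffle on its first `c` arguments. -/
def shuffleSet {m : ℕ} (c : ℕ) (τ : Equiv.Perm (Fin m)) : Finset (Fin m) :=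
  (Finset.univ.filter fun a : Fin m => a.1 < c).map τ.toEmbedding

theorem apply_mem_shuffleSet {m c : ℕ} (τ : Equiv.Perm (Fin m)) (a : Fin m) :
    τ a ∈ shuffleSet c τ ↔ a.1 < c := by
  simp [shuffleSet]

theorem card_shuffleSet {m c : ℕ} (hc : c ≤ m) (τ : Equiv.Perm (Fin m)) :
    (shuffleSet c τ).card = c := by
  rw [shuffleSet, Finset.card_map, Fin.card_filter_val_lt, min_eq_right hc]

/-- A shuffle is determined by the set `S` of its first `c` values: it lists `S` increasingly and
then the complement increasingly. -/
theorem sum_shuffle {M : Type*} [AddCommMonoid M] (c d : ℕ)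
    [DecidablePred fun τ : Equiv.Perm (Fin (c + d)) => IsShuffle c τ]
    (G : Finset (Fin (c + d)) → M) :
    ∑ τ : Equiv.Perm (Fin (c + d)) with IsShuffle c τ, G (shuffleSet c τ) =
      ∑ S ∈ Finset.powersetCard c (Finset.univ : Finset (Fin (c + d))), G S := by
  refine Finset.sum_bij (fun τ _ => shuffleSet c τ) ?_ ?_ ?_ (fun _ _ => rfl)
  · intro τ _
    rw [Finset.mem_powersetCard]
    exact ⟨Finset.subset_univ _, card_shuffleSet (Nat.le_add_right c d) τ⟩
  · intro τ hτ τ' hτ' h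
    rw [Finset.mem_filter] at hτ hτ'
    have hcard : ∀ σ : Equiv.Perm (Fin (c + d)), (shuffleSet c σ).card = c :=
      card_shuffleSet (Nat.le_add_right c d)
    have hcard' : ∀ σ : Equiv.Perm (Fin (c + d)), (shuffleSet c σ)ᶜ.card = d := by
      intro σ; rw [Finset.card_compl, hcard]; simp
    have key : ∀ σ : Equiv.Perm (Fin (c + d)), IsShuffle c σ →
        (fun i : Fin c => σ (Fin.castAdd d i)) = (shuffleSet c σ).orderEmbOfFin (hcard σ) ∧
        (fun i : Fin d => σ (Fin.natAdd c i)) = (shuffleSet c σ)ᶜ.orderEmbOfFin (hcard' σ) := by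
      intro σ hσ
      constructor
      · refine Finset.orderEmbOfFin_unique _ (fun i => (apply_mem_shuffleSet σ _).2 i.2) ?_
        intro i j hij
        exact hσ _ _ hij (Or.inl j.2)
      · refine Finset.orderEmbOfFin_unique _ (fun i => ?_) ?_
        · rw [Finset.mem_compl, apply_mem_shuffleSet]; simp
        · intro i j hij
          exact hσ _ _ (Nat.add_lt_add_left hij c) (Or.inr (by simp))
    have cast : ∀ {r : ℕ} {S S' : Finset (Fin (c + d))} (h : S = S') (hS : S.card = r)
        (hS' : S'.card = r) (i : Fin r), S.orderEmbOfFin hS i = S'.orderEmbOfFin hS' i := by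
      intro r S S' h hS hS' i
      subst h; rfl
    obtain ⟨h1, h2⟩ := key τ hτ.2
    obtain ⟨h1', h2'⟩ := key τ' hτ'.2
    ext1 a
    refine Fin.addCases (fun i => ?_) (fun i => ?_) a
    · have e1 := congrFun h1 i
      have e2 := congrFun h1' i
      exact (e1.trans ((cast h _ _ i).trans e2.symm))
    · have e1 := congrFun h2 i
      have e2 := congrFun h2' i
      exact (e1.trans ((cast (congrArg _ h) _ _ i).trans e2.symm))
  · intro S hS
    have hc := (Finset.mem_powersetCard.1 hS).2
    have hd : Sᶜ.card = d := by rw [Finset.card_compl, hc]; simp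
    refine ⟨finSumFinEquiv.symm.trans (finSumEquivOfFinset hc hd), ?_, ?_⟩
    · rw [Finset.mem_filter]
      refine ⟨Finset.mem_univ _, ?_⟩
      intro a b
      refine Fin.addCases (fun i => ?_) (fun i => ?_) a <;>
      refine Fin.addCases (fun j => ?_) (fun j => ?_) b
      · intro h _
        have h : i < j := h
        simpa using h
      · intro _ h
        simp at h
        omega
      · intro h _
        have h : c + i.1 < j.1 := h
        omega
      · intro h _
        have h : i < j := Nat.lt_of_add_lt_add_left h
        simpa using h
    · have hsub : shuffleSet c (finSumFinEquiv.symm.trans (finSumEquivOfFinset hc hd)) ⊆ S := by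
        intro x hx
        rw [shuffleSet, Finset.mem_map] at hx
        obtain ⟨a, ha, rfl⟩ := hx
        revert ha
        refine Fin.addCases (fun i => ?_) (fun i => ?_) a
        · intro _
          simp
        · intro h
          simp at h
      exact Finset.eq_of_subset_of_card_le hsub
        (by rw [hc, card_shuffleSet (Nat.le_add_right c d)])

theorem prod_shuffle {m c : ℕ} (τ : Equiv.Perm (Fin m)) (x : Fin m → ℂ) :
    ∏ a : Fin m, (if a.1 < c then x (τ a) else (x (τ a))⁻¹) =
      (∏ i ∈ shuffleSet c τ, x i) * ∏ i ∈ (shuffleSet c τ)ᶜ, (x i)⁻¹ := by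
  rw [← Equiv.prod_comp τ.symm]
  simp only [Equiv.apply_symm_apply]
  have : ∀ i, (τ.symm i).1 < c ↔ i ∈ shuffleSet c τ := by
    intro i
    rw [← apply_mem_shuffleSet τ, Equiv.apply_symm_apply]
  simp only [this]
  rw [Finset.prod_ite]
  congr 2
  · ext i; simp
  · ext i; simp

end Shuffles

/-! ### Laurent coefficients -/

section LaurentCoeff

/-- The coefficients of `∏ (z y_i - (z y_i)⁻¹)`. -/
def laurent {m : ℕ} (y : Fin m → ℂ) (c : ℕ) : ℂ :=
  ∑ S ∈ Finset.powersetCard c (Finset.univ : Finset (Fin m)), (∏ i ∈ S, y i) * ∏ i ∈ Sᶜ, -(y i)⁻¹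

theorem prod_hh_eq_laurent {m : ℕ} (y : Fin m → ℂ) {z : ℂ} (hz : z ≠ 0) :
    ∏ i, hh (z * y i) = ∑ c ∈ Finset.range (m + 1), z ^ (2 * c - m : ℤ) * laurent y c := by
  simp only [hh, sub_eq_add_neg]
  rw [Finset.prod_add, Finset.sum_powerset, Finset.card_univ, Fintype.card_fin]
  refine Finset.sum_congr rfl fun c hc => ?_
  have hc : c ≤ m := by simpa [Nat.lt_succ_iff] using hc
  rw [laurent, Finset.mul_sum]
  refine Finset.sum_congr rfl fun S hS => ?_
  have hS := (Finset.mem_powersetCard.1 hS).2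
  have hSc : Sᶜ.card = m - c := by rw [Finset.card_compl, hS, Fintype.card_fin]
  have e : ∀ i : Fin m, -(z * y i)⁻¹ = z⁻¹ * -(y i)⁻¹ := fun i => by rw [mul_inv]; ring
  have e2 : z ^ (2 * c - m : ℤ) = z ^ c * z⁻¹ ^ (m - c) := by
    rw [inv_pow, ← zpow_natCast, ← zpow_natCast, ← zpow_neg, ← zpow_add₀ hz]
    congr 1
    push_cast [hc]
    ring
  rw [← Finset.compl_eq_univ_sdiff]
  simp only [e, Finset.prod_mul_distrib, Finset.prod_const]
  rw [hS, hSc, ← sub_eq_add_neg, e2]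
  ring

theorem laurent_eq_shuffle {c d : ℕ} {q : ℂ} (hq0 : q ≠ 0)
    [DecidablePred fun τ : Equiv.Perm (Fin (c + d)) => IsShuffle c τ] (x : Fin (c + d) → ℂ) :
    laurent (fun i => q * x i) c = (-1) ^ d * q ^ (c - d : ℤ) *
      ∑ τ : Equiv.Perm (Fin (c + d)) with IsShuffle c τ,
        ∏ a, (if a.1 < c then x (τ a) else (x (τ a))⁻¹) := by
  simp only [prod_shuffle]
  rw [sum_shuffle c d fun S => (∏ i ∈ S, x i) * ∏ i ∈ Sᶜ, (x i)⁻¹, laurent, Finset.mul_sum]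
  refine Finset.sum_congr rfl fun S hS => ?_
  have hS := (Finset.mem_powersetCard.1 hS).2
  have hSc : Sᶜ.card = d := by rw [Finset.card_compl, hS, Fintype.card_fin]; omega
  have e : ∀ i, -(q * x i)⁻¹ = (-1) * q⁻¹ * (x i)⁻¹ := fun i => by rw [mul_inv]; ring
  simp only [e, Finset.prod_mul_distrib, Finset.prod_const]
  rw [hS, hSc, zpow_sub₀ hq0, zpow_natCast, zpow_natCast, inv_pow]
  ring

end LaurentCoeff

end QuantumGT

end

noncomputable section

namespace QuantumGT

/-! ### The eigenvalues of the quantum determinants and of `c_{mk}` -/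

section Eigenvalues

variable {n : ℕ} {q η : ℂ} {C : Set (Rel n)} {L : Tableau n}

/-- The eigenvalue of the quantum determinant. -/
def detVal (q η : ℂ) (m : ℕ) (z : ℂ) (R : Tableau n) : ℂ :=
  ∏ c ∈ rowP n m, hh (q * z * qpow η (R c))

theorem detVal_eq {m : ℕ} (hm : m ≤ n) (z : ℂ) (R : Tableau n) :
    detVal q η m z R = ∏ i : Fin m, hh (z * (q * qpow η (entry R m (i.1 + 1)))) := by
  have h := prod_Icc_eq hm fun j => hh (z * (q * qpow η (entry R m j)))
  have e : detVal q η m z R = ∏ a ∈ rowP n m, hh (z * (q * qpow η (entry R m a.col))) := by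
    refine Finset.prod_congr rfl fun a ha => ?_
    rw [← mem_rowP.1 ha, entry_pos]
    congr 1; ring
  rw [e, ← h, Fin.prod_univ_eq_prod_range (fun i => hh (z * (q * qpow η (entry R m (i + 1))))) m,
    Finset.range_eq_Ico, Finset.prod_Ico_add' (fun j => hh (z * (q * qpow η (entry R m j)))) 0 m 1]
  rfl

/-- The equations for the action of `c_{mk}`. -/
theorem cgen_tab_of_detU (hη : Complex.exp η = q) (hq : ∀ r : ℕ, 0 < r → q ^ r ≠ 1)
    (ρ : Uq n q →ₐ[ℂ] Module.End ℂ (VC η C L)) {m : ℕ} (hm : m ≤ n) (R : Tableau n) {F : Set ℂ}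
    (hF : F.Finite) (h : ∀ z : ℂ, z ≠ 0 → z ∉ F →
      ρ (detU n q m z) (tab η C L R) = detVal q η m z R • tab η C L R) {c : ℕ} (hc : c ≤ m) :
    detCoeff q m c • ρ (cgen n q m c) (tab η C L R) =
      (qfac q m * laurent (fun i : Fin m => q * qpow η (entry R m (i.1 + 1))) c) • tab η C L R := by
  have hq0 : q ≠ 0 := by rw [← hη]; exact Complex.exp_ne_zero _
  have H := uq_gens (n := n) hq0 hq
  have key := mem_of_forall_sum_zpow_smul_mem (⊥ : Submodule ℂ (VC η C L)) m
    (fun c => detCoeff q m c • ρ (cmk q (eU n q) (fU n q) (fun c => qU n q (eps n c))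
      (fun c => qU n q (-eps n c)) m c) (tab η C L R) -
      (qfac q m * laurent (fun i : Fin m => q * qpow η (entry R m (i.1 + 1))) c) • tab η C L R)
    hF (by
      intro z hz hzF
      rw [Submodule.mem_bot]
      simp only [smul_sub, Finset.sum_sub_distrib, smul_smul]
      have h2 := congrArg (fun x => ρ x (tab η C L R)) (H.qdet_expansion hm hz)
      simp only [map_smul, map_sum, LinearMap.smul_apply, LinearMap.sum_apply] at h2
      rw [← h2, h z hz hzF, detVal_eq hm, prod_hh_eq_laurent _ hz, smul_smul, Finset.mul_sum,
        Finset.sum_smul, sub_eq_zero]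
      refine Finset.sum_congr rfl fun c _ => ?_
      congr 1; ring) hc
  rw [Submodule.mem_bot, sub_eq_zero] at key
  rw [cgen_eq n q hc]
  exact key

/-- Both sides are Laurent polynomials in `z`. Agreement outside a finite set gives agreement of the
coefficients, hence agreement for every `z ≠ 0`. -/
theorem detU_tab_of_finite (hη : Complex.exp η = q) (hq : ∀ r : ℕ, 0 < r → q ^ r ≠ 1)
    (ρ : Uq n q →ₐ[ℂ] Module.End ℂ (VC η C L)) {m : ℕ} (hm : m ≤ n) (R : Tableau n) {F : Set ℂ}
    (hF : F.Finite) (h : ∀ z : ℂ, z ≠ 0 → z ∉ F →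
      ρ (detU n q m z) (tab η C L R) = detVal q η m z R • tab η C L R) {z : ℂ} (hz : z ≠ 0) :
    ρ (detU n q m z) (tab η C L R) = detVal q η m z R • tab η C L R := by
  have hq0 : q ≠ 0 := by rw [← hη]; exact Complex.exp_ne_zero _
  have H := uq_gens (n := n) hq0 hq
  have h2 := congrArg (fun x => ρ x (tab η C L R)) (H.qdet_expansion hm hz)
  simp only [map_smul, map_sum, LinearMap.smul_apply, LinearMap.sum_apply] at h2
  have h3 : ∀ c ∈ Finset.range (m + 1), (z ^ (2 * c - m : ℤ) * detCoeff q m c) •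
      ρ (cmk q (eU n q) (fU n q) (fun c => qU n q (eps n c)) (fun c => qU n q (-eps n c)) m c)
        (tab η C L R) = (qfac q m * (z ^ (2 * c - m : ℤ) *
          laurent (fun i : Fin m => q * qpow η (entry R m (i.1 + 1))) c)) • tab η C L R := by
    intro c hc
    have hc : c ≤ m := by simpa [Nat.lt_succ_iff] using hc
    have := cgen_tab_of_detU hη hq ρ hm R hF h hc
    rw [cgen_eq n q hc] at this
    rw [mul_smul, this, smul_smul]
    congr 1; ring
  rw [Finset.sum_congr rfl h3, ← Finset.sum_smul, ← Finset.mul_sum, ← prod_hh_eq_laurent _ hz,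
    ← detVal_eq hm, mul_smul] at h2
  exact smul_right_injective _ (qfac_ne_zero hq m) h2

theorem rowP_zero : rowP n 0 = ∅ := by
  ext a
  simp only [mem_rowP, Finset.notMem_empty, iff_false]
  have := a.row_pos
  omega

theorem rowP_one (hn : 1 ≤ n) : rowP n 1 = {⟨(1, 1), le_refl 1, le_refl 1, hn⟩} := by
  ext a
  simp only [mem_rowP, Finset.mem_singleton]
  constructor
  · intro h
    have h1 := a.2.1
    have h2 := a.2.2.1
    refine Subtype.ext (Prod.ext h ?_)
    change a.1.1 = 1 at h
    simp only
    omega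
  · rintro rfl; rfl

theorem apply_rec {A V : Type*} [Ring A] [Algebra ℂ A] [AddCommGroup V] [Module ℂ V]
    (ρ : A →ₐ[ℂ] Module.End ℂ V) {d d' c e a a' κ : A} {s : ℂ}
    (h : d * d' = s • (c * (e * a)) - e * (c * a) - c * (a * e) + κ * (a' * a)) (v : V) :
    ρ d (ρ d' v) = s • ρ c (ρ e (ρ a v)) - ρ e (ρ c (ρ a v)) - ρ c (ρ a (ρ e v)) +
      ρ κ (ρ a' (ρ a v)) := by
  have := congrArg (fun x => ρ x v) h
  simpa only [map_mul, map_sub, map_add, map_smul, Module.End.mul_apply, LinearMap.sub_apply,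
    LinearMap.add_apply, LinearMap.smul_apply] using this

/-- The action of the quantum determinants. -/
theorem detU_tab (hη : Complex.exp η = q) (hq : ∀ r : ℕ, 0 < r → q ^ r ≠ 1)
    (hC : Admissible C) (hL : IsRealization η C L) {ρ : Uq n q →ₐ[ℂ] Module.End ℂ (VC η C L)}
    (hρ : ∀ g, ρ (gen n q g) = genOp q η C L g) : ∀ (m : ℕ), m ≤ n → ∀ {z : ℂ}, z ≠ 0 →
    ∀ {R : Tableau n}, R ∈ basisSet η C L →
      ρ (detU n q m z) (tab η C L R) = detVal q η m z R • tab η C L R := by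
  have hq0 : q ≠ 0 := by rw [← hη]; exact Complex.exp_ne_zero _
  have H := uq_gens (n := n) hq0 hq
  intro m
  induction m using Nat.strong_induction_on with
  | _ m ih =>
    intro hm z hz R hR
    match m, ih, hm with
    | 0, _, _ =>
      rw [detVal, rowP_zero, Finset.prod_empty, one_smul, detU, qdet]
      simp [fused, qminor]
    | 1, _, hm =>
      rw [detVal, rowP_one hm, Finset.prod_singleton, detU, qdet]
      have e1 : qminor q (fused q (eU n q) (fU n q) (fun c => qU n q (eps n c))
          (fun c => qU n q (-eps n c)) 1 z) (Finset.Icc 1 1) (List.range' 1 1) =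
          z • qU n q (eps n 1) - z⁻¹ • qU n q (-eps n 1) := by
        simp [fused, qminor, below, Lz, lp, lm, Finset.filter_singleton]
      rw [e1, map_sub, map_smul, map_smul, qU, qU, hρ, hρ]
      simp only [genOp, LinearMap.sub_apply, LinearMap.smul_apply]
      rw [wtOp_tab _ hR, wtOp_tab _ hR, wtExp_neg, wtExp_eps le_rfl hm, weightExp_eq R hm,
        rowP_one hm, rowP_zero, Finset.sum_singleton, Finset.sum_empty, smul_smul, smul_smul,
        ← sub_smul, qpow_neg, sub_zero, Nat.cast_one, qpow_add, qpow_one hη, hh, mul_inv, mul_inv,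
        mul_inv]
      congr 1; ring
    | p + 2, ih, hm =>
      -- The excluded values are the zeros in `z` of the eigenvalue of the determinant of order `p`
      -- at `z q⁻¹`, by which the recursion is divided at the end.
      refine detU_tab_of_finite hη hq ρ hm R (F := ⋃ a ∈ rowP n p,
        {(qpow η (R a))⁻¹, -(qpow η (R a))⁻¹}) ?_ ?_ hz
      · exact Set.Finite.biUnion (Finset.finite_toSet _) fun a _ => Set.toFinite _
      · clear hz z
        intro z hz hzF
        have hz' : z * q⁻¹ ≠ 0 := mul_ne_zero hz (inv_ne_zero hq0)
        have hne : ∏ c ∈ rowP n p, hh (z * qpow η (R c)) ≠ 0 := by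
          rw [Finset.prod_ne_zero_iff]
          intro a ha h0
          apply hzF
          have hx := qpow_ne_zero η (R a)
          rw [Set.mem_iUnion₂]
          refine ⟨a, ha, ?_⟩
          rw [hh, sub_eq_zero] at h0
          have h1 : (z * qpow η (R a)) ^ 2 = 1 := by
            rw [sq]; nth_rewrite 2 [h0]; exact mul_inv_cancel₀ (mul_ne_zero hz hx)
          rcases mul_self_eq_one_iff.1 ((sq _).symm.trans h1) with h2 | h2
          · left; exact eq_inv_of_mul_eq_one_left h2
          · right
            rw [Set.mem_singleton_iff, ← neg_eq_iff_eq_neg]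
            exact eq_inv_of_mul_eq_one_left (by rw [neg_mul, h2, neg_neg])
        have hrec := H.qdet_rec (fun r => qfac_ne_zero hq r) hm hz rfl rfl rfl
        have hrec := apply_rec ρ hrec (tab η C L R)
        have hpi : 1 ≤ p + 1 ∧ p + 1 < n := ⟨by omega, by omega⟩
        have hE : ρ (eU n q (p + 1)) = rowOp q η C L true (p + 1) := by
          rw [eU, dif_pos hpi, hρ]; rfl
        have hFo : ρ (fU n q (p + 1)) = rowOp q η C L false (p + 1) := by
          rw [fU, dif_pos hpi, hρ]; rfl
        have hA : ∀ S ∈ basisSet η C L, ρ (detU n q (p + 1) z) (tab η C L S) =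
            (∏ c ∈ rowP n (p + 1), hh (q * z * qpow η (S c))) • tab η C L S :=
          fun S hS => ih (p + 1) (by omega) (by omega) hz hS
        -- The extra `q` in `detVal` compensates the shift of the argument, so the eigenvalues at `z
        -- q⁻¹` have the factors required by `eigen_step`.
        have hqz : q * (z * q⁻¹) = z := by field_simp
        have hA' : ∀ S ∈ basisSet η C L, ρ (detU n q (p + 1) (z * q⁻¹)) (tab η C L S) =
            (∏ c ∈ rowP n (p + 1), hh (z * qpow η (S c))) • tab η C L S := by
          intro S hS
          have := ih (p + 1) (by omega) (by omega) hz' hS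
          rw [detVal, hqz] at this
          exact this
        have h0 := ih p (by omega) (by omega) hz' hR
        rw [detVal, hqz] at h0
        have hK : ρ (qU n q (-eps n (p + 1)) * qU n q (eps n (p + 2))) (tab η C L R) =
            (kval q η R (p + 1))⁻¹ • tab η C L R := by
          rw [qU_add, qU, hρ, genOp, wtOp_tab _ hR, wtExp_add, wtExp_neg, wtExp_eps hpi.1 hpi.2.le,
            wtExp_eps (by omega) hm, ← kval_eq hη R hpi.2, ← qpow_neg]
          congr 2; ring
        have hstep := eigen_step hη hq hC hL hR hpi.1 hpi.2 hz hA hA'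
          (c := ρ (q⁻¹ • (fU n q (p + 1) * detU n q (p + 1) (z * q⁻¹)) -
            detU n q (p + 1) (z * q⁻¹) * fU n q (p + 1)))
          (by rw [map_sub, map_smul, map_mul, map_mul, hFo])
        rw [hE] at hrec
        rw [h0, hA R hR, map_smul (ρ (detU n q (p + 1) (z * q⁻¹))), hA' R hR] at hrec
        rw [hA R hR, map_smul (ρ (detU n q (p + 1) (z * q⁻¹))), hA' R hR] at hstep
        rw [map_smul (ρ (qU n q (-eps n (p + 1)) * _)), map_smul (ρ (qU n q (-eps n (p + 1)) * _)), hK,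
          smul_comm _ (kval q η R (p + 1))⁻¹, smul_comm _ (kval q η R (p + 1))⁻¹, hstep,
          map_smul, mul_comm, mul_smul] at hrec
        exact smul_right_injective _ hne hrec

/-- Comparison of normalizations: `[m]_{q²}!` is `q^{m(m-1)}` times the factorial in `q⁻²`, and the
Gaussian binomial in `detCoeff` splits this factorial into the two factorials of `gammaVal`. The
remaining powers of `q` and the signs agree. -/
theorem detCoeff_mul_gammaVal (hη : Complex.exp η = q) (hq : ∀ r : ℕ, 0 < r → q ^ r ≠ 1) {m c : ℕ}
    (hc : c ≤ m) (R : Tableau n) : detCoeff q m c * gammaVal q η m c R =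
      qfac q m * laurent (fun i : Fin m => q * qpow η (entry R m (i.1 + 1))) c := by
  classical
  have hq0 : q ≠ 0 := by rw [← hη]; exact Complex.exp_ne_zero _
  obtain ⟨d, rfl⟩ := Nat.exists_eq_add_of_le hc
  have hS : ∀ τ : Equiv.Perm (Fin (c + d)), qpow η (∑ a : Fin (c + d),
      if a.1 < c then entry R (c + d) ((τ a).1 + 1) else -entry R (c + d) ((τ a).1 + 1)) =
      ∏ a : Fin (c + d), if a.1 < c then qpow η (entry R (c + d) ((τ a).1 + 1)) else
        (qpow η (entry R (c + d) ((τ a).1 + 1)))⁻¹ := by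
    intro τ
    rw [qpow_sum]
    refine Finset.prod_congr rfl fun a _ => ?_
    split_ifs
    · rfl
    · rw [qpow_neg]
  -- Because `m(m-3)/2` is `m.choose 2 - m`, the exponent is an integer and the power does not
  -- depend on the logarithm.
  have hexp : ((c : ℂ) * (c + 1) + ((c + d : ℕ) : ℂ) * (((c + d : ℕ) : ℂ) - 3) / 2) =
      (((c : ℤ) * (c + 1) + ((c + d).choose 2 : ℤ) - (c + d : ℤ) : ℤ) : ℂ) := by
    push_cast
    rw [Nat.cast_choose_two]
    push_cast
    ring
  have hbin := qbin_mul_qfactorial (p := q⁻¹ ^ 2) (by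
    have := inv_sq_pow_ne_one hq 1 one_pos
    rwa [pow_one] at this) hc
  have hch : (((c + d) * (c + d - 1) : ℕ) : ℤ) = 2 * ((c + d).choose 2 : ℤ) := by
    have h2 : (c + d) * (c + d - 1) = 2 * (c + d).choose 2 := by
      rw [Nat.choose_two_right, Nat.mul_div_cancel' (Nat.even_mul_pred_self _).two_dvd]
    exact_mod_cast h2
  rw [gammaVal, laurent_eq_shuffle hq0 fun i : Fin (c + d) => qpow η (entry R (c + d) (i.1 + 1)),
    hexp, qpow_int hη, qfac_eq hq0 (hq 2 two_pos), ← hbin, detCoeff]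
  simp only [hS]
  have hpow : q ^ (((c + d).choose 2 : ℤ) - c * (c - 1)) *
      q ^ ((c : ℤ) * (c + 1) + ((c + d).choose 2 : ℤ) - (c + d : ℤ)) =
      q ^ ((c + d) * (c + d - 1)) * q ^ (c - d : ℤ) := by
    rw [← zpow_natCast q ((c + d) * (c + d - 1)), hch, ← zpow_add₀ hq0, ← zpow_add₀ hq0]
    congr 1; ring
  have hsign : (-1 : ℂ) ^ (c + d + c) = (-1) ^ d := by
    rw [show c + d + c = d + 2 * c by ring, pow_add, pow_mul]; simp
  rw [hsign]
  generalize (∑ τ : Equiv.Perm (Fin (c + d)) with IsShuffle c τ, _ : ℂ) = S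
  linear_combination (-1) ^ d * qbin (q⁻¹ ^ 2) (c + d) c * (qfactorial (q⁻¹ ^ 2) c *
    qfactorial (q⁻¹ ^ 2) (c + d - c)) * S * hpow

theorem cgen_tab (hη : Complex.exp η = q) (hq : ∀ r : ℕ, 0 < r → q ^ r ≠ 1)
    (hC : Admissible C) (hL : IsRealization η C L) {ρ : Uq n q →ₐ[ℂ] Module.End ℂ (VC η C L)}
    (hρ : ∀ g, ρ (gen n q g) = genOp q η C L g) {m c : ℕ} (hm : m ≤ n) (hc : c ≤ m)
    {R : Tableau n} (hR : R ∈ basisSet η C L) :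
    ρ (cgen n q m c) (tab η C L R) = gammaVal q η m c R • tab η C L R := by
  have hq0 : q ≠ 0 := by rw [← hη]; exact Complex.exp_ne_zero _
  have h := cgen_tab_of_detU hη hq ρ hm R Set.finite_empty
    (fun z hz _ => detU_tab hη hq hC hL hρ m hm hz hR) hc
  rw [← detCoeff_mul_gammaVal hη hq hc, mul_smul] at h
  exact smul_right_injective _ (detCoeff_ne_zero hq0 hq hc) h

end Eigenvalues

end QuantumGT

end

/-! ### The Gelfand–Tsetlin property: separation, weight decomposition, finite generation. -/

noncomputable section

namespace QuantumGT

/-! ### Separation by the quantum determinants -/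

section Separate

variable {n : ℕ} {q η : ℂ} {C : Set (Rel n)} {L : Tableau n}

theorem detVal_eq_zero_iff (hq0 : q ≠ 0) {m : ℕ} {z : ℂ} (hz : z ≠ 0) (R : Tableau n) :
    detVal q η m z R = 0 ↔ ∃ a : Pos n, a.row = m ∧ (q * z) ^ 2 * qpow η (R a) ^ 2 = 1 := by
  rw [detVal, Finset.prod_eq_zero_iff]
  simp only [mem_rowP]
  refine exists_congr fun a => and_congr_right fun _ => ?_
  have hx : q * z * qpow η (R a) ≠ 0 := mul_ne_zero (mul_ne_zero hq0 hz) (qpow_ne_zero _ _)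
  rw [hh, sub_eq_zero, ← mul_pow, sq]
  constructor
  · intro h
    nth_rewrite 2 [h]
    exact mul_inv_cancel₀ hx
  · intro h; exact eq_inv_of_mul_eq_one_left h

/-- If the quantum determinants have the same values then the entries of a row are the same up to
the order and up to `1(q)/2`. -/
theorem exists_sq_eq (hη : Complex.exp η = q) {R S : Tableau n} {m : ℕ}
    (h : ∀ z : ℂ, z ≠ 0 → detVal q η m z R = detVal q η m z S) {a : Pos n} (ha : a.row = m) :
    ∃ b : Pos n, b.row = m ∧ Dif η (R a - S b) 0 := by
  have hq0 : q ≠ 0 := by rw [← hη]; exact Complex.exp_ne_zero _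
  have hx := qpow_ne_zero η (R a)
  -- This value of `z` makes the factor of `a` in the eigenvalue vanish, so some factor belonging to
  -- `S` has to vanish there as well.
  have hz : (q * qpow η (R a))⁻¹ ≠ 0 := inv_ne_zero (mul_ne_zero hq0 hx)
  have h1 : detVal q η m (q * qpow η (R a))⁻¹ R = 0 := by
    rw [detVal_eq_zero_iff hq0 hz]
    refine ⟨a, ha, ?_⟩
    field_simp
  rw [h _ hz, detVal_eq_zero_iff hq0 hz] at h1
  obtain ⟨b, hb, h2⟩ := h1
  refine ⟨b, hb, ?_⟩
  have hy := qpow_ne_zero η (S b)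
  rw [dif_iff, Int.cast_zero, sub_zero, qpow_two_mul, qpow_sub]
  field_simp at h2 ⊢
  rw [← h2]

/-- The quantum determinants separate the tableaux of the basis. -/
theorem exists_detVal_ne (hη : Complex.exp η = q) (hq : ∀ r : ℕ, 0 < r → q ^ r ≠ 1)
    (hC : Admissible C) {R S : Tableau n} (hR : R ∈ basisSet η C L) (hS : S ∈ basisSet η C L)
    (hRS : R ≠ S) : ∃ m z, 1 ≤ m ∧ m ≤ n ∧ z ≠ 0 ∧ detVal q η m z R ≠ detVal q η m z S := by
  by_contra hcon
  push Not at hcon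
  obtain ⟨zR, hzR0, hzR⟩ := hR.1
  obtain ⟨zS, hzS0, hzS⟩ := hS.1
  obtain ⟨a₀, ha₀⟩ := Function.ne_iff.1 hRS
  -- The leftmost position, in a row where `R` and `S` differ, at which they differ.
  obtain ⟨a, ha, hmin⟩ := Finset.exists_min_image
    ((rowP n a₀.row).filter fun c => R c ≠ S c) Pos.col
    ⟨a₀, Finset.mem_filter.2 ⟨mem_rowP.2 rfl, ha₀⟩⟩
  rw [Finset.mem_filter, mem_rowP] at ha
  obtain ⟨har, hne⟩ := ha
  have han : a.row < n := by
    refine lt_of_le_of_ne a.2.2.2 fun h => hne ?_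
    rw [hzR, hzS, hzR0 a h, hzS0 a h]
  have hsame : ∀ c : Pos n, c.row = a.row → c.col < a.col → R c = S c := by
    intro c hc hcol
    by_contra hcne
    have := hmin c (Finset.mem_filter.2 ⟨mem_rowP.2 (hc.trans har), hcne⟩)
    omega
  have hd : R a - S a = ((zR a - zS a : ℤ) : ℂ) := by rw [hzR, hzS]; push_cast; ring
  have hd0 : zR a - zS a ≠ 0 := by
    intro h
    rw [h, Int.cast_zero, sub_eq_zero] at hd
    exact hne hd
  have hval : ∀ z : ℂ, z ≠ 0 → detVal q η a.row z R = detVal q η a.row z S :=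
    fun z hz => hcon a.row z a.row_pos han.le hz
  -- The entry of `R` at `a` equals, modulo `1(q)/2`, the entry of `S` at some `b` in the same row.
  -- The position `b` cannot be to the left, where `R` and `S` agree and comparable entries of `R`
  -- are distinct, nor be `a` itself. So it is to the right, and the entries of `S` decrease, which
  -- fixes the sign of the shift at `a`. The same with `R` and `S` exchanged gives the opposite
  -- sign.
  have key : ∀ {R S : Tableau n}, R ∈ basisSet η C L → S ∈ basisSet η C L →
      (∀ z : ℂ, z ≠ 0 → detVal q η a.row z R = detVal q η a.row z S) →
      (∀ c : Pos n, c.row = a.row → c.col < a.col → R c = S c) →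
      ∀ d : ℤ, R a - S a = d → d ≠ 0 → d < 0 := by
    intro R S hR hS hval hsame d hd hd0
    obtain ⟨b, hb, hab⟩ := exists_sq_eq hη hval rfl
    have h2 : Dif η (S a - S b) (-d) := by
      have := hab.add_int (-d)
      rw [zero_add] at this
      convert this using 1
      push_cast
      rw [← hd]; ring
    have hcol : a.col < b.col := by
      rcases lt_trichotomy a.col b.col with h | h | h
      · exact h
      · exfalso
        obtain rfl := Pos.ext_iff'.2 ⟨hb.symm, h⟩
        rw [sub_self] at h2
        have := h2.unique hη hq (m' := 0) (by exact_mod_cast dif_int η 0)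
        omega
      · exfalso
        rw [← hsame b hb h] at hab
        exact qbracket_row_ne_zero hη hq hC hR hb.symm han (by rintro rfl; omega)
          ((qbracket_eq_zero_iff hη hq).2 hab)
    have := pos_of_dif hη hq hC hS hb.symm han hcol h2
    omega
  have h1 := key hR hS hval hsame _ hd hd0
  have h2 := key hS hR (fun z hz => (hval z hz).symm) (fun c hc hcol => (hsame c hc hcol).symm)
    (-(zR a - zS a)) (by rw [Int.cast_neg, ← hd]; ring) (by omega)
  omega

theorem diag_apply {D : Module.End ℂ (VC η C L)} {d : Tableau n → ℂ}
    (h : ∀ S ∈ basisSet η C L, D (tab η C L S) = d S • tab η C L S) (v : VC η C L)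
    (S : basisSet η C L) : D v S = d S.1 * v S := by
  have : (Finsupp.lapply S).comp D = d S.1 • (Finsupp.lapply S : VC η C L →ₗ[ℂ] ℂ) := by
    refine linearMap_ext_tab fun R hR => ?_
    rw [LinearMap.comp_apply, h R hR, map_smul, LinearMap.smul_apply, tab_of_mem hR,
      Finsupp.lapply_apply, Finsupp.single_apply]
    split_ifs with hRS
    · rw [← hRS]
    · simp
  exact LinearMap.congr_fun this v

theorem eq_smul_tab {v : VC η C L} {R : Tableau n} (hR : R ∈ basisSet η C L)
    (h : ∀ S : basisSet η C L, S.1 ≠ R → v S = 0) : v = v ⟨R, hR⟩ • tab η C L R := by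
  rw [tab_of_mem hR]
  ext S
  rw [Finsupp.smul_apply, Finsupp.single_apply]
  split_ifs with hS
  · subst hS; simp
  · rw [h S fun h => hS (Subtype.ext h.symm), smul_zero]

/-- A subspace which is invariant under the quantum determinants contains the basis vectors that
occur in its elements. -/
theorem tab_mem_of_apply_ne_zero (hη : Complex.exp η = q) (hq : ∀ r : ℕ, 0 < r → q ^ r ≠ 1)
    (hC : Admissible C) (hL : IsRealization η C L) {ρ : Uq n q →ₐ[ℂ] Module.End ℂ (VC η C L)}
    (hρ : ∀ g, ρ (gen n q g) = genOp q η C L g) (N : Submodule ℂ (VC η C L))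
    (hN : ∀ m z, ∀ v ∈ N, ρ (detU n q m z) v ∈ N) (S : basisSet η C L) :
    ∀ (k : ℕ) (v : VC η C L), v.support.card ≤ k → v ∈ N → v S ≠ 0 → tab η C L S.1 ∈ N := by
  intro k
  induction k with
  | zero =>
    intro v hv _ hvS
    rw [Nat.le_zero, Finset.card_eq_zero, Finsupp.support_eq_empty] at hv
    rw [hv] at hvS
    exact absurd rfl hvS
  | succ k ih =>
    intro v hv hvN hvS
    by_cases hT : ∃ T : basisSet η C L, T ≠ S ∧ v T ≠ 0
    · obtain ⟨T, hTS, hvT⟩ := hT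
      obtain ⟨m, z, h1, hm, hz, hne⟩ := exists_detVal_ne hη hq hC S.2 T.2
        (fun h => hTS (Subtype.ext h.symm))
      have hdiag : ∀ U : basisSet η C L, (ρ (detU n q m z) v - detVal q η m z T.1 • v) U =
          (detVal q η m z U.1 - detVal q η m z T.1) * v U := by
        intro U
        rw [Finsupp.sub_apply, Finsupp.smul_apply, diag_apply (d := detVal q η m z)
          (fun R hR => detU_tab hη hq hC hL hρ m hm hz hR), smul_eq_mul]
        ring
      -- Subtracting the eigenvalue at `T` removes `T` from the support, adds nothing, and keeps the
      -- coordinate at `S` nonzero.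
      refine ih (ρ (detU n q m z) v - detVal q η m z T.1 • v) ?_
        (N.sub_mem (hN m z v hvN) (N.smul_mem _ hvN)) ?_
      · have hss : (ρ (detU n q m z) v - detVal q η m z T.1 • v).support ⊂ v.support := by
          refine Finset.ssubset_iff_subset_ne.2 ⟨fun U hU => ?_, fun h => ?_⟩
          · rw [Finsupp.mem_support_iff, hdiag] at hU
            exact Finsupp.mem_support_iff.2 (right_ne_zero_of_mul hU)
          · have hmem : T ∈ v.support := Finsupp.mem_support_iff.2 hvT
            rw [← h, Finsupp.mem_support_iff, hdiag, sub_self, zero_mul] at hmem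
            exact hmem rfl
        have := Finset.card_lt_card hss
        omega
      · rw [hdiag]
        exact mul_ne_zero (sub_ne_zero.2 hne) hvS
    · push Not at hT
      have h1 := eq_smul_tab S.2 (fun T hTS => hT T fun h => hTS (congrArg Subtype.val h))
      rw [h1] at hvN
      exact (N.smul_mem_iff hvS).1 hvN

/-- The elements of the Gelfand–Tsetlin subalgebra act diagonally. -/
theorem gam_diag (hη : Complex.exp η = q) (hq : ∀ r : ℕ, 0 < r → q ^ r ≠ 1)
    (hC : Admissible C) (hL : IsRealization η C L) {ρ : Uq n q →ₐ[ℂ] Module.End ℂ (VC η C L)}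
    (hρ : ∀ g, ρ (gen n q g) = genOp q η C L g) {x : Uq n q} (hx : x ∈ Gam n q)
    {R : Tableau n} (hR : R ∈ basisSet η C L) :
    ρ x (tab η C L R) = ρ x (tab η C L R) ⟨R, hR⟩ • tab η C L R := by
  have hq0 : q ≠ 0 := by rw [← hη]; exact Complex.exp_ne_zero _
  refine eq_smul_tab hR fun S hS => ?_
  obtain ⟨m, z, h1, hm, hz, hne⟩ := exists_detVal_ne hη hq hC S.2 hR hS
  -- An operator commuting with the determinants has no matrix entry between basis vectors that some
  -- determinant distinguishes.
  have hcomm : x * detU n q m z = detU n q m z * x :=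
    congrArg Subtype.val (Gam_mul_comm n q ⟨x, hx⟩ ⟨_, detU_mem_Gam hq0 hq h1 hm hz⟩)
  have h2 := congrArg (fun y => ρ y (tab η C L R)) hcomm
  simp only [map_mul, Module.End.mul_apply] at h2
  rw [detU_tab hη hq hC hL hρ m hm hz hR, map_smul] at h2
  have h3 := DFunLike.congr_fun h2 S
  rw [diag_apply (d := detVal q η m z) (fun R hR => detU_tab hη hq hC hL hρ m hm hz hR),
    Finsupp.smul_apply, smul_eq_mul] at h3
  have h4 : (detVal q η m z S.1 - detVal q η m z R) * ρ x (tab η C L R) S = 0 := by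
    rw [sub_mul, ← h3, sub_self]
  exact (mul_eq_zero.1 h4).resolve_left (sub_ne_zero.2 hne)

end Separate

end QuantumGT

end

noncomputable section

namespace QuantumGT

/-! ### The decomposition into generalized weight spaces -/

section Decomposition

variable {n : ℕ} {q η : ℂ} {C : Set (Rel n)} {L : Tableau n}

theorem tab_apply_self (R : basisSet η C L) : tab η C L R.1 R = 1 := by
  rw [tab_of_mem R.2, Finsupp.single_eq_same]

/-- The character by which the Gelfand–Tsetlin subalgebra acts on `T(R)`. -/
def gtChar {ρ : Uq n q →ₐ[ℂ] Module.End ℂ (VC η C L)}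
    (hd : ∀ x ∈ Gam n q, ∀ R : basisSet η C L,
      ρ x (tab η C L R.1) = ρ x (tab η C L R.1) R • tab η C L R.1) (R : basisSet η C L) :
    GamAlg n q →+* ℂ where
  toFun x := ρ x.incl (tab η C L R.1) R
  map_one' := by
    change ρ (1 : Uq n q) (tab η C L R.1) R = 1
    rw [map_one, Module.End.one_apply, tab_apply_self]
  map_zero' := by
    change ρ (0 : Uq n q) (tab η C L R.1) R = 0
    rw [map_zero]; rfl
  map_add' x y := by
    change ρ (x.incl + y.incl) (tab η C L R.1) R = _
    rw [map_add]; rfl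
  map_mul' x y := by
    change ρ (x.incl * y.incl) (tab η C L R.1) R = _
    have h := congrArg (fun v => ρ x.incl v R) (hd y.incl y.2 R)
    simp only [map_smul, Finsupp.smul_apply, smul_eq_mul] at h
    rw [map_mul, Module.End.mul_apply, h, mul_comm]

theorem gtChar_surjective {ρ : Uq n q →ₐ[ℂ] Module.End ℂ (VC η C L)}
    (hd : ∀ x ∈ Gam n q, ∀ R : basisSet η C L,
      ρ x (tab η C L R.1) = ρ x (tab η C L R.1) R • tab η C L R.1) (R : basisSet η C L) :
    Function.Surjective (gtChar hd R) := by
  intro c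
  refine ⟨(⟨algebraMap ℂ _ c, (Gam n q).algebraMap_mem c⟩ : Gam n q), ?_⟩
  change ρ (algebraMap ℂ _ c) (tab η C L R.1) R = c
  rw [AlgHom.commutes, Module.algebraMap_end_apply, Finsupp.smul_apply, tab_apply_self,
    smul_eq_mul, mul_one]

/-- The maximal ideal of the Gelfand–Tsetlin subalgebra which annihilates `T(R)`. -/
def gtIdeal {ρ : Uq n q →ₐ[ℂ] Module.End ℂ (VC η C L)}
    (hd : ∀ x ∈ Gam n q, ∀ R : basisSet η C L,
      ρ x (tab η C L R.1) = ρ x (tab η C L R.1) R • tab η C L R.1) (R : basisSet η C L) :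
    MaximalSpectrum (GamAlg n q) :=
  ⟨RingHom.ker (gtChar hd R), RingHom.ker_isMaximal_of_surjective _ (gtChar_surjective hd R)⟩

theorem tab_mem_genSpace {ρ : Uq n q →ₐ[ℂ] Module.End ℂ (VC η C L)}
    (hd : ∀ x ∈ Gam n q, ∀ R : basisSet η C L,
      ρ x (tab η C L R.1) = ρ x (tab η C L R.1) R • tab η C L R.1) (R : basisSet η C L) :
    tab η C L R.1 ∈ genSpace ρ (gtIdeal hd R) := by
  refine ⟨1, fun x hx => ?_⟩
  rw [pow_one] at hx
  have h1 : ρ x.incl (tab η C L R.1) R = 0 := hx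
  rw [hd x.incl x.2 R, h1, zero_smul]

/-- If `T(R)` occurs in `v` and `𝔪^k` kills `v`, then for `x ∈ 𝔪` the `k`-th power of the value of
the character of `R` at `x` is `0`. Thus `𝔪` is contained in the kernel of that character, and both
are maximal. -/
theorem genSpace_le_supported {ρ : Uq n q →ₐ[ℂ] Module.End ℂ (VC η C L)}
    (hd : ∀ x ∈ Gam n q, ∀ R : basisSet η C L,
      ρ x (tab η C L R.1) = ρ x (tab η C L R.1) R • tab η C L R.1)
    (𝔪 : MaximalSpectrum (GamAlg n q)) :
    genSpace ρ 𝔪 ≤ Finsupp.supported ℂ ℂ {R | gtIdeal hd R = 𝔪} := by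
  rintro v ⟨k, hk⟩
  rw [Finsupp.mem_supported]
  intro R hR
  have hvR : v R ≠ 0 := Finsupp.mem_support_iff.1 hR
  have hle : 𝔪.asIdeal ≤ (gtIdeal hd R).asIdeal := by
    intro x hx
    have h1 := DFunLike.congr_fun (hk (x ^ k) (Ideal.pow_mem_pow hx k)) R
    rw [diag_apply (d := fun S => open scoped Classical in
      if hS : S ∈ basisSet η C L then gtChar hd ⟨S, hS⟩ (x ^ k) else 0)] at h1
    · rw [dif_pos R.2, map_pow] at h1
      exact eq_zero_of_pow_eq_zero ((mul_eq_zero.1 h1).resolve_right hvR)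
    · intro S hS
      rw [dif_pos hS]
      exact hd _ (x ^ k).2 ⟨S, hS⟩
  exact (MaximalSpectrum.ext (𝔪.isMaximal.eq_of_le (gtIdeal hd R).isMaximal.ne_top hle)).symm

/-- Independence holds because different `𝔪` are supported on disjoint parts of the basis; the sum
is everything because each `T(R)` lies in the space of its own ideal. -/
theorem isInternal_genSpace {ρ : Uq n q →ₐ[ℂ] Module.End ℂ (VC η C L)}
    (hd : ∀ x ∈ Gam n q, ∀ R : basisSet η C L,
      ρ x (tab η C L R.1) = ρ x (tab η C L R.1) R • tab η C L R.1) :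
    open scoped Classical in DirectSum.IsInternal (genSpace ρ) := by
  classical
  rw [DirectSum.isInternal_submodule_iff_iSupIndep_and_iSup_eq_top]
  constructor
  · refine iSupIndep.mono (s := fun 𝔪 => Finsupp.supported ℂ ℂ {R | gtIdeal hd R = 𝔪}) ?_
      (genSpace_le_supported hd)
    intro 𝔪
    have h1 : ⨆ 𝔫, ⨆ (_ : 𝔫 ≠ 𝔪), Finsupp.supported ℂ ℂ {R | gtIdeal hd R = 𝔫} ≤
        Finsupp.supported ℂ ℂ {R | gtIdeal hd R ≠ 𝔪} :=
      iSup₂_le fun 𝔫 h𝔫 => Finsupp.supported_mono fun R hR => by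
        change gtIdeal hd R = 𝔫 at hR
        change gtIdeal hd R ≠ 𝔪
        rw [hR]; exact h𝔫
    refine Disjoint.mono_right h1 (Finsupp.disjoint_supported_supported ?_)
    rw [Set.disjoint_left]
    intro R h2 h3
    exact h3 h2
  · rw [eq_top_iff]
    intro v _
    rw [← Finsupp.sum_single v]
    refine Submodule.sum_mem _ fun R _ => ?_
    have h1 : Finsupp.single R (v R) = v R • tab η C L R.1 := by
      rw [tab_of_mem R.2, Finsupp.smul_single, smul_eq_mul, mul_one]
    rw [h1]
    exact Submodule.smul_mem _ _
      (Submodule.mem_iSup_of_mem (gtIdeal hd R) (tab_mem_genSpace hd R))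

end Decomposition

end QuantumGT

end

noncomputable section

namespace QuantumGT

/-! ### Finite generation -/

section Generation

variable {n : ℕ} {q η : ℂ} {C : Set (Rel n)} {L : Tableau n}

theorem co_ne_zero (hη : Complex.exp η = q) (hq : ∀ r : ℕ, 0 < r → q ^ r ≠ 1)
    (hC : Admissible C) {R : Tableau n} (hR : R ∈ basisSet η C L) {s : Bool} {a : Pos n}
    (ha : a.row < n) (h : ∀ c : Pos n, c.row = src s a.row → ¬ Dif η (R c - R a) 0) :
    co q η s a.row a.col R ≠ 0 := by
  rw [co, gtCoeff_eq R (src_le s ha)]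
  refine mul_ne_zero (by cases s <;> simp [sg]) (div_ne_zero ?_ ?_)
  · refine Finset.prod_ne_zero_iff.2 fun c hc => ?_
    rw [Ne, qbracket_eq_zero_iff hη hq]
    exact h c (mem_rowP.1 hc)
  · refine Finset.prod_ne_zero_iff.2 fun c hc => ?_
    rw [Finset.mem_erase, mem_rowP] at hc
    exact qbracket_row_ne_zero hη hq hC hR hc.2 (by omega) hc.1

/-- A generator produces all moves in a row at once. The different results are different basis
tableaux, so a subspace closed under the action contains each one that occurs. -/
theorem tab_mv_mem (hη : Complex.exp η = q) (hq : ∀ r : ℕ, 0 < r → q ^ r ≠ 1)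
    (hC : Admissible C) (hL : IsRealization η C L) {ρ : Uq n q →ₐ[ℂ] Module.End ℂ (VC η C L)}
    (hρ : ∀ g, ρ (gen n q g) = genOp q η C L g) (N : Submodule ℂ (VC η C L))
    (hN : ∀ x, ∀ v ∈ N, ρ x v ∈ N) {R : Tableau n} (hR : R ∈ basisSet η C L)
    (hRN : tab η C L R ∈ N) {s : Bool} {a : Pos n} (ha : a.row < n)
    (hco : co q η s a.row a.col R ≠ 0) (hmv : mv s a.row a.col R ∈ basisSet η C L) :
    tab η C L (mv s a.row a.col R) ∈ N := by
  have hmem : rowOp q η C L s a.row (tab η C L R) ∈ N := by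
    cases s
    · have := hN (gen n q (Gen.f ⟨a.row, a.row_pos, ha⟩)) _ hRN
      rwa [hρ] at this
    · have := hN (gen n q (Gen.e ⟨a.row, a.row_pos, ha⟩)) _ hRN
      rwa [hρ] at this
  refine tab_mem_of_apply_ne_zero hη hq hC hL hρ N (fun m z => hN _) ⟨_, hmv⟩ _ _ le_rfl hmem ?_
  rw [rowOp_apply, Finsupp.finsetSum_apply, Finset.sum_eq_single_of_mem a (mem_rowP.2 rfl)]
  · rw [op_tab_of_mem hR, Finsupp.smul_apply, tab_of_mem hmv, Finsupp.single_eq_same, smul_eq_mul,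
      mul_one]
    exact hco
  · intro c hc hca
    rw [op_tab_of_mem hR, Finsupp.smul_apply]
    by_cases hmc : mv s c.row c.col R ∈ basisSet η C L
    · rw [tab_of_mem hmc, Finsupp.single_eq_of_ne, smul_zero]
      intro h
      have h1 := congrFun (congrArg Subtype.val h) c
      simp only at h1
      rw [mv_apply, mv_apply, if_neg hca, if_pos rfl, add_right_inj, Int.cast_inj] at h1
      cases s <;> simp [sg] at h1
    · rw [tab_of_notMem hmc, Finsupp.zero_apply, smul_zero]

/-- The pairs of positions in adjacent rows whose entries are in weakly decreasing order. -/
def cone (η : ℂ) (R : Tableau n) : Set (Pos n × Pos n) :=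
  {p | p.1.row = p.2.row + 1 ∧ ∃ m : ℤ, 0 ≤ m ∧ Dif η (R p.1 - R p.2) m}

theorem mem_cone_iff (hη : Complex.exp η = q) (hq : ∀ r : ℕ, 0 < r → q ^ r ≠ 1) {R : Tableau n}
    {c d : Pos n} (hcd : c.row = d.row + 1) {m : ℤ} (h : Dif η (R c - R d) m) :
    (c, d) ∈ cone η R ↔ 0 ≤ m := by
  constructor
  · rintro ⟨-, m', h1, h2⟩
    have := h.unique hη hq h2
    omega
  · intro hm
    exact ⟨hcd, m, hm, h⟩

theorem Dif.swap {R : Tableau n} {c d : Pos n} {m : ℤ} (h : Dif η (R c - R d) m) :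
    Dif η (R d - R c) (-m) := by
  have := h.neg
  rwa [neg_sub] at this

/-- Membership of an integral shift in the basis depends on its cone only. -/
theorem mem_basisSet_of_cone_eq (hη : Complex.exp η = q) (hq : ∀ r : ℕ, 0 < r → q ^ r ≠ 1)
    (hC : Admissible C) (hL : IsRealization η C L) {R S : Tableau n} (hR : R ∈ basisSet η C L)
    {z : Pos n → ℤ} (hz0 : ∀ a, a.row = n → z a = 0) (hz : ∀ a, S a = R a + z a)
    (h : cone η S = cone η R) : S ∈ basisSet η C L := by
  rw [mem_basisSet_iff hL] at hR ⊢
  obtain ⟨⟨w, hw0, hw⟩, hrel⟩ := hR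
  refine ⟨⟨fun a => w a + z a, fun a ha => ?_, fun a => ?_⟩, fun r hr => ?_⟩
  · simp only [hw0 a ha, hz0 a ha, add_zero]
  · rw [hz, hw]; push_cast; ring
  · obtain ⟨d, hd0, hds, hd⟩ := satisfiesRel_iff.1 (hrel r hr)
    have hS := Dif.shift hz hd
    refine satisfiesRel_iff.2 ⟨_, ?_, ?_, hS⟩
    all_goals rcases hC.1 hr with (⟨c, e, hrow, rfl⟩ | ⟨c, e, hrow, rfl⟩) | ⟨c, e, hc, he, -, rfl⟩
    all_goals simp only [ge, gt, forall_const, reduceCtorEq, false_imp_iff] at *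
    · exact (mem_cone_iff hη hq hrow hS).1 (h ▸ (mem_cone_iff hη hq hrow hd).2 hd0)
    -- A strict relation `c > e` has `e` in the upper row and says that the pair `(e, c)` is not in
    -- the cone.
    · have h1 := mem_cone_iff hη hq hrow hS.swap
      have h2 := mem_cone_iff hη hq hrow hd.swap
      rw [h] at h1
      have := h1.symm.trans h2
      omega
    · rw [hz0 c hc, hz0 e he]; omega
    · have h1 := mem_cone_iff hη hq hrow hS.swap
      have h2 := mem_cone_iff hη hq hrow hd.swap
      rw [h] at h1
      have := h1.symm.trans h2
      omega

/-- The entry at `a` can be moved in direction `s` without changing the cone. -/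
def Movable (η : ℂ) (R : Tableau n) (s : Bool) (a : Pos n) : Prop :=
  (∀ c : Pos n, c.row = src s a.row → ¬ Dif η (R c - R a) 0) ∧
    ∀ c : Pos n, c.row = src (!s) a.row → ¬ Dif η (R c - R a) (sg s)

/-- A step at `a` changes the membership of a pair only if its difference passes between `0` and
`-1`. `Movable` forbids this against both adjacent rows; its first clause also makes the coefficient
of the move nonzero (`co_ne_zero`). -/
theorem cone_mv (hη : Complex.exp η = q) (hq : ∀ r : ℕ, 0 < r → q ^ r ≠ 1) {R : Tableau n}
    {s : Bool} {a : Pos n} (h : Movable η R s a) :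
    cone η (mv s a.row a.col R) = cone η R := by
  ext ⟨c, d⟩
  by_cases hcd : c.row = d.row + 1
  · by_cases hm : ∃ m, Dif η (R c - R d) m
    · obtain ⟨m, hm⟩ := hm
      have h1 := Dif.shift (mv_apply s a R) hm
      rw [mem_cone_iff hη hq hcd h1, mem_cone_iff hη hq hcd hm]
      by_cases hca : c = a
      · subst hca
        have hdc : d ≠ c := by rintro rfl; omega
        rw [if_pos rfl, if_neg hdc]
        cases s
        · have h2 : m ≠ 0 := by
            rintro rfl
            exact h.1 d (by simp [src]; omega) (by simpa using hm.swap)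
          simp only [sg, Bool.false_eq_true, if_false]
          omega
        · have h2 : m ≠ -1 := by
            rintro rfl
            exact h.2 d (by simp [src]; omega) (by simpa [sg] using hm.swap)
          simp only [sg, if_true]
          omega
      · rw [if_neg hca]
        by_cases hda : d = a
        · subst hda
          rw [if_pos rfl]
          cases s
          · have h2 : m ≠ -1 := by
              rintro rfl
              exact h.2 c (by simp [src]; omega) (by simpa [sg] using hm)
            simp only [sg, Bool.false_eq_true, if_false]
            omega
          · have h2 : m ≠ 0 := by
              rintro rfl
              exact h.1 c (by simp [src]; omega) hm
            simp only [sg, if_true]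
            omega
        · rw [if_neg hda]
          omega
    · constructor
      · rintro ⟨-, m, -, h1⟩
        exact absurd ⟨_, Dif.unshift (mv_apply s a R) h1⟩ hm
      · rintro ⟨-, m, -, h1⟩
        exact absurd ⟨m, h1⟩ hm
  · exact iff_of_false (fun h => hcd h.1) fun h => hcd h.1

/-- If `S` is an integral shift of `R` with the same cone, then some entry of `R` can be moved
towards `S`. -/
theorem exists_movable (hη : Complex.exp η = q) (hq : ∀ r : ℕ, 0 < r → q ^ r ≠ 1)
    {R S : Tableau n} {z : Pos n → ℤ} (hz : ∀ a, S a = R a + z a) (h : cone η R = cone η S)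
    (hne : ∃ a, z a ≠ 0) : ∃ (s : Bool) (a : Pos n), 0 < sg s * z a ∧ Movable η R s a := by
  classical
  obtain ⟨a₀, ha₀⟩ := hne
  obtain ⟨s, hs⟩ : ∃ s, 0 < sg s * z a₀ := by
    rcases lt_or_gt_of_ne ha₀ with h1 | h1
    · exact ⟨false, by simp [sg]; omega⟩
    · exact ⟨true, by simp [sg]; omega⟩
  -- The positions which have to move in direction `s` and whose entries are comparable with the one
  -- at `a₀`.
  let P : Finset (Pos n) :=
    Finset.univ.filter fun a => 0 < sg s * z a ∧ ∃ m, Dif η (R a - R a₀) m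
  have hself : Dif η (R a₀ - R a₀) 0 := by
    rw [sub_self]; exact_mod_cast dif_int η 0
  have ha₀P : a₀ ∈ P := Finset.mem_filter.2 ⟨Finset.mem_univ _, hs, 0, hself⟩
  have hmm : ∀ a, ∃ k : ℤ, ∀ m, Dif η (R a - R a₀) m → k = m := by
    intro a
    by_cases h1 : ∃ m, Dif η (R a - R a₀) m
    · obtain ⟨m, hm⟩ := h1
      exact ⟨m, fun m' hm' => hm.unique hη hq hm'⟩
    · exact ⟨0, fun m hm => absurd ⟨m, hm⟩ h1⟩
  choose f hf using hmm
  -- An obstructing position at `a` is level with it in the row ahead, or one step further in the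
  -- row behind, relative to the direction `s`. As `R` and `S` have the same cone, it has to move at
  -- least as far as `a` and hence belongs to `P`. In both cases the weight, twice the entry plus
  -- the row, signed by `s`, would be larger by `1` there, so a maximizer is free to move.
  obtain ⟨a, haP, hmax⟩ :=
    P.exists_max_image (fun a => sg s * (2 * f a + (a.row : ℤ))) ⟨a₀, ha₀P⟩
  obtain ⟨-, has, m, hm⟩ := Finset.mem_filter.1 haP
  have key : ∀ (c : Pos n) (d : ℤ), Dif η (R c - R a) d →
      sg s * z a ≤ sg s * z c → sg s * (2 * d + (c.row : ℤ)) ≤ sg s * (a.row : ℤ) := by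
    intro c d hd hle
    have h1 : Dif η (R c - R a₀) (d + m) := by
      have := hd.add hm
      rwa [sub_add_sub_cancel] at this
    have h2 := hmax c (Finset.mem_filter.2 ⟨Finset.mem_univ _, by omega, _, h1⟩)
    rw [hf c _ h1, hf a _ hm] at h2
    linarith
  have hrow := a.row_pos
  refine ⟨s, a, has, fun c hc hd => ?_, fun c hc hd => ?_⟩
  · have h0 := key c 0 hd
    have h1 := Dif.shift hz hd
    cases s
    · have hca : a.row = c.row + 1 := by simp [src] at hc; have := c.row_pos; omega
      have h2 := mem_cone_iff hη hq hca hd.swap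
      rw [h, mem_cone_iff hη hq hca h1.swap] at h2
      simp only [sg, Bool.false_eq_true, if_false] at h0
      omega
    · have hca : c.row = a.row + 1 := by simpa [src] using hc
      have h2 := mem_cone_iff hη hq hca hd
      rw [h, mem_cone_iff hη hq hca h1] at h2
      simp only [sg, if_true] at h0
      omega
  · have h0 := key c _ hd
    have h1 := Dif.shift hz hd
    cases s
    · have hca : c.row = a.row + 1 := by simpa [src] using hc
      have h2 := mem_cone_iff hη hq hca hd
      rw [h, mem_cone_iff hη hq hca h1] at h2
      simp only [sg, Bool.false_eq_true, if_false] at h0 h2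
      omega
    · have hca : a.row = c.row + 1 := by simp [src] at hc; have := c.row_pos; omega
      have h2 := mem_cone_iff hη hq hca hd.swap
      rw [h, mem_cone_iff hη hq hca h1.swap] at h2
      simp only [sg, if_true] at h0 h2
      omega

/-- Induction on the total distance between `R` and `S`: a movable position is moved one step
towards `S`. The cone is unchanged, so the new tableau is again in the basis, and the coefficient of
the step is nonzero. -/
theorem tab_mem_of_cone_eq (hη : Complex.exp η = q) (hq : ∀ r : ℕ, 0 < r → q ^ r ≠ 1)
    (hC : Admissible C) (hL : IsRealization η C L) {ρ : Uq n q →ₐ[ℂ] Module.End ℂ (VC η C L)}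
    (hρ : ∀ g, ρ (gen n q g) = genOp q η C L g) (N : Submodule ℂ (VC η C L))
    (hN : ∀ x, ∀ v ∈ N, ρ x v ∈ N) {S : Tableau n} (k : ℕ) {R : Tableau n}
    (hR : R ∈ basisSet η C L) {z : Pos n → ℤ} (hz0 : ∀ a, a.row = n → z a = 0)
    (hz : ∀ a, S a = R a + z a) (hk : ∑ a, (z a).natAbs ≤ k) (h : cone η R = cone η S)
    (hRN : tab η C L R ∈ N) : tab η C L S ∈ N := by
  induction k generalizing R z with
  | zero =>
    have : S = R := by
      funext a
      have h1 := (Finset.sum_eq_zero_iff.1 (Nat.le_zero.1 hk)) a (Finset.mem_univ a)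
      rw [hz, Int.natAbs_eq_zero.1 h1, Int.cast_zero, add_zero]
    rwa [this]
  | succ k ih =>
    by_cases hne : ∃ a, z a ≠ 0
    · obtain ⟨s, a, hs, hmov⟩ := exists_movable hη hq hz h hne
      have ha : a.row < n := by
        refine lt_of_le_of_ne a.2.2.2 fun h1 => ?_
        rw [hz0 a h1, mul_zero] at hs
        exact lt_irrefl _ hs
      have hcone := cone_mv hη hq hmov
      have hmem : mv s a.row a.col R ∈ basisSet η C L :=
        mem_basisSet_of_cone_eq hη hq hC hL hR
          (fun c hc => if_neg (by rintro rfl; omega)) (mv_apply s a R) hcone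
      refine ih hmem (z := fun c => z c - if c = a then sg s else 0) ?_ ?_ ?_ (hcone.trans h)
        (tab_mv_mem hη hq hC hL hρ N hN hR hRN ha (co_ne_zero hη hq hC hR ha hmov.1) hmem)
      · intro c hc
        simp only [hz0 c hc]
        rw [if_neg (by rintro rfl; omega), sub_zero]
      · intro c
        rw [mv_apply, hz]; push_cast; ring
      · refine Nat.le_of_lt_succ (lt_of_lt_of_le (Finset.sum_lt_sum (fun c _ => ?_)
          ⟨a, Finset.mem_univ _, ?_⟩) hk)
        · by_cases hca : c = a
          · subst hca
            rw [if_pos rfl]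
            cases s <;> simp [sg] at hs ⊢ <;> omega
          · rw [if_neg hca, sub_zero]
        · rw [if_pos rfl]
          cases s <;> simp [sg] at hs ⊢ <;> omega
    · push Not at hne
      have : S = R := by
        funext a
        rw [hz, hne a, Int.cast_zero, add_zero]
      rwa [this]

/-- A cone is a subset of the finite set of pairs of positions, so finitely many cones occur. One
tableau for each of them generates the module. -/
theorem isFinitelyGenerated (hη : Complex.exp η = q) (hq : ∀ r : ℕ, 0 < r → q ^ r ≠ 1)
    (hC : Admissible C) (hL : IsRealization η C L) {ρ : Uq n q →ₐ[ℂ] Module.End ℂ (VC η C L)}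
    (hρ : ∀ g, ρ (gen n q g) = genOp q η C L g) : IsFinitelyGenerated ρ := by
  let _ : Module (Uq n q) (VC η C L) :=
    Module.compHom _ (ρ : Uq n q →+* Module.End ℂ (VC η C L))
  change Module.Finite (Uq n q) (VC η C L)
  let F : basisSet η C L → Set (Pos n × Pos n) := fun R => cone η R.1
  let G : Set (VC η C L) := Set.range fun w : Set.range F => tab η C L (Classical.choose w.2).1
  refine ⟨Submodule.fg_def.2 ⟨G, Set.finite_range _, eq_top_iff.2 fun v _ => ?_⟩⟩
  -- The `U_q`-span of the chosen tableaux, regarded as a complex subspace; scalars act through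
  -- `algebraMap`.
  let N : Submodule ℂ (VC η C L) :=
    { (Submodule.span (Uq n q) G).toAddSubmonoid with
      smul_mem' := fun c v hv => by
        have h1 := (Submodule.span (Uq n q) G).smul_mem (algebraMap ℂ (Uq n q) c) hv
        change ρ (algebraMap ℂ (Uq n q) c) v ∈ Submodule.span (Uq n q) G at h1
        rwa [AlgHom.commutes, Module.algebraMap_end_apply] at h1 }
  have hN : ∀ x, ∀ v ∈ N, ρ x v ∈ N := fun x v hv =>
    (Submodule.span (Uq n q) G).smul_mem x hv
  have htab : ∀ S : basisSet η C L, tab η C L S.1 ∈ N := by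
    intro S
    have hw : F S ∈ Set.range F := ⟨S, rfl⟩
    have hc : cone η (Classical.choose hw).1 = cone η S.1 := Classical.choose_spec hw
    obtain ⟨w, hw0, hwz⟩ := (Classical.choose hw).2.1
    obtain ⟨y, hy0, hyz⟩ := S.2.1
    refine tab_mem_of_cone_eq hη hq hC hL hρ N hN _ (Classical.choose hw).2
      (z := fun a => y a - w a) (fun a ha => ?_) (fun a => ?_) le_rfl hc
      (Submodule.subset_span ⟨⟨F S, hw⟩, rfl⟩)
    · simp only [hw0 a ha, hy0 a ha, sub_zero]
    · rw [hyz, hwz]; push_cast; ring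
  change v ∈ N
  rw [← Finsupp.sum_single v]
  refine Submodule.sum_mem _ fun R _ => ?_
  have h1 : Finsupp.single R (v R) = v R • tab η C L R.1 := by
    rw [tab_of_mem R.2, Finsupp.smul_single, smul_eq_mul, mul_one]
  rw [h1]
  exact N.smul_mem _ (htab R)

end Generation

end QuantumGT

end

theorem theorem4p1 (n : ℕ) (hn : 2 ≤ n) (q η : ℂ) (hη : Complex.exp η = q)
    (hq : ∀ r : ℕ, 0 < r → q ^ r ≠ 1)
    (C : Set (QuantumGT.Rel n)) (hC : QuantumGT.Admissible C)
    (L : QuantumGT.Tableau n) (hL : QuantumGT.IsRealization η C L) :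
    ∃ ρ : QuantumGT.Uq n q →ₐ[ℂ] Module.End ℂ (QuantumGT.VC η C L),
      QuantumGT.IsGTAction q η C L ρ ∧
      QuantumGT.IsGelfandTsetlin ρ ∧
      (∀ x ∈ QuantumGT.Gam n q, ∀ R ∈ QuantumGT.basisSet η C L,
        ∃ c : ℂ, ρ x (QuantumGT.tab η C L R) = c • QuantumGT.tab η C L R) ∧
      ∀ m k : ℕ, 1 ≤ m → m ≤ n → k ≤ m →
        QuantumGT.cgen n q m k ∈ QuantumGT.Gam n q ∧
        ∀ R ∈ QuantumGT.basisSet η C L,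
          ρ (QuantumGT.cgen n q m k) (QuantumGT.tab η C L R) =
            QuantumGT.gammaVal q η m k R • QuantumGT.tab η C L R := by
  have hq0 : q ≠ 0 := by rw [← hη]; exact Complex.exp_ne_zero _
  obtain ⟨ρ, hρ⟩ := QuantumGT.exists_rep hη hq hC hL
  exact ⟨ρ, QuantumGT.isGTAction_of_gen hρ,
    ⟨QuantumGT.isFinitelyGenerated hη hq hC hL hρ,
      QuantumGT.isInternal_genSpace fun x hx R => QuantumGT.gam_diag hη hq hC hL hρ hx R.2⟩,
    fun x hx R hR => ⟨_, QuantumGT.gam_diag hη hq hC hL hρ hx hR⟩,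
    fun m k h1 hm hk => ⟨QuantumGT.cgen_mem_Gam hq0 hq h1 hm hk,
      fun R hR => QuantumGT.cgen_tab hη hq hC hL hρ hm hk hR⟩⟩
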